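/- A lattice of unit density is a discrete subgroup $L\subset\mathbb C\cong\mathbb R^2$ of rank two that spans the plane over $\mathbb R$ and whose fundamental cell has area $1$. For $\alpha>0$ put $$E_\alpha(L)=\sum_{P\in L}|P|^2e^{-\pi\alpha|P|^2}.$$ Up to linear isometries of the plane, the square lattice is $\mathbb Z\oplus i\mathbb Z$, the hexagonal lattice is $\sqrt{2/\sqrt3}\,\bigl(\mathbb Z\oplus e^{i\pi/3}\mathbb Z\bigr)$, and the (non-square) rectangular lattices are $R_y=\sqrt{1/y}\,\bigl(\mathbb Z\oplus iy\,\mathbb Z\bigr)$ with $y>1$. **Theorem (Hexagonal-Square-Rectangular Phase Transitions).** There exist $\alpha_a<\alpha_b$ in $(\tfrac45,1)$, with $|\alpha_a-0.8947044415|<10^{-10}$ and $|\alpha_b-0.9203340927|<10^{-10}$, such that for every $\alpha>0$ the minimisers of $E_\alpha$ among all lattices of unit density are, up to linear isometries of the plane, exactly: - one rectangular lattice $R_{y_\alpha}$, for some $y_\alpha>1$, if $\alpha<\alpha_a$; - the square lattice, if $\alpha_a\le\alpha<\alpha_b$; - the square lattice and the hexagonal lattice, if $\alpha=\alpha_b$;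 - the hexagonal lattice, if $\alpha>\alpha_b$. -/

import Mathlib

namespace LatticePhase

/-- A (full-rank, discrete) lattice of the plane `ℂ ≅ ℝ²` whose fundamental cells have area `1`. -/
def IsUnitLattice (L : Submodule ℤ ℂ) : Prop :=
  ∃ _ : DiscreteTopology L, IsZLattice ℝ L ∧ ZLattice.covolume L = 1

/-- The lattice sum `∑_{P ∈ L} |P|² exp(-π α |P|²)`; the series converges for every lattice `L`
and every `α > 0`. -/
noncomputable def energy (α : ℝ) (L : Submodule ℤ ℂ) : ℝ :=
  ∑' P : L, ‖(P : ℂ)‖ ^ 2 * Real.exp (-(Real.pi * α * ‖(P : ℂ)‖ ^ 2))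

/-- `L` is a minimiser of the lattice sum among all lattices of unit density. -/
def IsMinimizer (α : ℝ) (L : Submodule ℤ ℂ) : Prop :=
  IsUnitLattice L ∧ ∀ L' : Submodule ℤ ℂ, IsUnitLattice L' → energy α L ≤ energy α L'

/-- The lattice `√(1 / Im z) (ℤ ⊕ z ℤ)` attached to a point `z` of the upper half-plane. -/
noncomputable def bravais (z : UpperHalfPlane) : Submodule ℤ ℂ :=
  Submodule.span ℤ {((√(1 / z.im) : ℝ) : ℂ), ((√(1 / z.im) : ℝ) : ℂ) * (z : ℂ)}

/-- The point `i y` of the upper half-plane. -/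
noncomputable def imagPoint (y : ℝ) (hy : 0 < y) : UpperHalfPlane :=
  ⟨Complex.I * (y : ℂ), by simpa using hy⟩

/-- The point `exp(i π / 3)` of the upper half-plane. -/
noncomputable def hexPoint : UpperHalfPlane :=
  ⟨Complex.exp (Complex.I * ((Real.pi / 3 : ℝ) : ℂ)), by
    rw [mul_comm, Complex.exp_ofReal_mul_I_im, Real.sin_pi_div_three]
    positivity⟩

/-- Two lattices have the same shape and size: a linear isometry of the plane maps one onto the
other. -/
def Congruent (L L' : Submodule ℤ ℂ) : Prop :=
  ∃ e : ℂ ≃ₗᵢ[ℝ] ℂ, e '' (L' : Set ℂ) = (L : Set ℂ)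

/-- `L` is a rectangular lattice of unit density with side ratio `y`
(for `y > 1` it is a rectangular lattice that is not square). -/
def IsRectangularLattice (y : ℝ) (hy : 0 < y) (L : Submodule ℤ ℂ) : Prop :=
  Congruent L (bravais (imagPoint y hy))

/-- `L` is a square lattice of unit density. -/
def IsSquareLattice (L : Submodule ℤ ℂ) : Prop :=
  Congruent L (bravais UpperHalfPlane.I)

/-- `L` is a hexagonal lattice of unit density. -/
def IsHexagonalLattice (L : Submodule ℤ ℂ) : Prop :=
  Congruent L (bravais hexPoint)

end LatticePhase

namespace LatticePhase

/-! ### Ball arithmetic for kernel evaluation -/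

noncomputable section BallArithmetic

/-! Reduction theory turns the problem into one about two real variables. Every lattice of unit
density is congruent to `bravais z` with z = x + iy, 0 ≤ x ≤ 1/2 and x² + y² ≥ 1
(`exists_congruent_bravais`), and its energy is `En A x y` with A = πα (`energy_bravais`). It
remains to find the minimum points of `En A` on this half of the fundamental domain
(`isMinimizer_iff`).

Horizontal direction. Poisson summation in one index expands `En A x y` as a cosine series in x
(`En_eq_fourier`). For α ≤ 0.905, and for y ≥ 1 as long as α ≤ 0.922, the first nonconstant
coefficient dominates, so at each height the minimum is at x = 0 (`En_zero_le`) and only rectangular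
lattices compete.

Rectangular lattices. On x = 0 the energy is a combination of products of one-dimensional theta
series. In u = log y its derivative is a positive multiple of H(b + u) - H(b - u), where e^b = π/α
and H = `ratioH` rises to a single maximum at a and then falls. At two points of equal level H rises
more steeply than it falls (`ratioH'_add_pos`), so for u > 0 this difference can vanish only while
increasing. It has no zero if b ≤ a and exactly one if b > a (`exists_ratioDiff_sign`). Hence the
square is optimal among rectangular lattices exactly for α ≥ αa = π/e^a.

Square against hexagonal. For larger α, up to 2, and heights below 1, the energy is compared with
the interpolation p En(0, y) + q En(1/2, y), where p + q = 1 and the weights are affine in cos 2πx;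
the error carries the factor pq (`En_interp`). On x = 0 the energy is least at the square, on x =
1/2 it increases away from the hexagonal point (`En_half_strictMonoOn`), and since the error
vanishes at both ends, small certified gaps exclude all other points (`lt_En_of_window`,
`En_square_lt_of_window`). The gap between the two distinguished energies, times A, increases in A
near the transition, and its zero is π αb (`exists_hexagonal_transition`). For y ≥ 1 and α above
about 0.922 this gap exceeds the whole horizontal oscillation (`En_hex_lt_of_one_le`).

For α ≥ 2 the hexagonal lattice wins by a linear programming argument: r e^{-Ar} is bounded below by
its tangents at the hexagonal lengths, with a quadratic gain on the six shortest vectors, and the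
tangent terms are summed by averaging over rotations (`En_hex_lt_of_sell`); elongated lattices are
excluded by a single pair of vectors (`En_hex_lt_of_long`).

The finitely many numerical inequalities are certified by fixed-point ball arithmetic with first
derivatives and bisection, proved sound in `value_pos_of_checkBox` and `value_pos_of_checkTree`. -/

/-- The scale of fixed-point numbers. -/
def scale : ℕ := 18446744073709551616

theorem scale_ge : 65536 ≤ scale := by decide

theorem scale_pos : (0 : ℝ) < scale := by exact_mod_cast (by decide : 0 < scale)

-- The correctness proofs rely only on the two bounds above, not on the value 2 ^ 64; kernel
-- evaluation still sees the literal.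
attribute [irreducible] scale

theorem scale_pos_nat : 0 < scale := scale_ge.trans_lt' (by norm_num)

/-- Makes the kernel evaluate `n` before it is substituted into `k`. -/
def forceNat {β : Type} (n : ℕ) (k : ℕ → β) : β :=
  Nat.rec (k 0) (fun m _ => k (Nat.succ m)) n

theorem forceNat_eq {β : Type} (n : ℕ) (k : ℕ → β) : forceNat n k = k n := by
  cases n <;> rfl

/-- A ball with centre `(p - n) / scale` and radius `r / scale`. -/
structure Ball where
  p : ℕ
  n : ℕ
  r : ℕ

namespace Ball

/-- `x` lies in the ball `b`. -/
def Mem (b : Ball) (x : ℝ) : Prop := |x * scale - ((b.p : ℝ) - b.n)| ≤ b.r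

def mkF (p n r : ℕ) : Ball :=
  forceNat p fun p => forceNat n fun n => forceNat r fun r => ⟨p, n, r⟩

theorem mkF_eq (p n r : ℕ) : mkF p n r = ⟨p, n, r⟩ := by simp [mkF, forceNat_eq]

/-- The operations use recursors and bare `Nat` functions, so that they reduce by built-in natural
number arithmetic. A signed centre is a difference `p - n`; the two truncated subtractions make one
of its parts vanish and keep the numbers small. -/
def add (a b : Ball) : Ball :=
  Ball.rec (fun p n r => Ball.rec (fun p' n' r' =>
    ⟨Nat.sub (Nat.add p p') (Nat.add n n'), Nat.sub (Nat.add n n') (Nat.add p p'),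
      Nat.add r r'⟩) b) a

def neg (a : Ball) : Ball := Ball.rec (fun p n r => ⟨n, p, r⟩) a

/-- The final 2 in the radius pays for two roundings, of the centre and of the quotient in the
radius itself. -/
def mul (a b : Ball) : Ball :=
  Ball.rec (fun p n r => Ball.rec (fun p' n' r' =>
    ⟨Nat.div (Nat.sub (Nat.add (Nat.mul p p') (Nat.mul n n'))
        (Nat.add (Nat.mul p n') (Nat.mul n p'))) scale,
      Nat.div (Nat.sub (Nat.add (Nat.mul p n') (Nat.mul n p'))
        (Nat.add (Nat.mul p p') (Nat.mul n n'))) scale,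
      Nat.add (Nat.div (Nat.add (Nat.mul (Nat.add p n) r')
        (Nat.mul (Nat.add (Nat.add p' n') r') r)) scale) 2⟩) b) a

def smul (k : ℕ) (a : Ball) : Ball :=
  Ball.rec (fun p n r => ⟨Nat.mul k p, Nat.mul k n, Nat.mul k r⟩) a

def const (a b : ℕ) : Ball := mkF (Nat.div (Nat.mul a scale) b) 0 1

/-- Downward Horner steps for `exp (-w / scale)`. -/
def expHorner (w : ℕ) (k : ℕ) : ℕ → ℕ → (ℕ → ℕ → Ball) → Ball :=
  Nat.rec (fun lo hi c => c lo hi)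
    (fun k ih lo hi c =>
      forceNat (Nat.sub scale (Nat.succ (Nat.div (Nat.mul w hi) (Nat.mul scale (Nat.succ k)))))
        fun lo' =>
      forceNat (Nat.sub scale (Nat.div (Nat.mul w lo) (Nat.mul scale (Nat.succ k)))) fun hi' =>
      ih lo' hi' c) k

/-- Repeated squaring. -/
def expSquare (k : ℕ) : ℕ → ℕ → (ℕ → ℕ → Ball) → Ball :=
  Nat.rec (fun lo hi c => c lo hi)
    (fun _ ih lo hi c =>
      forceNat (Nat.div (Nat.mul lo lo) scale) fun lo' =>
      forceNat (Nat.succ (Nat.div (Nat.mul hi hi) scale)) fun hi' => ih lo' hi' c) k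

/-- Encloses `exp (-x)`, for `x` in the ball with centre `m / scale ≤ 128` and radius at most
`1`. -/
def nexpCore (m r : ℕ) : Ball :=
  forceNat (Nat.div m 256) fun w =>
  forceNat (Nat.succ (Nat.div (Nat.mul 2 w) 13)) fun e =>
  expHorner w 12 (Nat.sub scale e) (Nat.add scale e) fun lo hi =>
  expSquare 8 lo hi fun lo hi =>
  forceNat (Nat.add r 256) fun R =>
    mkF lo 0 (Nat.add (Nat.sub hi lo)
      (Nat.succ (Nat.div (Nat.mul hi (Nat.add R (Nat.succ (Nat.div (Nat.mul R R) scale)))) scale)))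

/-- Outside the range of `nexpCore` (the first branch of `Bool.rec`, the value false) the result is
a huge ball around 0, valid by e < 3. The enclosure is thus sound without side conditions. -/
def nexp (a : Ball) : Ball :=
  Ball.rec (fun p n r =>
    Bool.rec (mkF 0 0 (Nat.mul scale (Nat.pow 3 (Nat.succ (Nat.div (Nat.add (Nat.add p n) r) scale)))))
      (nexpCore (Nat.sub p n) r)
      (and (Nat.ble n p) (and (Nat.ble (Nat.sub p n) (Nat.mul 128 scale))
        (Nat.ble (Nat.add r 256) scale)))) a

theorem mem_mk {p n r : ℕ} {x : ℝ} : Mem ⟨p, n, r⟩ x ↔ |x * scale - ((p : ℝ) - n)| ≤ r := Iff.rfl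

theorem sub_sub_sub (P N : ℕ) : ((P - N : ℕ) : ℝ) - ((N - P : ℕ) : ℝ) = (P : ℝ) - N := by
  rcases le_total P N with h | h
  · rw [Nat.sub_eq_zero_of_le h, Nat.cast_sub h]; simp
  · rw [Nat.sub_eq_zero_of_le h, Nat.cast_sub h]; simp

theorem Mem.add {a b : Ball} {x y : ℝ} (hx : a.Mem x) (hy : b.Mem y) :
    (a.add b).Mem (x + y) := by
  obtain ⟨p, n, r⟩ := a
  obtain ⟨p', n', r'⟩ := b
  rw [mem_mk] at hx hy
  have : Ball.add ⟨p, n, r⟩ ⟨p', n', r'⟩ =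
      ⟨(p + p') - (n + n'), (n + n') - (p + p'), r + r'⟩ := by
    rfl
  rw [this, mem_mk, sub_sub_sub]
  push_cast
  calc _ = |(x * scale - ((p : ℝ) - n)) + (y * scale - ((p' : ℝ) - n'))| := by
        congr 1; ring
    _ ≤ _ := (abs_add_le _ _).trans (add_le_add hx hy)

theorem Mem.neg {a : Ball} {x : ℝ} (hx : a.Mem x) : a.neg.Mem (-x) := by
  obtain ⟨p, n, r⟩ := a
  rw [mem_mk] at hx
  show |-x * scale - ((n : ℝ) - p)| ≤ r
  rw [← abs_neg]
  convert hx using 2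
  ring

theorem Mem.smul {a : Ball} {x : ℝ} (k : ℕ) (hx : a.Mem x) : (a.smul k).Mem (k * x) := by
  obtain ⟨p, n, r⟩ := a
  rw [mem_mk] at hx
  have : Ball.smul k ⟨p, n, r⟩ = ⟨k * p, k * n, k * r⟩ := by
    rfl
  rw [this, mem_mk]
  push_cast
  calc _ = |(k : ℝ)| * |x * scale - ((p : ℝ) - n)| := by
        rw [← abs_mul]; congr 1; ring
    _ ≤ _ := by
      rw [abs_of_nonneg (Nat.cast_nonneg k)]
      gcongr

theorem natDiv_bounds (a b : ℕ) (hb : 0 < b) :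
    ((a / b : ℕ) : ℝ) ≤ (a : ℝ) / b ∧ (a : ℝ) / b ≤ ((a / b : ℕ) : ℝ) + 1 := by
  have hb' : (0 : ℝ) < b := by exact_mod_cast hb
  constructor
  · exact Nat.cast_div_le
  · rw [div_le_iff₀ hb']
    have := Nat.lt_div_mul_add (a := a) hb
    have h2 : (a : ℝ) < ((a / b : ℕ) : ℝ) * b + b := by exact_mod_cast this
    nlinarith

theorem Mem.mul {a b : Ball} {x y : ℝ} (hx : a.Mem x) (hy : b.Mem y) :
    (a.mul b).Mem (x * y) := by
  obtain ⟨p, n, r⟩ := a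
  obtain ⟨p', n', r'⟩ := b
  rw [mem_mk] at hx hy
  have : Ball.mul ⟨p, n, r⟩ ⟨p', n', r'⟩ =
      ⟨((p * p' + n * n') - (p * n' + n * p')) / scale,
        ((p * n' + n * p') - (p * p' + n * n')) / scale,
        ((p + n) * r' + ((p' + n') + r') * r) / scale + 2⟩ := by
    rfl
  rw [this, mem_mk]
  set P := p * p' + n * n' with hP
  set N := p * n' + n * p' with hN
  set R := (p + n) * r' + ((p' + n') + r') * r with hR
  have hs := scale_pos
  have e1 := natDiv_bounds (P - N) scale scale_pos_nat
  have e2 := natDiv_bounds (N - P) scale scale_pos_nat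
  have e3 := natDiv_bounds R scale scale_pos_nat
  have hsub := sub_sub_sub P N
  -- one of the two differences vanishes
  have hc : |(((P - N) / scale : ℕ) : ℝ) - (((N - P) / scale : ℕ) : ℝ)
      - ((P : ℝ) - N) / scale| ≤ 1 := by
    rcases le_total P N with h | h
    · have h0 : P - N = 0 := Nat.sub_eq_zero_of_le h
      rw [← hsub]
      rw [h0] at *
      simp only [Nat.zero_div, Nat.cast_zero, zero_sub] at *
      rw [abs_le]
      constructor <;> rw [neg_div] <;> linarith [e2.1, e2.2]
    · have h0 : N - P = 0 := Nat.sub_eq_zero_of_le h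
      rw [← hsub]
      rw [h0] at *
      simp only [Nat.zero_div, Nat.cast_zero, sub_zero] at *
      rw [abs_le]
      constructor <;> linarith [e1.1, e1.2]
  have hPN : (P : ℝ) - N = ((p : ℝ) - n) * ((p' : ℝ) - n') := by
    rw [hP, hN]; push_cast; ring
  have hRc : (R : ℝ) = ((p : ℝ) + n) * r' + (p' + n' + r') * r := by
    rw [hR]; push_cast; ring
  set c := (p : ℝ) - n
  set c' := (p' : ℝ) - n'
  set ex := x * scale - c
  set ey := y * scale - c'
  have hxy : x * y * scale - (P - N : ℝ) / scale = (c * ey + c' * ex + ex * ey) / scale := by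
    rw [hPN, eq_div_iff hs.ne']
    simp only [ex, ey]
    field_simp
    ring
  have hcabs : |c| ≤ p + n := by
    rw [abs_le]; constructor <;> simp only [c] <;>
      linarith [(Nat.cast_nonneg p : (0 : ℝ) ≤ p), (Nat.cast_nonneg n : (0 : ℝ) ≤ n)]
  have hcabs' : |c'| ≤ p' + n' := by
    rw [abs_le]; constructor <;> simp only [c'] <;>
      linarith [(Nat.cast_nonneg p' : (0 : ℝ) ≤ p'), (Nat.cast_nonneg n' : (0 : ℝ) ≤ n')]
  have hnum : |c * ey + c' * ex + ex * ey| ≤ R := by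
    have h1 : |c * ey| ≤ (p + n) * r' := by
      rw [abs_mul]; exact mul_le_mul hcabs hy (abs_nonneg _) (by positivity)
    have h2 : |c' * ex| ≤ (p' + n') * r := by
      rw [abs_mul]; exact mul_le_mul hcabs' hx (abs_nonneg _) (by positivity)
    have h3 : |ex * ey| ≤ r * r' := by
      rw [abs_mul]; exact mul_le_mul hx hy (abs_nonneg _) (by positivity)
    calc _ ≤ |c * ey| + |c' * ex| + |ex * ey| :=
          (abs_add_le _ _).trans (add_le_add (abs_add_le _ _) le_rfl)
      _ ≤ _ := by rw [hRc]; linarith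
  have hq : |x * y * scale - (P - N : ℝ) / scale| ≤ R / scale := by
    rw [hxy, abs_div, abs_of_pos hs]
    gcongr
  calc _ = |(x * y * scale - (P - N : ℝ) / scale) - ((((P - N) / scale : ℕ) : ℝ)
        - (((N - P) / scale : ℕ) : ℝ) - ((P : ℝ) - N) / scale)| := by congr 1; ring
    _ ≤ R / scale + 1 := (abs_sub _ _).trans (add_le_add hq hc)
    _ ≤ _ := by push_cast at e3 ⊢; linarith [e3.2]

theorem mem_const (a b : ℕ) (hb : 0 < b) : (const a b).Mem ((a : ℝ) / b) := by
  have : const a b = ⟨a * scale / b, 0, 1⟩ := by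
    simp only [const, mkF_eq]
    rfl
  rw [this, mem_mk]
  have h := natDiv_bounds (a * scale) b hb
  have e : (a : ℝ) / b * scale = ((a * scale : ℕ) : ℝ) / b := by push_cast; ring
  rw [e, abs_le]
  constructor <;> push_cast at * <;> linarith [h.1, h.2]

/-- The nested form of the exponential series, with remainder `h`. -/
def hornerReal (x : ℝ) : ℕ → ℝ → ℝ
  | 0, h => h
  | k + 1, h => hornerReal x k (1 - x / (k + 1) * h)

theorem hornerReal_eq (x : ℝ) (k : ℕ) (h : ℝ) : hornerReal x k h =
    ∑ m ∈ Finset.range k, (-x) ^ m / m.factorial + (-x) ^ k / k.factorial * h := by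
  induction k generalizing h with
  | zero => simp [hornerReal]
  | succ k ih =>
    rw [hornerReal, ih, Finset.sum_range_succ, Nat.factorial_succ]
    push_cast
    field_simp
    ring

/-- The innermost value of the nested form is solved for; the Taylor remainder bounds it by (k +
1)/k ≤ 2. -/
theorem exists_hornerReal_eq_exp (x : ℝ) (h0 : 0 ≤ x) (h1 : x ≤ 1) (k : ℕ) (hk : 0 < k) :
    ∃ h : ℝ, |h| ≤ 2 ∧ hornerReal x k h = Real.exp (-x) := by
  rcases h0.eq_or_lt with rfl | hx
  · refine ⟨0, by simp, ?_⟩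
    rw [hornerReal_eq]
    obtain ⟨k, rfl⟩ := Nat.exists_eq_succ_of_ne_zero hk.ne'
    simp [Finset.sum_range_succ']
  · have hb := Real.exp_bound (x := -x) (by rw [abs_neg, abs_of_pos hx]; exact h1) hk
    have hf : (0 : ℝ) < k.factorial := by exact_mod_cast k.factorial_pos
    have hne : (-x) ^ k ≠ 0 := pow_ne_zero _ (by linarith)
    refine ⟨(Real.exp (-x) - ∑ m ∈ Finset.range k, (-x) ^ m / m.factorial) *
      k.factorial / (-x) ^ k, ?_, ?_⟩
    · rw [abs_div, abs_mul, abs_of_pos hf, div_le_iff₀ (abs_pos.2 hne), abs_pow]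
      have hk' : (0 : ℝ) < k := by exact_mod_cast hk
      have hk1 : (1 : ℝ) ≤ k := by exact_mod_cast hk
      have e : |-x| ^ k * (((k.succ : ℕ) : ℝ) / (k.factorial * k)) * k.factorial ≤ 2 * |-x| ^ k := by
        have e' : |-x| ^ k * (((k.succ : ℕ) : ℝ) / (k.factorial * k)) * k.factorial
            = |-x| ^ k * (((k.succ : ℕ) : ℝ) / k) := by field_simp
        rw [e', mul_comm 2]
        gcongr
        rw [div_le_iff₀ hk']
        push_cast
        linarith
      refine le_trans ?_ e
      gcongr
    · rw [hornerReal_eq]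
      field_simp
      ring

theorem expHorner_succ (w k lo hi : ℕ) (c : ℕ → ℕ → Ball) : expHorner w (k + 1) lo hi c =
    forceNat (Nat.sub scale (Nat.succ (Nat.div (Nat.mul w hi) (Nat.mul scale (Nat.succ k)))))
      fun lo' =>
    forceNat (Nat.sub scale (Nat.div (Nat.mul w lo) (Nat.mul scale (Nat.succ k)))) fun hi' =>
      expHorner w k lo' hi' c := rfl

/-- The map h ↦ 1 - x h/(k + 1) is decreasing, so lower and upper bounds trade places at each step.
Since x ≤ 1/2, the range 0 ≤ h ≤ 2 is preserved. -/
theorem expHorner_spec (w : ℕ) (hw : 2 * w ≤ scale) (k : ℕ) :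
    ∀ (lo hi : ℕ) (h : ℝ) (c : ℕ → ℕ → Ball), 0 ≤ h → h ≤ 2 → (lo : ℝ) ≤ h * scale →
      h * scale ≤ hi → ∃ lo' hi' : ℕ, expHorner w k lo hi c = c lo' hi' ∧
        (lo' : ℝ) ≤ hornerReal (w / scale) k h * scale ∧
        hornerReal (w / scale) k h * scale ≤ hi' := by
  induction k with
  | zero => intro lo hi h c _ _ h3 h4; exact ⟨lo, hi, rfl, h3, h4⟩
  | succ k ih =>
    intro lo hi h c h1 h2 h3 h4
    have hs := scale_pos
    have hw' : (w : ℝ) / scale ≤ 1 / 2 := by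
      rw [div_le_iff₀ hs]
      have : (2 : ℝ) * w ≤ scale := by exact_mod_cast hw
      linarith
    have hw0 : (0 : ℝ) ≤ (w : ℝ) / scale := by positivity
    have hk1 : (1 : ℝ) ≤ (k : ℝ) + 1 := by
      have : (0 : ℝ) ≤ k := Nat.cast_nonneg k
      linarith
    have hq : (w : ℝ) / scale / (k + 1) * h ≤ 1 := by
      have : (w : ℝ) / scale / (k + 1) ≤ 1 / 2 := (div_le_self hw0 hk1).trans hw'
      nlinarith [div_nonneg hw0 (by linarith : (0 : ℝ) ≤ (k : ℝ) + 1)]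
    have hq0 : 0 ≤ (w : ℝ) / scale / (k + 1) * h :=
      mul_nonneg (div_nonneg hw0 (by linarith)) h1
    have hpos : 0 < scale * (k + 1) := Nat.mul_pos scale_pos_nat (Nat.succ_pos k)
    have d1 := natDiv_bounds (w * hi) (scale * (k + 1)) hpos
    have d2 := natDiv_bounds (w * lo) (scale * (k + 1)) hpos
    have E : expHorner w (k + 1) lo hi c =
        expHorner w k (scale - (w * hi / (scale * (k + 1)) + 1))
          (scale - w * lo / (scale * (k + 1))) c := by
      rw [expHorner_succ, forceNat_eq, forceNat_eq]
      rfl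
    rw [E]
    have key : ∀ z : ℝ, (w : ℝ) / scale / (k + 1) * z * scale
        = (w * (z * scale)) / (scale * (k + 1)) := by intro z; field_simp
    refine ih _ _ (1 - (w : ℝ) / scale / (k + 1) * h) c (by linarith) (by linarith) ?_ ?_
    · rw [sub_mul, one_mul, key]
      have hle : (w * (h * scale)) / (scale * (k + 1) : ℝ)
          ≤ ((w * hi : ℕ) : ℝ) / ((scale * (k + 1) : ℕ) : ℝ) := by
        push_cast
        gcongr
      rcases le_total (w * hi / (scale * (k + 1)) + 1) scale with hc | hc
      · rw [Nat.cast_sub hc]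
        push_cast at *
        linarith [d1.2]
      · rw [Nat.sub_eq_zero_of_le hc]
        have := mul_le_mul_of_nonneg_right hq hs.le
        rw [key] at this
        push_cast at *
        linarith
    · rw [sub_mul, one_mul, key]
      have hle : ((w * lo : ℕ) : ℝ) / ((scale * (k + 1) : ℕ) : ℝ)
          ≤ (w * (h * scale)) / (scale * (k + 1) : ℝ) := by
        push_cast
        gcongr
      have hsub : (scale : ℝ) - ((w * lo / (scale * (k + 1)) : ℕ) : ℝ)
          ≤ ((scale - w * lo / (scale * (k + 1)) : ℕ) : ℝ) := by
        rw [sub_le_iff_le_add]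
        exact_mod_cast le_tsub_add
      linarith [d2.1]

theorem expSquare_succ (k lo hi : ℕ) (c : ℕ → ℕ → Ball) : expSquare (k + 1) lo hi c =
    forceNat (Nat.div (Nat.mul lo lo) scale) fun lo' =>
    forceNat (Nat.succ (Nat.div (Nat.mul hi hi) scale)) fun hi' => expSquare k lo' hi' c := rfl

theorem expSquare_spec (k : ℕ) :
    ∀ (lo hi : ℕ) (h : ℝ) (c : ℕ → ℕ → Ball), (lo : ℝ) ≤ h * scale →
      h * scale ≤ hi → 0 ≤ h → ∃ lo' hi' : ℕ, expSquare k lo hi c = c lo' hi' ∧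
        (lo' : ℝ) ≤ h ^ (2 ^ k) * scale ∧ h ^ (2 ^ k) * scale ≤ hi' := by
  induction k with
  | zero => intro lo hi h c h3 h4 _; exact ⟨lo, hi, rfl, by simpa using h3, by simpa using h4⟩
  | succ k ih =>
    intro lo hi h c h3 h4 h0
    have hs := scale_pos
    have d1 := natDiv_bounds (lo * lo) scale scale_pos_nat
    have d2 := natDiv_bounds (hi * hi) scale scale_pos_nat
    have E : expSquare (k + 1) lo hi c =
        expSquare k (lo * lo / scale) (hi * hi / scale + 1) c := by
      rw [expSquare_succ, forceNat_eq, forceNat_eq]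
      rfl
    rw [E, pow_succ' 2 k, pow_mul]
    have e : h ^ 2 * scale = (h * scale) * (h * scale) / scale := by field_simp
    refine ih _ _ (h ^ 2) c ?_ ?_ (by positivity)
    · rw [e]
      refine d1.1.trans ?_
      push_cast
      gcongr
    · rw [e]
      have : (h * scale) * (h * scale) / scale ≤ ((hi * hi : ℕ) : ℝ) / scale := by
        push_cast
        gcongr
      push_cast at *
      linarith [d2.2]

theorem exp_sub_one_le {t : ℝ} (h0 : 0 ≤ t) (h1 : t ≤ 1) : Real.exp t - 1 ≤ t + t ^ 2 := by
  have := Real.abs_exp_sub_one_sub_id_le (x := t) (by rwa [abs_of_nonneg h0])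
  have := (abs_le.1 this).2
  linarith

theorem abs_exp_neg_sub_le {x X0 ρ : ℝ} (hρ0 : 0 ≤ ρ) (hρ1 : ρ ≤ 1) (hxX : |x - X0| ≤ ρ) :
    |Real.exp (-x) - Real.exp (-X0)| ≤ Real.exp (-X0) * (ρ + ρ ^ 2) := by
  have hEpos := Real.exp_pos (-X0)
  have hb := exp_sub_one_le hρ0 hρ1
  obtain ⟨g1, g2⟩ := abs_le.1 hxX
  have hup : Real.exp (-x) ≤ Real.exp (-X0) * Real.exp ρ := by
    rw [← Real.exp_add]; exact Real.exp_le_exp.2 (by linarith)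
  have hdn : Real.exp (-X0) * (1 - ρ) ≤ Real.exp (-x) := by
    have : 1 - ρ ≤ Real.exp (-ρ) := by linarith [Real.add_one_le_exp (-ρ)]
    calc _ ≤ Real.exp (-X0) * Real.exp (-ρ) := by gcongr
      _ ≤ _ := by rw [← Real.exp_add]; exact Real.exp_le_exp.2 (by linarith)
  rw [abs_le]
  constructor <;> nlinarith [sq_nonneg ρ]

/-- The exponential is the 256th power of one at an argument at most 1/2, obtained from a Taylor sum
and eight squarings. The radius `r` and the loss in dividing `m` by 256 together shift the argument
by at most (r + 256)/scale, which is paid for at the end. -/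
theorem Mem.nexpCore {m r : ℕ} {x : ℝ} (hm : m ≤ 128 * scale) (hr : r + 256 ≤ scale)
    (hx : |x * scale - m| ≤ r) : (Ball.nexpCore m r).Mem (Real.exp (-x)) := by
  have hs := scale_pos
  obtain ⟨w, hw⟩ : ∃ w, w = m / 256 := ⟨_, rfl⟩
  have hw2 : 2 * w ≤ scale := by omega
  have hx0 : (0 : ℝ) ≤ (w : ℝ) / scale := by positivity
  have hx1 : (w : ℝ) / scale ≤ 1 / 2 := by
    rw [div_le_iff₀ hs]
    have : (2 : ℝ) * w ≤ scale := by exact_mod_cast hw2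
    linarith
  obtain ⟨h, hh, hexp⟩ := exists_hornerReal_eq_exp ((w : ℝ) / scale) hx0 (by linarith) 13
    (by norm_num)
  -- The thirteenth, innermost Horner step has an unknown argument in [-2, 2], hence a value within
  -- 2x/13 of 1. This interval starts the other twelve steps.
  obtain ⟨e, he⟩ : ∃ e, e = 2 * w / 13 + 1 := ⟨_, rfl⟩
  have hde := natDiv_bounds (2 * w) 13 (by norm_num)
  have hstep : hornerReal ((w : ℝ) / scale) 13 h =
      hornerReal ((w : ℝ) / scale) 12 (1 - (w : ℝ) / scale / (12 + 1) * h) := by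
    rw [show (13 : ℕ) = 12 + 1 from rfl, hornerReal]; norm_num
  rw [hstep] at hexp
  obtain ⟨hh1, hh2⟩ := abs_le.1 hh
  have hq : |(w : ℝ) / scale / (12 + 1) * h| ≤ 2 * (w / scale) / 13 := by
    rw [abs_mul, abs_of_nonneg (by positivity)]
    nlinarith [abs_nonneg h, hx0]
  obtain ⟨hq1, hq2⟩ := abs_le.1 hq
  have hes : e ≤ scale := by have := scale_ge; omega
  have hee : 2 * ((w : ℝ) / scale) / 13 * scale ≤ e := by
    have : 2 * ((w : ℝ) / scale) / 13 * scale = 2 * w / 13 := by field_simp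
    rw [this, he]
    push_cast at hde ⊢
    linarith [hde.2]
  obtain ⟨lo, hi, hE, hlo, hhi⟩ := expHorner_spec w hw2 12 (scale - e) (scale + e)
    (1 - (w : ℝ) / scale / (12 + 1) * h)
    (fun lo hi => expSquare 8 lo hi fun lo hi => forceNat (Nat.add r 256) fun R =>
      mkF lo 0 (Nat.add (Nat.sub hi lo)
      (Nat.succ (Nat.div (Nat.mul hi (Nat.add R (Nat.succ (Nat.div (Nat.mul R R) scale)))) scale))))
    (by linarith) (by linarith)
    (by rw [Nat.cast_sub hes]; nlinarith)
    (by push_cast; nlinarith)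
  rw [hexp] at hlo hhi
  obtain ⟨lo', hi', hE', hlo', hhi'⟩ := expSquare_spec 8 lo hi (Real.exp (-((w : ℝ) / scale)))
    (fun lo hi => forceNat (Nat.add r 256) fun R =>
      mkF lo 0 (Nat.add (Nat.sub hi lo)
      (Nat.succ (Nat.div (Nat.mul hi (Nat.add R (Nat.succ (Nat.div (Nat.mul R R) scale)))) scale))))
    hlo hhi (Real.exp_pos _).le
  have hdef : Ball.nexpCore m r = ⟨lo', 0, (hi' - lo') +
      (hi' * ((r + 256) + ((r + 256) * (r + 256) / scale + 1)) / scale + 1)⟩ := by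
    rw [Ball.nexpCore, forceNat_eq, forceNat_eq]
    subst he hw
    refine hE.trans (hE'.trans ?_)
    rw [forceNat_eq, mkF_eq]
    rfl
  rw [hdef, mem_mk]
  set X0 : ℝ := 256 * ((w : ℝ) / scale) with hX0
  have hpow : Real.exp (-((w : ℝ) / scale)) ^ (2 ^ 8) = Real.exp (-X0) := by
    rw [← Real.exp_nat_mul, hX0]; congr 1; push_cast; ring
  rw [hpow] at hlo' hhi'
  set R := r + 256 with hR
  set ρ : ℝ := (R : ℝ) / scale with hρ
  have hρ0 : 0 ≤ ρ := by positivity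
  have hρ1 : ρ ≤ 1 := by rw [hρ, div_le_one hs]; exact_mod_cast hr
  have hwm : |(m : ℝ) - 256 * w| ≤ 256 := by
    have h1 : 256 * w ≤ m := by omega
    have h2 : m ≤ 256 * w + 256 := by omega
    have h1' : (256 : ℝ) * w ≤ m := by exact_mod_cast h1
    have h2' : (m : ℝ) ≤ 256 * w + 256 := by exact_mod_cast h2
    rw [abs_le]; constructor <;> linarith
  have hxX : |x - X0| ≤ ρ := by
    have : x - X0 = ((x * scale - m) + (m - 256 * w)) / scale := by
      rw [hX0]; field_simp; ring
    rw [this, abs_div, abs_of_pos hs, hρ]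
    gcongr
    refine (abs_add_le _ _).trans ?_
    rw [hR]; push_cast
    linarith
  have hEpos := Real.exp_pos (-X0)
  have hdiff := abs_exp_neg_sub_le hρ0 hρ1 hxX
  have hle : lo' ≤ hi' := by
    have : (lo' : ℝ) ≤ hi' := hlo'.trans hhi'
    exact_mod_cast this
  have d1 := natDiv_bounds (R * R) scale scale_pos_nat
  have d2 := natDiv_bounds (hi' * (R + (R * R / scale + 1))) scale scale_pos_nat
  have hfin : Real.exp (-X0) * (ρ + ρ ^ 2) * scale
      ≤ ((hi' * (R + (R * R / scale + 1)) : ℕ) : ℝ) / scale := by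
    have h1 : (ρ + ρ ^ 2) * scale ≤ R + ((R * R / scale : ℕ) + 1 : ℝ) := by
      have : (ρ + ρ ^ 2) * scale = R + (R * R : ℝ) / scale := by rw [hρ]; field_simp
      rw [this]
      push_cast at d1
      linarith [d1.2]
    rw [le_div_iff₀ hs]
    push_cast
    calc Real.exp (-X0) * (ρ + ρ ^ 2) * scale * scale
        = (Real.exp (-X0) * scale) * ((ρ + ρ ^ 2) * scale) := by ring
      _ ≤ (hi' : ℝ) * (R + ((R * R / scale : ℕ) + 1 : ℝ)) := by
        apply mul_le_mul hhi' h1 (by positivity) (by positivity)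
      _ = _ := by ring
  have hmul := mul_le_mul_of_nonneg_right hdiff hs.le
  rw [← abs_of_pos hs, ← abs_mul, abs_of_pos hs] at hmul
  have hc : |Real.exp (-X0) * scale - lo'| ≤ hi' - lo' := by
    rw [abs_le]; constructor <;> linarith
  calc _ = |(Real.exp (-x) - Real.exp (-X0)) * scale + (Real.exp (-X0) * scale - lo')| := by
        congr 1; push_cast; ring
    _ ≤ _ := (abs_add_le _ _).trans (add_le_add hmul hc)
    _ ≤ _ := by
      push_cast [Nat.cast_sub hle] at *
      linarith [d2.2]

theorem Mem.nexp {a : Ball} {x : ℝ} (hx : a.Mem x) : a.nexp.Mem (Real.exp (-x)) := by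
  obtain ⟨p, n, r⟩ := a
  rw [mem_mk] at hx
  rcases hb : (and (Nat.ble n p) (and (Nat.ble (Nat.sub p n) (Nat.mul 128 scale))
        (Nat.ble (Nat.add r 256) scale))) with _ | _
  · have : Ball.nexp ⟨p, n, r⟩ = ⟨0, 0, scale * 3 ^ ((p + n + r) / scale + 1)⟩ := by
      simp only [Ball.nexp, hb, mkF_eq]
      rfl
    rw [this, mem_mk]
    have hs := scale_pos
    have d := natDiv_bounds (p + n + r) scale scale_pos_nat
    have hle : -x ≤ ((p + n + r : ℕ) : ℝ) / scale := by
      rw [le_div_iff₀ hs]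
      push_cast
      have := (abs_le.1 hx).1
      have h1 : (0 : ℝ) ≤ p := Nat.cast_nonneg p
      linarith
    have h3 : Real.exp (-x) ≤ 3 ^ ((p + n + r) / scale + 1) := by
      calc Real.exp (-x) ≤ Real.exp (((p + n + r) / scale + 1 : ℕ) : ℝ) := by
            apply Real.exp_le_exp.2
            push_cast at *
            linarith [d.2]
        _ = Real.exp 1 ^ ((p + n + r) / scale + 1) := by rw [← Real.exp_nat_mul, mul_one]
        _ ≤ _ := by
          gcongr
          exact Real.exp_one_lt_three.le
    rw [abs_of_nonneg (by push_cast; linarith [mul_pos (Real.exp_pos (-x)) hs])]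
    push_cast
    nlinarith
  · have hE : Ball.nexp ⟨p, n, r⟩ = Ball.nexpCore (p - n) r := by
      simp only [Ball.nexp, hb]
      rfl
    rw [hE]
    simp only [Bool.and_eq_true, Nat.ble_eq] at hb
    obtain ⟨h1, h2, h3⟩ := hb
    refine Mem.nexpCore h2 h3 ?_
    rw [Nat.cast_sub h1]
    exact hx

end Ball

end BallArithmetic

end LatticePhase

/-! ### Straight-line programs, first-order jets and bisection of boxes. -/

namespace LatticePhase

noncomputable section BoxCheck

/-- The value and the two partial derivatives of a function of two variables. -/
structure Jet where
  v : Ball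
  x : Ball
  y : Ball

/-- Expressions in a list of variables. -/
inductive Expr where
  | var (i : ℕ)
  | const (a b : ℕ)
  | add (e f : Expr)
  | neg (e : Expr)
  | mul (e f : Expr)
  | smul (k : ℕ) (e : Expr)
  | nexp (e : Expr)

namespace Expr

/-- The real value of an expression; the variable `i` is the entry of the list `ρ` of length
`n + 1` with index `i`, counted from the end. -/
def eval (n : ℕ) (ρ : List ℝ) : Expr → ℝ
  | var i => ρ.getD (n - i) 0
  | const a b => (a : ℝ) / b
  | add e f => e.eval n ρ + f.eval n ρ
  | neg e => -e.eval n ρ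
  | mul e f => e.eval n ρ * f.eval n ρ
  | smul k e => k * e.eval n ρ
  | nexp e => Real.exp (-e.eval n ρ)

/-- No constant has denominator zero. -/
def WF : Expr → Prop
  | var _ => True
  | const _ b => 0 < b
  | add e f => e.WF ∧ f.WF
  | neg e => e.WF
  | mul e f => e.WF ∧ f.WF
  | smul _ e => e.WF
  | nexp e => e.WF

/-- The value of a program: each expression of the list is pushed on the environment. -/
def run (n : ℕ) (ρ : List ℝ) : List Expr → Expr → ℝ
  | [], e => e.eval n ρ
  | a :: l, e => run (n + 1) (a.eval n ρ :: ρ) l e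

end Expr

namespace Ball

def zero : Ball := ⟨0, 0, 0⟩

/-- Forces all components before continuing. -/
def seq {β : Type} (b : Ball) (k : Ball → β) : β :=
  Ball.rec (fun p n r => forceNat p fun p => forceNat n fun n => forceNat r fun r => k ⟨p, n, r⟩) b

theorem seq_eq {β : Type} (b : Ball) (k : Ball → β) : seq b k = k b := by
  cases b; simp [seq, forceNat_eq]

theorem mem_zero : zero.Mem 0 := by simp [zero, mem_mk]

end Ball

/-- Lookup in a list, written with recursors. -/
def lookup {β : Type} (d : β) (l : List β) : ℕ → β :=
  List.rec (fun _ => d) (fun a _ ih i => Nat.rec a (fun i _ => ih i) i) l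

theorem lookup_eq {β : Type} (d : β) (l : List β) (i : ℕ) : lookup d l i = l.getD i d := by
  induction l generalizing i with
  | nil => simp [lookup]
  | cons a l ih =>
    cases i with
    | zero => simp [lookup]
    | succ i => simpa [lookup] using ih i

namespace Expr

def ball (n : ℕ) (ρ : List Ball) (e : Expr) : Ball :=
  Expr.rec (fun i => lookup Ball.zero ρ (Nat.sub n i)) (fun a b => Ball.const a b)
    (fun _ _ a b => Ball.add a b) (fun _ a => Ball.neg a) (fun _ _ a b => Ball.mul a b)
    (fun k _ a => Ball.smul k a) (fun _ a => Ball.nexp a) e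

/-- Forward differentiation by the product and chain rules; `Ball.seq` evaluates a value shared by
several components once. -/
def jet (n : ℕ) (ρ : List Jet) (e : Expr) : Jet :=
  Expr.rec (fun i => lookup ⟨Ball.zero, Ball.zero, Ball.zero⟩ ρ (Nat.sub n i))
    (fun a b => ⟨Ball.const a b, Ball.zero, Ball.zero⟩)
    (fun _ _ a b => Jet.rec (fun v x y => Jet.rec (fun v' x' y' =>
      ⟨v.add v', x.add x', y.add y'⟩) b) a)
    (fun _ a => Jet.rec (fun v x y => ⟨v.neg, x.neg, y.neg⟩) a)
    (fun _ _ a b => Jet.rec (fun v x y => Jet.rec (fun v' x' y' =>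
      Ball.seq v fun v => Ball.seq v' fun v' =>
      ⟨v.mul v', (x.mul v').add (v.mul x'), (y.mul v').add (v.mul y')⟩) b) a)
    (fun k _ a => Jet.rec (fun v x y => ⟨v.smul k, x.smul k, y.smul k⟩) a)
    (fun _ a => Jet.rec (fun v x y => Ball.seq v.nexp fun w =>
      ⟨w, (w.mul x).neg, (w.mul y).neg⟩) a) e

def runBall {β : Type} (l : List Expr) (e : Expr) : ℕ → List Ball → (Ball → β) → β :=
  List.rec (fun n ρ k => Ball.seq (e.ball n ρ) k)
    (fun a _ ih n ρ k => Ball.seq (a.ball n ρ) fun b =>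
      forceNat (Nat.succ n) fun n => ih n (b :: ρ) k) l

def seqJet {β : Type} (j : Jet) (k : Jet → β) : β :=
  Jet.rec (fun v x y => Ball.seq v fun v => Ball.seq x fun x => Ball.seq y fun y => k ⟨v, x, y⟩) j

theorem seqJet_eq {β : Type} (j : Jet) (k : Jet → β) : seqJet j k = k j := by
  cases j; simp [seqJet, Ball.seq_eq]

def runJet {β : Type} (l : List Expr) (e : Expr) : ℕ → List Jet → (Jet → β) → β :=
  List.rec (fun n ρ k => seqJet (e.jet n ρ) k)
    (fun a _ ih n ρ k => seqJet (a.jet n ρ) fun b =>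
      forceNat (Nat.succ n) fun n => ih n (b :: ρ) k) l

/-- The result of `runJet`. -/
def jetResult : List Expr → Expr → ℕ → List Jet → Jet
  | [], e, n, ρ => e.jet n ρ
  | a :: l, e, n, ρ => jetResult l e (n + 1) (a.jet n ρ :: ρ)

end Expr

/-- A ball enclosing all reals between `a / u` and `b / u`. -/
def coordBall (u a b : ℕ) : Ball :=
  Ball.mkF (Nat.div (Nat.mul (Nat.add a b) scale) (Nat.mul 2 u)) 0
    (Nat.add (Nat.div (Nat.mul (Nat.sub b a) scale) (Nat.mul 2 u)) 2)

/-- A ball enclosing the inverses of all reals between `a / u` and `b / u`. -/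
def invBall (u a b : ℕ) : Ball :=
  forceNat (Nat.div (Nat.mul u scale) b) fun lo =>
  forceNat (Nat.succ (Nat.div (Nat.mul u scale) a)) fun hi => Ball.mkF lo 0 (Nat.sub hi lo)

/-- Expressions have no division, so the inverse of the second coordinate is supplied as a variable.
Programs that need 1/A take A as second coordinate. -/
def ballEnv (u : ℕ) (ex : List Ball) (x y : ℕ) : List Ball :=
  List.append ex [invBall u y y, coordBall u y y, coordBall u x x]

def jetEnv (u : ℕ) (ex : List Ball) (x0 x1 y0 y1 : ℕ) : List Jet :=
  List.rec [⟨invBall u y0 y1, Ball.zero, (Ball.mul (invBall u y0 y1) (invBall u y0 y1)).neg⟩,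
      ⟨coordBall u y0 y1, Ball.zero, Ball.const 1 1⟩, ⟨coordBall u x0 x1, Ball.const 1 1, Ball.zero⟩]
    (fun b _ ih => ⟨b, Ball.zero, Ball.zero⟩ :: ih) ex

def magnitude (b : Ball) : ℕ := Ball.rec (fun p n r => Nat.add (Nat.add p n) r) b

/-- Bisection: proves positivity of the program on the box `[x0, x1] × [y0, y1]`. -/
def checkBox (u : ℕ) (ex : List Ball) (l : List Expr) (e : Expr) (fuel : ℕ) : ℕ → ℕ → ℕ → ℕ → Bool :=
  Nat.rec (fun _ _ _ _ => false) (fun _ ih x0 x1 y0 y1 =>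
    forceNat (Nat.div (Nat.add x0 x1) 2) fun cx =>
    forceNat (Nat.div (Nat.add y0 y1) 2) fun cy =>
    Expr.runBall l e (Nat.add (List.length ex) 2) (ballEnv u ex cx cy) fun c =>
    Expr.runJet l e (Nat.add (List.length ex) 2) (jetEnv u ex x0 x1 y0 y1) fun j =>
    forceNat (Nat.mul (magnitude j.x) (Nat.sub x1 cx)) fun mx =>
    forceNat (Nat.mul (magnitude j.y) (Nat.sub y1 cy)) fun my =>
    -- Mean value test with denominators cleared: the lower bound at the centre must exceed the
    -- derivative bounds times the half-widths. `Bool.rec` lists the false branch first; on failure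
    -- the coordinate with the larger contribution is halved.
    Bool.rec
      (Bool.rec
        (Bool.rec false (ih x0 x1 cy y1) (ih x0 x1 y0 cy))
        (Bool.rec false (ih cx x1 y0 y1) (ih x0 cx y0 y1))
        (Nat.ble my mx))
      true
      (Nat.blt (Nat.add (Nat.mul (Nat.add c.n c.r) u) (Nat.add mx my)) (Nat.mul c.p u)))
    fuel

end BoxCheck
end LatticePhase

/-! ### Soundness of the box check. -/

namespace LatticePhase

noncomputable section BoxCheckSound

namespace Expr

theorem mem_lookup {β γ : Type} {R : β → γ → Prop} {d : β} {d' : γ} (hd : R d d') {l : List β}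
    {l' : List γ} (h : List.Forall₂ R l l') (i : ℕ) : R (lookup d l i) (l'.getD i d') := by
  rw [lookup_eq]
  induction h generalizing i with
  | nil => simpa using hd
  | cons h _ ih => cases i with
    | zero => simpa using h
    | succ i => simpa using ih i

theorem mem_ball {ρb : List Ball} {ρ : List ℝ} (h : List.Forall₂ Ball.Mem ρb ρ) (n : ℕ) :
    ∀ e : Expr, e.WF → (e.ball n ρb).Mem (e.eval n ρ)
  | var i, _ => mem_lookup Ball.mem_zero h (n - i)
  | const a b, hb => Ball.mem_const a b hb
  | add e f, hw => (mem_ball h n e hw.1).add (mem_ball h n f hw.2)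
  | neg e, hw => (mem_ball h n e hw).neg
  | mul e f, hw => (mem_ball h n e hw.1).mul (mem_ball h n f hw.2)
  | smul k e, hw => (mem_ball h n e hw).smul k
  | nexp e, hw => (mem_ball h n e hw).nexp

theorem mem_runBall (l : List Expr) (e : Expr) (hl : ∀ a ∈ l, a.WF) (he : e.WF) :
    ∀ (n : ℕ) {ρb : List Ball} {ρ : List ℝ}, List.Forall₂ Ball.Mem ρb ρ →
      ∃ b : Ball, (∀ k : Ball → Bool, runBall l e n ρb k = k b) ∧ b.Mem (run n ρ l e) := by
  induction l with
  | nil => exact fun n ρb ρ h => ⟨_, fun k => Ball.seq_eq _ k, mem_ball h n e he⟩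
  | cons a l ih =>
    intro n ρb ρ h
    obtain ⟨b, hb, hm⟩ := ih (fun c hc => hl c (List.mem_cons_of_mem _ hc)) (n + 1)
      (List.Forall₂.cons (mem_ball h n a (hl a List.mem_cons_self)) h)
    refine ⟨b, fun k => ?_, hm⟩
    have : runBall (a :: l) e n ρb k = Ball.seq (a.ball n ρb) fun b =>
      forceNat (Nat.succ n) fun n => runBall l e n (b :: ρb) k := rfl
    rw [this, Ball.seq_eq, forceNat_eq]
    exact hb k

end Expr

/-- The jet `j` encloses the value and the partial derivatives of `f` at `(x, y)`. -/
structure Jet.Mem (x y : ℝ) (j : Jet) (f : ℝ → ℝ → ℝ) : Prop where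
  v : j.v.Mem (f x y)
  dx : ∃ d, HasDerivAt (fun t => f t y) d x ∧ j.x.Mem d
  dy : ∃ d, HasDerivAt (fun t => f x t) d y ∧ j.y.Mem d

namespace Expr

theorem mem_jet {x y : ℝ} {ρj : List Jet} {ρ : List (ℝ → ℝ → ℝ)}
    (h : List.Forall₂ (Jet.Mem x y) ρj ρ) (n : ℕ) :
    ∀ e : Expr, e.WF → Jet.Mem x y (e.jet n ρj) fun x y => e.eval n (ρ.map fun f => f x y)
  | var i, _ => by
    have := mem_lookup (R := Jet.Mem x y) (d := ⟨Ball.zero, Ball.zero, Ball.zero⟩)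
      (d' := fun _ _ => 0)
      ⟨Ball.mem_zero, ⟨0, hasDerivAt_const _ _, Ball.mem_zero⟩,
        ⟨0, hasDerivAt_const _ _, Ball.mem_zero⟩⟩ h (n - i)
    have e : (fun x y => eval n (ρ.map fun f => f x y) (var i))
        = ρ.getD (n - i) (fun _ _ => 0) := by
      funext s t
      simp only [eval]
      generalize n - i = k
      rw [List.getD_eq_getElem?_getD, List.getD_eq_getElem?_getD, List.getElem?_map]
      cases ρ[k]? <;> rfl
    rw [e]
    exact this
  | const a b, hb => ⟨Ball.mem_const a b hb, ⟨0, hasDerivAt_const _ _, Ball.mem_zero⟩,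
        ⟨0, hasDerivAt_const _ _, Ball.mem_zero⟩⟩
  | add e f, hw => by
    obtain ⟨hv, ⟨d, hd, hdm⟩, ⟨d', hd', hdm'⟩⟩ := mem_jet h n e hw.1
    obtain ⟨kv, ⟨c, hc, hcm⟩, ⟨c', hc', hcm'⟩⟩ := mem_jet h n f hw.2
    exact ⟨hv.add kv, ⟨_, hd.add hc, hdm.add hcm⟩, ⟨_, hd'.add hc', hdm'.add hcm'⟩⟩
  | neg e, hw => by
    obtain ⟨hv, ⟨d, hd, hdm⟩, ⟨d', hd', hdm'⟩⟩ := mem_jet h n e hw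
    exact ⟨hv.neg, ⟨_, hd.neg, hdm.neg⟩, ⟨_, hd'.neg, hdm'.neg⟩⟩
  | mul e f, hw => by
    obtain ⟨hv, ⟨d, hd, hdm⟩, ⟨d', hd', hdm'⟩⟩ := mem_jet h n e hw.1
    obtain ⟨kv, ⟨c, hc, hcm⟩, ⟨c', hc', hcm'⟩⟩ := mem_jet h n f hw.2
    have E : (mul e f).jet n ρj = ⟨(e.jet n ρj).v.mul (f.jet n ρj).v,
      ((e.jet n ρj).x.mul (f.jet n ρj).v).add ((e.jet n ρj).v.mul (f.jet n ρj).x),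
      ((e.jet n ρj).y.mul (f.jet n ρj).v).add ((e.jet n ρj).v.mul (f.jet n ρj).y)⟩ := by
      show Ball.seq (e.jet n ρj).v (fun v => Ball.seq (f.jet n ρj).v fun v' => Jet.mk (v.mul v')
        (((e.jet n ρj).x.mul v').add (v.mul (f.jet n ρj).x))
        (((e.jet n ρj).y.mul v').add (v.mul (f.jet n ρj).y))) = _
      rw [Ball.seq_eq, Ball.seq_eq]
    rw [E]
    exact ⟨hv.mul kv, ⟨_, hd.mul hc, (hdm.mul kv).add (hv.mul hcm)⟩,
      ⟨_, hd'.mul hc', (hdm'.mul kv).add (hv.mul hcm')⟩⟩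
  | smul k e, hw => by
    obtain ⟨hv, ⟨d, hd, hdm⟩, ⟨d', hd', hdm'⟩⟩ := mem_jet h n e hw
    exact ⟨hv.smul k, ⟨_, hd.const_mul _, hdm.smul k⟩, ⟨_, hd'.const_mul _, hdm'.smul k⟩⟩
  | nexp e, hw => by
    obtain ⟨hv, ⟨d, hd, hdm⟩, ⟨d', hd', hdm'⟩⟩ := mem_jet h n e hw
    have E : (nexp e).jet n ρj = ⟨(e.jet n ρj).v.nexp,
      ((e.jet n ρj).v.nexp.mul (e.jet n ρj).x).neg,
      ((e.jet n ρj).v.nexp.mul (e.jet n ρj).y).neg⟩ := by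
      show Ball.seq (e.jet n ρj).v.nexp (fun w => Jet.mk w (w.mul (e.jet n ρj).x).neg
        (w.mul (e.jet n ρj).y).neg) = _
      rw [Ball.seq_eq]
    rw [E]
    refine ⟨hv.nexp, ⟨_, hd.neg.exp, ?_⟩, ⟨_, hd'.neg.exp, ?_⟩⟩
    · rw [mul_neg]; exact (hv.nexp.mul hdm).neg
    · rw [mul_neg]; exact (hv.nexp.mul hdm').neg

theorem mem_runJet (l : List Expr) (e : Expr) (hl : ∀ a ∈ l, a.WF) (he : e.WF) {x y : ℝ} :
    ∀ (n : ℕ) {ρj : List Jet} {ρ : List (ℝ → ℝ → ℝ)}, List.Forall₂ (Jet.Mem x y) ρj ρ →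
      Jet.Mem x y (jetResult l e n ρj) fun x y => run n (ρ.map fun f => f x y) l e := by
  induction l with
  | nil => exact fun n ρj ρ h => mem_jet h n e he
  | cons a l ih =>
    intro n ρj ρ h
    exact ih (fun c hc => hl c (List.mem_cons_of_mem _ hc)) (n + 1)
      (List.Forall₂.cons (mem_jet h n a (hl a List.mem_cons_self)) h)

theorem runJet_eq (l : List Expr) (e : Expr) :
    ∀ (n : ℕ) (ρj : List Jet) (k : Jet → Bool), runJet l e n ρj k = k (jetResult l e n ρj) := by
  induction l with
  | nil => exact fun n ρj k => seqJet_eq _ k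
  | cons a l ih =>
    intro n ρj k
    have : runJet (a :: l) e n ρj k = seqJet (a.jet n ρj) fun b =>
      forceNat (Nat.succ n) fun n => runJet l e n (b :: ρj) k := rfl
    rw [this, seqJet_eq, forceNat_eq]
    exact ih _ _ k

end Expr

variable {u : ℕ}

theorem mem_coordBall (hu : 0 < u) {a b : ℕ} (hab : a ≤ b) {x : ℝ} (h0 : a / u ≤ x) (h1 : x ≤ b / u) :
    (coordBall u a b).Mem x := by
  have hs := scale_pos
  have hu' : 0 < 2 * u := by omega
  have hu : (0 : ℝ) < u := by exact_mod_cast hu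
  rw [coordBall, Ball.mkF_eq, Ball.mem_mk]
  have e1 := Ball.natDiv_bounds ((a + b) * scale) (2 * u) hu'
  have e2 := Ball.natDiv_bounds ((b - a) * scale) (2 * u) hu'
  have c1 : x * scale ≤ b * scale / u := by
    rw [mul_div_right_comm]; gcongr
  have c0 : a * scale / u ≤ x * scale := by
    rw [mul_div_right_comm]; gcongr
  have f1 : (((a + b) * scale : ℕ) : ℝ) / ((2 * u : ℕ) : ℝ)
      = (a * scale / u + b * scale / u) / 2 := by push_cast; field_simp
  have f2 : (((b - a) * scale : ℕ) : ℝ) / ((2 * u : ℕ) : ℝ)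
      = (b * scale / u - a * scale / u) / 2 := by
    push_cast [Nat.cast_sub hab]; field_simp
  rw [f1] at e1
  rw [f2] at e2
  show |x * scale - ((((a + b) * scale / (2 * u) : ℕ) : ℝ) - (0 : ℕ))| ≤
    (((b - a) * scale / (2 * u) + 2 : ℕ) : ℝ)
  rw [abs_le]
  push_cast at *
  constructor <;> linarith [e1.1, e1.2, e2.1, e2.2]

theorem mem_invBall (hu : 0 < u) {a b : ℕ} (ha : 0 < a) (hab : a ≤ b) {x : ℝ} (h0 : a / u ≤ x)
    (h1 : x ≤ b / u) : (invBall u a b).Mem x⁻¹ := by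
  have hu' : (0 : ℝ) < u := by exact_mod_cast hu
  have hs := scale_pos
  have ha' : (0 : ℝ) < a := by exact_mod_cast ha
  have hb' : (0 : ℝ) < b := by exact_mod_cast ha.trans_le hab
  have hx : 0 < x := lt_of_lt_of_le (by positivity) h0
  rw [invBall, forceNat_eq, forceNat_eq, Ball.mkF_eq, Ball.mem_mk]
  have e1 := Ball.natDiv_bounds (u * scale) b (ha.trans_le hab)
  have e2 := Ball.natDiv_bounds (u * scale) a ha
  have c0 : (u : ℝ) * scale / b ≤ x⁻¹ * scale := by
    rw [mul_div_right_comm, ← inv_div]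
    gcongr
  have c1 : x⁻¹ * scale ≤ (u : ℝ) * scale / a := by
    rw [mul_div_right_comm, ← inv_div (a : ℝ)]
    gcongr
  have hle : u * scale / b ≤ u * scale / a + 1 :=
    (Nat.div_le_div_left hab ha).trans (Nat.le_succ _)
  show |x⁻¹ * scale - (((u * scale / b : ℕ) : ℝ) - (0 : ℕ))| ≤
    ((u * scale / a + 1 - u * scale / b : ℕ) : ℝ)
  rw [abs_le, Nat.cast_sub hle]
  push_cast at *
  constructor <;> linarith [e1.1, e1.2, e2.1, e2.2]

theorem Ball.Mem.abs_le_magnitude {b : Ball} {x : ℝ} (h : b.Mem x) :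
    |x| ≤ magnitude b / scale := by
  obtain ⟨p, n, r⟩ := b
  have hs := scale_pos
  rw [Ball.mem_mk] at h
  rw [le_div_iff₀ hs]
  have e : |x| * scale = |x * scale| := by rw [abs_mul, abs_of_pos hs]
  rw [e]
  show |x * scale| ≤ ((p + n + r : ℕ) : ℝ)
  obtain ⟨h1, h2⟩ := abs_le.1 h
  have hp : (0 : ℝ) ≤ p := Nat.cast_nonneg p
  have hn : (0 : ℝ) ≤ n := Nat.cast_nonneg n
  rw [abs_le]
  push_cast
  constructor <;> linarith

theorem forall₂_ballEnv (hu : 0 < u) {ex : List Ball} {c : List ℝ} (hc : List.Forall₂ Ball.Mem ex c)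
    {x y : ℕ} (hy : 0 < y) :
    List.Forall₂ Ball.Mem (ballEnv u ex x y)
      (c ++ [((y : ℝ) / u)⁻¹, (y : ℝ) / u, (x : ℝ) / u]) := by
  induction hc with
  | nil =>
    exact .cons (mem_invBall hu hy le_rfl le_rfl le_rfl) (.cons (mem_coordBall hu le_rfl le_rfl le_rfl)
      (.cons (mem_coordBall hu le_rfl le_rfl le_rfl) .nil))
  | cons h _ ih => exact .cons h ih

/-- The environment of a check, as functions of the two variables. -/
def funEnv (c : List ℝ) : List (ℝ → ℝ → ℝ) :=
  c.map (fun a _ _ => a) ++ [fun _ y => y⁻¹, fun _ y => y, fun x _ => x]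

theorem map_funEnv (c : List ℝ) (x y : ℝ) :
    (funEnv c).map (fun f => f x y) = c ++ [y⁻¹, y, x] := by
  simp [funEnv, Function.comp_def]

theorem forall₂_jetEnv (hu : 0 < u) {ex : List Ball} {c : List ℝ} (hc : List.Forall₂ Ball.Mem ex c)
    {x0 x1 y0 y1 : ℕ} (hy : 0 < y0) (hx01 : x0 ≤ x1) (hy01 : y0 ≤ y1) {x y : ℝ}
    (hx0 : x0 / u ≤ x) (hx1 : x ≤ x1 / u) (hy0 : y0 / u ≤ y) (hy1 : y ≤ y1 / u) :
    List.Forall₂ (Jet.Mem x y) (jetEnv u ex x0 x1 y0 y1) (funEnv c) := by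
  have one : (Ball.const 1 1).Mem 1 := by simpa using Ball.mem_const 1 1 one_pos
  induction hc with
  | nil =>
    have hu' : (0 : ℝ) < u := by exact_mod_cast hu
    have hy' : (0 : ℝ) < y0 := by exact_mod_cast hy
    have hypos : 0 < y := lt_of_lt_of_le (by positivity) hy0
    have hi := mem_invBall hu hy hy01 hy0 hy1
    refine .cons ⟨hi, ⟨0, hasDerivAt_const _ _, Ball.mem_zero⟩, ⟨_, hasDerivAt_inv hypos.ne', ?_⟩⟩
      (.cons ⟨mem_coordBall hu hy01 hy0 hy1, ⟨0, hasDerivAt_const _ _, Ball.mem_zero⟩,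
        ⟨1, hasDerivAt_id _, one⟩⟩ (.cons ⟨mem_coordBall hu hx01 hx0 hx1, ⟨1, hasDerivAt_id _, one⟩,
          ⟨0, hasDerivAt_const _ _, Ball.mem_zero⟩⟩ .nil))
    rw [show (y ^ 2)⁻¹ = y⁻¹ * y⁻¹ by rw [sq, mul_inv]]
    exact (hi.mul hi).neg
  | cons h _ ih =>
    exact .cons ⟨h, ⟨0, hasDerivAt_const _ _, Ball.mem_zero⟩,
      ⟨0, hasDerivAt_const _ _, Ball.mem_zero⟩⟩ ih

/-- A mean value bound on an interval. -/
theorem abs_sub_le_of_hasDerivAt {f : ℝ → ℝ} {a b C : ℝ} {s t : ℝ} (hs : s ∈ Set.Icc a b)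
    (ht : t ∈ Set.Icc a b) (hf : ∀ u ∈ Set.Icc a b, ∃ d, HasDerivAt f d u ∧ |d| ≤ C) :
    |f t - f s| ≤ C * |t - s| := by
  have := (convex_Icc a b).norm_image_sub_le_of_norm_deriv_le (𝕜 := ℝ) (f := f) (C := C)
    (fun u hu => (hf u hu).choose_spec.1.differentiableAt)
    (fun u hu => by rw [(hf u hu).choose_spec.1.deriv]; exact (hf u hu).choose_spec.2) hs ht
  simpa using this

/-- The value of the program `(l, e)` with constants `c` at `(x, y)`. The variables are numbered
`0` for `x`, `1` for `y`, `2` for `y⁻¹`, followed by the constants in reverse order and the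
expressions of the list `l`. -/
def Expr.value (c : List ℝ) (l : List Expr) (e : Expr) (x y : ℝ) : ℝ :=
  Expr.run (c.length + 2) (c ++ [y⁻¹, y, x]) l e

/-- Induction on the fuel. When the test succeeds, a point is reached from the centre by a
horizontal and then a vertical move, and the jet over the whole box bounds the change along each. -/
theorem value_pos_of_checkBox (hu : 0 < u) {ex : List Ball} {c : List ℝ} (hc : List.Forall₂ Ball.Mem ex c)
    {l : List Expr} {e : Expr} (hl : ∀ a ∈ l, a.WF) (he : e.WF) (fuel : ℕ) :
    ∀ (x0 x1 y0 y1 : ℕ), 0 < y0 → x0 ≤ x1 → y0 ≤ y1 → checkBox u ex l e fuel x0 x1 y0 y1 = true →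
      ∀ x y : ℝ, x0 / u ≤ x → x ≤ x1 / u → y0 / u ≤ y → y ≤ y1 / u →
        0 < Expr.value c l e x y := by
  induction fuel with
  | zero => intro x0 x1 y0 y1 _ _ _ h; cases h
  | succ fuel ih =>
    intro x0 x1 y0 y1 hy hx01 hy01 h x y hx0 hx1 hy0 hy1
    have hun := hu
    replace hu : (0 : ℝ) < u := by exact_mod_cast hu
    have hs := scale_pos
    obtain ⟨cx, hcx⟩ : ∃ cx, cx = (x0 + x1) / 2 := ⟨_, rfl⟩
    obtain ⟨cy, hcy⟩ : ∃ cy, cy = (y0 + y1) / 2 := ⟨_, rfl⟩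
    obtain ⟨b, hb, hbm⟩ := Expr.mem_runBall l e hl he (ex.length + 2)
      (forall₂_ballEnv hun hc (x := cx) (y := cy) (by omega))
    obtain ⟨j, hj⟩ : ∃ j, j = Expr.jetResult l e (ex.length + 2) (jetEnv u ex x0 x1 y0 y1) :=
      ⟨_, rfl⟩
    have hE : checkBox u ex l e (fuel + 1) x0 x1 y0 y1 =
        Bool.rec
          (Bool.rec
            (Bool.rec false (checkBox u ex l e fuel x0 x1 cy y1) (checkBox u ex l e fuel x0 x1 y0 cy))
            (Bool.rec false (checkBox u ex l e fuel cx x1 y0 y1) (checkBox u ex l e fuel x0 cx y0 y1))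
            (Nat.ble (magnitude j.y * (y1 - cy)) (magnitude j.x * (x1 - cx))))
          true
          (Nat.blt ((b.n + b.r) * u +
            (magnitude j.x * (x1 - cx) + magnitude j.y * (y1 - cy))) (b.p * u)) := by
      have h1 : checkBox u ex l e (fuel + 1) x0 x1 y0 y1 =
          forceNat (Nat.div (Nat.add x0 x1) 2) fun cx =>
          forceNat (Nat.div (Nat.add y0 y1) 2) fun cy =>
          Expr.runBall l e (Nat.add (List.length ex) 2) (ballEnv u ex cx cy) fun c =>
          Expr.runJet l e (Nat.add (List.length ex) 2) (jetEnv u ex x0 x1 y0 y1) fun j =>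
          forceNat (Nat.mul (magnitude j.x) (Nat.sub x1 cx)) fun mx =>
          forceNat (Nat.mul (magnitude j.y) (Nat.sub y1 cy)) fun my =>
          Bool.rec
            (Bool.rec
              (Bool.rec false (checkBox u ex l e fuel x0 x1 cy y1)
                (checkBox u ex l e fuel x0 x1 y0 cy))
              (Bool.rec false (checkBox u ex l e fuel cx x1 y0 y1)
                (checkBox u ex l e fuel x0 cx y0 y1))
              (Nat.ble my mx))
            true
            (Nat.blt (Nat.add (Nat.mul (Nat.add c.n c.r) u) (Nat.add mx my))
              (Nat.mul c.p u)) := rfl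
      rw [h1, forceNat_eq, forceNat_eq]
      subst hcx hcy hj
      refine (hb _).trans ?_
      rw [Expr.runJet_eq, forceNat_eq, forceNat_eq]
      rfl
    have hlen : ex.length = c.length := hc.length_eq
    rw [hlen] at hbm hj
    have hd : ∀ s t : ℝ, x0 / u ≤ s → s ≤ x1 / u → y0 / u ≤ t → t ≤ y1 / u →
        Jet.Mem s t j (Expr.value c l e) := by
      intro s t h1 h2 h3 h4
      have := Expr.mem_runJet l e hl he (c.length + 2)
        (forall₂_jetEnv hun hc hy hx01 hy01 h1 h2 h3 h4)
      rw [← hj] at this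
      simp only [map_funEnv] at this
      exact this
    rw [hE] at h
    rcases hT : (Nat.blt ((b.n + b.r) * u +
            (magnitude j.x * (x1 - cx) + magnitude j.y * (y1 - cy))) (b.p * u)) with _ | _
    · rw [hT] at h
      have hcx1 : (cx : ℝ) ≤ x1 := by exact_mod_cast (by omega : cx ≤ x1)
      rcases hM : (Nat.ble (magnitude j.y * (y1 - cy)) (magnitude j.x * (x1 - cx))) with _ | _
      · rw [hM] at h
        rcases h1 : checkBox u ex l e fuel x0 x1 y0 cy with _ | _
        · rw [h1] at h; cases h
        · rw [h1] at h
          rcases le_total y (cy / u) with hle | hle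
          · exact ih x0 x1 y0 cy hy hx01 (by omega) h1 x y hx0 hx1 hy0 hle
          · exact ih x0 x1 cy y1 (by omega) hx01 (by omega) h x y hx0 hx1 hle hy1
      · rw [hM] at h
        rcases h1 : checkBox u ex l e fuel x0 cx y0 y1 with _ | _
        · rw [h1] at h; cases h
        · rw [h1] at h
          rcases le_total x (cx / u) with hle | hle
          · exact ih x0 cx y0 y1 hy (by omega) hy01 h1 x y hx0 hle hy0 hy1
          · exact ih cx x1 y0 y1 hy (by omega) hy01 h x y hle hx1 hy0 hy1
    · have hlt := Nat.le_of_ble_eq_true hT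
      have hlt' : ((b.n : ℝ) + b.r) * u + (magnitude j.x * ((x1 - cx : ℕ) : ℝ)
          + magnitude j.y * ((y1 - cy : ℕ) : ℝ)) < b.p * u := by
        have : (b.n + b.r) * u + (magnitude j.x * (x1 - cx) + magnitude j.y * (y1 - cy))
          < b.p * u := hlt
        exact_mod_cast this
      have ha0 : ((x0 : ℕ) : ℝ) ≤ cx := by exact_mod_cast (by omega : x0 ≤ cx)
      have ha1 : (cx : ℝ) ≤ x1 := by exact_mod_cast (by omega : cx ≤ x1)
      have hb0 : ((y0 : ℕ) : ℝ) ≤ cy := by exact_mod_cast (by omega : y0 ≤ cy)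
      have hb1 : (cy : ℝ) ≤ y1 := by exact_mod_cast (by omega : cy ≤ y1)
      have hc0 : (cx : ℝ) - x0 ≤ (x1 - cx : ℕ) := by
        have : cx ≤ (x1 - cx) + x0 := by omega
        rw [sub_le_iff_le_add]; exact_mod_cast this
      have hc1 : (x1 : ℝ) - cx ≤ (x1 - cx : ℕ) := by rw [Nat.cast_sub (by omega)]
      have hd0 : (cy : ℝ) - y0 ≤ (y1 - cy : ℕ) := by
        have : cy ≤ (y1 - cy) + y0 := by omega
        rw [sub_le_iff_le_add]; exact_mod_cast this
      have hd1 : (y1 : ℝ) - cy ≤ (y1 - cy : ℕ) := by rw [Nat.cast_sub (by omega)]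
      have g0 : (x0 : ℝ) / u ≤ cx / u := by gcongr
      have g1 : (cx : ℝ) / u ≤ x1 / u := by gcongr
      have k0 : (y0 : ℝ) / u ≤ cy / u := by gcongr
      have k1 : (cy : ℝ) / u ≤ y1 / u := by gcongr
      have m1 : |Expr.value c l e x (cy / u) - Expr.value c l e (cx / u) (cy / u)|
          ≤ magnitude j.x / scale * |x - cx / u| := by
        refine abs_sub_le_of_hasDerivAt (f := fun t => Expr.value c l e t (cy / u))
          (a := x0 / u) (b := x1 / u) ⟨g0, g1⟩ ⟨hx0, hx1⟩ fun t ht => ?_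
        obtain ⟨d, hd, hdm⟩ := (hd t (cy / u) ht.1 ht.2 k0 k1).dx
        exact ⟨d, hd, hdm.abs_le_magnitude⟩
      have m2 : |Expr.value c l e x y - Expr.value c l e x (cy / u)|
          ≤ magnitude j.y / scale * |y - cy / u| := by
        refine abs_sub_le_of_hasDerivAt (f := fun t => Expr.value c l e x t)
          (a := y0 / u) (b := y1 / u) ⟨k0, k1⟩ ⟨hy0, hy1⟩ fun t ht => ?_
        obtain ⟨d, hd, hdm⟩ := (hd x t hx0 hx1 ht.1 ht.2).dy
        exact ⟨d, hd, hdm.abs_le_magnitude⟩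
      have n1 : |x - cx / u| ≤ ((x1 - cx : ℕ) : ℝ) / u := by
        rw [div_le_iff₀ hu] at hx0
        rw [le_div_iff₀ hu] at hx1
        have : x - cx / u = (x * u - cx) / u := by field_simp
        rw [this, abs_div, abs_of_pos hu]
        gcongr
        rw [abs_le]; constructor <;> linarith
      have n2 : |y - cy / u| ≤ ((y1 - cy : ℕ) : ℝ) / u := by
        rw [div_le_iff₀ hu] at hy0
        rw [le_div_iff₀ hu] at hy1
        have : y - cy / u = (y * u - cy) / u := by field_simp
        rw [this, abs_div, abs_of_pos hu]
        gcongr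
        rw [abs_le]; constructor <;> linarith
      have q1 : |Expr.value c l e x (cy / u) - Expr.value c l e (cx / u) (cy / u)|
          ≤ magnitude j.x / scale * (((x1 - cx : ℕ) : ℝ) / u) := m1.trans (by gcongr)
      have q2 : |Expr.value c l e x y - Expr.value c l e x (cy / u)|
          ≤ magnitude j.y / scale * (((y1 - cy : ℕ) : ℝ) / u) := m2.trans (by gcongr)
      have hbv : |Expr.value c l e (cx / u) (cy / u) * scale - ((b.p : ℝ) - b.n)| ≤ b.r :=
        hbm
      have v0 := (abs_le.1 hbv).1
      have v1 := (abs_le.1 q1).1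
      have v2 := (abs_le.1 q2).1
      have z : (magnitude j.x * ((x1 - cx : ℕ) : ℝ) + magnitude j.y * ((y1 - cy : ℕ) : ℝ)) / u
          < (b.p : ℝ) - b.n - b.r := by
        rw [div_lt_iff₀ hu]; linarith
      have z2 : (magnitude j.x / scale * (((x1 - cx : ℕ) : ℝ) / u)
          + magnitude j.y / scale * (((y1 - cy : ℕ) : ℝ) / u)) * scale
          = (magnitude j.x * ((x1 - cx : ℕ) : ℝ) + magnitude j.y * ((y1 - cy : ℕ) : ℝ)) / u := by
        field_simp
      have fin : 0 < Expr.value c l e x y * scale := by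
        have : Expr.value c l e (cx / u) (cy / u) * scale
          - (magnitude j.x / scale * (((x1 - cx : ℕ) : ℝ) / u)
          + magnitude j.y / scale * (((y1 - cy : ℕ) : ℝ) / u)) * scale
          ≤ Expr.value c l e x y * scale := by
          rw [← sub_mul]
          exact mul_le_mul_of_nonneg_right (by linarith) hs.le
        rw [z2] at this
        linarith
      exact pos_of_mul_pos_left fin hs.le

end BoxCheckSound
end LatticePhase

/-! ### One-dimensional theta series and Poisson summation. -/

namespace LatticePhase

noncomputable section ThetaSeries

open Real

theorem summable_weighted_series {ι : Type*} {b c : ι → ℝ} {j : ℕ} {X : ℝ} (hc : ∀ n, |c n| ≤ 1)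
    (hb : ∀ n, 0 ≤ b n) (hs : Summable fun n => b n ^ j * exp (-X * b n)) :
    Summable fun n => c n * (b n ^ j * exp (-X * b n)) := by
  refine hs.of_norm_bounded fun n => ?_
  have := mul_nonneg (pow_nonneg (hb n) j) (exp_pos (-X * b n)).le
  rw [norm_mul, norm_eq_abs, norm_of_nonneg this]
  exact mul_le_of_le_one_left this (hc n)

/-- Termwise differentiation of `∑ c b ^ j exp (-X b)`. -/
theorem hasDerivAt_weighted_series {ι : Type*} {b c : ι → ℝ} (hc : ∀ n, |c n| ≤ 1)
    (hb : ∀ n, 0 ≤ b n) (hs : ∀ j : ℕ, ∀ X : ℝ, 0 < X → Summable fun n => b n ^ j * exp (-X * b n))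
    (j : ℕ) {X : ℝ} (hX : 0 < X) :
    HasDerivAt (fun X => ∑' n, c n * (b n ^ j * exp (-X * b n)))
      (-∑' n, c n * (b n ^ (j + 1) * exp (-X * b n))) X := by
  rw [← tsum_neg]
  refine hasDerivAt_tsum_of_isPreconnected (t := Set.Ioi (X / 2))
    (u := fun n => b n ^ (j + 1) * exp (-(X / 2) * b n)) (y₀ := X)
    (g := fun n X => c n * (b n ^ j * exp (-X * b n)))
    (g' := fun n X => -(c n * (b n ^ (j + 1) * exp (-X * b n)))) (hs _ _ (by positivity)) isOpen_Ioi
    isPreconnected_Ioi (fun n Y _ => ?_) (fun n Y hY => ?_)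
    (show X / 2 < X by linarith) (summable_weighted_series hc hb (hs j X hX))
    (show X / 2 < X by linarith)
  · have h1 : HasDerivAt (fun Y : ℝ => -Y * b n) (-1 * b n) Y :=
      (hasDerivAt_id Y).neg.mul_const (b n)
    have := (h1.exp.const_mul (b n ^ j)).const_mul (c n)
    refine this.congr_deriv ?_
    ring
  · have hY' : X / 2 < Y := hY
    have h1 : 0 ≤ b n ^ (j + 1) := pow_nonneg (hb n) _
    rw [norm_neg, norm_mul, norm_eq_abs, norm_of_nonneg (mul_nonneg h1 (exp_pos _).le)]
    calc _ ≤ 1 * (b n ^ (j + 1) * exp (-Y * b n)) := by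
          gcongr
          exact hc n
      _ ≤ _ := by
        rw [one_mul]
        gcongr
        nlinarith [hb n]

/-- The series `∑ ((n + ξ) ^ 2) ^ j exp (-X (n + ξ) ^ 2)`. -/
def th (j : ℕ) (ξ X : ℝ) : ℝ := ∑' n : ℤ, ((n + ξ) ^ 2) ^ j * exp (-X * (n + ξ) ^ 2)

/-- The series `∑ (n ^ 2) ^ j exp (-X n ^ 2) cos (2 π n ξ)`. -/
def cs (j : ℕ) (ξ X : ℝ) : ℝ :=
  ∑' n : ℤ, cos (2 * π * n * ξ) * (((n : ℝ) ^ 2) ^ j * exp (-X * (n : ℝ) ^ 2))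

/-- Since (n + ξ)² ≥ n² - 2|n||ξ|, the terms are dominated by those of a Jacobi theta series with
polynomial weights. -/
theorem summable_th (j : ℕ) (ξ : ℝ) {X : ℝ} (hX : 0 < X) :
    Summable fun n : ℤ => ((n + ξ) ^ 2) ^ j * exp (-X * (n + ξ) ^ 2) := by
  have hT : 0 < X / π := by positivity
  have h1 := summable_pow_mul_jacobiTheta₂_term_bound (X / π * |ξ|) hT (2 * j)
  have h2 := summable_pow_mul_jacobiTheta₂_term_bound (X / π * |ξ|) hT 0
  refine ((h1.mul_left (2 ^ (2 * j))).add (h2.mul_left (2 ^ (2 * j) * |ξ| ^ (2 * j)))).of_norm_bounded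
    fun n => ?_
  have hE : exp (-X * (n + ξ) ^ 2)
      ≤ exp (-π * (X / π * (n : ℝ) ^ 2 - 2 * (X / π * |ξ|) * |(n : ℝ)|)) := by
    apply exp_le_exp.2
    have e : -π * (X / π * (n : ℝ) ^ 2 - 2 * (X / π * |ξ|) * |(n : ℝ)|)
        = -X * ((n : ℝ) ^ 2 - 2 * (|(n : ℝ)| * |ξ|)) := by field_simp
    rw [e, ← abs_mul]
    have := neg_abs_le ((n : ℝ) * ξ)
    nlinarith [sq_nonneg ξ, mul_nonneg hX.le (sq_nonneg ξ)]
  have hP : ((n + ξ) ^ 2) ^ j ≤ 2 ^ (2 * j) * |(n : ℝ)| ^ (2 * j) + 2 ^ (2 * j) * |ξ| ^ (2 * j) := by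
    rw [← pow_mul, ← mul_pow, ← mul_pow, ← (even_two_mul j).pow_abs]
    have hab : |(n : ℝ) + ξ| ≤ |(n : ℝ)| + |ξ| := abs_add_le _ _
    rcases le_total |(n : ℝ)| |ξ| with h | h
    · calc |(n : ℝ) + ξ| ^ (2 * j) ≤ (2 * |ξ|) ^ (2 * j) := by gcongr; linarith
        _ ≤ _ := le_add_of_nonneg_left (by positivity)
    · calc |(n : ℝ) + ξ| ^ (2 * j) ≤ (2 * |(n : ℝ)|) ^ (2 * j) := by gcongr; linarith
        _ ≤ _ := le_add_of_nonneg_right (by positivity)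
  rw [norm_of_nonneg (by positivity)]
  calc _ ≤ (2 ^ (2 * j) * |(n : ℝ)| ^ (2 * j) + 2 ^ (2 * j) * |ξ| ^ (2 * j)) *
        exp (-π * (X / π * (n : ℝ) ^ 2 - 2 * (X / π * |ξ|) * |(n : ℝ)|)) := by gcongr
    _ = _ := by rw [pow_zero]; push_cast; ring

theorem summable_sq (j : ℕ) {X : ℝ} (hX : 0 < X) :
    Summable fun n : ℤ => ((n : ℝ) ^ 2) ^ j * exp (-X * (n : ℝ) ^ 2) := by
  simpa using summable_th j 0 hX

theorem summable_cs (j : ℕ) (ξ : ℝ) {X : ℝ} (hX : 0 < X) :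
    Summable fun n : ℤ =>
      cos (2 * π * n * ξ) * (((n : ℝ) ^ 2) ^ j * exp (-X * (n : ℝ) ^ 2)) :=
  summable_weighted_series (fun _ => abs_cos_le_one _) (fun n => sq_nonneg (n : ℝ))
    (summable_sq j hX)

theorem hasDerivAt_th (j : ℕ) (ξ : ℝ) {X : ℝ} (hX : 0 < X) :
    HasDerivAt (th j ξ) (-th (j + 1) ξ X) X := by
  have := hasDerivAt_weighted_series (b := fun n : ℤ => ((n : ℝ) + ξ) ^ 2) (c := fun _ => 1)
    (by simp) (fun n => sq_nonneg _) (fun j X hX => summable_th j ξ hX) j hX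
  simp only [one_mul] at this
  exact this

theorem hasDerivAt_cs (j : ℕ) (ξ : ℝ) {X : ℝ} (hX : 0 < X) :
    HasDerivAt (cs j ξ) (-cs (j + 1) ξ X) X :=
  hasDerivAt_weighted_series (b := fun n : ℤ => (n : ℝ) ^ 2)
    (c := fun n : ℤ => cos (2 * π * n * ξ)) (fun _ => abs_cos_le_one _) (fun _ => sq_nonneg _)
    (fun j _ hX => summable_sq j hX) j hX

theorem cs_zero (j : ℕ) (X : ℝ) : cs j 0 X = th j 0 X := by simp [cs, th]

theorem th_nonneg (j : ℕ) (ξ X : ℝ) : 0 ≤ th j ξ X := tsum_nonneg fun _ => by positivity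

theorem th_zero_pos (ξ : ℝ) {X : ℝ} (hX : 0 < X) : 0 < th 0 ξ X :=
  (summable_th 0 ξ hX).tsum_pos (fun _ => by positivity) 0 (by positivity)

/-- Poisson summation. -/
theorem th_zero_eq_cs (ξ : ℝ) {X : ℝ} (hX : 0 < X) :
    th 0 ξ X = √(π / X) * cs 0 ξ (π ^ 2 / X) := by
  have ha : 0 < π / X := by positivity
  have h := Complex.tsum_exp_neg_quadratic (a := ((π / X : ℝ) : ℂ)) (by rwa [Complex.ofReal_re])
    (-Complex.I * ξ)
  have hr : ∑' n : ℤ, Complex.exp (-π / ((π / X : ℝ) : ℂ) * (n + Complex.I * (-Complex.I * ξ)) ^ 2)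
      = ((th 0 ξ X : ℝ) : ℂ) := by
    rw [th, Complex.ofReal_tsum]
    refine tsum_congr fun n => ?_
    push_cast
    rw [pow_zero, one_mul, ← mul_assoc Complex.I, mul_neg, Complex.I_mul_I, neg_neg, one_mul]
    congr 2
    have : (π : ℂ) ≠ 0 := by exact_mod_cast pi_ne_zero
    have : (X : ℂ) ≠ 0 := by exact_mod_cast hX.ne'
    field_simp
  have hl : (∑' n : ℤ, Complex.exp (-π * ((π / X : ℝ) : ℂ) * n ^ 2
      + 2 * π * (-Complex.I * ξ) * n)).re = cs 0 ξ (π ^ 2 / X) := by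
    have key : ∀ n : ℤ, Complex.exp (-π * ((π / X : ℝ) : ℂ) * n ^ 2
        + 2 * π * (-Complex.I * ξ) * n) =
        Complex.exp ((-(π ^ 2 / X) * n ^ 2 : ℝ) + (-(2 * π * n * ξ) : ℝ) * Complex.I) := by
      intro n
      push_cast
      congr 1
      ring
    have hsum : Summable fun n : ℤ => Complex.exp (-π * ((π / X : ℝ) : ℂ) * n ^ 2
        + 2 * π * (-Complex.I * ξ) * n) := by
      refine (summable_sq 0 (X := π ^ 2 / X) (by positivity)).of_norm_bounded fun n => ?_
      rw [key n, Complex.norm_exp, Complex.add_re, Complex.ofReal_re, Complex.re_ofReal_mul,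
        Complex.I_re]
      simp
    rw [Complex.re_tsum hsum, cs]
    refine tsum_congr fun n => ?_
    rw [key n, Complex.exp_re]
    simp only [Complex.add_re, Complex.ofReal_re, Complex.re_ofReal_mul, Complex.I_re, mul_zero,
      add_zero, Complex.add_im, Complex.ofReal_im, Complex.im_ofReal_mul, Complex.I_im, mul_one,
      zero_add, cos_neg, pow_zero, one_mul]
    ring
  rw [hr] at h
  have h2 := congrArg Complex.re h
  rw [hl] at h2
  have h3 : (1 : ℂ) / ((π / X : ℝ) : ℂ) ^ (1 / 2 : ℂ) = (((√(π / X))⁻¹ : ℝ) : ℂ) := by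
    rw [show (1 / 2 : ℂ) = ((1 / 2 : ℝ) : ℂ) by push_cast; ring, ← Complex.ofReal_cpow ha.le,
      ← sqrt_eq_rpow]
    push_cast
    rw [one_div]
  rw [h3, ← Complex.ofReal_mul, Complex.ofReal_re] at h2
  rw [h2, ← mul_assoc, mul_inv_cancel₀ (sqrt_pos.2 ha).ne', one_mul]

/-- The Poisson formula `th_zero_eq_cs` differentiated in X. -/
theorem th_one_eq_cs (ξ : ℝ) {X : ℝ} (hX : 0 < X) :
    th 1 ξ X = √(π / X) * (1 / (2 * X) * cs 0 ξ (π ^ 2 / X)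
      - π ^ 2 / X ^ 2 * cs 1 ξ (π ^ 2 / X)) := by
  have hp := pi_pos
  have h1 := hasDerivAt_th 0 ξ hX
  have hd : HasDerivAt (fun X : ℝ => π ^ 2 / X) (-(π ^ 2 / X ^ 2)) X := by
    have := (hasDerivAt_inv hX.ne').const_mul (π ^ 2)
    refine this.congr_deriv ?_
    field_simp
  have hs : HasDerivAt (fun X : ℝ => √(π / X)) (-(√(π / X) * (1 / (2 * X)))) X := by
    have h2 : HasDerivAt (fun X : ℝ => π / X) (-(π / X ^ 2)) X := by
      have := (hasDerivAt_inv hX.ne').const_mul π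
      refine this.congr_deriv ?_
      field_simp
    have h3 := h2.sqrt (by positivity)
    refine h3.congr_deriv ?_
    symm
    have h4 : √(π / X) * √(π / X) = π / X := mul_self_sqrt (by positivity)
    have h5 : √(π / X) ≠ 0 := (sqrt_pos.2 (by positivity)).ne'
    rw [eq_div_iff (by positivity)]
    calc -(√(π / X) * (1 / (2 * X))) * (2 * √(π / X))
        = -((√(π / X) * √(π / X)) * (1 / X)) := by field_simp
      _ = _ := by rw [h4]; field_simp
  have hc : HasDerivAt (fun X : ℝ => cs 0 ξ (π ^ 2 / X))
      (-cs 1 ξ (π ^ 2 / X) * -(π ^ 2 / X ^ 2)) X :=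
    (hasDerivAt_cs 0 ξ (X := π ^ 2 / X) (by positivity)).comp X hd
  have h6 := hs.mul hc
  have h7 : HasDerivAt (th 0 ξ) _ X := h6.congr_of_eventuallyEq (by
    filter_upwards [lt_mem_nhds hX] with Y hY
    exact th_zero_eq_cs ξ hY)
  have := h1.unique h7
  rw [zero_add] at this
  linear_combination -this

end ThetaSeries

end LatticePhase

/-! ### The lattice sum and its Fourier expansion in x. -/

namespace LatticePhase

noncomputable section PlaneSeries

open Real

/-- The squared length of `m z + n`, `z = x + i y`, in the lattice of unit density. -/
def rad (x y : ℝ) (p : ℤ × ℤ) : ℝ := (p.2 + p.1 * x) ^ 2 / y + p.1 ^ 2 * y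

/-- The lattice sum in the coordinates of the upper half-plane. -/
def En (A x y : ℝ) : ℝ := ∑' p : ℤ × ℤ, rad x y p * exp (-A * rad x y p)

theorem rad_nonneg {x y : ℝ} (hy : 0 < y) (p : ℤ × ℤ) : 0 ≤ rad x y p := by
  unfold rad; positivity

theorem abs_cs_le (j : ℕ) (ξ : ℝ) {X : ℝ} (hX : 0 < X) : |cs j ξ X| ≤ th j 0 X := by
  rw [← cs_zero]
  have h := (summable_cs j ξ hX).norm
  refine (norm_tsum_le_tsum_norm h).trans ?_
  refine h.tsum_le_tsum (fun n => ?_) (summable_cs j 0 hX)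
  rw [norm_mul, norm_of_nonneg (by positivity : (0 : ℝ) ≤ ((n : ℝ) ^ 2) ^ j * exp (-X * (n : ℝ) ^ 2))]
  simp only [mul_zero, cos_zero, one_mul]
  exact mul_le_of_le_one_left (by positivity) (abs_cos_le_one _)

/-- By Poisson summation the inner sum over n is bounded uniformly in the shift m x, so the outer
sum is dominated by a Gaussian in m. -/
theorem summable_exp_rad {A x y : ℝ} (hA : 0 < A) (hy : 0 < y) :
    Summable fun p : ℤ × ℤ => exp (-A * rad x y p) := by
  have e : ∀ m n : ℤ, exp (-A * rad x y (m, n))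
      = exp (-(A * y) * (m : ℝ) ^ 2) * (((n + m * x) ^ 2) ^ 0 * exp (-(A / y) * (n + m * x) ^ 2)) := by
    intro m n
    rw [pow_zero, one_mul, ← exp_add, rad]
    congr 1
    field_simp
    ring
  have hB : 0 < A / y := by positivity
  rw [summable_prod_of_nonneg (fun p => (exp_pos _).le)]
  refine ⟨fun m => ?_, ?_⟩
  · simp only [e]
    exact (summable_th 0 (m * x) hB).mul_left _
  · simp only [e, tsum_mul_left]
    refine ((summable_sq 0 (X := A * y) (by positivity)).mul_right
      (√(π / (A / y)) * th 0 0 (π ^ 2 / (A / y)))).of_norm_bounded fun m => ?_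
    change ‖_ * th 0 (m * x) (A / y)‖ ≤ _
    rw [norm_mul, norm_of_nonneg (exp_pos _).le, pow_zero, one_mul, th_zero_eq_cs _ hB, norm_mul,
      norm_of_nonneg (sqrt_nonneg _)]
    gcongr
    exact abs_cs_le 0 _ (by positivity)

theorem pow_mul_exp_le (j : ℕ) {A : ℝ} (hA : 0 < A) : ∃ C : ℝ, 0 ≤ C ∧ ∀ r : ℝ, 0 ≤ r →
    r ^ j * exp (-A * r) ≤ C * exp (-(A / 2) * r) := by
  refine ⟨j.factorial * (2 / A) ^ j, by positivity, fun r hr => ?_⟩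
  have h := pow_div_factorial_le_exp (A / 2 * r) (by positivity) j
  have hf : (0 : ℝ) < j.factorial := by exact_mod_cast j.factorial_pos
  rw [div_le_iff₀ hf, mul_pow] at h
  have e : exp (-(A / 2) * r) = exp (A / 2 * r) * exp (-A * r) := by rw [← exp_add]; ring_nf
  rw [e, ← mul_assoc]
  gcongr
  calc r ^ j = ((A / 2) ^ j * r ^ j) * (2 / A) ^ j := by
        rw [mul_right_comm, ← mul_pow]
        have : A / 2 * (2 / A) = 1 := by field_simp
        rw [this, one_pow, one_mul]
    _ ≤ (exp (A / 2 * r) * j.factorial) * (2 / A) ^ j := by gcongr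
    _ = _ := by ring

theorem summable_rad (j : ℕ) {A x y : ℝ} (hA : 0 < A) (hy : 0 < y) :
    Summable fun p : ℤ × ℤ => rad x y p ^ j * exp (-A * rad x y p) := by
  obtain ⟨C, _, hC⟩ := pow_mul_exp_le j hA
  refine ((summable_exp_rad (x := x) (half_pos hA) hy).mul_left C).of_norm_bounded fun p => ?_
  have := rad_nonneg (x := x) hy p
  rw [norm_of_nonneg (by positivity)]
  exact hC _ this

theorem summable_En {A x y : ℝ} (hA : 0 < A) (hy : 0 < y) :
    Summable fun p : ℤ × ℤ => rad x y p * exp (-A * rad x y p) := by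
  simpa using summable_rad 1 (x := x) hA hy

/-- The coefficients of the Fourier series in `x`. -/
def fc (σ τ : ℝ) (p : ℤ × ℤ) : ℝ :=
  (1 / 2 + σ * (p.1 : ℝ) ^ 2 - τ * (p.2 : ℝ) ^ 2) *
    (exp (-σ * (p.1 : ℝ) ^ 2) * exp (-τ * (p.2 : ℝ) ^ 2))

theorem summable_pow_fc (j : ℕ) {σ τ : ℝ} (hσ : 0 < σ) (hτ : 0 < τ) :
    Summable fun p : ℤ × ℤ => ((p.1 : ℝ) ^ 2 * (p.2 : ℝ) ^ 2) ^ j * |fc σ τ p| := by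
  have h : ∀ i k : ℕ, Summable fun p : ℤ × ℤ => (((p.1 : ℝ) ^ 2) ^ i * exp (-σ * (p.1 : ℝ) ^ 2)) *
      (((p.2 : ℝ) ^ 2) ^ k * exp (-τ * (p.2 : ℝ) ^ 2)) := fun i k => by
    have h := (summable_sq i hσ).mul_of_nonneg (summable_sq k hτ) (fun _ => by positivity)
      (fun _ => by positivity)
    exact h
  have hs := (((h j j).mul_left (1 / 2)).add ((h (j + 1) j).mul_left σ)).add
    ((h j (j + 1)).mul_left τ)
  refine Summable.of_nonneg_of_le (fun p => by positivity) (fun p => ?_) hs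
  rw [fc, abs_mul, abs_of_nonneg (by positivity :
    0 ≤ exp (-σ * (p.1 : ℝ) ^ 2) * exp (-τ * (p.2 : ℝ) ^ 2))]
  have : |1 / 2 + σ * (p.1 : ℝ) ^ 2 - τ * (p.2 : ℝ) ^ 2|
      ≤ 1 / 2 + σ * (p.1 : ℝ) ^ 2 + τ * (p.2 : ℝ) ^ 2 := by
    have h1 : 0 ≤ σ * (p.1 : ℝ) ^ 2 := by positivity
    have h2 : 0 ≤ τ * (p.2 : ℝ) ^ 2 := by positivity
    rw [abs_le]; constructor <;> linarith
  calc _ ≤ ((p.1 : ℝ) ^ 2 * (p.2 : ℝ) ^ 2) ^ j *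
        ((1 / 2 + σ * (p.1 : ℝ) ^ 2 + τ * (p.2 : ℝ) ^ 2) *
        (exp (-σ * (p.1 : ℝ) ^ 2) * exp (-τ * (p.2 : ℝ) ^ 2))) := by gcongr
    _ = _ := by ring

theorem summable_fc_mul {σ τ : ℝ} (hσ : 0 < σ) (hτ : 0 < τ) {c : ℤ × ℤ → ℝ} {C : ℝ}
    (hc : ∀ p, |c p| ≤ C) : Summable fun p : ℤ × ℤ => fc σ τ p * c p := by
  refine ((summable_pow_fc 0 hσ hτ).mul_right C).of_norm_bounded fun p => ?_
  rw [norm_mul, pow_zero, one_mul, norm_eq_abs, norm_eq_abs]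
  exact mul_le_mul_of_nonneg_left (hc p) (abs_nonneg _)

/-- The Fourier expansion of the lattice sum in `x`. -/
theorem En_eq_fourier {A x y : ℝ} (hA : 0 < A) (hy : 0 < y) :
    En A x y = √(π * y / A) / A *
      ∑' p : ℤ × ℤ, fc (A * y) (π ^ 2 * y / A) p * cos (2 * π * p.2 * (p.1 * x)) := by
  have hB : 0 < A / y := by positivity
  have hτ : 0 < π ^ 2 * y / A := by positivity
  have hσ : 0 < A * y := by positivity
  rw [En, (summable_En hA hy).tsum_prod,
    (summable_fc_mul hσ hτ (fun p => abs_cos_le_one _)).tsum_prod, ← tsum_mul_left]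
  refine tsum_congr fun m => ?_
  have e : ∀ n : ℤ, rad x y (m, n) * exp (-A * rad x y (m, n))
      = exp (-(A * y) * (m : ℝ) ^ 2) * (1 / y) *
          (((n + m * x) ^ 2) ^ 1 * exp (-(A / y) * (n + m * x) ^ 2))
        + exp (-(A * y) * (m : ℝ) ^ 2) * ((m : ℝ) ^ 2 * y) *
          (((n + m * x) ^ 2) ^ 0 * exp (-(A / y) * (n + m * x) ^ 2)) := by
    intro n
    have : exp (-A * rad x y (m, n)) = exp (-(A * y) * (m : ℝ) ^ 2) *
        exp (-(A / y) * (n + m * x) ^ 2) := by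
      rw [← exp_add, rad]
      congr 1
      field_simp
      ring
    rw [this, rad]
    ring
  have f : ∀ k : ℤ, fc (A * y) (π ^ 2 * y / A) (m, k) * cos (2 * π * k * (m * x))
      = (1 / 2 + A * y * (m : ℝ) ^ 2) * exp (-(A * y) * (m : ℝ) ^ 2) *
          (cos (2 * π * k * (m * x)) * (((k : ℝ) ^ 2) ^ 0 * exp (-(π ^ 2 * y / A) * (k : ℝ) ^ 2)))
        + -(π ^ 2 * y / A) * exp (-(A * y) * (m : ℝ) ^ 2) *
          (cos (2 * π * k * (m * x)) *
            (((k : ℝ) ^ 2) ^ 1 * exp (-(π ^ 2 * y / A) * (k : ℝ) ^ 2))) := by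
    intro k
    simp only [fc]
    ring
  simp only [e, f]
  rw [((summable_th 1 (m * x) hB).mul_left _).tsum_add ((summable_th 0 (m * x) hB).mul_left _),
    ((summable_cs 0 (m * x) hτ).mul_left _).tsum_add ((summable_cs 1 (m * x) hτ).mul_left _),
    tsum_mul_left, tsum_mul_left, tsum_mul_left, tsum_mul_left]
  change _ * th 1 (m * x) (A / y) + _ * th 0 (m * x) (A / y)
    = _ * (_ * cs 0 (m * x) (π ^ 2 * y / A) + _ * cs 1 (m * x) (π ^ 2 * y / A))
  -- Poisson summation in n, for each fixed m, turns the shift m x into the phase of a cosine.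
  rw [th_zero_eq_cs _ hB, th_one_eq_cs _ hB]
  have e1 : π / (A / y) = π * y / A := by field_simp
  have e2 : π ^ 2 / (A / y) = π ^ 2 * y / A := by field_simp
  rw [e1, e2]
  field_simp
  ring

theorem tsum_int_of_even {f : ℤ → ℝ} (hf : Summable f) (he : ∀ n, f (-n) = f n) :
    ∑' n, f n = f 0 + 2 * ∑' n : ℕ, f (n + 1) := by
  have h1 : Summable fun n : ℕ => f n := hf.comp_injective Nat.cast_injective
  have h2 : Summable fun n : ℕ => f (-(n + 1 : ℤ)) :=
    hf.comp_injective fun a b h => by simpa using h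
  rw [tsum_of_nat_of_neg_add_one h1 h2, h1.tsum_eq_zero_add]
  simp only [he]
  push_cast
  ring

/-- A sum over the plane lattice of a function that is even in both variables and vanishes on the
axes. -/
theorem tsum_prod_of_even {F : ℤ × ℤ → ℝ} (hF : Summable F) (h1 : ∀ m n, F (-m, n) = F (m, n))
    (h2 : ∀ m n, F (m, -n) = F (m, n)) (h3 : ∀ m, F (m, 0) = 0) (h4 : ∀ n, F (0, n) = 0) :
    ∑' p, F p = 4 * ∑' p : ℕ × ℕ, F (p.1 + 1, p.2 + 1) := by
  have hi : Function.Injective fun p : ℕ × ℕ => ((p.1 + 1 : ℤ), (p.2 + 1 : ℤ)) := by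
    rintro ⟨a, b⟩ ⟨c, d⟩ h
    simp only [Prod.mk.injEq] at h
    ext <;> dsimp <;> omega
  have hN : Summable fun p : ℕ × ℕ => F (p.1 + 1, p.2 + 1) := hF.comp_injective hi
  have hin : ∀ m, ∑' n, F (m, n) = 2 * ∑' n : ℕ, F (m, n + 1) := by
    intro m
    rw [tsum_int_of_even (hF.prod_factor m) (h2 m), h3, zero_add]
  rw [hF.tsum_prod, tsum_int_of_even hF.prod (fun m => by simp only [h1]), hN.tsum_prod]
  simp only [h4, tsum_zero, zero_add, hin, tsum_mul_left]
  ring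

end PlaneSeries

end LatticePhase

/-! ### Estimates for cosines of multiples and for Fourier coefficients. -/

namespace LatticePhase

noncomputable section FourierBounds

open Real

theorem abs_sin_nat_mul_le (n : ℕ) (θ : ℝ) : |sin (n * θ)| ≤ n * |sin θ| := by
  induction n with
  | zero => simp
  | succ n ih =>
    have e : ((n + 1 : ℕ) : ℝ) * θ = n * θ + θ := by push_cast; ring
    rw [e, sin_add]
    calc _ ≤ |sin (n * θ) * cos θ| + |cos (n * θ) * sin θ| := abs_add_le _ _
      _ ≤ |sin (n * θ)| * 1 + 1 * |sin θ| := by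
        rw [abs_mul, abs_mul]
        gcongr
        · exact abs_cos_le_one _
        · exact abs_cos_le_one _
      _ ≤ _ := by push_cast; linarith

theorem sin_nat_mul_sq_le (n : ℕ) (θ : ℝ) : sin (n * θ) ^ 2 ≤ n ^ 2 * sin θ ^ 2 := by
  rw [← sq_abs, ← sq_abs (sin θ), ← mul_pow]
  exact pow_le_pow_left₀ (abs_nonneg _) (abs_sin_nat_mul_le n θ) 2

theorem one_sub_cos_nat_mul_le (n : ℕ) (θ : ℝ) : 1 - cos (n * θ) ≤ n ^ 2 * (1 - cos θ) := by
  have h := sin_nat_mul_sq_le n (θ / 2)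
  have h1 : cos (n * θ) = 1 - 2 * sin (n * (θ / 2)) ^ 2 := by
    rw [← cos_two_mul_eq_one_sub]; congr 1; ring
  have h2 : cos θ = 1 - 2 * sin (θ / 2) ^ 2 := by
    rw [← cos_two_mul_eq_one_sub]; congr 1; ring
  rw [h1, h2]
  linarith

/-- The error of the interpolation of `cos (n θ)` between `θ = 0` and `θ = π`. -/
theorem abs_cos_nat_mul_sub_le (n : ℕ) (θ : ℝ) :
    |cos (n * θ) - (1 + cos θ) / 2 - (1 - cos θ) / 2 * (-1) ^ n| ≤ n ^ 2 / 2 * sin θ ^ 2 := by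
  rcases Nat.even_or_odd' n with ⟨i, rfl | rfl⟩
  · rw [pow_mul, neg_one_sq, one_pow]
    have h1 : cos ((2 * i : ℕ) * θ) = 1 - 2 * sin (i * θ) ^ 2 := by
      rw [← cos_two_mul_eq_one_sub]; congr 1; push_cast; ring
    have h := sin_nat_mul_sq_le i θ
    rw [h1, abs_le]
    push_cast
    constructor <;> nlinarith [sq_nonneg (sin (i * θ)), sq_nonneg (sin θ)]
  · rw [pow_succ, pow_mul, neg_one_sq, one_pow]
    have h1 : cos ((2 * i + 1 : ℕ) * θ) - cos θ
        = -2 * sin (((i + 1 : ℕ) : ℝ) * θ) * sin (i * θ) := by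
      rw [cos_sub_cos]; push_cast; congr 3 <;> ring
    have e : cos ((2 * i + 1 : ℕ) * θ) - (1 + cos θ) / 2 - (1 - cos θ) / 2 * (1 * -1)
        = -2 * sin (((i + 1 : ℕ) : ℝ) * θ) * sin (i * θ) := by rw [← h1]; ring
    rw [e, abs_mul, abs_mul, abs_neg, abs_two]
    have a1 := abs_sin_nat_mul_le (i + 1) θ
    have a2 := abs_sin_nat_mul_le i θ
    calc _ ≤ 2 * ((i + 1 : ℕ) * |sin θ|) * (i * |sin θ|) := by gcongr
      _ = 2 * ((i : ℝ) + 1) * i * sin θ ^ 2 := by rw [← sq_abs (sin θ)]; push_cast; ring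
      _ ≤ _ := by push_cast; nlinarith [sq_nonneg (sin θ)]

/-- The sum `∑ (m + 1) ^ 4 exp (-σ ((m + 1) ^ 2 - 1))`. -/
def qs (σ : ℝ) : ℝ := ∑' m : ℕ, ((m : ℝ) + 1) ^ 4 * exp (-σ * (((m : ℝ) + 1) ^ 2 - 1))

theorem summable_qs {σ : ℝ} (hσ : 0 < σ) :
    Summable fun m : ℕ => ((m : ℝ) + 1) ^ 4 * exp (-σ * (((m : ℝ) + 1) ^ 2 - 1)) := by
  have h := ((summable_sq 2 hσ).comp_injective (i := fun m : ℕ => (m + 1 : ℤ))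
    (fun a b h => by simpa using h)).mul_right (exp σ)
  refine h.congr fun m => ?_
  simp only [Function.comp]
  rw [mul_assoc, ← exp_add]
  push_cast
  congr 1
  · ring
  · congr 1; ring

theorem tsum_le_of_ratio {f : ℕ → ℝ} {ρ : ℝ} (hf : ∀ i, 0 ≤ f i) (h0 : 0 ≤ ρ) (h1 : ρ < 1)
    (h : ∀ i, f (i + 1) ≤ ρ * f i) : Summable f ∧ ∑' i, f i ≤ f 0 / (1 - ρ) := by
  have hle : ∀ i, f i ≤ f 0 * ρ ^ i := by
    intro i
    induction i with
    | zero => simp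
    | succ i ih =>
      calc f (i + 1) ≤ ρ * f i := h i
        _ ≤ ρ * (f 0 * ρ ^ i) := by gcongr
        _ = _ := by ring
  have hg := (summable_geometric_of_lt_one h0 h1).mul_left (f 0)
  have hs := Summable.of_nonneg_of_le hf hle hg
  refine ⟨hs, (hs.tsum_le_tsum hle hg).trans_eq ?_⟩
  rw [tsum_mul_left, tsum_geometric_of_lt_one h0 h1, div_eq_mul_inv]

/-- All members of the ball are smaller than `c / d`. -/
def Ball.upperLt (b : Ball) (c d : ℕ) : Bool :=
  Ball.rec (fun p n r => Nat.blt (Nat.mul (Nat.add p r) d) (Nat.add (Nat.mul c scale) (Nat.mul n d)))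
    b

theorem lt_of_blt {a b : ℕ} (h : Nat.blt a b = true) : a < b := Nat.le_of_ble_eq_true h

theorem Ball.Mem.lt_of_upperLt {b : Ball} {x : ℝ} {c d : ℕ} (hm : b.Mem x) (hd : 0 < d)
    (h : b.upperLt c d = true) : x < (c : ℝ) / d := by
  obtain ⟨p, n, r⟩ := b
  have h' : Nat.blt (Nat.mul (Nat.add p r) d) (Nat.add (Nat.mul c scale) (Nat.mul n d)) = true := h
  have hlt := lt_of_blt h'
  simp only [Nat.add_eq, Nat.mul_eq] at hlt
  have hlt' : ((p : ℝ) + r) * d < c * scale + n * d := by exact_mod_cast hlt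
  rw [Ball.mem_mk] at hm
  have hs := scale_pos
  have hd' : (0 : ℝ) < d := by exact_mod_cast hd
  have h2 := (abs_le.1 hm).2
  rw [lt_div_iff₀ hd']
  have : x * d * scale < c * scale := by nlinarith
  exact lt_of_mul_lt_mul_right this hs.le

theorem exp_neg_lt_of_check {a b c d : ℕ} (hb : 0 < b) (hd : 0 < d)
    (h : (Ball.nexp (Ball.const a b)).upperLt c d = true) :
    exp (-((a : ℝ) / b)) < (c : ℝ) / d :=
  (Ball.mem_const a b hb).nexp.lt_of_upperLt hd h

/-- From the third term on, consecutive ratios are at most 1/200, and 3⁴/(1 - 1/200) < 82. -/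
theorem qs_le {σ : ℝ} (hσ : 1.3 ≤ σ) : qs σ ≤ 1 + 16 * exp (-(3 * σ)) + 82 * exp (-(8 * σ)) := by
  have h := summable_qs (σ := σ) (by linarith)
  have hE : exp (-(7 * σ)) ≤ 1 / 1000 := by
    have h1 : exp (-((91 : ℕ) / (10 : ℕ))) < (1 : ℕ) / (1000 : ℕ) :=
      exp_neg_lt_of_check (by norm_num) (by norm_num) (by decide +kernel)
    push_cast at h1
    refine (exp_le_exp.2 ?_).trans h1.le
    linarith
  obtain ⟨_, h3⟩ := tsum_le_of_ratio
    (f := fun i : ℕ => ((i : ℝ) + 3) ^ 4 * exp (-σ * (((i : ℝ) + 3) ^ 2 - 1))) (ρ := 1 / 200)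
    (fun i => by positivity) (by norm_num) (by norm_num) (fun i => by
      push_cast
      have e : exp (-σ * (((i : ℝ) + 1 + 3) ^ 2 - 1))
          = exp (-σ * (((i : ℝ) + 3) ^ 2 - 1)) * exp (-σ * (2 * i + 7)) := by
        rw [← exp_add]; congr 1; ring
      have e2 : exp (-σ * (2 * i + 7)) ≤ 1 / 1000 := by
        refine le_trans (exp_le_exp.2 ?_) hE
        have : 0 ≤ σ * i := by positivity
        nlinarith
      have e3 : ((i : ℝ) + 1 + 3) ^ 4 ≤ 4 * ((i : ℝ) + 3) ^ 4 := by
        have hi : (0 : ℝ) ≤ i := Nat.cast_nonneg i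
        have : ((i : ℝ) + 1 + 3) ^ 2 ≤ 2 * ((i : ℝ) + 3) ^ 2 := by nlinarith
        calc ((i : ℝ) + 1 + 3) ^ 4 = (((i : ℝ) + 1 + 3) ^ 2) ^ 2 := by ring
          _ ≤ (2 * ((i : ℝ) + 3) ^ 2) ^ 2 := by gcongr
          _ = _ := by ring
      rw [e]
      calc _ ≤ 4 * ((i : ℝ) + 3) ^ 4 * (exp (-σ * (((i : ℝ) + 3) ^ 2 - 1)) * (1 / 1000)) := by
            gcongr
        _ ≤ _ := by
          have : 0 ≤ ((i : ℝ) + 3) ^ 4 * exp (-σ * (((i : ℝ) + 3) ^ 2 - 1)) := by positivity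
          linarith)
  have hS := h.sum_add_tsum_nat_add 2
  rw [qs, ← hS, Finset.sum_range_succ, Finset.sum_range_one]
  have e1 : ∀ i : ℕ, ((i + 2 : ℕ) : ℝ) + 1 = (i : ℝ) + 3 := by intro i; push_cast; ring
  simp only [e1]
  have e2 : -σ * (((0 : ℕ) : ℝ) + 3) ^ 2 + σ = -(8 * σ) := by push_cast; ring
  norm_num at h3 ⊢
  rw [show -(σ * 3) = -(3 * σ) by ring]
  rw [show -(σ * 8) = -(8 * σ) by ring] at h3
  have := exp_pos (-(8 * σ))
  linarith

/-- A lower bound for a double series with a product majorant. -/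
theorem tsum_prod_ge {F : ℕ × ℕ → ℝ} {a b : ℕ → ℝ} {C : ℝ} (s : Finset (ℕ × ℕ)) (hF : Summable F)
    (ha : Summable a) (hb : Summable b) (ha0 : ∀ i, 0 ≤ a i) (hb0 : ∀ i, 0 ≤ b i)
    (h : ∀ p ∉ s, -(C * (a p.1 * b p.2)) ≤ F p) :
    ∑ p ∈ s, (F p + C * (a p.1 * b p.2)) - C * ((∑' i, a i) * ∑' i, b i) ≤ ∑' p, F p := by
  have hab := ha.mul_of_nonneg hb ha0 hb0
  have hG := hF.add (hab.mul_left C)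
  have h1 := hG.sum_le_tsum s fun p hp => by
    have := h p hp
    linarith
  rw [hF.tsum_add (hab.mul_left C), tsum_mul_left, ← ha.tsum_mul_tsum hb hab] at h1
  linarith

/-- A product majorant scaled by the leading exponential. The factor (mn)² from the cosine estimates
is included, and the polynomial factor of the coefficient costs another (mn)², whence the fourth
powers. -/
theorem abs_fc_le {σ τ : ℝ} (hσ : 0 < σ) (hτ : 0 < τ) (m k : ℕ) :
    (((m + 1) * (k + 1) : ℕ) : ℝ) ^ 2 * |fc σ τ (m + 1, k + 1)| ≤
      (1 / 2 + σ + τ) * exp (-(σ + τ)) * ((((m : ℝ) + 1) ^ 4 * exp (-σ * (((m : ℝ) + 1) ^ 2 - 1))) *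
        (((k : ℝ) + 1) ^ 4 * exp (-τ * (((k : ℝ) + 1) ^ 2 - 1)))) := by
  have hm : (1 : ℝ) ≤ ((m : ℝ) + 1) ^ 2 := by nlinarith [(Nat.cast_nonneg m : (0 : ℝ) ≤ m)]
  have hk : (1 : ℝ) ≤ ((k : ℝ) + 1) ^ 2 := by nlinarith [(Nat.cast_nonneg k : (0 : ℝ) ≤ k)]
  have h0 : (1 : ℝ) ≤ ((m : ℝ) + 1) ^ 2 * ((k : ℝ) + 1) ^ 2 := one_le_mul_of_one_le_of_one_le hm hk
  have e : exp (-σ * ((m : ℝ) + 1) ^ 2) * exp (-τ * ((k : ℝ) + 1) ^ 2) = exp (-(σ + τ)) *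
      (exp (-σ * (((m : ℝ) + 1) ^ 2 - 1)) * exp (-τ * (((k : ℝ) + 1) ^ 2 - 1))) := by
    rw [← exp_add, ← exp_add, ← exp_add]; congr 1; ring
  have h1 : |1 / 2 + σ * ((m : ℝ) + 1) ^ 2 - τ * ((k : ℝ) + 1) ^ 2|
      ≤ (1 / 2 + σ + τ) * (((m : ℝ) + 1) ^ 2 * ((k : ℝ) + 1) ^ 2) := by
    have h2 : σ * ((m : ℝ) + 1) ^ 2 ≤ σ * (((m : ℝ) + 1) ^ 2 * ((k : ℝ) + 1) ^ 2) := by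
      gcongr; nlinarith
    have h3 : τ * ((k : ℝ) + 1) ^ 2 ≤ τ * (((m : ℝ) + 1) ^ 2 * ((k : ℝ) + 1) ^ 2) := by
      gcongr; nlinarith
    have h4 : 0 ≤ σ * ((m : ℝ) + 1) ^ 2 := by positivity
    have h5 : 0 ≤ τ * ((k : ℝ) + 1) ^ 2 := by positivity
    rw [abs_le]; constructor <;> nlinarith
  simp only [fc]
  push_cast
  rw [abs_mul, abs_of_nonneg (by positivity :
    0 ≤ exp (-σ * ((m : ℝ) + 1) ^ 2) * exp (-τ * ((k : ℝ) + 1) ^ 2)), e]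
  calc _ ≤ (((m : ℝ) + 1) * ((k : ℝ) + 1)) ^ 2 *
        ((1 / 2 + σ + τ) * (((m : ℝ) + 1) ^ 2 * ((k : ℝ) + 1) ^ 2) *
          (exp (-(σ + τ)) *
      (exp (-σ * (((m : ℝ) + 1) ^ 2 - 1)) * exp (-τ * (((k : ℝ) + 1) ^ 2 - 1))))) := by gcongr
    _ = _ := by ring

/-- The difference of the lattice sum to a combination of its values at `x = 0` and
`x = 1 / 2`. -/
theorem En_sub_eq {A x y p q : ℝ} (hA : 0 < A) (hy : 0 < y) (hpq : p + q = 1) :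
    Summable (fun i : ℕ × ℕ => fc (A * y) (π ^ 2 * y / A) (i.1 + 1, i.2 + 1) *
      (cos (((i.1 + 1) * (i.2 + 1) : ℕ) * (2 * π * x)) - p - q * (-1) ^ ((i.1 + 1) * (i.2 + 1)))) ∧
    En A x y - p * En A 0 y - q * En A (1 / 2) y = √(π * y / A) / A * (4 *
      ∑' i : ℕ × ℕ, fc (A * y) (π ^ 2 * y / A) (i.1 + 1, i.2 + 1) *
        (cos (((i.1 + 1) * (i.2 + 1) : ℕ) * (2 * π * x)) - p - q * (-1) ^ ((i.1 + 1) * (i.2 + 1)))) := by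
  have hτ : 0 < π ^ 2 * y / A := by positivity
  have hσ : 0 < A * y := by positivity
  set F : ℤ × ℤ → ℝ := fun i => fc (A * y) (π ^ 2 * y / A) i *
    (cos (2 * π * i.2 * (i.1 * x)) - p * cos (2 * π * i.2 * (i.1 * 0))
      - q * cos (2 * π * i.2 * (i.1 * (1 / 2)))) with hF
  have hs : ∀ x : ℝ, Summable fun i : ℤ × ℤ => fc (A * y) (π ^ 2 * y / A) i *
      cos (2 * π * i.2 * (i.1 * x)) := fun x => summable_fc_mul hσ hτ fun i => abs_cos_le_one _
  have hFs : Summable F := by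
    refine (((hs x).sub ((hs 0).mul_left p)).sub ((hs (1 / 2)).mul_left q)).congr fun i => ?_
    simp only [hF]; ring
  have hE : En A x y - p * En A 0 y - q * En A (1 / 2) y = √(π * y / A) / A * ∑' i, F i := by
    rw [En_eq_fourier hA hy, En_eq_fourier hA hy, En_eq_fourier hA hy]
    have h1 := (((hs x).hasSum.sub ((hs 0).hasSum.mul_left p)).sub
      ((hs (1 / 2)).hasSum.mul_left q)).tsum_eq
    have h2 : ∑' i, F i = _ := (tsum_congr fun i => by simp only [hF]; ring).trans h1
    rw [h2]
    ring
  have hterm : ∀ i : ℕ × ℕ, F (i.1 + 1, i.2 + 1) = fc (A * y) (π ^ 2 * y / A) (i.1 + 1, i.2 + 1) *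
        (cos (((i.1 + 1) * (i.2 + 1) : ℕ) * (2 * π * x)) - p
          - q * (-1) ^ ((i.1 + 1) * (i.2 + 1))) := by
    intro i
    simp only [hF]
    have e1 : cos (2 * π * ((i.2 + 1 : ℤ) : ℝ) * (((i.1 + 1 : ℤ) : ℝ) * x))
        = cos (((i.1 + 1) * (i.2 + 1) : ℕ) * (2 * π * x)) := by
      congr 1; push_cast; ring
    have e2 : cos (2 * π * ((i.2 + 1 : ℤ) : ℝ) * (((i.1 + 1 : ℤ) : ℝ) * 0)) = 1 := by simp
    have e3 : cos (2 * π * ((i.2 + 1 : ℤ) : ℝ) * (((i.1 + 1 : ℤ) : ℝ) * (1 / 2)))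
        = (-1) ^ ((i.1 + 1) * (i.2 + 1)) := by
      rw [← cos_nat_mul_pi]; congr 1; push_cast; ring
    rw [e1, e2, e3, mul_one]
  -- Because p + q = 1 the combination vanishes on both axes, so by evenness only a quarter of the
  -- index plane remains.
  have key := tsum_prod_of_even hFs
    (fun m n => by simp only [hF, fc]; push_cast; simp only [neg_sq, mul_neg, neg_mul, cos_neg])
    (fun m n => by simp only [hF, fc]; push_cast; simp only [neg_sq, mul_neg, neg_mul, cos_neg])
    (fun m => by
      simp only [hF, Int.cast_zero, mul_zero, zero_mul, cos_zero, mul_one]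
      rw [show (1 : ℝ) - p - q = 0 by linarith, mul_zero])
    (fun n => by
      simp only [hF, Int.cast_zero, mul_zero, zero_mul, cos_zero, mul_one]
      rw [show (1 : ℝ) - p - q = 0 by linarith, mul_zero])
  have hi : Function.Injective fun p : ℕ × ℕ => ((p.1 + 1 : ℤ), (p.2 + 1 : ℤ)) := by
    rintro ⟨a, b⟩ ⟨c, d⟩ h
    simp only [Prod.mk.injEq] at h
    ext <;> dsimp <;> omega
  refine ⟨(hFs.comp_injective hi).congr fun i => hterm i, ?_⟩
  rw [hE, key]
  simp only [hterm]

end FourierBounds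

end LatticePhase

/-! ### Interpolation between x = 0 and x = 1/2, and comparison with x = 0. -/

namespace LatticePhase

noncomputable section FourierConsequences

open Real

/-- The prefactor of the Fourier series. -/
def pref (A y : ℝ) : ℝ := √(π * y / A) / A

/-- A bound for `qs`. -/
def qb (σ : ℝ) : ℝ := 16 * exp (-(3 * σ)) + 82 * exp (-(8 * σ))

/-- The constant in the comparison of the lattice sum with its values at `x = 0` and
`x = 1 / 2`. -/
def interpErr (σ τ : ℝ) : ℝ :=
  2 * max 0 ((1 / 2 + σ - 4 * τ) * exp (-(σ + 4 * τ)) + (1 / 2 + 4 * σ - τ) * exp (-(4 * σ + τ))) +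
    1 / 2 * (1 / 2 + σ + τ) * exp (-(σ + τ)) *
      (82 * exp (-(8 * σ)) + 82 * exp (-(8 * τ)) + qb σ * qb τ)

theorem qs_nonneg (σ : ℝ) : 0 ≤ qs σ := tsum_nonneg fun _ => by positivity

theorem pref_pos {A y : ℝ} (hA : 0 < A) (hy : 0 < y) : 0 < pref A y :=
  div_pos (sqrt_pos.2 (by positivity)) hA

/-- With θ = 2πx the frequency mn = 1 is interpolated exactly, mn = 2 contributes -8pq exactly, and
every other frequency at most 2(mn)²pq in absolute value, because sin²θ = 4pq. The error therefore
vanishes at both ends. -/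
theorem En_interp {A x y : ℝ} (hA : 0 < A) (hy : 0 < y) (hσ : 1.3 ≤ A * y)
    (hτ : 1.3 ≤ π ^ 2 * y / A) :
    (1 + cos (2 * π * x)) / 2 * En A 0 y + (1 - cos (2 * π * x)) / 2 * En A (1 / 2) y
      - 4 * (4 * pref A y * interpErr (A * y) (π ^ 2 * y / A)) *
        ((1 + cos (2 * π * x)) / 2 * ((1 - cos (2 * π * x)) / 2)) ≤ En A x y := by
  obtain ⟨hs, hE⟩ := En_sub_eq (x := x) (p := (1 + cos (2 * π * x)) / 2)
    (q := (1 - cos (2 * π * x)) / 2) hA hy (by ring)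
  have hP := pref_pos hA hy
  rw [pref] at hP ⊢
  set P := √(π * y / A) / A
  set σ := A * y
  set τ := π ^ 2 * y / A
  set p := (1 + cos (2 * π * x)) / 2 with hp
  set q := (1 - cos (2 * π * x)) / 2 with hq
  have hpq : p * q = sin (2 * π * x) ^ 2 / 4 := by
    have := sin_sq_add_cos_sq (2 * π * x)
    rw [hp, hq]; linarith
  have hpq0 : 0 ≤ p * q := by rw [hpq]; positivity
  have hσ0 : 0 < σ := by linarith
  have hτ0 : 0 < τ := by linarith
  have hC : 0 ≤ 2 * (p * q) * ((1 / 2 + σ + τ) * exp (-(σ + τ))) := by positivity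
  have key := tsum_prod_ge (C := 2 * (p * q) * ((1 / 2 + σ + τ) * exp (-(σ + τ))))
    {(0, 0), (0, 1), (1, 0)} hs (summable_qs hσ0) (summable_qs hτ0) (fun _ => by positivity)
    (fun _ => by positivity) (fun i _ => by
      have h1 := abs_cos_nat_mul_sub_le ((i.1 + 1) * (i.2 + 1)) (2 * π * x)
      have h2 := abs_fc_le hσ0 hτ0 i.1 i.2
      refine (neg_le_neg ?_).trans (neg_abs_le _)
      rw [abs_mul]
      calc _ ≤ |fc σ τ (i.1 + 1, i.2 + 1)| *
            ((((i.1 + 1) * (i.2 + 1) : ℕ) : ℝ) ^ 2 / 2 * sin (2 * π * x) ^ 2) := by gcongr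
        _ = 2 * (p * q) * ((((i.1 + 1) * (i.2 + 1) : ℕ) : ℝ) ^ 2 *
            |fc σ τ (i.1 + 1, i.2 + 1)|) := by rw [hpq]; ring
        _ ≤ 2 * (p * q) * _ := mul_le_mul_of_nonneg_left h2 (by positivity)
        _ = _ := by ring)
  change _ - _ * (qs σ * qs τ) ≤ _ at key
  rw [Finset.sum_insert (by decide), Finset.sum_insert (by decide), Finset.sum_singleton] at key
  have c2 : cos (2 * (2 * π * x)) - p - q = -8 * (p * q) := by
    have h1 : p + q = 1 := by rw [hp, hq]; ring
    have := cos_two_mul_eq_one_sub (2 * π * x)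
    rw [hpq]; linarith
  have c1 : cos (2 * π * x) - p + q = 0 := by rw [hp, hq]; ring
  have f12 : fc σ τ (1, 2) = (1 / 2 + σ - 4 * τ) * exp (-(σ + 4 * τ)) := by
    simp only [fc]; push_cast; rw [← exp_add]; ring_nf
  have f21 : fc σ τ (2, 1) = (1 / 2 + 4 * σ - τ) * exp (-(4 * σ + τ)) := by
    simp only [fc]; push_cast; rw [← exp_add]; ring_nf
  norm_num at key
  rw [c1, c2, f12, f21, show -τ + -σ = -(σ + τ) by ring, show -(σ * 3) = -(3 * σ) by ring,
    show -(τ * 3) = -(3 * τ) by ring] at key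
  have q1 : qs σ ≤ 1 + qb σ := by have := qs_le hσ; rw [qb]; linarith
  have q2 : qs τ ≤ 1 + qb τ := by have := qs_le hτ; rw [qb]; linarith
  have q3 : qs σ * qs τ ≤ (1 + qb σ) * (1 + qb τ) :=
    mul_le_mul q1 q2 (qs_nonneg _) ((qs_nonneg _).trans q1)
  have q4 := mul_le_mul_of_nonneg_left q3 hC
  -- The explicit terms with mn = 2 count as an error only when their sign is unfavourable.
  have hm := le_max_right 0
    ((1 / 2 + σ - 4 * τ) * exp (-(σ + 4 * τ)) + (1 / 2 + 4 * σ - τ) * exp (-(4 * σ + τ)))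
  have hm' := mul_le_mul_of_nonneg_left hm hpq0
  have hfin : -(4 * (p * q) * interpErr σ τ) ≤ ∑' i : ℕ × ℕ, fc σ τ (i.1 + 1, i.2 + 1) *
      (cos (((i.1 + 1) * (i.2 + 1) : ℕ) * (2 * π * x)) - p - q * (-1) ^ ((i.1 + 1) * (i.2 + 1))) := by
    push_cast
    rw [interpErr]
    simp only [qb] at *
    linarith
  have := mul_le_mul_of_nonneg_left hfin hP.le
  linarith

/-- Bounds how far the energy can fall below its value at x = 0, by 1 - cos(nθ) ≤ n²(1 - cos θ). The
leading coefficient is kept with its sign, so its share, the final -1, is taken out of the product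
majorant. -/
theorem En_zero_sub_le {A x y : ℝ} (hA : 0 < A) (hy : 0 < y) (hσ : 1.3 ≤ A * y)
    (hτ : 1.3 ≤ π ^ 2 * y / A) :
    En A 0 y - 4 * pref A y * ((1 - cos (2 * π * x)) * (exp (-(A * y + π ^ 2 * y / A)) *
      (1 / 2 + A * y - π ^ 2 * y / A + (1 / 2 + A * y + π ^ 2 * y / A) *
        ((1 + qb (A * y)) * (1 + qb (π ^ 2 * y / A)) - 1)))) ≤ En A x y := by
  obtain ⟨hs, hE⟩ := En_sub_eq (x := x) (p := 1) (q := 0) hA hy (by ring)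
  have hP := pref_pos hA hy
  rw [pref] at hP ⊢
  set P := √(π * y / A) / A
  set σ := A * y
  set τ := π ^ 2 * y / A
  have hv : 0 ≤ 1 - cos (2 * π * x) := by linarith [cos_le_one (2 * π * x)]
  have hσ0 : 0 < σ := by linarith
  have hτ0 : 0 < τ := by linarith
  have hC : 0 ≤ (1 - cos (2 * π * x)) * ((1 / 2 + σ + τ) * exp (-(σ + τ))) := by positivity
  have key := tsum_prod_ge (C := (1 - cos (2 * π * x)) * ((1 / 2 + σ + τ) * exp (-(σ + τ))))
    {(0, 0)} hs (summable_qs hσ0) (summable_qs hτ0) (fun _ => by positivity)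
    (fun _ => by positivity) (fun i _ => by
      have h1 := one_sub_cos_nat_mul_le ((i.1 + 1) * (i.2 + 1)) (2 * π * x)
      have h3 := cos_le_one (((i.1 + 1) * (i.2 + 1) : ℕ) * (2 * π * x))
      have h2 := abs_fc_le hσ0 hτ0 i.1 i.2
      refine (neg_le_neg ?_).trans (neg_abs_le _)
      rw [abs_mul, zero_mul, sub_zero, abs_sub_comm (cos _), abs_of_nonneg (sub_nonneg.2 h3)]
      calc _ ≤ |fc σ τ (i.1 + 1, i.2 + 1)| *
            ((((i.1 + 1) * (i.2 + 1) : ℕ) : ℝ) ^ 2 * (1 - cos (2 * π * x))) := by gcongr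
        _ = (1 - cos (2 * π * x)) * ((((i.1 + 1) * (i.2 + 1) : ℕ) : ℝ) ^ 2 *
            |fc σ τ (i.1 + 1, i.2 + 1)|) := by ring
        _ ≤ (1 - cos (2 * π * x)) * _ := mul_le_mul_of_nonneg_left h2 hv
        _ = _ := by ring)
  change _ - _ * (qs σ * qs τ) ≤ _ at key
  rw [Finset.sum_singleton] at key
  have f11 : fc σ τ (1, 1) = (1 / 2 + σ - τ) * exp (-(σ + τ)) := by
    simp only [fc]; push_cast; rw [← exp_add]; ring_nf
  norm_num at key
  rw [f11, show -τ + -σ = -(σ + τ) by ring] at key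
  have q1 : qs σ ≤ 1 + qb σ := by have := qs_le hσ; rw [qb]; linarith
  have q2 : qs τ ≤ 1 + qb τ := by have := qs_le hτ; rw [qb]; linarith
  have q3 : qs σ * qs τ ≤ (1 + qb σ) * (1 + qb τ) :=
    mul_le_mul q1 q2 (qs_nonneg _) ((qs_nonneg _).trans q1)
  have q4 := mul_le_mul_of_nonneg_left q3 hC
  simp only [zero_mul, sub_zero] at hE
  push_cast at hE
  have hfin := mul_le_mul_of_nonneg_left key hP.le
  have q5 := mul_le_mul_of_nonneg_left q4 hP.le
  linarith

/-- A lower bound for `En A x y - En A 0 y` in terms of a product majorant of the positive Fourier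
coefficients. -/
theorem En_sub_zero_ge {A x y C : ℝ} (hA : 0 < A) (hy : 0 < y) {a b : ℕ → ℝ} (hC : 0 ≤ C)
    (ha : Summable a) (hb : Summable b) (ha0 : ∀ i, 0 ≤ a i) (hb0 : ∀ i, 0 ≤ b i) (ha1 : a 0 = 0)
    (h : ∀ i k : ℕ, (((i + 1) * (k + 1) : ℕ) : ℝ) ^ 2 *
      fc (A * y) (π ^ 2 * y / A) (i + 1, k + 1) ≤ C * (a i * b k)) :
    En A 0 y + 4 * pref A y * (1 - cos (2 * π * x)) *
      (exp (-(A * y + π ^ 2 * y / A)) * (π ^ 2 * y / A - A * y - 1 / 2)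
        - C * ((∑' i, a i) * ∑' k, b k)) ≤ En A x y := by
  obtain ⟨hs, hE⟩ := En_sub_eq (x := x) (p := 1) (q := 0) hA hy (by ring)
  have hP := pref_pos hA hy
  rw [pref] at hP ⊢
  set P := √(π * y / A) / A
  set σ := A * y
  set τ := π ^ 2 * y / A
  have hv : 0 ≤ 1 - cos (2 * π * x) := by linarith [cos_le_one (2 * π * x)]
  have key := tsum_prod_ge (C := (1 - cos (2 * π * x)) * C)
    {(0, 0)} hs ha hb ha0 hb0 (fun i _ => by
      have h1 := one_sub_cos_nat_mul_le ((i.1 + 1) * (i.2 + 1)) (2 * π * x)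
      have h3 := cos_le_one (((i.1 + 1) * (i.2 + 1) : ℕ) * (2 * π * x))
      have h2 := h i.1 i.2
      have h4 : 0 ≤ C * (a i.1 * b i.2) := mul_nonneg hC (mul_nonneg (ha0 _) (hb0 _))
      rw [zero_mul, sub_zero, neg_le_iff_add_nonneg']
      -- A nonpositive coefficient only raises the energy above its value at x = 0, so only positive
      -- ones need the majorant.
      rcases le_total (fc σ τ (i.1 + 1, i.2 + 1)) 0 with h0 | h0
      · have := mul_nonneg_of_nonpos_of_nonpos h0 (sub_nonpos.2 h3)
        have := mul_nonneg hv h4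
        linarith
      · have h5 := mul_le_mul_of_nonneg_left h1 h0
        have h6 := mul_le_mul_of_nonneg_left h2 hv
        linarith)
  rw [Finset.sum_singleton] at key
  have f11 : fc σ τ (1, 1) = (1 / 2 + σ - τ) * exp (-(σ + τ)) := by
    simp only [fc]; push_cast; rw [← exp_add]; ring_nf
  simp only [ha1] at key
  norm_num at key
  rw [f11] at key
  simp only [zero_mul, sub_zero] at hE
  push_cast at hE
  have hfin := mul_le_mul_of_nonneg_left key hP.le
  linarith

/-- The gap between σ and τ makes all coefficients with m = 1 nonpositive, so the majorant starts at
m = 2; there the polynomial factor is at most σ(m² - 1). -/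
theorem En_sub_zero_ge_of_two_le {A x y : ℝ} (hA : 0 < A) (hy : 0 < y) (hσ : 2 ≤ A * y)
    (hτ : A * y + 1 / 2 ≤ π ^ 2 * y / A) :
    En A 0 y + 4 * pref A y * (1 - cos (2 * π * x)) * (exp (-(A * y + π ^ 2 * y / A)) *
      (π ^ 2 * y / A - A * y - 1 / 2 - A * y * (qb (A * y) * (1 + qb (π ^ 2 * y / A)))))
      ≤ En A x y := by
  have hP := pref_pos hA hy
  have hv : 0 ≤ 1 - cos (2 * π * x) := by linarith [cos_le_one (2 * π * x)]
  set σ := A * y with hσd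
  set τ := π ^ 2 * y / A with hτd
  have hσ0 : 0 < σ := by linarith
  have hτ0 : 0 < τ := by linarith
  set f : ℕ → ℝ := fun m => ((m : ℝ) + 1) ^ 4 * exp (-σ * (((m : ℝ) + 1) ^ 2 - 1)) with hf
  set a : ℕ → ℝ := fun i => if i = 0 then 0 else f i with haD
  have hf0 : ∀ i, 0 ≤ f i := fun i => by simp only [hf]; positivity
  have ha0 : ∀ i, 0 ≤ a i := fun i => by simp only [haD]; split_ifs; exacts [le_rfl, hf0 i]
  have hfs : Summable f := summable_qs hσ0
  have ha : Summable a := Summable.of_nonneg_of_le ha0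
    (fun i => by simp only [haD]; split_ifs; exacts [hf0 i, le_rfl]) hfs
  have hsum : ∑' i, a i = qs σ - 1 := by
    have h1 : qs σ = f 0 + ∑' i, f (i + 1) := hfs.tsum_eq_zero_add
    rw [h1, ha.tsum_eq_zero_add]
    simp [haD, hf]
  have key := En_sub_zero_ge (x := x) (C := σ * exp (-(σ + τ))) hA hy (by positivity) ha
    (summable_qs hτ0) ha0 (fun _ => by positivity) (by simp [haD]) (fun i k => by
      have hk : (1 : ℝ) ≤ ((k : ℝ) + 1) ^ 2 := by nlinarith [(Nat.cast_nonneg k : (0 : ℝ) ≤ k)]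
      have h1 : 1 / 2 + σ * ((i : ℝ) + 1) ^ 2 - τ * ((k : ℝ) + 1) ^ 2
          ≤ σ * (((i : ℝ) + 1) ^ 2 - 1) := by nlinarith
      rw [← hσd, ← hτd]
      have e : exp (-σ * ((i : ℝ) + 1) ^ 2) * exp (-τ * ((k : ℝ) + 1) ^ 2) = exp (-(σ + τ)) *
          (exp (-σ * (((i : ℝ) + 1) ^ 2 - 1)) * exp (-τ * (((k : ℝ) + 1) ^ 2 - 1))) := by
        rw [← exp_add, ← exp_add, ← exp_add]; congr 1; ring
      simp only [fc]
      push_cast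
      rw [e]
      rcases Nat.eq_zero_or_pos i with rfl | hi
      · simp only [haD, if_true, zero_mul, mul_zero]
        norm_num at h1
        apply mul_nonpos_of_nonneg_of_nonpos (by positivity)
        apply mul_nonpos_of_nonpos_of_nonneg _ (by positivity)
        norm_num
        linarith
      · simp only [haD, hf, if_neg hi.ne']
        have hm : (1 : ℝ) ≤ ((i : ℝ) + 1) ^ 2 := by nlinarith [(Nat.cast_nonneg i : (0 : ℝ) ≤ i)]
        calc _ ≤ (((i : ℝ) + 1) * ((k : ℝ) + 1)) ^ 2 * (σ * (((i : ℝ) + 1) ^ 2 * ((k : ℝ) + 1) ^ 2) *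
            (exp (-(σ + τ)) * (exp (-σ * (((i : ℝ) + 1) ^ 2 - 1)) *
              exp (-τ * (((k : ℝ) + 1) ^ 2 - 1))))) := by
              gcongr
              refine h1.trans ?_
              gcongr
              nlinarith
          _ = _ := by ring)
  rw [← hσd, ← hτd, hsum] at key
  change _ + _ * (_ - _ * ((qs σ - 1) * qs τ)) ≤ _ at key
  have q1 : qs σ - 1 ≤ qb σ := by have := qs_le (σ := σ) (by linarith); rw [qb]; linarith
  have q2 : qs τ ≤ 1 + qb τ := by have := qs_le (σ := τ) (by linarith); rw [qb]; linarith
  have q3 : (qs σ - 1) * qs τ ≤ qb σ * (1 + qb τ) :=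
    mul_le_mul q1 q2 (qs_nonneg _) (by unfold qb; positivity)
  refine le_trans ?_ key
  have hPv : 0 ≤ 4 * pref A y * (1 - cos (2 * π * x)) := by positivity
  have q4 := mul_le_mul_of_nonneg_left q3 (by positivity : 0 ≤ σ * exp (-(σ + τ)))
  have q5 := mul_le_mul_of_nonneg_left q4 hPv
  linarith

end FourierConsequences

end LatticePhase

/-! ### The horizontal minimum at x = 0 for small parameters. -/

namespace LatticePhase

noncomputable section HorizontalMonotonicity

open Real

theorem tsum_sq_mul_geometric_le {z : ℝ} (h0 : 0 ≤ z) (h1 : z < 1) :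
    Summable (fun i : ℕ => ((i : ℝ) + 1) ^ 2 * z ^ i) ∧
      ∑' i : ℕ, ((i : ℝ) + 1) ^ 2 * z ^ i ≤ 2 / (1 - z) ^ 3 := by
  have hz : ‖z‖ < 1 := by rwa [norm_of_nonneg h0]
  have hs := (summable_choose_mul_geometric_of_norm_lt_one 2 hz).mul_left 2
  have hle : ∀ i : ℕ, ((i : ℝ) + 1) ^ 2 * z ^ i ≤ 2 * (((i + 2).choose 2 : ℕ) * z ^ i) := by
    intro i
    have hc : ((i + 2).choose 2 : ℝ) = ((i : ℝ) + 2) * (i + 1) / 2 := by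
      rw [Nat.cast_choose_two]; push_cast; ring
    rw [hc, ← mul_assoc]
    gcongr
    nlinarith [(Nat.cast_nonneg i : (0 : ℝ) ≤ i)]
  have hsum := Summable.of_nonneg_of_le (fun i => by positivity) hle hs
  refine ⟨hsum, (hsum.tsum_le_tsum hle hs).trans_eq ?_⟩
  rw [tsum_mul_left, tsum_choose_mul_geometric_of_norm_lt_one 2 hz]
  ring

theorem le_two_mul_exp (w : ℝ) : w ≤ 2 * exp (w / 2 - 1) := by
  have := add_one_le_exp (w / 2 - 1)
  linarith

theorem sq_le_four_pow (k : ℕ) : ((k : ℝ) + 1) ^ 2 ≤ 4 ^ k := by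
  induction k with
  | zero => norm_num
  | succ k ih =>
    have hk : (0 : ℝ) ≤ k := Nat.cast_nonneg k
    have e : (4 : ℝ) ^ (k + 1) = 4 * 4 ^ k := by ring
    rw [e]
    push_cast
    nlinarith

/-- With q = 1/σ one has 1 - e^{-σ} ≥ 1/(1 + q) and τ ≥ 7.4 q, so e^{-τ/2} overcomes (1 + q)³. The
estimate of the left side is worst at q = 1/2, where it is about 1.01, while the right side is at
least 1.2. -/
theorem small_sigma_bound {σ τ : ℝ} (h0 : 0 < σ) (h2 : σ ≤ 2) (hst : 7.4 ≤ σ * τ) :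
    2 * exp (-(3 / 4)) * (2 / (1 - exp (-σ)) ^ 3 * (exp (-(τ / 2)) * (1000 / 999)))
      < τ - σ - 1 / 2 := by
  have hτ : 3.7 ≤ τ := by nlinarith
  have hz : σ / (1 + σ) ≤ 1 - exp (-σ) := by
    rw [exp_neg, div_le_iff₀ (by linarith)]
    have h := add_one_le_exp σ
    have h3 : (exp σ)⁻¹ * (1 + σ) ≤ 1 := by
      rw [inv_mul_le_iff₀ (exp_pos σ)]; linarith
    linarith
  have e34 : exp (-(3 / 4)) < 0.473 := by
    have h1 : exp (-((3 : ℕ) / (4 : ℕ))) < (473 : ℕ) / (1000 : ℕ) :=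
      exp_neg_lt_of_check (by norm_num) (by norm_num) (by decide +kernel)
    push_cast at h1
    norm_num at h1 ⊢
    exact h1
  have e185 : exp (-1.85) < 0.158 := by
    have h1 : exp (-((185 : ℕ) / (100 : ℕ))) < (158 : ℕ) / (1000 : ℕ) :=
      exp_neg_lt_of_check (by norm_num) (by norm_num) (by decide +kernel)
    push_cast at h1
    norm_num at h1 ⊢
    exact h1
  obtain ⟨q, hq⟩ : ∃ q, q = 1 / σ := ⟨_, rfl⟩
  have hq2 : 1 / 2 ≤ q := by
    rw [hq, div_le_div_iff₀ (by norm_num) h0]; linarith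
  have hd : 2 / (1 - exp (-σ)) ^ 3 ≤ 2 * (1 + q) ^ 3 := by
    have hp : 0 < σ / (1 + σ) := by positivity
    have : 2 * (1 + q) ^ 3 = 2 / (σ / (1 + σ)) ^ 3 := by rw [hq]; field_simp; ring
    rw [this]
    gcongr
  have hτq : 7.4 * q ≤ τ := by
    rw [hq, mul_one_div, div_le_iff₀ h0]; linarith
  have hE : (1 + q) ^ 3 * exp (-(τ / 2)) ≤ 0.5333 := by
    have h1 : 1 + q ≤ 3 / 2 * exp ((q - 1 / 2) * (2 / 3)) := by
      have := add_one_le_exp ((q - 1 / 2) * (2 / 3))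
      linarith
    calc (1 + q) ^ 3 * exp (-(τ / 2)) ≤ (3 / 2 * exp ((q - 1 / 2) * (2 / 3))) ^ 3 *
          exp (-(τ / 2)) := by gcongr
      _ = 27 / 8 * exp (2 * (q - 1 / 2) - τ / 2) := by
        rw [mul_pow, ← exp_nat_mul, mul_assoc, ← exp_add]
        congr 1
        · norm_num
        · congr 1; push_cast; ring
      _ ≤ 27 / 8 * exp (-1.85) := by
        gcongr
        linarith
      _ ≤ _ := by linarith
  have hpos := exp_pos (-(τ / 2))
  have hz0 : 0 < 1 - exp (-σ) := lt_of_lt_of_le (by positivity) hz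
  calc _ ≤ 2 * 0.473 * (2 * (1 + q) ^ 3 * (exp (-(τ / 2)) * (1000 / 999))) := by gcongr
    _ = 2 * 0.473 * 2 * (1000 / 999) * ((1 + q) ^ 3 * exp (-(τ / 2))) := by ring
    _ ≤ 2 * 0.473 * 2 * (1000 / 999) * 0.5333 := by gcongr
    _ < _ := by
      norm_num at hτ ⊢
      linarith

/-- The majorant through `qs σ` degenerates as σ → 0. Here `le_two_mul_exp` trades the polynomial
factor w of a coefficient for e^{w/2}, which leaves e^{-σm²/2} e^{-3τn²/2} and hence geometric
majorants. -/
theorem En_sub_zero_ge_of_le_two {A x y : ℝ} (hA : 0 < A) (hy : 0 < y) (hσ : A * y ≤ 2)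
    (hst : 7.4 ≤ A * y * (π ^ 2 * y / A)) :
    ∃ D > 0, En A 0 y + D * (1 - cos (2 * π * x)) ≤ En A x y := by
  have hP := pref_pos hA hy
  set σ := A * y with hσd
  set τ := π ^ 2 * y / A with hτd
  have hσ0 : 0 < σ := by positivity
  have hτ0 : 0 < τ := by positivity
  have hτ : 3.7 ≤ τ := by nlinarith
  have hz1 : exp (-σ) < 1 := by rw [exp_lt_one_iff]; linarith
  obtain ⟨hfs, hft⟩ := tsum_sq_mul_geometric_le (exp_pos (-σ)).le hz1
  set f : ℕ → ℝ := fun i => ((i : ℝ) + 1) ^ 2 * exp (-σ) ^ i with hf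
  set a : ℕ → ℝ := fun i => if i = 0 then 0 else f i with haD
  set b : ℕ → ℝ := fun k => exp (-(τ / 2)) * (1 / 1000) ^ k with hbD
  have hf0 : ∀ i, 0 ≤ f i := fun i => by simp only [hf]; positivity
  have ha0 : ∀ i, 0 ≤ a i := fun i => by simp only [haD]; split_ifs; exacts [le_rfl, hf0 i]
  have haf : ∀ i, a i ≤ f i := fun i => by simp only [haD]; split_ifs; exacts [hf0 i, le_rfl]
  have ha : Summable a := Summable.of_nonneg_of_le ha0 haf hfs
  have hsum : ∑' i, a i ≤ 2 / (1 - exp (-σ)) ^ 3 := (ha.tsum_le_tsum haf hfs).trans hft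
  have hb : Summable b := (summable_geometric_of_lt_one (by norm_num) (by norm_num)).mul_left _
  have hbs : ∑' k, b k = exp (-(τ / 2)) * (1000 / 999) := by
    simp only [hbD]
    rw [tsum_mul_left, tsum_geometric_of_lt_one (by norm_num) (by norm_num)]
    norm_num
  -- Here 9τ/2 > 16; together with (k + 1)² ≤ 4^k this gives the geometric ratio 1/1000 in k.
  have e16 : exp (-(9 / 2 * τ)) ≤ 1 / 4000 := by
    have h1 : exp (-((16 : ℕ) / (1 : ℕ))) < (1 : ℕ) / (4000 : ℕ) :=
      exp_neg_lt_of_check (by norm_num) (by norm_num) (by decide +kernel)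
    push_cast at h1
    refine (exp_le_exp.2 ?_).trans h1.le
    norm_num at hτ ⊢
    linarith
  have hstep : ∀ k : ℕ, ((k : ℝ) + 1) ^ 2 * exp (-(3 / 2 * τ) * (((k : ℝ) + 1) ^ 2 - 1))
      ≤ (1 / 1000) ^ k := by
    intro k
    have hk : (0 : ℝ) ≤ k := Nat.cast_nonneg k
    have hk2 : (k : ℝ) ≤ (k : ℝ) ^ 2 := by
      have : k ≤ k ^ 2 := Nat.le_self_pow (by norm_num) k
      exact_mod_cast this
    calc ((k : ℝ) + 1) ^ 2 * exp (-(3 / 2 * τ) * (((k : ℝ) + 1) ^ 2 - 1))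
        ≤ 4 ^ k * exp (k * (-(9 / 2 * τ))) := by
          refine mul_le_mul (sq_le_four_pow k) (exp_le_exp.2 ?_) (exp_pos _).le (by positivity)
          nlinarith
      _ ≤ 4 ^ k * (1 / 4000) ^ k := by rw [exp_nat_mul]; gcongr
      _ = _ := by rw [← mul_pow]; norm_num
  have key := En_sub_zero_ge (x := x) (C := 2 * exp (-(3 / 4)) * exp (-(σ + τ))) hA hy
    (by positivity) ha hb ha0 (fun k => by simp only [hbD]; positivity) (by simp [haD])
    (fun i k => by
      rw [← hσd, ← hτd]
      have hk : (1 : ℝ) ≤ ((k : ℝ) + 1) ^ 2 := by nlinarith [(Nat.cast_nonneg k : (0 : ℝ) ≤ k)]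
      simp only [fc]
      push_cast
      rcases Nat.eq_zero_or_pos i with rfl | hi
      · simp only [haD, if_true, zero_mul, mul_zero]
        apply mul_nonpos_of_nonneg_of_nonpos (by positivity)
        apply mul_nonpos_of_nonpos_of_nonneg _ (by positivity)
        norm_num at hτ ⊢
        nlinarith
      · simp only [haD, if_neg hi.ne']
        have hi1 : (1 : ℝ) ≤ i := by exact_mod_cast hi
        have h1 := le_two_mul_exp (1 / 2 + σ * ((i : ℝ) + 1) ^ 2 - τ * ((k : ℝ) + 1) ^ 2)
        have h2 : exp ((1 / 2 + σ * ((i : ℝ) + 1) ^ 2 - τ * ((k : ℝ) + 1) ^ 2) / 2 - 1) *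
            (exp (-σ * ((i : ℝ) + 1) ^ 2) * exp (-τ * ((k : ℝ) + 1) ^ 2)) =
            exp (-(3 / 4)) * exp (-(σ + τ)) * exp (-(τ / 2)) *
              exp (-σ * (((i : ℝ) + 1) ^ 2 / 2 - 1)) *
              exp (-(3 / 2 * τ) * (((k : ℝ) + 1) ^ 2 - 1)) := by
          simp only [← exp_add]; congr 1; ring
        have h3 : exp (-σ * (((i : ℝ) + 1) ^ 2 / 2 - 1)) ≤ exp (-σ) ^ i := by
          rw [← exp_nat_mul]
          apply exp_le_exp.2
          have := mul_nonneg hσ0.le (by nlinarith : (0 : ℝ) ≤ (i : ℝ) ^ 2 - 1)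
          nlinarith
        calc _ ≤ (((i : ℝ) + 1) * ((k : ℝ) + 1)) ^ 2 *
              (2 * exp ((1 / 2 + σ * ((i : ℝ) + 1) ^ 2 - τ * ((k : ℝ) + 1) ^ 2) / 2 - 1) *
                (exp (-σ * ((i : ℝ) + 1) ^ 2) * exp (-τ * ((k : ℝ) + 1) ^ 2))) := by gcongr
          _ = 2 * exp (-(3 / 4)) * exp (-(σ + τ)) * ((((i : ℝ) + 1) ^ 2 *
              exp (-σ * (((i : ℝ) + 1) ^ 2 / 2 - 1))) * (exp (-(τ / 2)) *
              (((k : ℝ) + 1) ^ 2 * exp (-(3 / 2 * τ) * (((k : ℝ) + 1) ^ 2 - 1))))) := by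
            rw [mul_assoc 2, h2]; ring
          _ ≤ _ := by
            simp only [hf, hbD]
            gcongr
            exact hstep k)
  rw [← hσd, ← hτd, hbs] at key
  have hB := small_sigma_bound hσ0 hσ hst
  refine ⟨4 * pref A y * (exp (-(σ + τ)) * (τ - σ - 1 / 2 - 2 * exp (-(3 / 4)) *
    (2 / (1 - exp (-σ)) ^ 3 * (exp (-(τ / 2)) * (1000 / 999))))), ?_, ?_⟩
  · have := sub_pos.2 hB
    positivity
  · refine le_trans ?_ key
    have hv : 0 ≤ 1 - cos (2 * π * x) := by linarith [cos_le_one (2 * π * x)]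
    have h1 : 2 * exp (-(3 / 4)) * exp (-(σ + τ)) *
        ((∑' i, a i) * (exp (-(τ / 2)) * (1000 / 999))) ≤ 2 * exp (-(3 / 4)) * exp (-(σ + τ)) *
        (2 / (1 - exp (-σ)) ^ 3 * (exp (-(τ / 2)) * (1000 / 999))) := by gcongr
    have h2 := mul_le_mul_of_nonneg_left h1 (by positivity :
      0 ≤ 4 * pref A y * (1 - cos (2 * π * x)))
    linarith

theorem qb_anti {s t : ℝ} (h : s ≤ t) : qb t ≤ qb s := by
  unfold qb
  gcongr

/-- Lets the error term be evaluated at the left end of a range of σ. -/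
theorem mul_qb_anti {s t : ℝ} (hs : 1 ≤ s) (h : s ≤ t) : t * qb t ≤ s * qb s := by
  have key : ∀ c : ℝ, 1 ≤ c → t * exp (-(c * t)) ≤ s * exp (-(c * s)) := by
    intro c hc
    have h1 : t ≤ s * exp (c * (t - s)) := by
      have h2 := add_one_le_exp (c * (t - s))
      have h3 : t - s ≤ c * (t - s) := le_mul_of_one_le_left (by linarith) hc
      nlinarith
    calc t * exp (-(c * t)) ≤ s * exp (c * (t - s)) * exp (-(c * t)) := by gcongr
      _ = _ := by rw [mul_assoc, ← exp_add]; ring_nf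
  have := key 3 (by norm_num)
  have := key 8 (by norm_num)
  unfold qb
  linarith

theorem exp_neg_lt_of_le {w : ℝ} (a b c d : ℕ) (hb : 0 < b) (hd : 0 < d) (hw : (a : ℝ) / b ≤ w)
    (h : (Ball.nexp (Ball.const a b)).upperLt c d = true) : exp (-w) < (c : ℝ) / d :=
  (exp_le_exp.2 (neg_le_neg hw)).trans_lt (exp_neg_lt_of_check hb hd h)

theorem qb_two_lt : qb 2 < 0.0398 := by
  have h1 := exp_neg_lt_of_le (w := 3 * 2) 6 1 248 100000 (by norm_num) (by norm_num) (by norm_num)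
    (by decide +kernel)
  have h2 := exp_neg_lt_of_le (w := 8 * 2) 16 1 1 1000000 (by norm_num) (by norm_num) (by norm_num)
    (by decide +kernel)
  unfold qb
  norm_num at *
  linarith

theorem qb_12_5_lt : qb 2.4 < 0.012 := by
  have h1 := exp_neg_lt_of_le (w := 3 * 2.4) 72 10 747 1000000 (by norm_num) (by norm_num)
    (by norm_num) (by decide +kernel)
  have h2 := exp_neg_lt_of_le (w := 8 * 2.4) 192 10 1 10000000 (by norm_num) (by norm_num)
    (by norm_num) (by decide +kernel)
  unfold qb
  norm_num at *
  linarith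

theorem qb_2_84_lt : qb 2.84 < 0.0032 := by
  have h1 := exp_neg_lt_of_le (w := 3 * 2.84) 852 100 1995 10000000 (by norm_num) (by norm_num)
    (by norm_num) (by decide +kernel)
  have h2 := exp_neg_lt_of_le (w := 8 * 2.84) 2272 100 1 1000000000 (by norm_num) (by norm_num)
    (by norm_num) (by decide +kernel)
  unfold qb
  norm_num at *
  linarith

/-- The constant 433/500 is just below √3/2, and 503/500 stands for a bound on 1 + `qb τ`. For σ ≤
12/5 the error is larger, but then α ≤ 0.883 and the margin π(y/α - αy) is larger too. -/
theorem horizontal_bound_of_le {α y : ℝ} (hα : 0 < α) (hy : 433 / 500 ≤ y) (ha : α ≤ 181 / 200)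
    (h2 : 2 ≤ π * α * y) :
    π * α * y * (qb (π * α * y) * (503 / 500)) < π * (y / α) - π * α * y - 1 / 2 := by
  have hp := pi_pos
  have hp1 := pi_gt_d2
  have hp2 := pi_lt_d2
  have hpa : 0 < π * α := by positivity
  have e : π * (y / α) - π * α * y = π * (y / α - α * y) := by ring
  rw [e]
  rcases le_total (π * α * y) (12 / 5) with hs | hs
  · have hb := mul_qb_anti (by norm_num) h2
    have hq := qb_two_lt
    have ha2 : α ≤ 883 / 1000 := by
      by_contra hc
      push Not at hc
      have h3 : 314 / 100 * (883 / 1000) < π * α :=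
        mul_lt_mul'' (by linarith) hc (by norm_num) (by norm_num)
      nlinarith
    have h3 : 1132 / 1000 * y ≤ y / α := by
      rw [le_div_iff₀ hα]
      nlinarith
    have h5 : 213 / 1000 ≤ y / α - α * y := by nlinarith
    have h4 : 66 / 100 ≤ π * (y / α - α * y) := by nlinarith
    norm_num at hq
    linarith
  · have hb := mul_qb_anti (by norm_num) hs
    have hq := qb_12_5_lt
    have h3 : 11049 / 10000 * y ≤ y / α := by
      rw [le_div_iff₀ hα]
      nlinarith
    have h5 : 1731 / 10000 ≤ y / α - α * y := by nlinarith
    have h4 : 543 / 1000 ≤ π * (y / α - α * y) := by nlinarith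
    norm_num at hq hb
    linarith

theorem horizontal_bound_of_one_le {α y : ℝ} (hα : 181 / 200 ≤ α) (hy : 1 ≤ y)
    (ha : α ≤ 461 / 500) :
    π * α * y * (qb (π * α * y) * (503 / 500)) < π * (y / α) - π * α * y - 1 / 2 := by
  have hp := pi_pos
  have hp1 := pi_gt_d4
  have e : π * (y / α) - π * α * y = π * (y / α - α * y) := by ring
  rw [e]
  have hs : 2.84 ≤ π * α * y := by
    have h1 : 3.1415 * (181 / 200) ≤ π * α := mul_le_mul hp1.le hα (by norm_num) hp.le
    norm_num at h1 ⊢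
    nlinarith
  have hb := mul_qb_anti (by norm_num) hs
  have hq := qb_2_84_lt
  have h3 : 10845 / 10000 * y ≤ y / α := by
    rw [le_div_iff₀ (by linarith)]
    nlinarith
  have h5 : 1625 / 10000 ≤ y / α - α * y := by nlinarith
  have h4 : 51049 / 100000 ≤ π * (y / α - α * y) := by nlinarith
  norm_num at hq hb
  linarith

/-- For small parameters the lattice sum is minimal at `x = 0`, for a fixed height `y`. -/
theorem En_zero_le {α y : ℝ} (x : ℝ) (hα : 0 < α) (hy : 0 < y)
    (h : α ≤ 181 / 200 ∧ 3 / 4 ≤ y ^ 2 ∨ α ≤ 461 / 500 ∧ 1 ≤ y) :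
    ∃ D > 0, En (π * α) 0 y + D * (1 - cos (2 * π * x)) ≤ En (π * α) x y := by
  have hp := pi_pos
  have hp1 := pi_gt_d4
  have hA : 0 < π * α := by positivity
  have hy2 : 3 / 4 ≤ y ^ 2 := by
    rcases h with ⟨_, h⟩ | ⟨_, h⟩
    · exact h
    · nlinarith
  have hy0 : 433 / 500 ≤ y := by nlinarith
  have hstE : π * α * y * (π ^ 2 * y / (π * α)) = π ^ 2 * y ^ 2 := by field_simp
  have hτE : π ^ 2 * y / (π * α) = π * (y / α) := by field_simp
  rcases le_total (π * α * y) 2 with h2 | h2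
  · refine En_sub_zero_ge_of_le_two hA hy h2 ?_
    rw [hstE]
    -- The threshold 7.4 lies just below 3π²/4.
    have : 98690 / 10000 ≤ π ^ 2 := by norm_num at hp1; nlinarith
    norm_num
    nlinarith
  · have hm1 : π * α * y * (qb (π * α * y) * (503 / 500)) < π * (y / α) - π * α * y - 1 / 2 := by
      rcases le_or_gt α (181 / 200) with ha | ha
      · exact horizontal_bound_of_le hα hy0 ha h2
      · rcases h with ⟨h1, _⟩ | ⟨h1, h3⟩
        · exact absurd h1 (not_le.2 ha)
        · exact horizontal_bound_of_one_le ha.le h3 h1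
    rw [← hτE] at hm1
    set σ := π * α * y with hσ
    set τ := π ^ 2 * y / (π * α) with hτ
    have hσ0 : 0 < σ := by linarith
    have hq0 : 0 ≤ qb σ := by unfold qb; positivity
    have hm2 : σ + 1 / 2 ≤ τ := by
      have : 0 ≤ σ * (qb σ * (503 / 500)) := by positivity
      linarith
    have key := En_sub_zero_ge_of_two_le (x := x) hA hy h2 hm2
    rw [← hσ, ← hτ] at key
    have hq2 : qb τ ≤ 3 / 500 := by
      have hτ3 : 29 / 10 ≤ τ := by
        have h9 : 98690 / 10000 ≤ π ^ 2 := by norm_num at hp1; nlinarith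
        have h74 : 74 / 10 ≤ σ * τ := by rw [hstE]; nlinarith
        by_contra hc
        push Not at hc
        nlinarith
      refine (qb_anti hτ3).trans ?_
      have h1 := exp_neg_lt_of_le (w := 3 * (29 / 10)) 87 10 17 100000 (by norm_num) (by norm_num)
        (by norm_num) (by decide +kernel)
      have h2 := exp_neg_lt_of_le (w := 8 * (29 / 10)) 232 10 1 1000000000 (by norm_num)
        (by norm_num) (by norm_num) (by decide +kernel)
      unfold qb
      norm_num at h1 h2 ⊢
      linarith
    refine ⟨4 * pref (π * α) y * (exp (-(σ + τ)) * (τ - σ - 1 / 2 - σ * (qb σ * (1 + qb τ)))),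
      ?_, ?_⟩
    · have hP := pref_pos hA hy
      have : σ * (qb σ * (1 + qb τ)) ≤ σ * (qb σ * (503 / 500)) := by
        gcongr; linarith
      have : 0 < τ - σ - 1 / 2 - σ * (qb σ * (1 + qb τ)) := by linarith
      positivity
    · linarith

end HorizontalMonotonicity

end LatticePhase

/-! ### Scaled theta series in the logarithmic variable and their tails. -/

namespace LatticePhase

noncomputable section ScaledTheta

open Real

/-- The theta series `∑ (X (n + ξ) ^ 2) ^ j exp (-X (n + ξ) ^ 2)`. -/
def tp (ξ : ℝ) (j : ℕ) (X : ℝ) : ℝ := X ^ j * th j ξ X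

/-- The one-sided series `∑_{i ≥ 0} ((i + c) ^ 2 X) ^ j exp (-(i + c) ^ 2 X)`. -/
def hs (j : ℕ) (c X : ℝ) : ℝ := ∑' i : ℕ, ((i + c) ^ 2 * X) ^ j * exp (-((i + c) ^ 2 * X))

theorem tp_zero_pos (ξ : ℝ) {X : ℝ} (hX : 0 < X) : 0 < tp ξ 0 X := by
  simpa [tp] using th_zero_pos ξ hX

theorem tp_nonneg (ξ : ℝ) (j : ℕ) {X : ℝ} (hX : 0 ≤ X) : 0 ≤ tp ξ j X :=
  mul_nonneg (pow_nonneg hX j) (th_nonneg j ξ X)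

/-- In the logarithmic variable the scaled theta series satisfy a closed system of differential
equations. -/
theorem hasDerivAt_tp (ξ : ℝ) (j : ℕ) (v : ℝ) :
    HasDerivAt (fun v => tp ξ j (exp v)) (j * tp ξ j (exp v) - tp ξ (j + 1) (exp v)) v := by
  have h1 := (hasDerivAt_th j ξ (exp_pos v)).comp v (hasDerivAt_exp v)
  have h2 := ((hasDerivAt_exp v).pow j).mul h1
  refine h2.congr_deriv ?_
  simp only [tp, Function.comp]
  cases j with
  | zero => simp; ring
  | succ j => simp only [Nat.add_sub_cancel, Pi.pow_apply]; push_cast; ring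

theorem summable_hs (j : ℕ) (c : ℝ) {X : ℝ} (hX : 0 < X) :
    Summable fun i : ℕ => ((i + c) ^ 2 * X) ^ j * exp (-((i + c) ^ 2 * X)) := by
  refine (((summable_th j c hX).comp_injective (i := fun i : ℕ => (i : ℤ))
    Nat.cast_injective).mul_left (X ^ j)).congr fun i => ?_
  simp only [Function.comp, Int.cast_natCast]
  rw [mul_pow, show -X * (i + c) ^ 2 = -((i + c) ^ 2 * X) by ring]
  ring

theorem hs_nonneg (j : ℕ) (c : ℝ) {X : ℝ} (hX : 0 ≤ X) : 0 ≤ hs j c X :=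
  tsum_nonneg fun _ => by positivity

theorem hs_eq_add (j : ℕ) (c : ℝ) {X : ℝ} (hX : 0 < X) :
    hs j c X = (c ^ 2 * X) ^ j * exp (-(c ^ 2 * X)) + hs j (c + 1) X := by
  rw [hs, (summable_hs j c hX).tsum_eq_zero_add, hs]
  congr 1
  · simp
  · refine tsum_congr fun i => ?_
    rw [show ((i + 1 : ℕ) : ℝ) + c = i + (c + 1) by push_cast; ring]

theorem tp_zero_eq_hs (j : ℕ) {X : ℝ} (hX : 0 < X) : tp 0 j X = 0 ^ j + 2 * hs j 1 X := by
  have hs' := summable_th j 0 hX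
  rw [tp, th, tsum_int_of_even hs' (fun n => by push_cast; ring_nf), mul_add, hs, ← tsum_mul_left,
    ← tsum_mul_left, ← tsum_mul_left]
  congr 1
  · cases j <;> simp
  · refine tsum_congr fun i => ?_
    push_cast
    rw [mul_pow, add_zero, show -X * ((i : ℝ) + 1) ^ 2 = -((i + 1) ^ 2 * X) by ring]
    ring

theorem tp_half_eq_hs (j : ℕ) {X : ℝ} (hX : 0 < X) : tp (1 / 2) j X = 2 * hs j (1 / 2) X := by
  have h := ((summable_th j (1 / 2) hX).mul_left (X ^ j))
  set f : ℤ → ℝ := fun n => X ^ j * (((n + 1 / 2) ^ 2) ^ j * exp (-X * (n + 1 / 2) ^ 2)) with hf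
  have e1 : ∀ i : ℕ, f i = ((i + 1 / 2) ^ 2 * X) ^ j * exp (-((i + 1 / 2) ^ 2 * X)) := fun i => by
    simp only [hf, Int.cast_natCast]
    rw [mul_pow, show -X * ((i : ℝ) + 1 / 2) ^ 2 = -((i + 1 / 2) ^ 2 * X) by ring]
    ring
  have e2 : ∀ i : ℕ, f (-((i : ℤ) + 1)) = f i := fun i => by
    simp only [hf]
    push_cast
    rw [show (-((i : ℝ) + 1) + 1 / 2) ^ 2 = (i + 1 / 2) ^ 2 by ring]
  have s1 : Summable fun i : ℕ => f i := h.comp_injective Nat.cast_injective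
  have s2 : Summable fun i : ℕ => f (-((i : ℤ) + 1)) := by simpa only [e2] using s1
  have := tsum_of_nat_of_neg_add_one s1 s2
  simp only [e2] at this
  rw [tp, th, ← tsum_mul_left, this, ← two_mul, hs]
  simp only [e1]

theorem pow_mul_exp_neg_anti {k : ℕ} {w v : ℝ} (h0 : 0 < w) (hk : (k : ℝ) ≤ w) (hwv : w ≤ v) :
    v ^ k * exp (-v) ≤ w ^ k * exp (-w) := by
  have h1 : v / w ≤ exp (v / w - 1) := by linarith [add_one_le_exp (v / w - 1)]
  have h2 : (v / w) ^ k ≤ exp (v - w) := by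
    calc (v / w) ^ k ≤ exp (v / w - 1) ^ k := by gcongr; exact div_nonneg (h0.le.trans hwv) h0.le
      _ = exp (k * (v / w - 1)) := by rw [← exp_nat_mul]
      _ ≤ _ := by
        apply exp_le_exp.2
        have h3 : v - w = w * (v / w - 1) := by field_simp
        rw [h3]
        have : 0 ≤ v / w - 1 := by rw [sub_nonneg, le_div_iff₀ h0]; linarith
        gcongr
  calc v ^ k * exp (-v) = (v / w) ^ k * (w ^ k * exp (-v)) := by
        rw [div_pow]; field_simp
    _ ≤ exp (v - w) * (w ^ k * exp (-v)) := by gcongr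
    _ = w ^ k * (exp (v - w) * exp (-v)) := by ring
    _ = _ := by rw [← exp_add]; ring_nf

/-- Ratios of consecutive terms are largest at the start, since both (i + c + 1)/(i + c) and the
exponential factor decrease with i. -/
theorem hs_le (j : ℕ) {c X : ℝ} (hc : 0 < c) (hX : 0 < X)
    (hr : ((c + 1) / c) ^ (2 * j) * exp (-((2 * c + 1) * X)) ≤ 1 / 2) :
    hs j c X ≤ 2 * ((c ^ 2 * X) ^ j * exp (-(c ^ 2 * X))) := by
  obtain ⟨_, h⟩ := tsum_le_of_ratio
    (f := fun i : ℕ => ((i + c) ^ 2 * X) ^ j * exp (-((i + c) ^ 2 * X))) (ρ := 1 / 2)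
    (fun i => by positivity) (by norm_num) (by norm_num) (fun i => by
      have hi : (0 : ℝ) ≤ i := i.cast_nonneg
      have e1 : exp (-(((i + 1 : ℕ) + c) ^ 2 * X))
          = exp (-((2 * (i + c) + 1) * X)) * exp (-((i + c) ^ 2 * X)) := by
        rw [← exp_add]; push_cast; ring_nf
      have e2 : (((i + 1 : ℕ) + c) ^ 2 * X) ^ j
          = ((i + c + 1) / (i + c)) ^ (2 * j) * ((i + c) ^ 2 * X) ^ j := by
        rw [pow_mul, ← mul_pow]; push_cast; field_simp; ring
      have e3 : (i + c + 1) / (i + c) ≤ (c + 1) / c := by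
        rw [div_le_div_iff₀ (by positivity) hc]; nlinarith
      have e4 : exp (-((2 * (i + c) + 1) * X)) ≤ exp (-((2 * c + 1) * X)) := by
        apply exp_le_exp.2; nlinarith [mul_nonneg hi hX.le]
      rw [e1, e2]
      calc _ = (((i + c + 1) / (i + c)) ^ (2 * j) * exp (-((2 * (i + c) + 1) * X)))
            * (((i + c) ^ 2 * X) ^ j * exp (-((i + c) ^ 2 * X))) := by ring
        _ ≤ (((c + 1) / c) ^ (2 * j) * exp (-((2 * c + 1) * X)))
            * (((i + c) ^ 2 * X) ^ j * exp (-((i + c) ^ 2 * X))) := by gcongr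
        _ ≤ _ := by gcongr)
  refine h.trans_eq ?_
  simp
  ring

/-- A tail bound that is uniform in the variable and in the exponent. -/
theorem hs_le_of_le {j k : ℕ} {c X₀ X : ℝ} (hjk : j ≤ k) (hc : 0 < c) (hX₀ : 0 < X₀) (hX : X₀ ≤ X)
    (h1 : 1 ≤ c ^ 2 * X₀) (hk : (k : ℝ) ≤ c ^ 2 * X₀)
    (hr : ((c + 1) / c) ^ (2 * k) * exp (-((2 * c + 1) * X₀)) ≤ 1 / 2) :
    hs j c X ≤ 2 * ((c ^ 2 * X₀) ^ k * exp (-(c ^ 2 * X₀))) := by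
  have hX' : 0 < X := hX₀.trans_le hX
  have hw : c ^ 2 * X₀ ≤ c ^ 2 * X := by gcongr
  refine (hs_le j hc hX' (le_trans ?_ hr)).trans ?_
  · have : 1 ≤ (c + 1) / c := by rw [le_div_iff₀ hc]; linarith
    gcongr
  · refine mul_le_mul_of_nonneg_left (le_trans ?_ (pow_mul_exp_neg_anti (by positivity) hk hw))
      (by norm_num)
    gcongr
    linarith

/-- A ball around zero. -/
def Ball.tail (a b : ℕ) : Ball := ⟨0, 0, Nat.succ (Nat.div (Nat.mul a scale) b)⟩

theorem Ball.mem_tail {a b : ℕ} (hb : 0 < b) {x : ℝ} (h0 : 0 ≤ x) (h1 : x ≤ (a : ℝ) / b) :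
    (Ball.tail a b).Mem x := by
  rw [Ball.tail, Ball.mem_mk]
  have h := natDiv_bounds (Nat.mul a scale) b hb
  have hs := scale_pos
  have h2 : x * scale ≤ ((Nat.mul a scale : ℕ) : ℝ) / b := by
    rw [Nat.mul_eq]; push_cast
    calc x * scale ≤ (a : ℝ) / b * scale := by gcongr
      _ = _ := by ring
  simp only [Nat.succ_eq_add_one, Nat.cast_zero, sub_zero]
  rw [abs_of_nonneg (by positivity), Nat.cast_add_one]
  exact h2.trans h.2

end ScaledTheta
end LatticePhase

/-! ### A program for the theta series in one variable. -/

namespace LatticePhase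

noncomputable section ThetaProgram

open Real

namespace Expr

def sub (a b : Expr) : Expr := add a (neg b)

/-- Twice the sum of four expressions. -/
def twice (a b c d : Expr) : Expr := smul 2 (add (add a b) (add c d))

theorem eval_twice (n : ℕ) (ρ : List ℝ) (a b c d : Expr) : (twice a b c d).eval n ρ
    = 2 * (a.eval n ρ + b.eval n ρ + (c.eval n ρ + d.eval n ρ)) := by
  simp [twice, eval]

end Expr

open LatticePhase.Expr in
/-- Computes `tp 0 j X` for `j ≤ 5` as the variables `27, …, 32` from `X` (the variable `0`) and the
tails `hs j 4 X` (the variables `3, …, 8`). -/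
def thetaProg : List Expr :=
  [nexp (var 0), nexp (smul 4 (var 0)), nexp (smul 9 (var 0)),
    mul (var 0) (var 9), mul (smul 4 (var 0)) (var 10), mul (smul 9 (var 0)) (var 11),
    mul (var 0) (var 12), mul (smul 4 (var 0)) (var 13), mul (smul 9 (var 0)) (var 14),
    mul (var 0) (var 15), mul (smul 4 (var 0)) (var 16), mul (smul 9 (var 0)) (var 17),
    mul (var 0) (var 18), mul (smul 4 (var 0)) (var 19), mul (smul 9 (var 0)) (var 20),
    mul (var 0) (var 21), mul (smul 4 (var 0)) (var 22), mul (smul 9 (var 0)) (var 23),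
    add (const 1 1) (twice (var 9) (var 10) (var 11) (var 3)),
    twice (var 12) (var 13) (var 14) (var 4), twice (var 15) (var 16) (var 17) (var 5),
    twice (var 18) (var 19) (var 20) (var 6), twice (var 21) (var 22) (var 23) (var 7),
    twice (var 24) (var 25) (var 26) (var 8)]

theorem thetaProg_wf : ∀ a ∈ thetaProg, a.WF := by
  simp [thetaProg, Expr.WF, Expr.twice]

theorem hs_one_expand (j : ℕ) {X : ℝ} (hX : 0 < X) : hs j 1 X =
    X ^ j * exp (-X) + (4 * X) ^ j * exp (-(4 * X)) + ((9 * X) ^ j * exp (-(9 * X)) + hs j 4 X) := by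
  rw [hs_eq_add j 1 hX, hs_eq_add j (1 + 1) hX, hs_eq_add j (1 + 1 + 1) hX]
  norm_num
  ring

def tailList (a b : ℕ) : List Ball :=
  [Ball.tail a b, Ball.tail a b, Ball.tail a b, Ball.tail a b, Ball.tail a b, Ball.tail a b]

/-- Positivity on an interval of a polynomial in the theta series. -/
theorem theta_pos_of_check {u : ℕ} (hu : 0 < u) {a b : ℕ} (hb : 0 < b) {e : Expr} (he : e.WF)
    (fuel x0 x1 : ℕ) (hx : x0 ≤ x1)
    (h : checkBox u (tailList a b) thetaProg e fuel x0 x1 u u = true) {X : ℝ} (hX : 0 < X)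
    (ht : ∀ j ≤ 5, hs j 4 X ≤ (a : ℝ) / b) (h0 : (x0 : ℝ) / u ≤ X) (h1 : X ≤ (x1 : ℝ) / u) :
    ∃ l, 0 < e.eval 32 (tp 0 5 X :: tp 0 4 X :: tp 0 3 X :: tp 0 2 X :: tp 0 1 X :: tp 0 0 X :: l)
    := by
  have hm : ∀ j ≤ 5, (Ball.tail a b).Mem (hs j 4 X) := fun j hj =>
    Ball.mem_tail hb (hs_nonneg j 4 hX.le) (ht j hj)
  have hu' : (u : ℝ) ≠ 0 := by positivity
  -- Only X varies; the second coordinate is frozen at 1 = u/u.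
  have key := value_pos_of_checkBox (y := 1) (by exact_mod_cast hu)
    (c := [hs 5 4 X, hs 4 4 X, hs 3 4 X, hs 2 4 X, hs 1 4 X, hs 0 4 X])
    (by
      unfold tailList
      exact .cons (hm 5 (by norm_num)) (.cons (hm 4 (by norm_num)) (.cons (hm 3 (by norm_num))
        (.cons (hm 2 (by norm_num)) (.cons (hm 1 (by norm_num)) (.cons (hm 0 (by norm_num))
          .nil))))))
    thetaProg_wf he fuel x0 x1 u u hu hx le_rfl h X h0 h1 (by rw [div_self hu'])
    (by rw [div_self hu'])
  have e0 : ∀ j, tp 0 j X = 0 ^ j + 2 * (X ^ j * exp (-X) + (4 * X) ^ j * exp (-(4 * X))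
      + ((9 * X) ^ j * exp (-(9 * X)) + hs j 4 X)) := fun j => by
    rw [tp_zero_eq_hs j hX, hs_one_expand j hX]
  simp only [Expr.value, thetaProg, Expr.run, List.length_cons, List.length_nil, List.cons_append,
    List.nil_append, Expr.eval, Expr.eval_twice] at key
  simp at key
  have aux : ∀ {a₀ a₁ a₂ a₃ a₄ a₅ : ℝ} {l : List ℝ}, tp 0 0 X = a₀ → tp 0 1 X = a₁ → tp 0 2 X = a₂ →
      tp 0 3 X = a₃ → tp 0 4 X = a₄ → tp 0 5 X = a₅ →
      0 < e.eval 32 (a₅ :: a₄ :: a₃ :: a₂ :: a₁ :: a₀ :: l) →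
      ∃ l, 0 < e.eval 32 (tp 0 5 X :: tp 0 4 X :: tp 0 3 X :: tp 0 2 X :: tp 0 1 X :: tp 0 0 X :: l)
      := by
    rintro _ _ _ _ _ _ l rfl rfl rfl rfl rfl rfl h
    exact ⟨l, h⟩
  exact aux (by rw [e0]; ring) (by rw [e0]; ring) (by rw [e0]; ring) (by rw [e0]; ring)
    (by rw [e0]; ring) (by rw [e0]; ring) key

/-- Values near or below the resolution 2^{-64} of the fixed-point format are reached by bounding
e^{-w/2} and squaring. -/
theorem exp_neg_lt_sq_of_le {w : ℝ} (a b c d : ℕ) (hb : 0 < b) (hd : 0 < d)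
    (hw : (a : ℝ) / b ≤ w / 2) (h : (Ball.nexp (Ball.const a b)).upperLt c d = true) :
    exp (-w) < ((c : ℝ) / d) ^ 2 := by
  have := exp_neg_lt_of_le a b c d hb hd hw h
  rw [show -w = -(w / 2) + -(w / 2) by ring, exp_add, ← sq]
  gcongr

theorem hs_four_le {X : ℝ} (hX : 14 / 5 ≤ X) (j : ℕ) (hj : j ≤ 5) :
    hs j 4 X ≤ (1 : ℕ) / (10 ^ 10 : ℕ) := by
  have h1 := exp_neg_lt_of_le (w := (2 * 4 + 1) * (14 / 5)) 25 1 1 1000 (by norm_num) (by norm_num)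
    (by norm_num) (by decide +kernel)
  have h2 := exp_neg_lt_sq_of_le (w := 4 ^ 2 * (14 / 5)) 224 10 2 (10 ^ 10) (by norm_num)
    (by norm_num) (by norm_num) (by decide +kernel)
  refine (hs_le_of_le (X₀ := 14 / 5) hj (by norm_num) (by norm_num) hX (by norm_num) (by norm_num)
    ?_).trans ?_
  · calc ((4 + 1) / 4 : ℝ) ^ (2 * 5) * exp (-((2 * 4 + 1) * (14 / 5)))
        ≤ ((4 + 1) / 4 : ℝ) ^ (2 * 5) * ((1 : ℕ) / (1000 : ℕ)) := by gcongr
      _ ≤ _ := by norm_num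
  · refine (mul_le_mul_of_nonneg_left (mul_le_mul_of_nonneg_left h2.le (by norm_num))
      (by norm_num)).trans ?_
    norm_num

theorem hs_four_le_of_ge {X : ℝ} (hX : 7 / 2 ≤ X) (j : ℕ) (hj : j ≤ 5) :
    hs j 4 X ≤ (1 : ℕ) / (10 ^ 14 : ℕ) := by
  have h1 := exp_neg_lt_of_le (w := (2 * 4 + 1) * (7 / 2)) 25 1 1 1000 (by norm_num) (by norm_num)
    (by norm_num) (by decide +kernel)
  have h2 := exp_neg_lt_sq_of_le (w := 4 ^ 2 * (7 / 2)) 28 1 1 (10 ^ 12) (by norm_num)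
    (by norm_num) (by norm_num) (by decide +kernel)
  refine (hs_le_of_le (X₀ := 7 / 2) hj (by norm_num) (by norm_num) hX (by norm_num) (by norm_num)
    ?_).trans ?_
  · calc ((4 + 1) / 4 : ℝ) ^ (2 * 5) * exp (-((2 * 4 + 1) * (7 / 2)))
        ≤ ((4 + 1) / 4 : ℝ) ^ (2 * 5) * ((1 : ℕ) / (1000 : ℕ)) := by gcongr
      _ ≤ _ := by norm_num
  · refine (mul_le_mul_of_nonneg_left (mul_le_mul_of_nonneg_left h2.le (by norm_num))
      (by norm_num)).trans ?_
    norm_num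

end ThetaProgram
end LatticePhase

/-! ### Certified inequalities between theta series. -/

namespace LatticePhase

noncomputable section ThetaNumerics

open Real

/-- The numerator of the logarithmic derivative of `ratioH`. -/
def numM (X : ℝ) : ℝ :=
  (4 * tp 0 2 X - tp 0 3 X - 2 * tp 0 1 X) * tp 0 0 X + (tp 0 2 X - 2 * tp 0 1 X) * tp 0 1 X

/-- The logarithmic derivative of `numM`. -/
def numM' (X : ℝ) : ℝ :=
  (tp 0 4 X - 7 * tp 0 3 X + 10 * tp 0 2 X - 2 * tp 0 1 X) * tp 0 0 X
    + (tp 0 2 X - 2 * tp 0 1 X) * (tp 0 1 X - tp 0 2 X)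

/-- The logarithmic derivative of `numM'`. -/
def numM'' (X : ℝ) : ℝ :=
  (-tp 0 5 X + 11 * tp 0 4 X - 31 * tp 0 3 X + 22 * tp 0 2 X - 2 * tp 0 1 X) * tp 0 0 X
    - (tp 0 4 X - 7 * tp 0 3 X + 10 * tp 0 2 X - 2 * tp 0 1 X) * tp 0 1 X
    + (4 * tp 0 2 X - tp 0 3 X - 2 * tp 0 1 X) * (tp 0 1 X - tp 0 2 X)
    + (tp 0 2 X - 2 * tp 0 1 X) * (tp 0 1 X - 3 * tp 0 2 X + tp 0 3 X)

/-- The numerator of the logarithmic derivative of the ratio `κ`. -/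
def numK (X : ℝ) : ℝ :=
  (3 * tp 0 2 X - tp 0 3 X - tp 0 1 X) * tp 0 0 X + (tp 0 2 X - tp 0 1 X) * tp 0 1 X

namespace Expr

def p0 : Expr := var 27
def p1 : Expr := var 28
def p2 : Expr := var 29
def p3 : Expr := var 30
def p4 : Expr := var 31
def p5 : Expr := var 32

def exprM : Expr :=
  add (mul (sub (smul 4 p2) (add p3 (smul 2 p1))) p0) (mul (sub p2 (smul 2 p1)) p1)

def exprM1 : Expr := sub (add p4 (smul 10 p2)) (add (smul 7 p3) (smul 2 p1))

def exprM' : Expr := add (mul exprM1 p0) (mul (sub p2 (smul 2 p1)) (sub p1 p2))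

def exprM'' : Expr :=
  add (sub (mul (sub (add (smul 11 p4) (smul 22 p2)) (add p5 (add (smul 31 p3) (smul 2 p1)))) p0)
    (mul exprM1 p1))
    (add (mul (sub (smul 4 p2) (add p3 (smul 2 p1))) (sub p1 p2))
      (mul (sub p2 (smul 2 p1)) (add (sub p1 (smul 3 p2)) p3)))

/-- The numerator of the third logarithmic derivative of `ratioH`. -/
def exprThird : Expr :=
  add (mul (add (mul exprM'' p0) (add (mul exprM' p1) (smul 2 (mul exprM (sub p1 p2))))) p0)
    (smul 3 (mul (add (mul exprM' p0) (smul 2 (mul exprM p1))) p1))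

def exprK : Expr :=
  add (mul (sub (smul 3 p2) (add p3 p1)) p0) (mul (sub p2 p1) p1)

/-- `p₀ ^ 2 (4.15 (c p₀ - n) p₀ - 13 (c p₀ - n) ^ 2)`. -/
def exprComparator (a b : ℕ) (n : Expr) : Expr :=
  mul (mul p0 p0) (sub (mul (mul (const 83 20) (sub (mul (const a b) p0) n)) p0)
    (smul 13 (mul (sub (mul (const a b) p0) n) (sub (mul (const a b) p0) n))))

end Expr

open LatticePhase.Expr

theorem numM'_neg {X : ℝ} (h0 : 14 / 5 ≤ X) (h1 : X ≤ 4) : numM' X < 0 := by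
  obtain ⟨l, h⟩ := theta_pos_of_check (u := 10) (e := neg exprM') (by norm_num) (by norm_num)
    (by simp [exprM', exprM1, WF, sub, p0, p1, p2, p3, p4]) 20 28 40 (by norm_num)
    (by decide +kernel) (by linarith)
    (hs_four_le h0) (by norm_num; linarith) (by norm_num; linarith)
  simp [exprM', exprM1, eval, sub, p0, p1, p2, p3, p4] at h
  unfold numM'
  linarith

/-- This is the numerator of the derivative of `ratioH''`, on an interval around the turning point X
≈ 3.511. -/
theorem third_pos {X : ℝ} (h0 : 167 / 50 ≤ X) (h1 : X ≤ 187 / 50) :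
    0 < (numM'' X * tp 0 0 X + numM' X * tp 0 1 X + 2 * numM X * (tp 0 1 X - tp 0 2 X)) * tp 0 0 X
      + 3 * (numM' X * tp 0 0 X + 2 * numM X * tp 0 1 X) * tp 0 1 X := by
  obtain ⟨l, h⟩ := theta_pos_of_check (u := 50) (e := exprThird) (by norm_num) (by norm_num)
    (by simp [exprThird, exprM, exprM', exprM'', exprM1, WF, sub, p0, p1, p2, p3, p4, p5]) 20 167 187
    (by norm_num) (by decide +kernel) (by linarith)
    (hs_four_le (by linarith)) (by norm_num; linarith) (by norm_num; linarith)
  simp [exprThird, exprM, exprM', exprM'', exprM1, eval, sub, p0, p1, p2, p3, p4, p5] at h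
  unfold numM numM' numM''
  ring_nf at h ⊢
  linarith

theorem numM_pos_at : 0 < numM (351131894264 / 10 ^ 11) := by
  obtain ⟨l, h⟩ := theta_pos_of_check (u := 10 ^ 11) (e := exprM) (X := 351131894264 / 10 ^ 11)
    (by norm_num) (by norm_num)
    (by simp [exprM, WF, sub, p0, p1, p2, p3]) 2 351131894264 351131894264
    (by norm_num) (by decide +kernel) (by norm_num)
    (hs_four_le_of_ge (by norm_num)) (by norm_num) (by norm_num)
  simp [exprM, eval, sub, p0, p1, p2, p3] at h
  unfold numM
  linarith

theorem numM_neg_at : numM (351131894273 / 10 ^ 11) < 0 := by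
  obtain ⟨l, h⟩ := theta_pos_of_check (u := 10 ^ 11) (e := neg exprM) (X := 351131894273 / 10 ^ 11)
    (by norm_num) (by norm_num)
    (by simp [exprM, WF, sub, p0, p1, p2, p3]) 2 351131894273 351131894273
    (by norm_num) (by decide +kernel) (by norm_num)
    (hs_four_le_of_ge (by norm_num)) (by norm_num) (by norm_num)
  simp [exprM, eval, sub, p0, p1, p2, p3] at h
  unfold numM
  linarith

/-- Away from the turning point the two branches of H = `ratioH` are separated by F(H) = 4.15(c - H)
- 13(c - H)², with c = 0.299288 just above the maximum of H. On the falling branch H'² < F(H), as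
here; on the rising branch H'² > F(H), by `lt_numK_sq`. -/
theorem numM_sq_lt {X : ℝ} (h0 : 73 / 20 ≤ X) (h1 : X ≤ 10) :
    numM X ^ 2 < tp 0 0 X ^ 2 * (4.15 * (0.299288 * tp 0 0 X - (tp 0 2 X - 2 * tp 0 1 X)) * tp 0 0 X
      - 13 * (0.299288 * tp 0 0 X - (tp 0 2 X - 2 * tp 0 1 X)) ^ 2) := by
  obtain ⟨l, h⟩ := theta_pos_of_check (u := 10 ^ 6)
    (e := sub (exprComparator 299288 1000000 (sub p2 (smul 2 p1))) (mul exprM exprM))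
    (by norm_num) (by norm_num)
    (by simp [exprM, exprComparator, WF, sub, p0, p1, p2, p3]) 20 3650000 10000000
    (by norm_num) (by decide +kernel) (by linarith)
    (hs_four_le (by linarith)) (by norm_num; linarith) (by norm_num; linarith)
  simp [exprM, exprComparator, eval, sub, p0, p1, p2, p3] at h
  unfold numM
  norm_num at h ⊢
  linarith

/-- The rising branch is evaluated at the reflected argument π²/X, where few terms of the series
suffice. By `kap_eq` this adds 1/4 to the level, whence 0.549288. -/
theorem lt_numK_sq {X : ℝ} (h0 : 29531 / 10000 ≤ X) (h1 : X ≤ 107 / 20) :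
    tp 0 0 X ^ 2 * (4.15 * (0.549288 * tp 0 0 X - (tp 0 2 X - tp 0 1 X)) * tp 0 0 X
      - 13 * (0.549288 * tp 0 0 X - (tp 0 2 X - tp 0 1 X)) ^ 2) < numK X ^ 2 := by
  obtain ⟨l, h⟩ := theta_pos_of_check (u := 10 ^ 7)
    (e := sub (mul exprK exprK) (exprComparator 549288 1000000 (sub p2 p1)))
    (by norm_num) (by norm_num)
    (by simp [exprK, exprComparator, WF, sub, p0, p1, p2, p3]) 20 29531000 53500000
    (by norm_num) (by decide +kernel) (by linarith)
    (hs_four_le (by linarith)) (by norm_num; linarith) (by norm_num; linarith)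
  simp [exprK, exprComparator, eval, sub, p0, p1, p2, p3] at h
  unfold numK
  norm_num at h ⊢
  linarith

theorem kappa_num_lt {X : ℝ} (h0 : 267 / 50 ≤ X) (h1 : X ≤ 8) :
    4 * (tp 0 2 X - tp 0 1 X) < tp 0 0 X := by
  obtain ⟨l, h⟩ := theta_pos_of_check (u := 50)
    (e := sub p0 (smul 4 (sub p2 p1))) (by norm_num) (by norm_num)
    (by simp [WF, sub, p0, p1, p2]) 20 267 400
    (by norm_num) (by decide +kernel) (by linarith)
    (hs_four_le (by linarith)) (by norm_num; linarith) (by norm_num; linarith)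
  simp [eval, sub, p0, p1, p2] at h
  linarith

theorem ratio_num_lt {X : ℝ} {x u a b : ℕ} (hX : X = x / u) (hu : 0 < u) (hb : 0 < b) (h0 : 14 / 5 ≤ X)
    (hc : checkBox u (tailList 1 (10 ^ 10)) thetaProg
      (sub (mul (const a b) p0) (sub p2 (smul 2 p1))) 2 x x u u = true) :
    tp 0 2 X - 2 * tp 0 1 X < a / b * tp 0 0 X := by
  obtain ⟨l, h⟩ := theta_pos_of_check hu (by norm_num) (by simp [WF, sub, p0, p1, p2, hb])
    2 x x le_rfl hc (by linarith) (hs_four_le h0) hX.ge hX.le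
  simp [eval, sub, p0, p1, p2] at h
  linarith

theorem lt_ratio_num {X : ℝ} {x u a b : ℕ} (hX : X = x / u) (hu : 0 < u) (hb : 0 < b) (h0 : 14 / 5 ≤ X)
    (hc : checkBox u (tailList 1 (10 ^ 10)) thetaProg
      (sub (sub p2 (smul 2 p1)) (mul (const a b) p0)) 2 x x u u = true) :
    a / b * tp 0 0 X < tp 0 2 X - 2 * tp 0 1 X := by
  obtain ⟨l, h⟩ := theta_pos_of_check hu (by norm_num) (by simp [WF, sub, p0, p1, p2, hb])
    2 x x le_rfl hc (by linarith) (hs_four_le h0) hX.ge hX.le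
  simp [eval, sub, p0, p1, p2] at h
  linarith

end ThetaNumerics
end LatticePhase

/-! ### The ratio function H, its derivatives and its reflection formula. -/

namespace LatticePhase

noncomputable section RatioFunction

open Real

/-- The function `(p₂ - 2 p₁) / p₀` of the logarithmic variable. -/
def ratioH (v : ℝ) : ℝ := (tp 0 2 (exp v) - 2 * tp 0 1 (exp v)) / tp 0 0 (exp v)

/-- The derivative of `ratioH`. -/
def ratioH' (v : ℝ) : ℝ := numM (exp v) / tp 0 0 (exp v) ^ 2

/-- The second derivative of `ratioH`. -/
def ratioH'' (v : ℝ) : ℝ :=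
  (numM' (exp v) * tp 0 0 (exp v) + 2 * numM (exp v) * tp 0 1 (exp v)) / tp 0 0 (exp v) ^ 3

/-- The function `(p₂ - p₁) / p₀` of the logarithmic variable. -/
def kap (v : ℝ) : ℝ := (tp 0 2 (exp v) - tp 0 1 (exp v)) / tp 0 0 (exp v)

theorem tp_exp_ne (v : ℝ) : tp 0 0 (exp v) ≠ 0 := (tp_zero_pos 0 (exp_pos v)).ne'

theorem hasDerivAt_ratioH (v : ℝ) : HasDerivAt ratioH (ratioH' v) v := by
  have h0 := hasDerivAt_tp 0 0 v
  have h1 := hasDerivAt_tp 0 1 v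
  have h2 := hasDerivAt_tp 0 2 v
  have hne := tp_exp_ne v
  refine ((h2.sub (h1.const_mul 2)).div h0 hne).congr_deriv ?_
  simp only [ratioH', numM, Pi.sub_apply]
  congr 1
  push_cast
  ring

theorem hasDerivAt_kap (v : ℝ) : HasDerivAt kap (numK (exp v) / tp 0 0 (exp v) ^ 2) v := by
  have h0 := hasDerivAt_tp 0 0 v
  have h1 := hasDerivAt_tp 0 1 v
  have h2 := hasDerivAt_tp 0 2 v
  have hne := tp_exp_ne v
  refine ((h2.sub h1).div h0 hne).congr_deriv ?_
  simp only [numK, Pi.sub_apply]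
  congr 1
  push_cast
  ring

theorem hasDerivAt_numM (v : ℝ) : HasDerivAt (fun v => numM (exp v)) (numM' (exp v)) v := by
  have h0 := hasDerivAt_tp 0 0 v
  have h1 := hasDerivAt_tp 0 1 v
  have h2 := hasDerivAt_tp 0 2 v
  have h3 := hasDerivAt_tp 0 3 v
  refine (((((h2.const_mul 4).sub h3).sub (h1.const_mul 2)).mul h0).add
    ((h2.sub (h1.const_mul 2)).mul h1)).congr_deriv ?_
  simp only [numM', Pi.sub_apply]
  push_cast
  ring

theorem hasDerivAt_numM' (v : ℝ) : HasDerivAt (fun v => numM' (exp v)) (numM'' (exp v)) v := by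
  have h0 := hasDerivAt_tp 0 0 v
  have h1 := hasDerivAt_tp 0 1 v
  have h2 := hasDerivAt_tp 0 2 v
  have h3 := hasDerivAt_tp 0 3 v
  have h4 := hasDerivAt_tp 0 4 v
  refine ((((((h4.sub (h3.const_mul 7)).add (h2.const_mul 10)).sub (h1.const_mul 2)).mul h0).add
    ((h2.sub (h1.const_mul 2)).mul (h1.sub h2)))).congr_deriv ?_
  simp only [numM'', Pi.sub_apply, Pi.add_apply]
  push_cast
  ring

theorem hasDerivAt_ratioH' (v : ℝ) : HasDerivAt ratioH' (ratioH'' v) v := by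
  have h0 := hasDerivAt_tp 0 0 v
  have hne := tp_exp_ne v
  refine ((hasDerivAt_numM v).div (h0.pow 2) (pow_ne_zero 2 hne)).congr_deriv ?_
  simp only [ratioH'', Pi.pow_apply]
  push_cast
  field_simp
  ring

theorem ratioH''_strictMonoOn :
    StrictMonoOn ratioH'' (Set.Icc (log (167 / 50)) (log (187 / 50))) := by
  have hd : ∀ v, HasDerivAt ratioH''
      (((numM'' (exp v) * tp 0 0 (exp v) + numM' (exp v) * tp 0 1 (exp v)
        + 2 * numM (exp v) * (tp 0 1 (exp v) - tp 0 2 (exp v))) * tp 0 0 (exp v)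
      + 3 * (numM' (exp v) * tp 0 0 (exp v) + 2 * numM (exp v) * tp 0 1 (exp v)) * tp 0 1 (exp v))
        / tp 0 0 (exp v) ^ 4) v := by
    intro v
    have h0 := hasDerivAt_tp 0 0 v
    have h1 := hasDerivAt_tp 0 1 v
    have hne := tp_exp_ne v
    refine ((((hasDerivAt_numM' v).mul h0).add (((hasDerivAt_numM v).const_mul 2).mul h1)).div
      (h0.pow 3) (pow_ne_zero 3 hne)).congr_deriv ?_
    simp only [Pi.pow_apply, Pi.add_apply, Pi.mul_apply]
    push_cast
    field_simp
    ring
  refine strictMonoOn_of_deriv_pos (convex_Icc _ _)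
    (fun v _ => (hd v).continuousAt.continuousWithinAt) fun v hv => ?_
  rw [interior_Icc] at hv
  rw [(hd v).deriv]
  refine div_pos (third_pos ?_ ?_) (pow_pos (tp_zero_pos 0 (exp_pos v)) 4)
  · rw [← log_le_iff_le_exp (by norm_num)]; exact hv.1.le
  · rw [← le_log_iff_exp_le (by norm_num)]; exact hv.2.le

/-- The functional equation of the theta series, differentiated twice. -/
theorem kap_eq (v : ℝ) : kap v = 1 / 4 + ratioH (2 * log π - v) := by
  set a := 2 * log π with ha
  have hea : ∀ v, exp (a - v) = π ^ 2 / exp v := fun v => by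
    rw [exp_sub, ha, two_mul, exp_add, exp_log pi_pos, sq]
  have hr : ∀ v, HasDerivAt (fun v => a - v) (-1) v := fun v => by
    simpa using (hasDerivAt_id v).const_sub a
  have hE : ∀ v, HasDerivAt (fun v => √π * exp (-v / 2)) (-(1 / 2) * (√π * exp (-v / 2))) v :=
    fun v => by
      refine ((((hasDerivAt_id v).neg.div_const 2).exp).const_mul (√π)).congr_deriv ?_
      simp only [id, Pi.neg_apply]
      ring
  have e0 : (fun v => tp 0 0 (exp v)) = fun v => √π * exp (-v / 2) * tp 0 0 (exp (a - v)) := by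
    funext v
    have := th_zero_eq_cs 0 (exp_pos v)
    rw [cs_zero, ← hea] at this
    simp only [tp, pow_zero, one_mul, this]
    congr 1
    rw [sqrt_div pi_pos.le, div_eq_mul_inv]
    congr 1
    rw [sqrt_eq_rpow, ← exp_mul, ← exp_neg]
    ring_nf
  have e1 : (fun v => tp 0 1 (exp v)) = fun v => √π * exp (-v / 2) *
      (1 / 2 * tp 0 0 (exp (a - v)) - tp 0 1 (exp (a - v))) := by
    funext v
    have h1 := hasDerivAt_tp 0 0 v
    rw [e0] at h1
    have h2 := (hE v).mul ((hasDerivAt_tp 0 0 (a - v)).comp v (hr v))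
    have := h1.unique h2
    simp only [Function.comp] at this
    push_cast at this
    linarith
  have e2 : tp 0 2 (exp v) - tp 0 1 (exp v) = √π * exp (-v / 2) *
      (1 / 4 * tp 0 0 (exp (a - v)) + (tp 0 2 (exp (a - v)) - 2 * tp 0 1 (exp (a - v)))) := by
    have h1 := hasDerivAt_tp 0 1 v
    rw [e1] at h1
    have h2 := (hE v).mul ((((hasDerivAt_tp 0 0 (a - v)).comp v (hr v)).const_mul (1 / 2)).sub
      ((hasDerivAt_tp 0 1 (a - v)).comp v (hr v)))
    have h3 := h1.unique h2
    simp only [Function.comp, Pi.sub_apply] at h3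
    have h4 := congrFun e1 v
    push_cast at h3
    linarith
  have hne := tp_exp_ne (a - v)
  have hC : √π * exp (-v / 2) ≠ 0 := by positivity
  rw [kap, ratioH, e2, congrFun e0 v]
  field_simp

theorem ratioH_eq_kap (v : ℝ) : ratioH v = kap (2 * log π - v) - 1 / 4 := by
  rw [kap_eq]; ring_nf

theorem ratioH'_eq (v : ℝ) :
    ratioH' v = -(numK (exp (2 * log π - v)) / tp 0 0 (exp (2 * log π - v)) ^ 2) := by
  have h1 := hasDerivAt_ratioH v
  have h2 := ((hasDerivAt_kap (2 * log π - v)).comp v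
    (((hasDerivAt_id v).const_sub (2 * log π)))).sub_const (1 / 4)
  have e : ratioH = fun v => (kap ∘ fun v => 2 * log π - id v) v - 1 / 4 :=
    funext ratioH_eq_kap
  rw [e] at h1
  rw [h1.unique h2]
  simp

end RatioFunction
end LatticePhase

/-! ### The shape of H: one maximum, and a rise steeper than the fall. -/

namespace LatticePhase

noncomputable section RatioShape

open Real

/-- A linear inequality between theta series follows from a polynomial inequality for each term,
since all exponents (i + 1)²X are at least X. -/
theorem hs_comb_nonneg {X a b c : ℝ} (hX : 0 < X)
    (h : ∀ w, X ≤ w → 0 ≤ a * w + b * w ^ 2 + c * w ^ 3) :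
    0 ≤ a * hs 1 1 X + b * hs 2 1 X + c * hs 3 1 X := by
  have s1 := (summable_hs 1 1 hX).mul_left a
  have s2 := (summable_hs 2 1 hX).mul_left b
  have s3 := (summable_hs 3 1 hX).mul_left c
  rw [hs, hs, hs, ← tsum_mul_left, ← tsum_mul_left, ← tsum_mul_left, ← s1.tsum_add s2,
    ← (s1.add s2).tsum_add s3]
  refine tsum_nonneg fun i => ?_
  have hw : X ≤ ((i : ℝ) + 1) ^ 2 * X := by
    have : (1 : ℝ) ≤ ((i : ℝ) + 1) ^ 2 := by
      have : (0 : ℝ) ≤ i := i.cast_nonneg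
      nlinarith
    nlinarith
  have := mul_nonneg (h _ hw) (exp_pos (-(((i : ℝ) + 1) ^ 2 * X))).le
  linarith

theorem tp_comb_nonneg {X a b c : ℝ} (hX : 0 < X)
    (h : ∀ w, X ≤ w → 0 ≤ a * w + b * w ^ 2 + c * w ^ 3) :
    0 ≤ a * tp 0 1 X + b * tp 0 2 X + c * tp 0 3 X := by
  rw [tp_zero_eq_hs 1 hX, tp_zero_eq_hs 2 hX, tp_zero_eq_hs 3 hX]
  have := hs_comb_nonneg hX h
  norm_num
  linarith

theorem tp_one_pos {X : ℝ} (hX : 0 < X) : 0 < tp 0 1 X := by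
  rw [tp_zero_eq_hs 1 hX, hs_eq_add 1 1 hX]
  have := hs_nonneg 1 (1 + 1) hX.le
  positivity

theorem one_le_tp_zero {X : ℝ} (hX : 0 < X) : 1 ≤ tp 0 0 X := by
  rw [tp_zero_eq_hs 0 hX]
  have := hs_nonneg 0 1 hX.le
  simp
  linarith

theorem tp_le {j : ℕ} {X X₀ : ℝ} (hj : j ≠ 0) (hj3 : j ≤ 3) (h3 : 3 ≤ X₀) (hX : X₀ ≤ X) :
    tp 0 j X ≤ 4 * (X₀ ^ j * exp (-X₀)) := by
  have hX' : 0 < X := by linarith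
  have h1 := exp_neg_lt_of_le (w := (2 * 1 + 1) * X) 9 1 1 1000 (by norm_num) (by norm_num)
    (by norm_num; linarith) (by decide +kernel)
  have h2 : ((1 + 1 : ℝ) / 1) ^ (2 * j) ≤ 64 := by
    calc ((1 + 1 : ℝ) / 1) ^ (2 * j) ≤ ((1 + 1 : ℝ) / 1) ^ (2 * 3) := by gcongr; norm_num
      _ = 64 := by norm_num
  have h4 := hs_le j (c := 1) (by norm_num) hX' (by
    calc ((1 + 1 : ℝ) / 1) ^ (2 * j) * exp (-((2 * 1 + 1) * X))
        ≤ 64 * ((1 : ℕ) / (1000 : ℕ)) := by gcongr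
      _ ≤ _ := by norm_num)
  have h5 := pow_mul_exp_neg_anti (k := j) (by linarith)
    (le_trans (by exact_mod_cast hj3) h3) hX
  rw [tp_zero_eq_hs j hX', zero_pow hj]
  simp only [one_pow, one_mul] at h4
  linarith

theorem tp_one_lt_one {X : ℝ} (hX : 7 / 2 ≤ X) : tp 0 1 X < 1 := by
  have h := tp_le one_ne_zero (by norm_num) (by norm_num) hX
  have := exp_neg_lt_of_le (w := 7 / 2) 35 10 4 100 (by norm_num) (by norm_num) (by norm_num)
    (by decide +kernel)
  norm_num at *
  linarith

/-- With p_j for `tp 0 j X`, `numM X` equals -(p₃ - 5p₂ + 4p₁)p₀ - (p₂ - 2p₁)(p₀ - p₁). Termwise w(w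
- 1)(w - 4) ≥ 0 and w(w - 3) ≥ 0, and p₁ < 1 ≤ p₀. -/
theorem numM_neg_of_four_le {X : ℝ} (hX : 4 ≤ X) : numM X < 0 := by
  have hX' : 0 < X := by linarith
  have h1 := tp_comb_nonneg (a := 4) (b := -5) (c := 1) hX' (fun w hw => by
    have : 0 ≤ w * (w - 1) * (w - 4) :=
      mul_nonneg (mul_nonneg (by linarith) (by linarith)) (by linarith)
    linarith)
  have h2 := tp_comb_nonneg (a := -3) (b := 1) (c := 0) hX' (fun w hw => by nlinarith)
  have h3 := tp_one_pos hX'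
  have h4 := tp_one_lt_one (X := X) (by linarith)
  have h5 := one_le_tp_zero hX'
  unfold numM
  have h6 : (tp 0 2 X - 2 * tp 0 1 X) * (tp 0 0 X - tp 0 1 X) > 0 :=
    mul_pos (by linarith) (by linarith)
  have h7 : 0 ≤ (4 * tp 0 1 X - 5 * tp 0 2 X + tp 0 3 X) * tp 0 0 X :=
    mul_nonneg (by linarith) (by linarith)
  linarith

theorem numK_neg {X : ℝ} (hX : 7 / 2 ≤ X) : numK X < 0 := by
  have hX' : 0 < X := by linarith
  have h1 := tp_comb_nonneg (a := 2) (b := -4) (c := 1) hX' (fun w hw => by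
    have h0 : 0 ≤ w := by linarith
    have : 0 ≤ w * (w ^ 2 - 4 * w + 2) := mul_nonneg h0 (by nlinarith)
    linarith)
  have h2 := tp_comb_nonneg (a := -2) (b := 1) (c := 0) hX' (fun w hw => by nlinarith)
  have h3 := tp_one_pos hX'
  have h4 := tp_one_lt_one hX
  have h5 := one_le_tp_zero hX'
  unfold numK
  have h6 : (tp 0 2 X - tp 0 1 X) * (tp 0 0 X - tp 0 1 X) > 0 :=
    mul_pos (by linarith) (by linarith)
  have h7 : 0 ≤ (2 * tp 0 1 X - 4 * tp 0 2 X + tp 0 3 X) * tp 0 0 X :=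
    mul_nonneg (by linarith) (by linarith)
  linarith

theorem ratioH_pos {v : ℝ} (hv : log 3 ≤ v) : 0 < ratioH v := by
  have hX : 3 ≤ exp v := by rwa [← log_le_iff_le_exp (by norm_num)]
  have h2 := tp_comb_nonneg (a := -3) (b := 1) (c := 0) (exp_pos v) (fun w hw => by nlinarith)
  have h3 := tp_one_pos (exp_pos v)
  exact div_pos (by linarith) (tp_zero_pos 0 (exp_pos v))

theorem exp_reflect (v : ℝ) : exp (2 * log π - v) = π ^ 2 / exp v := by
  rw [exp_sub, two_mul, exp_add, exp_log pi_pos, sq]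

theorem ratioH_neg {v : ℝ} (hv : 267 / 50 ≤ exp (2 * log π - v)) : ratioH v < 0 := by
  rw [ratioH_eq_kap, sub_neg, kap]
  set X := exp (2 * log π - v)
  have h5 := one_le_tp_zero (X := X) (by linarith)
  rw [div_lt_iff₀ (by linarith)]
  rcases le_total X 8 with h8 | h8
  · have := kappa_num_lt hv h8; linarith
  · have h := tp_le two_ne_zero (by norm_num) (by norm_num) h8
    have := exp_neg_lt_of_le (w := 8) 8 1 4 10000 (by norm_num) (by norm_num) (by norm_num)
      (by decide +kernel)
    have := tp_one_pos (X := X) (by linarith)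
    norm_num at *
    linarith

theorem ratioH_continuous : Continuous ratioH :=
  continuous_iff_continuousAt.2 fun v => (hasDerivAt_ratioH v).continuousAt

/-- `ratioH` increases up to a critical point and decreases afterwards. -/
theorem exists_ratioH_turning_point : ∃ a, log (351131894264 / 10 ^ 11) < a ∧
    a < log (351131894273 / 10 ^ 11) ∧ (∀ v < a, 0 < ratioH' v) ∧ ∀ v, a < v → ratioH' v < 0 := by
  have hanti : StrictAntiOn (fun v => numM (exp v)) (Set.Icc (log (14 / 5)) (log 4)) := by
    refine strictAntiOn_of_deriv_neg (convex_Icc _ _)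
      (fun v _ => (hasDerivAt_numM v).continuousAt.continuousWithinAt) fun v hv => ?_
    rw [interior_Icc] at hv
    rw [(hasDerivAt_numM v).deriv]
    exact numM'_neg ((log_le_iff_le_exp (by norm_num)).1 hv.1.le)
      ((le_log_iff_exp_le (by norm_num)).1 hv.2.le)
  have l1 : log (14 / 5) < log (351131894264 / 10 ^ 11) := log_lt_log (by norm_num) (by norm_num)
  have l2 : log (351131894264 / 10 ^ 11 : ℝ) < log (351131894273 / 10 ^ 11) :=
    log_lt_log (by norm_num) (by norm_num)
  have l3 : log (351131894273 / 10 ^ 11) < log 4 := log_lt_log (by norm_num) (by norm_num)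
  have hp : 0 < numM (exp (log (351131894264 / 10 ^ 11))) := by
    rw [exp_log (by norm_num)]; exact numM_pos_at
  have hn : numM (exp (log (351131894273 / 10 ^ 11))) < 0 := by
    rw [exp_log (by norm_num)]; exact numM_neg_at
  have hc : Continuous fun v => numM (exp v) :=
    continuous_iff_continuousAt.2 fun v => (hasDerivAt_numM v).continuousAt
  obtain ⟨a, ⟨ha0, ha1⟩, ha⟩ := intermediate_value_Icc' l2.le hc.continuousOn ⟨hn.le, hp.le⟩
  simp only at ha
  have ha0' : log (351131894264 / 10 ^ 11) < a :=
    lt_of_le_of_ne ha0 fun h => by rw [h, ha] at hp; exact lt_irrefl _ hp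
  have ha1' : a < log (351131894273 / 10 ^ 11) :=
    lt_of_le_of_ne ha1 fun h => by rw [← h, ha] at hn; exact lt_irrefl _ hn
  refine ⟨a, ha0', ha1', fun v hv => ?_, fun v hv => ?_⟩
  · rcases le_total (log (14 / 5)) v with h | h
    · have := hanti ⟨h, by linarith⟩ ⟨by linarith, by linarith⟩ hv
      simp only [ha] at this
      exact div_pos this (pow_pos (tp_zero_pos 0 (exp_pos v)) 2)
    -- For exponentials up to 14/5 the reflected argument is at least π²/(14/5) > 7/2, the range of
    -- `numK_neg`.
    · rw [ratioH'_eq, neg_pos]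
      refine div_neg_of_neg_of_pos (numK_neg ?_) (pow_pos (tp_zero_pos 0 (exp_pos _)) 2)
      rw [exp_reflect, le_div_iff₀ (exp_pos v)]
      have := (le_log_iff_exp_le (by norm_num)).1 h
      nlinarith [pi_gt_d6]
  · refine div_neg_of_neg_of_pos ?_ (pow_pos (tp_zero_pos 0 (exp_pos v)) 2)
    rcases le_total v (log 4) with h | h
    · have := hanti ⟨by linarith, by linarith⟩ ⟨by linarith, h⟩ hv
      simpa only [ha] using this
    · exact numM_neg_of_four_le ((log_le_iff_le_exp (by norm_num)).1 h)

theorem ratioH'_sq_lt {v : ℝ} (hv : 73 / 20 ≤ exp v) :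
    ratioH' v ^ 2 < 4.15 * (0.299288 - ratioH v) - 13 * (0.299288 - ratioH v) ^ 2 := by
  have hp := tp_zero_pos 0 (exp_pos v)
  rcases le_total (exp v) 10 with h | h
  · have := numM_sq_lt hv h
    rw [ratioH', ratioH, div_pow, div_lt_iff₀ (by positivity)]
    refine this.trans_eq ?_
    field_simp
  · have h1 := tp_le two_ne_zero (by norm_num) (by norm_num) h
    have h2 := tp_le three_ne_zero (by norm_num) (by norm_num) h
    have hE := exp_neg_lt_of_le (w := 10) 10 1 46 1000000 (by norm_num) (by norm_num) (by norm_num)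
      (by decide +kernel)
    have h3 := one_le_tp_zero (exp_pos v)
    have hX' := exp_pos v
    have h4 := tp_comb_nonneg (a := 4) (b := -5) (c := 1) hX' (fun w hw => by
      have : 0 ≤ w * (w - 1) * (w - 4) :=
        mul_nonneg (mul_nonneg (by linarith) (by linarith)) (by linarith)
      linarith)
    have h5 := tp_comb_nonneg (a := -3) (b := 1) (c := 0) hX' (fun w hw => by nlinarith)
    have h6 := tp_one_pos hX'
    have h7 := tp_one_lt_one (X := exp v) (by linarith)
    have hM := numM_neg_of_four_le (X := exp v) (by linarith)
    norm_num at h1 h2 hE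
    have hH0 : 0 < ratioH v := div_pos (by linarith) hp
    have hH1 : ratioH v ≤ 0.1 := by
      rw [ratioH, div_le_iff₀ hp]; linarith
    have hd : |ratioH' v| ≤ 0.2 := by
      rw [ratioH', abs_div, abs_of_neg hM, abs_of_pos (by positivity), div_le_iff₀ (by positivity)]
      have k1 : 0 ≤ (tp 0 2 (exp v) - 2 * tp 0 1 (exp v)) * tp 0 1 (exp v) :=
        mul_nonneg (by linarith) h6.le
      have k2 : (tp 0 3 (exp v) - 4 * tp 0 2 (exp v) + 2 * tp 0 1 (exp v)) * tp 0 0 (exp v)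
          ≤ 0.2 * tp 0 0 (exp v) := mul_le_mul_of_nonneg_right (by linarith) hp.le
      unfold numM
      nlinarith
    have hd2 : ratioH' v ^ 2 ≤ 0.04 := by
      rw [← sq_abs]; nlinarith [abs_nonneg (ratioH' v)]
    nlinarith

theorem lt_ratioH'_sq {v : ℝ} (h0 : 29531 / 10000 ≤ exp (2 * log π - v))
    (h1 : exp (2 * log π - v) ≤ 107 / 20) :
    4.15 * (0.299288 - ratioH v) - 13 * (0.299288 - ratioH v) ^ 2 < ratioH' v ^ 2 := by
  have hp := tp_zero_pos 0 (exp_pos (2 * log π - v))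
  have := lt_numK_sq h0 h1
  rw [ratioH'_eq, ratioH_eq_kap, kap, neg_sq, div_pow, lt_div_iff₀ (by positivity)]
  refine lt_of_eq_of_lt ?_ this
  field_simp
  ring

theorem ratioH_log_lt {X : ℝ} {x u a b : ℕ} (hX : X = x / u) (hu : 0 < u) (hb : 0 < b)
    (h0 : 14 / 5 ≤ X) (hc : checkBox u (tailList 1 (10 ^ 10)) thetaProg
      (.sub (.mul (.const a b) .p0) (.sub .p2 (.smul 2 .p1))) 2 x x u u = true) :
    ratioH (log X) < a / b := by
  rw [ratioH, exp_log (by linarith), div_lt_iff₀ (tp_zero_pos 0 (by linarith))]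
  exact ratio_num_lt hX hu hb h0 hc

theorem lt_ratioH_log {X : ℝ} {x u a b : ℕ} (hX : X = x / u) (hu : 0 < u) (hb : 0 < b)
    (h0 : 14 / 5 ≤ X) (hc : checkBox u (tailList 1 (10 ^ 10)) thetaProg
      (.sub (.sub .p2 (.smul 2 .p1)) (.mul (.const a b) .p0)) 2 x x u u = true) :
    a / b < ratioH (log X) := by
  rw [ratioH, exp_log (by linarith), lt_div_iff₀ (tp_zero_pos 0 (by linarith))]
  exact lt_ratio_num hX hu hb h0 hc

/-- The Hermite–Hadamard inequality for a derivative `f'` with increasing derivative. -/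
theorem sub_lt_trapezoid {f f' f'' : ℝ → ℝ} (hf : ∀ v, HasDerivAt f (f' v) v)
    (hf' : ∀ v, HasDerivAt f' (f'' v) v) {a b : ℝ} (hab : a < b)
    (hm : StrictMonoOn f'' (Set.Icc a b)) : f b - f a < (b - a) / 2 * (f' a + f' b) := by
  set c := (a + b) / 2 with hc
  set t := (b - a) / 2 with ht
  have ht0 : 0 < t := by rw [ht]; linarith
  let F := fun s => f (c + s) - f (c - s) - s * (f' (c + s) + f' (c - s))
  have hF : ∀ s, HasDerivAt F (-s * (f'' (c + s) - f'' (c - s))) s := by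
    intro s
    have i1 : HasDerivAt (fun s => c + s) 1 s := by simpa using (hasDerivAt_id s).const_add c
    have i2 : HasDerivAt (fun s => c - s) (-1) s := by simpa using (hasDerivAt_id s).const_sub c
    have := (((hf _).comp s i1).sub ((hf _).comp s i2)).sub
      ((hasDerivAt_id s).mul (((hf' _).comp s i1).add ((hf' _).comp s i2)))
    refine this.congr_deriv ?_
    simp only [Function.comp, id, Pi.add_apply]
    ring
  have hanti : StrictAntiOn F (Set.Icc 0 t) := by
    refine strictAntiOn_of_deriv_neg (convex_Icc _ _)
      (fun s _ => (hF s).continuousAt.continuousWithinAt) fun s hs => ?_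
    rw [interior_Icc] at hs
    rw [(hF s).deriv]
    have := hm (a := c - s) (b := c + s) ⟨by linarith [hs.2], by linarith [hs.1]⟩
      ⟨by linarith [hs.1], by linarith [hs.2]⟩ (by linarith [hs.1])
    nlinarith [hs.1]
  have := hanti ⟨le_rfl, ht0.le⟩ ⟨ht0.le, le_rfl⟩ ht0
  simp only [F, add_zero, sub_zero, zero_mul, sub_self] at this
  rw [show c + t = b by rw [hc, ht]; ring, show c - t = a by rw [hc, ht]; ring] at this
  linarith

/-- Near the maximum, `ratioH''` is increasing, so the trapezoidal rule for the derivative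
overestimates H(v₁) - H(v₂) = 0. Farther out, the comparator F of `numM_sq_lt` lies strictly between
the squared slopes at the common level. -/
theorem ratioH'_add_pos {a v₁ v₂ : ℝ} (ha0 : log (351131894264 / 10 ^ 11) < a)
    (ha1 : a < log (351131894273 / 10 ^ 11)) (hpos : ∀ v < a, 0 < ratioH' v)
    (hneg : ∀ v, a < v → ratioH' v < 0) (h2 : v₂ < a) (h1 : a < v₁)
    (he : ratioH v₁ = ratioH v₂) : 0 < ratioH' v₁ + ratioH' v₂ := by
  have hmono : StrictMonoOn ratioH (Set.Iic a) :=
    strictMonoOn_of_deriv_pos (convex_Iic _) ratioH_continuous.continuousOn fun v hv => by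
      rw [interior_Iic] at hv; rw [(hasDerivAt_ratioH v).deriv]; exact hpos v hv
  have hanti : StrictAntiOn ratioH (Set.Ici a) :=
    strictAntiOn_of_deriv_neg (convex_Ici _) ratioH_continuous.continuousOn fun v hv => by
      rw [interior_Ici] at hv; rw [(hasDerivAt_ratioH v).deriv]; exact hneg v hv
  have l1 : log (1671 / 500) < log (351131894264 / 10 ^ 11) :=
    log_lt_log (by norm_num) (by norm_num)
  have l2 : log (351131894273 / 10 ^ 11) < log (73 / 20) := log_lt_log (by norm_num) (by norm_num)
  have l3 : log (73 / 20) < log (187 / 50) := log_lt_log (by norm_num) (by norm_num)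
  have l4 : log (167 / 50) < log (1671 / 500) := log_lt_log (by norm_num) (by norm_num)
  have n1 := ratioH_log_lt (X := 1671 / 500) (x := 1671) (u := 500) (a := 297) (b := 1000)
    (by norm_num) (by norm_num) (by norm_num) (by norm_num) (by decide +kernel)
  have n2 := lt_ratioH_log (X := 73 / 20) (x := 73) (u := 20) (a := 297) (b := 1000)
    (by norm_num) (by norm_num) (by norm_num) (by norm_num) (by decide +kernel)
  have n3 := lt_ratioH_log (X := 1671 / 500) (x := 1671) (u := 500) (a := 296) (b := 1000)
    (by norm_num) (by norm_num) (by norm_num) (by norm_num) (by decide +kernel)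
  have n4 := ratioH_log_lt (X := 187 / 50) (x := 187) (u := 50) (a := 296) (b := 1000)
    (by norm_num) (by norm_num) (by norm_num) (by norm_num) (by decide +kernel)
  -- The certified levels 0.296 and 0.297 locate the partner point: v₂ ≥ log(1671/500) forces v₁ <
  -- log(187/50), and v₂ < log(1671/500) forces v₁ ≥ log(73/20). Each range lies within one of the
  -- two methods.
  rcases le_or_gt (log (1671 / 500)) v₂ with hc | hc
  · have hv1 : v₁ < log (187 / 50) := by
      by_contra! h
      have k1 := hanti.antitoneOn (a := log (187 / 50)) (Set.mem_Ici.2 (by linarith))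
        (Set.mem_Ici.2 h1.le) h
      have k2 := hmono.monotoneOn (Set.mem_Iic.2 (by linarith)) (Set.mem_Iic.2 h2.le) hc
      linarith
    have := sub_lt_trapezoid hasDerivAt_ratioH hasDerivAt_ratioH' (h2.trans h1)
      (ratioH''_strictMonoOn.mono (Set.Icc_subset_Icc (by linarith) hv1.le))
    rw [he, sub_self] at this
    have := pos_of_mul_pos_right this (by linarith)
    linarith
  · have hv1 : log (73 / 20) ≤ v₁ := by
      by_contra! h
      have k1 := hanti (a := v₁) (b := log (73 / 20)) h1.le (Set.mem_Ici.2 (by linarith)) h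
      have k2 := hmono (Set.mem_Iic.2 h2.le) (Set.mem_Iic.2 (by linarith)) hc
      linarith
    have q1 := ratioH'_sq_lt ((log_le_iff_le_exp (by norm_num)).1 hv1)
    have hH : 0 < ratioH v₂ := by
      rw [← he]
      exact ratioH_pos ((log_le_log (by norm_num) (by norm_num : (3 : ℝ) ≤ 73 / 20)).trans hv1)
    have q2 := lt_ratioH'_sq (v := v₂) (by
      rw [exp_reflect, le_div_iff₀ (exp_pos _)]
      have := (lt_log_iff_exp_lt (by norm_num)).1 hc
      nlinarith [pi_gt_d6]) (by
      by_contra! h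
      exact absurd (ratioH_neg (v := v₂) (by linarith)) (not_lt.2 hH.le))
    rw [he] at q1
    have q3 := hpos v₂ h2
    have := abs_lt_of_sq_lt_sq (q1.trans q2) q3.le
    linarith [(abs_lt.1 this).1]

end RatioShape
end LatticePhase

/-! ### Rectangular lattices and the first transition. -/

namespace LatticePhase

noncomputable section RectangularLine

open Real Filter Topology

/-- A function all of whose zeros are up-crossings stays positive once it is nonnegative. -/
theorem pos_of_upcrossing {D D' : ℝ → ℝ} (hD : ∀ u, HasDerivAt D (D' u) u)
    (hz : ∀ u, 0 < u → D u = 0 → 0 < D' u) {s t : ℝ} (hs : 0 < s) (hst : s < t) (h0 : 0 ≤ D s) :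
    0 < D t := by
  have hcont : Continuous D := continuous_iff_continuousAt.2 fun u => (hD u).continuousAt
  by_contra! hle
  obtain ⟨r, hr, hrt, hDr⟩ : ∃ r, s ≤ r ∧ r < t ∧ 0 < D r := by
    rcases h0.eq_or_lt with h | h
    · have h1 := hz s hs h.symm
      have h2 := (hasDerivAt_iff_tendsto_slope.1 (hD s)).eventually (lt_mem_nhds h1)
      have h3 : ∀ᶠ x in 𝓝[>] s, 0 < slope D s x :=
        h2.filter_mono (nhdsWithin_mono _ fun x hx => ne_of_gt hx)
      obtain ⟨r, hr1, hr2⟩ := (h3.and (Ioo_mem_nhdsGT hst)).exists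
      refine ⟨r, hr2.1.le, hr2.2, ?_⟩
      rw [slope_def_field, ← h, sub_zero] at hr1
      exact (div_pos_iff_of_pos_right (sub_pos.2 hr2.1)).1 hr1
    · exact ⟨s, le_rfl, hst, h⟩
  have hK : IsCompact (Set.Icc r t ∩ {u | D u ≤ 0}) :=
    isCompact_Icc.inter_right (isClosed_le hcont continuous_const)
  obtain ⟨q, ⟨⟨hq1, hq2⟩, hq3⟩, hq⟩ := hK.exists_isLeast ⟨t, ⟨hrt.le, le_rfl⟩, hle⟩
  simp only [Set.mem_ofPred_eq] at hq3
  have hrq : r < q := lt_of_le_of_ne hq1 fun h => by rw [h] at hDr; linarith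
  have hpos : ∀ u, r ≤ u → u < q → 0 < D u := fun u hu hu' => by
    by_contra! h
    exact absurd (hq ⟨⟨hu, by linarith⟩, h⟩) (not_le.2 hu')
  have hq0 : D q = 0 := by
    refine le_antisymm hq3 ?_
    have : Tendsto D (𝓝[<] q) (𝓝 (D q)) := hcont.continuousAt.tendsto.mono_left inf_le_left
    refine ge_of_tendsto this ?_
    filter_upwards [Ioo_mem_nhdsLT hrq] with u hu using (hpos u hu.1.le hu.2).le
  have h1 := hz q (by linarith) hq0
  have h2 := (hasDerivAt_iff_tendsto_slope.1 (hD q)).eventually (lt_mem_nhds h1)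
  have h3 : ∀ᶠ x in 𝓝[<] q, 0 < slope D q x :=
    h2.filter_mono (nhdsWithin_mono _ fun x hx => ne_of_lt hx)
  obtain ⟨w, hw1, hw2⟩ := (h3.and (Ioo_mem_nhdsLT hrq)).exists
  rw [slope_def_field, hq0, sub_zero] at hw1
  have h5 := hpos w hw2.1.le hw2.2
  have : D w / (w - q) < 0 := div_neg_of_pos_of_neg h5 (sub_neg.2 hw2.2)
  linarith

/-- The difference that governs the sign of the derivative along rectangular lattices. -/
def ratioDiff (b u : ℝ) : ℝ := ratioH (b + u) - ratioH (b - u)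

theorem hasDerivAt_ratioDiff (b u : ℝ) :
    HasDerivAt (ratioDiff b) (ratioH' (b + u) + ratioH' (b - u)) u := by
  have i1 : HasDerivAt (fun s => b + s) 1 u := by simpa using (hasDerivAt_id u).const_add b
  have i2 : HasDerivAt (fun s => b - s) (-1) u := by simpa using (hasDerivAt_id u).const_sub b
  refine (((hasDerivAt_ratioH _).comp u i1).sub ((hasDerivAt_ratioH _).comp u i2)).congr_deriv ?_
  ring

/-- The sign of `ratioDiff`. -/
theorem exists_ratioDiff_sign : ∃ a, log (351131894264 / 10 ^ 11) < a ∧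
    a < log (351131894273 / 10 ^ 11) ∧ (∀ b ≤ a, ∀ u, 0 < u → 0 < ratioDiff b u) ∧
    ∀ b, a < b → ∃ u₀, 0 < u₀ ∧ (∀ u, 0 < u → u < u₀ → ratioDiff b u < 0) ∧
      ∀ u, u₀ < u → 0 < ratioDiff b u := by
  obtain ⟨a, ha0, ha1, hpos, hneg⟩ := exists_ratioH_turning_point
  have hmono : StrictMonoOn ratioH (Set.Iic a) :=
    strictMonoOn_of_deriv_pos (convex_Iic _) ratioH_continuous.continuousOn fun v hv => by
      rw [interior_Iic] at hv; rw [(hasDerivAt_ratioH v).deriv]; exact hpos v hv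
  have hanti : StrictAntiOn ratioH (Set.Ici a) :=
    strictAntiOn_of_deriv_neg (convex_Ici _) ratioH_continuous.continuousOn fun v hv => by
      rw [interior_Ici] at hv; rw [(hasDerivAt_ratioH v).deriv]; exact hneg v hv
  -- Equal levels at b - u < b + u force the two points onto different branches of H, so every zero
  -- with u > 0 is an up-crossing.
  have hup : ∀ b u, 0 < u → ratioDiff b u = 0 → 0 < ratioH' (b + u) + ratioH' (b - u) := by
    intro b u hu h0
    have he : ratioH (b + u) = ratioH (b - u) := sub_eq_zero.1 h0
    have h1 : a < b + u := by
      by_contra! h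
      exact absurd he (hmono (Set.mem_Iic.2 (by linarith)) (Set.mem_Iic.2 h)
        (by linarith : b - u < b + u)).ne'
    have h2 : b - u < a := by
      by_contra! h
      exact absurd he (hanti (Set.mem_Ici.2 h) (Set.mem_Ici.2 (by linarith))
        (by linarith : b - u < b + u)).ne
    exact ratioH'_add_pos ha0 ha1 hpos hneg h2 h1 he
  have hcross : ∀ b s t, 0 < s → s < t → 0 ≤ ratioDiff b s → 0 < ratioDiff b t :=
    fun b s t hs hst h => pos_of_upcrossing (hasDerivAt_ratioDiff b) (hup b) hs hst h
  have hzero : ∀ b, ratioDiff b 0 = 0 := fun b => by simp [ratioDiff]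
  have hlt : ∀ b < a, ∀ u, 0 < u → 0 < ratioDiff b u := by
    intro b hb u hu
    have h1 : 0 < ratioH' (b + 0) + ratioH' (b - 0) := by
      have := hpos b hb
      simp only [add_zero, sub_zero]; linarith
    have h2 := (hasDerivAt_iff_tendsto_slope.1 (hasDerivAt_ratioDiff b 0)).eventually
      (lt_mem_nhds h1)
    have h3 : ∀ᶠ x in 𝓝[>] (0 : ℝ), 0 < slope (ratioDiff b) 0 x :=
      h2.filter_mono (nhdsWithin_mono _ fun x hx => ne_of_gt hx)
    obtain ⟨r, hr1, hr2⟩ := (h3.and (Ioo_mem_nhdsGT hu)).exists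
    rw [slope_def_field, hzero, sub_zero, sub_zero] at hr1
    exact hcross b r u hr2.1 hr2.2 ((div_pos_iff_of_pos_right hr2.1).1 hr1).le
  refine ⟨a, ha0, ha1, fun b hb u hu => ?_, fun b hb => ?_⟩
  -- At the critical b = a the derivative at u = 0 vanishes and gives no start. Nonnegativity comes
  -- from the limit b ↑ a and becomes strict by crossing from u/2 to u.
  · rcases hb.lt_or_eq with hb | rfl
    · exact hlt b hb u hu
    · have hge : ∀ s, 0 < s → 0 ≤ ratioDiff b s := by
        intro s hs
        have hc : Continuous fun c => ratioDiff c s := by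
          unfold ratioDiff
          exact (ratioH_continuous.comp (by fun_prop)).sub (ratioH_continuous.comp (by fun_prop))
        have : Tendsto (fun c => ratioDiff c s) (𝓝[<] b) (𝓝 (ratioDiff b s)) :=
          hc.continuousAt.tendsto.mono_left inf_le_left
        refine ge_of_tendsto this ?_
        filter_upwards [self_mem_nhdsWithin] with c hc using (hlt c hc s hs).le
      exact hcross b (u / 2) u (by linarith) (by linarith) (hge _ (by linarith))
  · have h1 : ratioH' (b + 0) + ratioH' (b - 0) < 0 := by
      have := hneg b hb
      simp only [add_zero, sub_zero]; linarith
    have h2 := (hasDerivAt_iff_tendsto_slope.1 (hasDerivAt_ratioDiff b 0)).eventually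
      (gt_mem_nhds h1)
    have h3 : ∀ᶠ x in 𝓝[>] (0 : ℝ), slope (ratioDiff b) 0 x < 0 :=
      h2.filter_mono (nhdsWithin_mono _ fun x hx => ne_of_gt hx)
    obtain ⟨r, hr1, hr2⟩ := (h3.and self_mem_nhdsWithin).exists
    have hr2' : 0 < r := hr2
    rw [slope_def_field, hzero, sub_zero, sub_zero] at hr1
    have hr3 : ratioDiff b r < 0 := by
      by_contra! h
      exact absurd (div_nonneg h hr2'.le) (not_le.2 hr1)
    -- Large enough that H(b + t) > 0 by `ratioH_pos` and H(b - t) < 0 by `ratioH_neg`.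
    set t := |b| + r + log 3 + log (267 / 50) + 2 * log π
    have l3 : 0 < log (3 : ℝ) := log_pos (by norm_num)
    have l5 : 0 < log (267 / 50 : ℝ) := log_pos (by norm_num)
    have lp : 0 < log π := log_pos (by linarith [pi_gt_three])
    have ht : 0 < ratioDiff b t := by
      have k1 := ratioH_pos (v := b + t) (by simp only [t]; linarith [neg_abs_le b])
      have k2 := ratioH_neg (v := b - t) (by
        rw [← log_le_iff_le_exp (by norm_num)]
        simp only [t]; linarith [le_abs_self b])
      unfold ratioDiff; linarith
    have hrt : r < t := by simp only [t]; linarith [abs_nonneg b]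
    have hcont : Continuous (ratioDiff b) :=
      continuous_iff_continuousAt.2 fun u => (hasDerivAt_ratioDiff b u).continuousAt
    obtain ⟨q, ⟨hq0, hq1⟩, hq⟩ := intermediate_value_Icc hrt.le hcont.continuousOn ⟨hr3.le, ht.le⟩
    refine ⟨q, by linarith, fun u hu huq => ?_, fun u hu => hcross b q u (by linarith) hu hq.ge⟩
    by_contra! h
    exact absurd hq (hcross b u q hu huq h).ne'

theorem En_zero_eq {A y : ℝ} (hA : 0 < A) (hy : 0 < y) :
    En A 0 y = (tp 0 1 (A * y) * tp 0 0 (A / y) + tp 0 0 (A * y) * tp 0 1 (A / y)) / A := by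
  have hS : 0 < A * y := by positivity
  have hB : 0 < A / y := by positivity
  have nn : ∀ j X, (0 : ℤ → ℝ) ≤ fun n : ℤ => ((n : ℝ) ^ 2) ^ j * exp (-X * (n : ℝ) ^ 2) :=
    fun j X n => by dsimp; positivity
  have pr : ∀ i j, HasSum (fun p : ℤ × ℤ => (((p.1 : ℝ) ^ 2) ^ i * exp (-(A * y) * (p.1 : ℝ) ^ 2))
      * (((p.2 : ℝ) ^ 2) ^ j * exp (-(A / y) * (p.2 : ℝ) ^ 2)))
      (th i 0 (A * y) * th j 0 (A / y)) := by
    intro i j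
    have s := (summable_sq i hS).mul_of_nonneg (summable_sq j hB) (nn i _) (nn j _)
    have := (summable_sq i hS).hasSum.mul (summable_sq j hB).hasSum s
    simpa [th] using this
  have h := ((pr 1 0).mul_left y).add ((pr 0 1).mul_left (1 / y))
  have e : En A 0 y = y * (th 1 0 (A * y) * th 0 0 (A / y))
      + 1 / y * (th 0 0 (A * y) * th 1 0 (A / y)) := by
    rw [← h.tsum_eq, En]
    refine tsum_congr fun p => ?_
    have : exp (-A * rad 0 y p) = exp (-(A * y) * (p.1 : ℝ) ^ 2) * exp (-(A / y) * (p.2 : ℝ) ^ 2) := by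
      rw [← exp_add]; congr 1; unfold rad; field_simp; ring
    rw [this]
    unfold rad
    field_simp
    ring
  rw [e]
  simp only [tp]
  field_simp

theorem En_zero_inv {A y : ℝ} (hA : 0 < A) (hy : 0 < y) : En A 0 y⁻¹ = En A 0 y := by
  rw [En_zero_eq hA hy, En_zero_eq hA (inv_pos.2 hy), div_inv_eq_mul, ← div_eq_mul_inv]
  ring

/-- The products of two first-order series cancel in the derivative, leaving p₀p₀ times kap(a - u) -
kap(a + u); the reflection formula rewrites this through `ratioH`. -/
theorem hasDerivAt_En_zero (a u : ℝ) : ∃ C, 0 < C ∧ HasDerivAt (fun u => En (exp a) 0 (exp u))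
    (C * ratioDiff (2 * log π - a) u) u := by
  have e : (fun u => En (exp a) 0 (exp u)) = fun u =>
      (tp 0 1 (exp (a + u)) * tp 0 0 (exp (a - u)) + tp 0 0 (exp (a + u)) * tp 0 1 (exp (a - u)))
        / exp a := by
    funext u
    rw [En_zero_eq (exp_pos a) (exp_pos u), exp_add, exp_sub]
  have i1 : HasDerivAt (fun s => a + s) 1 u := by simpa using (hasDerivAt_id u).const_add a
  have i2 : HasDerivAt (fun s => a - s) (-1) u := by simpa using (hasDerivAt_id u).const_sub a
  have h := fun j => (hasDerivAt_tp 0 j (a + u)).comp u i1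
  have k := fun j => (hasDerivAt_tp 0 j (a - u)).comp u i2
  refine ⟨tp 0 0 (exp (a + u)) * tp 0 0 (exp (a - u)) / exp a,
    div_pos (mul_pos (tp_zero_pos 0 (exp_pos _)) (tp_zero_pos 0 (exp_pos _))) (exp_pos a), ?_⟩
  rw [e]
  refine ((((h 1).mul (k 0)).add ((h 0).mul (k 1))).div_const (exp a)).congr_deriv ?_
  have h1 := kap_eq (a + u)
  have h2 := kap_eq (a - u)
  have e1 : 2 * log π - a + u = 2 * log π - (a - u) := by ring
  have e2 : 2 * log π - a - u = 2 * log π - (a + u) := by ring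
  have hd : ratioDiff (2 * log π - a) u = kap (a - u) - kap (a + u) := by
    rw [ratioDiff, e1, e2, h1, h2]; ring
  rw [hd, kap, kap]
  have n1 := tp_exp_ne (a + u)
  have n2 := tp_exp_ne (a - u)
  simp only [Function.comp]
  push_cast
  field_simp
  ring

/-- The behaviour of the energy along the rectangular lattices. -/
theorem exists_rectangular_transition : ∃ αa : ℝ, |αa - 0.8947044415| < 1 / 10 ^ 10 ∧
    (∀ α, αa ≤ α → StrictMonoOn (En (π * α) 0) (Set.Ici 1)) ∧
    ∀ α, 0 < α → α < αa → ∃ y₀, 1 < y₀ ∧ ∀ y, 1 ≤ y → y ≠ y₀ →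
      En (π * α) 0 y₀ < En (π * α) 0 y := by
  obtain ⟨a, ha0, ha1, hle, hgt⟩ := exists_ratioDiff_sign
  have hpi := pi_pos
  have hX0 : 351131894264 / 10 ^ 11 < exp a := (log_lt_iff_lt_exp (by norm_num)).1 ha0
  have hX1 : exp a < 351131894273 / 10 ^ 11 := (lt_log_iff_exp_lt (by norm_num)).1 ha1
  have hmap : ∀ y, 0 < y → exp (log y) = y := fun y hy => exp_log hy
  have hb : ∀ α, 0 < α → 2 * log π - log (π * α) = log (π / α) := fun α hα => by
    rw [log_mul hpi.ne' hα.ne', log_div hpi.ne' hα.ne']; ring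
  have hA : ∀ α, 0 < α → exp (log (π * α)) = π * α := fun α hα => exp_log (by positivity)
  have hcont : ∀ α, 0 < α → Continuous fun u => En (π * α) 0 (exp u) := fun α hα =>
    continuous_iff_continuousAt.2 fun u => by
      obtain ⟨C, _, h⟩ := hasDerivAt_En_zero (log (π * α)) u
      rw [hA α hα] at h
      exact h.continuousAt
  -- With A = πα the base point is b = log(π/α), which meets the turning point a exactly at α =
  -- π/e^a.
  refine ⟨π / exp a, ?_, fun α hα => ?_, fun α hα0 hα => ?_⟩
  · rw [abs_lt]
    have h1 := pi_gt_d20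
    have h2 := pi_lt_d20
    constructor
    · rw [lt_sub_iff_add_lt, lt_div_iff₀ (exp_pos a)]
      norm_num at *
      linarith
    · rw [sub_lt_iff_lt_add, div_lt_iff₀ (exp_pos a)]
      norm_num at *
      linarith
  · have hα0 : 0 < α := (div_pos hpi (exp_pos a)).trans_le hα
    have hba : log (π / α) ≤ a := by
      rw [log_le_iff_le_exp (by positivity), div_le_iff₀ hα0]
      rwa [div_le_iff₀ (exp_pos a), mul_comm] at hα
    have hm : StrictMonoOn (fun u => En (π * α) 0 (exp u)) (Set.Ici 0) := by
      refine strictMonoOn_of_deriv_pos (convex_Ici _) (hcont α hα0).continuousOn fun u hu => ?_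
      rw [interior_Ici] at hu
      obtain ⟨C, hC, h⟩ := hasDerivAt_En_zero (log (π * α)) u
      rw [hA α hα0, hb α hα0] at h
      rw [h.deriv]
      exact mul_pos hC (hle _ hba u hu)
    intro y hy z hz hyz
    have hy' : 0 < y := zero_lt_one.trans_le hy
    have hz' : 0 < z := zero_lt_one.trans_le hz
    have := hm (Set.mem_Ici.2 (log_nonneg hy)) (Set.mem_Ici.2 (log_nonneg hz)) (log_lt_log hy' hyz)
    simpa only [hmap y hy', hmap z hz'] using this
  · have hba : a < log (π / α) := by
      rw [lt_log_iff_exp_lt (by positivity), lt_div_iff₀ hα0]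
      rwa [lt_div_iff₀ (exp_pos a), mul_comm] at hα
    obtain ⟨u₀, hu0, hn, hp⟩ := hgt _ hba
    have hm1 : StrictAntiOn (fun u => En (π * α) 0 (exp u)) (Set.Icc 0 u₀) := by
      refine strictAntiOn_of_deriv_neg (convex_Icc _ _) (hcont α hα0).continuousOn fun u hu => ?_
      rw [interior_Icc] at hu
      obtain ⟨C, hC, h⟩ := hasDerivAt_En_zero (log (π * α)) u
      rw [hA α hα0, hb α hα0] at h
      rw [h.deriv]
      exact mul_neg_of_pos_of_neg hC (hn u hu.1 hu.2)
    have hm2 : StrictMonoOn (fun u => En (π * α) 0 (exp u)) (Set.Ici u₀) := by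
      refine strictMonoOn_of_deriv_pos (convex_Ici _) (hcont α hα0).continuousOn fun u hu => ?_
      rw [interior_Ici] at hu
      obtain ⟨C, hC, h⟩ := hasDerivAt_En_zero (log (π * α)) u
      rw [hA α hα0, hb α hα0] at h
      rw [h.deriv]
      exact mul_pos hC (hp u hu)
    refine ⟨exp u₀, one_lt_exp_iff.2 hu0, fun y hy hne => ?_⟩
    have hy' : 0 < y := zero_lt_one.trans_le hy
    have hly := log_nonneg hy
    rcases lt_trichotomy (log y) u₀ with h | h | h
    · have := hm1 ⟨hly, h.le⟩ ⟨hu0.le, le_rfl⟩ h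
      simpa only [hmap y hy'] using this
    · exact absurd (by rw [← h, hmap y hy']) hne
    · have := hm2 (Set.mem_Ici.2 le_rfl) (Set.mem_Ici.2 h.le) h
      simpa only [hmap y hy'] using this

end RectangularLine
end LatticePhase

/-! ### Rhombic lattices: the line x = 1/2. -/

namespace LatticePhase

noncomputable section RhombicLine

open Real Filter Topology

theorem hasSum_of_eq {ι : Type*} {f g : ι → ℝ} {a : ℝ} (h : HasSum g a) (e : ∀ i, f i = g i) :
    HasSum f a := by
  rwa [funext e]

/-- After this change of indices n + m/2 is an integer for even m and a half-integer for odd m. A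
rhombic lattice becomes a rectangular lattice and its translate by half a diagonal, and the sums
factorise. -/
theorem hasSum_int_prod_parity {f : ℤ × ℤ → ℝ} {a b : ℝ}
    (ha : HasSum (fun p : ℤ × ℤ => f (2 * p.1, p.2 - p.1)) a)
    (hb : HasSum (fun p : ℤ × ℤ => f (2 * p.1 + 1, p.2 - p.1)) b) : HasSum f (a + b) := by
  have i1 : Function.Injective fun p : ℤ × ℤ => (2 * p.1, p.2 - p.1) := by
    rintro ⟨l, k⟩ ⟨l', k'⟩ h
    simp only [Prod.mk.injEq] at h ⊢
    omega
  have i2 : Function.Injective fun p : ℤ × ℤ => (2 * p.1 + 1, p.2 - p.1) := by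
    rintro ⟨l, k⟩ ⟨l', k'⟩ h
    simp only [Prod.mk.injEq] at h ⊢
    omega
  refine (i1.hasSum_range_iff.2 ha).add_isCompl ?_ (i2.hasSum_range_iff.2 hb)
  rw [isCompl_iff, Set.disjoint_iff_forall_ne, codisjoint_iff]
  constructor
  · rintro _ ⟨⟨l, k⟩, rfl⟩ _ ⟨⟨l', k'⟩, rfl⟩ h
    simp only [Prod.mk.injEq] at h
    omega
  · ext ⟨m, n⟩
    simp only [Set.sup_eq_union, Set.mem_union, Set.mem_range, Prod.mk.injEq, Prod.exists,
      Set.top_eq_univ, Set.mem_univ, iff_true]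
    rcases Int.even_or_odd' m with ⟨l, rfl | rfl⟩
    · exact .inl ⟨l, n + l, rfl, by ring⟩
    · exact .inr ⟨l, n + l, rfl, by ring⟩

theorem hasSum_tp (ξ : ℝ) (j : ℕ) {X : ℝ} (hX : 0 < X) :
    HasSum (fun n : ℤ => (X * (n + ξ) ^ 2) ^ j * exp (-(X * (n + ξ) ^ 2))) (tp ξ j X) := by
  refine hasSum_of_eq ((summable_th j ξ hX).hasSum.mul_left (X ^ j)) fun n => ?_
  rw [mul_pow, neg_mul]; ring

theorem hasSum_mul_of_nonneg {f g : ℤ → ℝ} {a b : ℝ} (hf : HasSum f a) (hg : HasSum g b)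
    (hf0 : ∀ n, 0 ≤ f n) (hg0 : ∀ n, 0 ≤ g n) : HasSum (fun p : ℤ × ℤ => f p.1 * g p.2) (a * b) :=
  hf.mul hg (hf.summable.mul_of_nonneg hg.summable hf0 hg0)

theorem hasSum_tp_mul (ξ : ℝ) (i j : ℕ) {S B : ℝ} (hS : 0 < S) (hB : 0 < B) :
    HasSum (fun p : ℤ × ℤ => ((S * (p.1 + ξ) ^ 2) ^ i * exp (-(S * (p.1 + ξ) ^ 2)))
      * ((B * (p.2 + ξ) ^ 2) ^ j * exp (-(B * (p.2 + ξ) ^ 2)))) (tp ξ i S * tp ξ j B) := by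
  have h := hasSum_mul_of_nonneg (hasSum_tp ξ i hS) (hasSum_tp ξ j hB) (fun n => by positivity)
    (fun n => by positivity)
  exact h

/-- The two parts of the squared lengths on the line `x = 1 / 2`. -/
def radS (A y : ℝ) (p : ℤ × ℤ) : ℝ := A * y * (p.1 : ℝ) ^ 2
def radB (A y : ℝ) (p : ℤ × ℤ) : ℝ := A / y * (p.2 + p.1 / 2 : ℝ) ^ 2

/-- The mixed sum of scaled theta series on the line `x = 1 / 2`. -/
def mixed (i j : ℕ) (S B : ℝ) : ℝ := tp 0 i S * tp 0 j B + tp (1 / 2) i S * tp (1 / 2) j B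

theorem hasSum_mixed (i j : ℕ) {A y : ℝ} (hA : 0 < A) (hy : 0 < y) :
    HasSum (fun p => radS A y p ^ i * radB A y p ^ j * exp (-(radS A y p + radB A y p)))
      (mixed i j (4 * (A * y)) (A / y)) := by
  have hS : 0 < 4 * (A * y) := by positivity
  have hB : 0 < A / y := by positivity
  refine hasSum_int_prod_parity (hasSum_of_eq (hasSum_tp_mul 0 i j hS hB) fun p => ?_)
    (hasSum_of_eq (hasSum_tp_mul (1 / 2) i j hS hB) fun p => ?_)
  · rw [neg_add, exp_add]
    have e1 : radS A y (2 * p.1, p.2 - p.1) = 4 * (A * y) * (p.1 + 0) ^ 2 := by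
      unfold radS; push_cast; ring
    have e2 : radB A y (2 * p.1, p.2 - p.1) = A / y * (p.2 + 0) ^ 2 := by
      unfold radB; push_cast; ring
    rw [e1, e2]; ring
  · rw [neg_add, exp_add]
    have e1 : radS A y (2 * p.1 + 1, p.2 - p.1) = 4 * (A * y) * (p.1 + 1 / 2) ^ 2 := by
      unfold radS; push_cast; ring
    have e2 : radB A y (2 * p.1 + 1, p.2 - p.1) = A / y * (p.2 + 1 / 2) ^ 2 := by
      unfold radB; push_cast; ring
    rw [e1, e2]; ring

theorem radS_add_radB (A : ℝ) {y : ℝ} (hy : y ≠ 0) (p : ℤ × ℤ) :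
    radS A y p + radB A y p = A * rad (1 / 2) y p := by
  unfold radS radB rad; field_simp; ring

theorem En_half_eq {A y : ℝ} (hA : 0 < A) (hy : 0 < y) :
    En A (1 / 2) y = (mixed 1 0 (4 * (A * y)) (A / y) + mixed 0 1 (4 * (A * y)) (A / y)) / A := by
  have h := ((hasSum_mixed 1 0 hA hy).add (hasSum_mixed 0 1 hA hy)).div_const A
  rw [← h.tsum_eq, En]
  refine tsum_congr fun p => ?_
  have e := radS_add_radB A hy.ne' p
  rw [e, eq_div_iff hA.ne', neg_mul]
  rw [show rad (1 / 2) y p * exp (-(A * rad (1 / 2) y p)) * A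
    = (A * rad (1 / 2) y p) * exp (-(A * rad (1 / 2) y p)) by ring, ← e]
  ring

/-- `A` times the logarithmic derivative in `y` of the energy on the line `x = 1 / 2`. -/
def halfQ (A y : ℝ) : ℝ :=
  (mixed 0 2 (4 * (A * y)) (A / y) - mixed 0 1 (4 * (A * y)) (A / y))
    - (mixed 2 0 (4 * (A * y)) (A / y) - mixed 1 0 (4 * (A * y)) (A / y))

/-- The logarithmic derivative of `halfQ`. -/
def halfQ' (A y : ℝ) : ℝ :=
  mixed 0 3 (4 * (A * y)) (A / y) - 3 * mixed 0 2 (4 * (A * y)) (A / y)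
    + mixed 0 1 (4 * (A * y)) (A / y) + mixed 3 0 (4 * (A * y)) (A / y)
    - 3 * mixed 2 0 (4 * (A * y)) (A / y) + mixed 1 0 (4 * (A * y)) (A / y)
    + 2 * mixed 1 1 (4 * (A * y)) (A / y) - mixed 1 2 (4 * (A * y)) (A / y)
    - mixed 2 1 (4 * (A * y)) (A / y)

theorem hasDerivAt_mixed (i j : ℕ) {A : ℝ} (hA : 0 < A) (u : ℝ) :
    HasDerivAt (fun u => mixed i j (4 * (A * exp u)) (A / exp u))
      ((i - j) * mixed i j (4 * (A * exp u)) (A / exp u)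
        - mixed (i + 1) j (4 * (A * exp u)) (A / exp u)
        + mixed i (j + 1) (4 * (A * exp u)) (A / exp u)) u := by
  have e1 : ∀ u, exp (log (4 * A) + u) = 4 * (A * exp u) := fun u => by
    rw [exp_add, exp_log (by positivity)]; ring
  have e2 : ∀ u, exp (log A - u) = A / exp u := fun u => by rw [exp_sub, exp_log hA]
  have i1 : HasDerivAt (fun s => log (4 * A) + s) 1 u := by
    simpa using (hasDerivAt_id u).const_add (log (4 * A))
  have i2 : HasDerivAt (fun s => log A - s) (-1) u := by
    simpa using (hasDerivAt_id u).const_sub (log A)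
  have h := fun ξ => ((hasDerivAt_tp ξ i (log (4 * A) + u)).comp u i1).mul
    ((hasDerivAt_tp ξ j (log A - u)).comp u i2)
  have h' := (h 0).add (h (1 / 2))
  have ef : (fun u => mixed i j (4 * (A * exp u)) (A / exp u)) =
      ((((fun v => tp 0 i (exp v)) ∘ fun s => log (4 * A) + s) *
          ((fun v => tp 0 j (exp v)) ∘ fun s => log A - s)) +
        (((fun v => tp (1 / 2) i (exp v)) ∘ fun s => log (4 * A) + s) *
          ((fun v => tp (1 / 2) j (exp v)) ∘ fun s => log A - s))) := by
    funext u
    simp only [mixed, Pi.add_apply, Pi.mul_apply, Function.comp, e1, e2]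
  rw [ef]
  refine h'.congr_deriv ?_
  simp only [mixed, Function.comp, e1, e2]
  ring

theorem hasDerivAt_En_half {A : ℝ} (hA : 0 < A) (u : ℝ) :
    HasDerivAt (fun u => En A (1 / 2) (exp u)) (halfQ A (exp u) / A) u := by
  have e : (fun u => En A (1 / 2) (exp u)) = fun u =>
      (mixed 1 0 (4 * (A * exp u)) (A / exp u) + mixed 0 1 (4 * (A * exp u)) (A / exp u)) / A :=
    funext fun u => En_half_eq hA (exp_pos u)
  rw [e]
  refine (((hasDerivAt_mixed 1 0 hA u).add (hasDerivAt_mixed 0 1 hA u)).div_const A).congr_deriv ?_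
  unfold halfQ
  push_cast
  ring

theorem hasDerivAt_halfQ {A : ℝ} (hA : 0 < A) (u : ℝ) :
    HasDerivAt (fun u => halfQ A (exp u)) (halfQ' A (exp u)) u := by
  refine (((hasDerivAt_mixed 0 2 hA u).sub (hasDerivAt_mixed 0 1 hA u)).sub
    ((hasDerivAt_mixed 2 0 hA u).sub (hasDerivAt_mixed 1 0 hA u))).congr_deriv ?_
  unfold halfQ'
  push_cast
  ring

/-- The rotation of order six of the hexagonal lattice in coordinates. -/
def hexRot : ℤ × ℤ ≃ ℤ × ℤ where
  toFun p := (-p.2, p.1 + p.2)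
  invFun p := (p.1 + p.2, -p.1)
  left_inv p := by simp
  right_inv p := by simp

/-- At the hexagonal point the summand is a function of m² + mn + n² times a quadratic form whose
three successive images under the rotation of order six add up to zero. -/
theorem halfQ_hex {A : ℝ} (hA : 0 < A) : halfQ A (√3 / 2) = 0 := by
  set y := √3 / 2 with hy
  have hy0 : 0 < y := by positivity
  have hy2 : y ^ 2 = 3 / 4 := by rw [hy, div_pow, sq_sqrt (by norm_num)]; norm_num
  have h := ((hasSum_mixed 0 2 hA hy0).sub (hasSum_mixed 0 1 hA hy0)).sub
    ((hasSum_mixed 2 0 hA hy0).sub (hasSum_mixed 1 0 hA hy0))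
  set F : ℝ → ℝ := fun q => A / y * (A / y * q - 1) * exp (-(A / y * q)) with hF
  set t : ℤ × ℤ → ℝ := fun p => ((p.2 : ℝ) ^ 2 + p.1 * p.2 - (p.1 : ℝ) ^ 2 / 2) *
    F ((p.1 : ℝ) ^ 2 + p.1 * p.2 + (p.2 : ℝ) ^ 2) with ht
  have h1 : HasSum t (halfQ A y) := by
    refine hasSum_of_eq h fun p => ?_
    have e1 : radS A y p = A / y * (3 / 4 * (p.1 : ℝ) ^ 2) := by
      rw [← hy2]; unfold radS; field_simp
    have e2 : radB A y p = A / y * ((p.2 : ℝ) ^ 2 + p.1 * p.2 + (p.1 : ℝ) ^ 2 / 4) := by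
      unfold radB; ring
    have e3 : radS A y p + radB A y p = A / y * ((p.1 : ℝ) ^ 2 + p.1 * p.2 + (p.2 : ℝ) ^ 2) := by
      rw [e1, e2]; ring
    simp only [ht, hF]
    rw [e3, e1, e2]
    ring
  have h2 : HasSum (t ∘ hexRot) (halfQ A y) := hexRot.hasSum_iff.2 h1
  have h3 : HasSum ((t ∘ hexRot) ∘ hexRot) (halfQ A y) := hexRot.hasSum_iff.2 h2
  have h4 := (h1.add h2).add h3
  have h5 : (fun p => t p + (t ∘ hexRot) p + ((t ∘ hexRot) ∘ hexRot) p) = fun _ => 0 := by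
    funext p
    simp only [Function.comp, ht, hexRot, Equiv.coe_fn_mk]
    push_cast
    rw [show (-(p.2 : ℝ)) ^ 2 + -(p.2 : ℝ) * (p.1 + p.2) + (p.1 + p.2) ^ 2
      = (p.1 : ℝ) ^ 2 + p.1 * p.2 + (p.2 : ℝ) ^ 2 by ring,
      show (-((p.1 : ℝ) + p.2)) ^ 2 + -((p.1 : ℝ) + p.2) * (-p.2 + (p.1 + p.2))
        + (-p.2 + (p.1 + p.2)) ^ 2 = (p.1 : ℝ) ^ 2 + p.1 * p.2 + (p.2 : ℝ) ^ 2 by ring]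
    ring
  rw [h5] at h4
  have := h4.unique hasSum_zero
  linarith

end RhombicLine
end LatticePhase

/-! ### Programs as systems of equations, prescribed subdivisions, theta blocks. -/

namespace LatticePhase

noncomputable section ThetaBlocks

open Real

namespace Expr

/-- The value of an expression, for an environment given as a function. -/
def evG (G : ℕ → ℝ) : Expr → ℝ
  | var i => G i
  | const a b => (a : ℝ) / b
  | add e f => e.evG G + f.evG G
  | neg e => -e.evG G
  | mul e f => e.evG G * f.evG G
  | smul k e => k * e.evG G
  | nexp e => Real.exp (-e.evG G)

theorem evG_sub (G : ℕ → ℝ) (e f : Expr) : evG G (sub e f) = evG G e - evG G f := by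
  simp [sub, evG, sub_eq_add_neg]

/-- All variables have index less than `n`. -/
def varsBelow (n : ℕ) : Expr → Bool
  | var i => i < n
  | const _ _ => true
  | add e f => e.varsBelow n && f.varsBelow n
  | neg e => e.varsBelow n
  | mul e f => e.varsBelow n && f.varsBelow n
  | smul _ e => e.varsBelow n
  | nexp e => e.varsBelow n

/-- Every expression of a program uses earlier variables only. -/
def wellScoped : ℕ → List Expr → Bool
  | _, [] => true
  | n, a :: l => a.varsBelow n && wellScoped (n + 1) l

/-- The environment `G` satisfies the equations of a program that starts with the variable `n`. -/
def Sat (G : ℕ → ℝ) (n : ℕ) (l : List Expr) : Prop :=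
  ∀ k (h : k < l.length), G (n + k) = evG G l[k]

theorem Sat.left {G : ℕ → ℝ} {n : ℕ} {l l' : List Expr} (h : Sat G n (l ++ l')) : Sat G n l :=
  fun k hk => by
    rw [h k (by rw [List.length_append]; omega), List.getElem_append_left hk]

theorem Sat.right {G : ℕ → ℝ} {n m : ℕ} {l l' : List Expr} (h : Sat G n (l ++ l'))
    (hm : n + l.length = m) : Sat G m l' :=
  fun k hk => by
    subst hm
    have := h (l.length + k) (by rw [List.length_append]; omega)
    rw [List.getElem_append_right (by omega)] at this
    simp only [Nat.add_sub_cancel_left] at this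
    rw [add_assoc, this]

theorem eval_eq_evG {n : ℕ} {ρ : List ℝ} {G : ℕ → ℝ} (h : ∀ i ≤ n, ρ.getD (n - i) 0 = G i) :
    ∀ e : Expr, e.varsBelow (n + 1) = true → e.eval n ρ = e.evG G
  | var i, hb => h i (by simp [varsBelow] at hb; omega)
  | const _ _, _ => rfl
  | add e f, hb => by
    simp only [varsBelow, Bool.and_eq_true] at hb
    rw [eval, evG, eval_eq_evG h e hb.1, eval_eq_evG h f hb.2]
  | neg e, hb => by rw [eval, evG, eval_eq_evG h e hb]
  | mul e f, hb => by
    simp only [varsBelow, Bool.and_eq_true] at hb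
    rw [eval, evG, eval_eq_evG h e hb.1, eval_eq_evG h f hb.2]
  | smul k e, hb => by rw [eval, evG, eval_eq_evG h e hb]
  | nexp e, hb => by rw [eval, evG, eval_eq_evG h e hb]

/-- Replaces nested evaluation by one equation per variable, so that long programs with shared
intermediate values can be resolved line by line. -/
theorem exists_sat (e : Expr) : ∀ (l : List Expr) (n : ℕ) (ρ : List ℝ) (G₀ : ℕ → ℝ),
    (∀ i ≤ n, ρ.getD (n - i) 0 = G₀ i) → wellScoped (n + 1) l = true →
    e.varsBelow (n + 1 + l.length) = true →
    ∃ G : ℕ → ℝ, (∀ i ≤ n, G i = G₀ i) ∧ Sat G (n + 1) l ∧ run n ρ l e = e.evG G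
  | [], n, ρ, G₀, h, _, he =>
    ⟨G₀, fun _ _ => rfl, fun k hk => absurd hk (by simp), eval_eq_evG h e he⟩
  | a :: l, n, ρ, G₀, h, hs, he => by
    simp only [wellScoped, Bool.and_eq_true] at hs
    obtain ⟨G, hG, hS, hr⟩ := exists_sat e l (n + 1) (a.eval n ρ :: ρ)
      (fun i => if i ≤ n then G₀ i else a.eval n ρ) (fun i hi => by
        rcases Nat.lt_or_ge n i with h' | h'
        · rw [show n + 1 - i = 0 by omega, List.getD_cons_zero, if_neg (by omega)]
        · rw [show n + 1 - i = (n - i) + 1 by omega, List.getD_cons_succ, if_pos h', h i h']) hs.2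
      (by rw [List.length_cons] at he; rw [← he]; congr 1; omega)
    have hlow : ∀ i ≤ n, G i = G₀ i := fun i hi => by rw [hG i (by omega), if_pos hi]
    refine ⟨G, hlow, fun k hk => ?_, hr⟩
    cases k with
    | zero =>
      simp only [add_zero, List.getElem_cons_zero]
      rw [hG (n + 1) le_rfl, if_neg (by omega)]
      exact eval_eq_evG (fun i hi => by rw [h i hi, hlow i hi]) a hs.1
    | succ k =>
      have := hS k (by simpa using hk)
      rw [List.getElem_cons_succ, ← this]
      congr 1
      omega

end Expr

/-- Checks the boxes of a subdivision. The ternary digits of `code`, from the lowest on, list the nodes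
of the tree of bisections in preorder: `0` for a box to be checked, `1` and `2` for a bisection in the
first and in the second coordinate. The remaining digits are passed to `k`. -/
def checkTree (u : ℕ) (ex : List Ball) (l : List Expr) (e : Expr) (fuel : ℕ) :
    ℕ → ℕ → ℕ → ℕ → ℕ → (ℕ → Bool) → Bool :=
  Nat.rec (fun _ _ _ _ _ _ => false) (fun _ ih code x0 x1 y0 y1 k =>
    forceNat (Nat.div code 3) fun rest =>
    Nat.rec (motive := fun _ => Bool) (Bool.rec false (k rest) (checkBox u ex l e 1 x0 x1 y0 y1))
      (fun d _ => Nat.rec (motive := fun _ => Bool)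
        (forceNat (Nat.div (Nat.add x0 x1) 2) fun c =>
          ih rest x0 c y0 y1 fun rest => ih rest c x1 y0 y1 k)
        (fun _ _ => forceNat (Nat.div (Nat.add y0 y1) 2) fun c =>
          ih rest x0 x1 y0 c fun rest => ih rest x0 x1 c y1 k) d)
      (Nat.mod code 3)) fuel

/-- The continuation receives the unread digits. Knowing that it succeeded on some remainder is what
the second half of a bisection needs. -/
theorem value_pos_of_checkTree {u : ℕ} (hu : 0 < u) {ex : List Ball} {c : List ℝ}
    (hc : List.Forall₂ Ball.Mem ex c) {l : List Expr} {e : Expr} (hl : ∀ a ∈ l, a.WF) (he : e.WF)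
    (fuel : ℕ) : ∀ (code x0 x1 y0 y1 : ℕ) (k : ℕ → Bool), 0 < y0 → x0 ≤ x1 → y0 ≤ y1 →
      checkTree u ex l e fuel code x0 x1 y0 y1 k = true → (∃ r, k r = true) ∧
        ∀ x y : ℝ, x0 / u ≤ x → x ≤ x1 / u → y0 / u ≤ y → y ≤ y1 / u → 0 < Expr.value c l e x y := by
  induction fuel with
  | zero => intro _ _ _ _ _ _ _ _ _ h; cases h
  | succ fuel ih =>
    intro code x0 x1 y0 y1 k hy hx01 hy01 h
    have hE : checkTree u ex l e (fuel + 1) code x0 x1 y0 y1 k =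
        forceNat (code / 3) fun rest =>
        Nat.rec (motive := fun _ => Bool) (Bool.rec false (k rest) (checkBox u ex l e 1 x0 x1 y0 y1))
          (fun d _ => Nat.rec (motive := fun _ => Bool)
            (forceNat ((x0 + x1) / 2) fun c => checkTree u ex l e fuel rest x0 c y0 y1 fun rest =>
              checkTree u ex l e fuel rest c x1 y0 y1 k)
            (fun _ _ => forceNat ((y0 + y1) / 2) fun c => checkTree u ex l e fuel rest x0 x1 y0 c
              fun rest => checkTree u ex l e fuel rest x0 x1 c y1 k) d)
          (code % 3) := rfl
    simp only [hE, forceNat_eq] at h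
    generalize code % 3 = m at h
    rcases m with _ | _ | d
    · rcases hb : checkBox u ex l e 1 x0 x1 y0 y1 with _ | _
      · rw [hb] at h; cases h
      · rw [hb] at h
        exact ⟨⟨_, h⟩, value_pos_of_checkBox hu hc hl he 1 x0 x1 y0 y1 hy hx01 hy01 hb⟩
    · obtain ⟨⟨r, h1⟩, h2⟩ := ih _ _ _ _ _ _ hy (by omega) hy01 h
      obtain ⟨h3, h4⟩ := ih _ _ _ _ _ _ hy (by omega) hy01 h1
      refine ⟨h3, fun x y hx0 hx1 hy0 hy1 => ?_⟩
      rcases le_total x (((x0 + x1) / 2 : ℕ) / u) with hle | hle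
      · exact h2 x y hx0 hle hy0 hy1
      · exact h4 x y hle hx1 hy0 hy1
    · obtain ⟨⟨r, h1⟩, h2⟩ := ih _ _ _ _ _ _ hy hx01 (by omega) h
      obtain ⟨h3, h4⟩ := ih _ _ _ _ _ _ (by omega) hx01 (by omega) h1
      refine ⟨h3, fun x y hx0 hx1 hy0 hy1 => ?_⟩
      rcases le_total y (((y0 + y1) / 2 : ℕ) / u) with hle | hle
      · exact h2 x y hx0 hx1 hy0 hle
      · exact h4 x y hx0 hx1 hle hy1

/-- Checks a box by the subdivision `code`. -/
def checkWith (u : ℕ) (ex : List Ball) (l : List Expr) (e : Expr) (code x0 x1 y0 y1 : ℕ) : Bool :=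
  checkTree u ex l e 30 code x0 x1 y0 y1 fun _ => true

/-- The result of a successful box check, in terms of the equations of the program. -/
theorem evG_pos_of_checkWith {u : ℕ} (hu : 0 < u) {ex : List Ball} {c : List ℝ}
    (hc : List.Forall₂ Ball.Mem ex c) {l : List Expr} {e : Expr} (hl : ∀ a ∈ l, a.WF) (he : e.WF)
    (hsc : Expr.wellScoped (c.length + 3) l = true) (hb : e.varsBelow (c.length + 3 + l.length) = true)
    {code x0 x1 y0 y1 : ℕ} (hy : 0 < y0) (hx01 : x0 ≤ x1) (hy01 : y0 ≤ y1)
    (h : checkWith u ex l e code x0 x1 y0 y1 = true) {x y : ℝ} (hx0 : x0 / u ≤ x) (hx1 : x ≤ x1 / u)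
    (hy0 : y0 / u ≤ y) (hy1 : y ≤ y1 / u) :
    ∃ G : ℕ → ℝ, G 0 = x ∧ G 1 = y ∧ G 2 = y⁻¹ ∧
      (∀ i, i < c.length → G (3 + i) = c.getD (c.length - 1 - i) 0) ∧
      Expr.Sat G (c.length + 3) l ∧ 0 < e.evG G := by
  have hv := (value_pos_of_checkTree hu hc hl he 30 code x0 x1 y0 y1 _ hy hx01 hy01 h).2 x y hx0 hx1
    hy0 hy1
  obtain ⟨G, hG, hS, hr⟩ := Expr.exists_sat e l (c.length + 2) (c ++ [y⁻¹, y, x])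
    (fun i => (c ++ [y⁻¹, y, x]).getD (c.length + 2 - i) 0) (fun _ _ => rfl) hsc
    (by rw [← hb])
  rw [Expr.value, hr] at hv
  refine ⟨G, ?_, ?_, ?_, fun i hi => ?_, hS, hv⟩
  · rw [hG 0 (by omega)]; simp
  · rw [hG 1 (by omega), show c.length + 2 - 1 = c.length + 1 by omega]; simp
  · rw [hG 2 (by omega), show c.length + 2 - 2 = c.length by omega]; simp
  · rw [hG (3 + i) (by omega), List.getD_append _ _ _ _ (by omega)]
    congr 1
    omega

namespace Expr

/-- Computes `tp 0 j X` and `tp (1 / 2) j X` for `j ≤ 3`, as the variables `n + 17, …, n + 20` and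
`n + 21, …, n + 24`, where `X` is the value of `x`; the variables `t, …, t + 7` are the tails. -/
def block (n t : ℕ) (x : Expr) : List Expr :=
  [x, mul (const 1 4) (var n), nexp (var (n + 1)), mul (var (n + 2)) (var (n + 2)),
    mul (var (n + 3)) (var (n + 3)), mul (var (n + 4)) (var (n + 4)),
    mul (var (n + 2)) (var (n + 5)), mul (var (n + 5)) (var (n + 5)),
    mul (var (n + 1)) (var (n + 1)), mul (var (n + 1)) (var (n + 8)),
    mul (var (n + 1)) (add (smul 4 (var (n + 4))) (smul 16 (var (n + 7)))),
    mul (var (n + 8)) (add (smul 16 (var (n + 4))) (smul 256 (var (n + 7)))),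
    mul (var (n + 9)) (add (smul 64 (var (n + 4))) (smul 4096 (var (n + 7)))),
    mul (var (n + 1)) (add (var (n + 2)) (smul 9 (var (n + 6)))),
    mul (var (n + 8)) (add (var (n + 2)) (smul 81 (var (n + 6)))),
    mul (var (n + 9)) (add (var (n + 2)) (smul 729 (var (n + 6)))),
    add (var (n + 4)) (var (n + 7)),
    add (const 1 1) (smul 2 (add (var (n + 16)) (var t))),
    smul 2 (add (var (n + 10)) (var (t + 1))), smul 2 (add (var (n + 11)) (var (t + 2))),
    smul 2 (add (var (n + 12)) (var (t + 3))),
    smul 2 (add (add (var (n + 2)) (var (n + 6))) (var (t + 4))),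
    smul 2 (add (var (n + 13)) (var (t + 5))), smul 2 (add (var (n + 14)) (var (t + 6))),
    smul 2 (add (var (n + 15)) (var (t + 7)))]

theorem block_wf (n t : ℕ) {x : Expr} (hx : x.WF) : ∀ a ∈ block n t x, a.WF := by
  simp [block, WF, hx]

/-- The tails used by `block`, in the order of the environment. -/
def tails (X : ℝ) : List ℝ :=
  [hs 3 (5 / 2) X, hs 2 (5 / 2) X, hs 1 (5 / 2) X, hs 0 (5 / 2) X, hs 3 3 X, hs 2 3 X, hs 1 3 X,
    hs 0 3 X]

theorem tp_zero_expand (j : ℕ) {X : ℝ} (hX : 0 < X) : tp 0 j X =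
    0 ^ j + 2 * (X ^ j * exp (-X) + (4 * X) ^ j * exp (-(4 * X)) + hs j 3 X) := by
  rw [tp_zero_eq_hs j hX, hs_eq_add j 1 hX, hs_eq_add j (1 + 1) hX]
  norm_num
  ring

theorem tp_half_expand (j : ℕ) {X : ℝ} (hX : 0 < X) : tp (1 / 2) j X =
    2 * ((1 / 4 * X) ^ j * exp (-(1 / 4 * X)) + (9 / 4 * X) ^ j * exp (-(9 / 4 * X))
      + hs j (5 / 2) X) := by
  rw [tp_half_eq_hs j hX, hs_eq_add j (1 / 2) hX, hs_eq_add j (1 / 2 + 1) hX]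
  norm_num
  ring

/-- All exponentials in a block are powers of e^{-X/4}, so each block evaluates the exponential only
once. -/
theorem exp_neg_eq_quarter_pow (X : ℝ) : exp (-X) = exp (-(1 / 4 * X)) ^ 4 ∧
    exp (-(4 * X)) = exp (-(1 / 4 * X)) ^ 16 ∧ exp (-(9 / 4 * X)) = exp (-(1 / 4 * X)) ^ 9 := by
  refine ⟨?_, ?_, ?_⟩ <;> (rw [← exp_nat_mul]; push_cast; congr 1; ring)

theorem Sat.block {G : ℕ → ℝ} {n t : ℕ} {x : Expr} (h : Sat G n (block n t x)) (hX : 0 < evG G x)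
    (h0 : ∀ j ≤ 3, G (t + j) = hs j 3 (evG G x))
    (h1 : ∀ j ≤ 3, G (t + 4 + j) = hs j (5 / 2) (evG G x)) :
    (G (n + 17) = tp 0 0 (evG G x) ∧ G (n + 18) = tp 0 1 (evG G x) ∧ G (n + 19) = tp 0 2 (evG G x) ∧
      G (n + 20) = tp 0 3 (evG G x)) ∧
    G (n + 21) = tp (1 / 2) 0 (evG G x) ∧ G (n + 22) = tp (1 / 2) 1 (evG G x) ∧
      G (n + 23) = tp (1 / 2) 2 (evG G x) ∧ G (n + 24) = tp (1 / 2) 3 (evG G x) := by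
  have q0 : G (n + 0) = _ := h 0 (by simp [Expr.block])
  have q1 : G (n + 1) = _ := h 1 (by simp [Expr.block])
  have q2 : G (n + 2) = _ := h 2 (by simp [Expr.block])
  have q3 : G (n + 3) = _ := h 3 (by simp [Expr.block])
  have q4 : G (n + 4) = _ := h 4 (by simp [Expr.block])
  have q5 : G (n + 5) = _ := h 5 (by simp [Expr.block])
  have q6 : G (n + 6) = _ := h 6 (by simp [Expr.block])
  have q7 : G (n + 7) = _ := h 7 (by simp [Expr.block])
  have q8 : G (n + 8) = _ := h 8 (by simp [Expr.block])
  have q9 : G (n + 9) = _ := h 9 (by simp [Expr.block])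
  have q10 : G (n + 10) = _ := h 10 (by simp [Expr.block])
  have q11 : G (n + 11) = _ := h 11 (by simp [Expr.block])
  have q12 : G (n + 12) = _ := h 12 (by simp [Expr.block])
  have q13 : G (n + 13) = _ := h 13 (by simp [Expr.block])
  have q14 : G (n + 14) = _ := h 14 (by simp [Expr.block])
  have q15 : G (n + 15) = _ := h 15 (by simp [Expr.block])
  have q16 : G (n + 16) = _ := h 16 (by simp [Expr.block])
  have q17 : G (n + 17) = _ := h 17 (by simp [Expr.block])
  have q18 : G (n + 18) = _ := h 18 (by simp [Expr.block])
  have q19 : G (n + 19) = _ := h 19 (by simp [Expr.block])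
  have q20 : G (n + 20) = _ := h 20 (by simp [Expr.block])
  have q21 : G (n + 21) = _ := h 21 (by simp [Expr.block])
  have q22 : G (n + 22) = _ := h 22 (by simp [Expr.block])
  have q23 : G (n + 23) = _ := h 23 (by simp [Expr.block])
  have q24 : G (n + 24) = _ := h 24 (by simp [Expr.block])
  have a0 := h0 0 (by norm_num)
  have a1 := h0 1 (by norm_num)
  have a2 := h0 2 (by norm_num)
  have a3 := h0 3 (by norm_num)
  have b0 := h1 0 (by norm_num)
  have b1 : G (t + 5) = _ := h1 1 (by norm_num)
  have b2 : G (t + 6) = _ := h1 2 (by norm_num)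
  have b3 : G (t + 7) = _ := h1 3 (by norm_num)
  rw [tp_zero_expand 0 hX, tp_zero_expand 1 hX, tp_zero_expand 2 hX, tp_zero_expand 3 hX,
    tp_half_expand 0 hX, tp_half_expand 1 hX, tp_half_expand 2 hX, tp_half_expand 3 hX]
  simp only [add_zero] at q0 a0 b0
  simp only [Expr.block, List.getElem_cons_succ, List.getElem_cons_zero, evG] at q0 q1 q2 q3 q4 q5 q6
  simp only [Expr.block, List.getElem_cons_succ, List.getElem_cons_zero, evG] at q7 q8 q9 q10 q11
  simp only [Expr.block, List.getElem_cons_succ, List.getElem_cons_zero, evG] at q12 q13 q14 q15 q16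
  simp only [Expr.block, List.getElem_cons_succ, List.getElem_cons_zero, evG] at q17 q18 q19 q20 q21
  simp only [Expr.block, List.getElem_cons_succ, List.getElem_cons_zero, evG] at q22 q23 q24
  generalize evG G x = X at *
  obtain ⟨E1, E4, E9⟩ := exp_neg_eq_quarter_pow X
  rw [E1, E4, E9]
  rw [q0] at q1
  rw [q1] at q2 q8 q9 q10 q13
  push_cast at *
  generalize exp (-(1 / 4 * X)) = Q at *
  rw [q2] at q3 q6 q13 q14 q15 q21
  refine ⟨⟨?_, ?_, ?_, ?_⟩, ?_, ?_, ?_, ?_⟩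
  · rw [q17, q16, q7, q5, q4, q3, a0]; ring
  · rw [q18, q10, q7, q5, q4, q3, a1]; ring
  · rw [q19, q11, q8, q7, q5, q4, q3, a2]; ring
  · rw [q20, q12, q9, q8, q7, q5, q4, q3, a3]; ring
  · rw [q21, q6, q5, q4, q3, b0]; ring
  · rw [q22, q13, q6, q5, q4, q3, b1]; ring
  · rw [q23, q14, q8, q6, q5, q4, q3, b2]; ring
  · rw [q24, q15, q9, q8, q6, q5, q4, q3, b3]; ring

/-- The variant of `block` for large arguments: the values are the variables `n + 9, …, n + 16`. -/
def blockLarge (n t : ℕ) (x : Expr) : List Expr :=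
  [x, mul (const 1 4) (var n), nexp (var (n + 1)), mul (var (n + 2)) (var (n + 2)),
    mul (var (n + 3)) (var (n + 3)), mul (var n) (var (n + 4)), mul (var n) (var (n + 5)),
    mul (var (n + 1)) (var (n + 2)), mul (var (n + 1)) (var (n + 7)),
    add (const 1 1) (smul 2 (add (var (n + 4)) (var t))),
    smul 2 (add (var (n + 5)) (var (t + 1))),
    smul 2 (add (var (n + 6)) (var (t + 2))),
    smul 2 (add (mul (var n) (var (n + 6))) (var (t + 3))),
    smul 2 (add (var (n + 2)) (var (t + 4))),
    smul 2 (add (var (n + 7)) (var (t + 5))),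
    smul 2 (add (var (n + 8)) (var (t + 6))),
    smul 2 (add (mul (var (n + 1)) (var (n + 8))) (var (t + 7)))]

theorem blockLarge_wf (n t : ℕ) {x : Expr} (hx : x.WF) : ∀ a ∈ blockLarge n t x, a.WF := by
  simp [blockLarge, WF, hx]

/-- The tails used by `blockLarge`, in the order of the environment. -/
def tailsLarge (X : ℝ) : List ℝ :=
  [hs 3 (3 / 2) X, hs 2 (3 / 2) X, hs 1 (3 / 2) X, hs 0 (3 / 2) X, hs 3 2 X, hs 2 2 X, hs 1 2 X,
    hs 0 2 X]

theorem tp_zero_expand_large (j : ℕ) {X : ℝ} (hX : 0 < X) : tp 0 j X =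
    0 ^ j + 2 * (X ^ j * exp (-X) + hs j 2 X) := by
  rw [tp_zero_eq_hs j hX, hs_eq_add j 1 hX]
  norm_num

theorem tp_half_expand_large (j : ℕ) {X : ℝ} (hX : 0 < X) : tp (1 / 2) j X =
    2 * ((1 / 4 * X) ^ j * exp (-(1 / 4 * X)) + hs j (3 / 2) X) := by
  rw [tp_half_eq_hs j hX, hs_eq_add j (1 / 2) hX]
  norm_num

theorem Sat.blockLarge {G : ℕ → ℝ} {n t : ℕ} {x : Expr} (h : Sat G n (blockLarge n t x))
    (hX : 0 < evG G x) (h0 : ∀ j ≤ 3, G (t + j) = hs j 2 (evG G x))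
    (h1 : ∀ j ≤ 3, G (t + 4 + j) = hs j (3 / 2) (evG G x)) :
    (G (n + 9) = tp 0 0 (evG G x) ∧ G (n + 10) = tp 0 1 (evG G x) ∧ G (n + 11) = tp 0 2 (evG G x) ∧
      G (n + 12) = tp 0 3 (evG G x)) ∧
    G (n + 13) = tp (1 / 2) 0 (evG G x) ∧ G (n + 14) = tp (1 / 2) 1 (evG G x) ∧
      G (n + 15) = tp (1 / 2) 2 (evG G x) ∧ G (n + 16) = tp (1 / 2) 3 (evG G x) := by
  have q0 : G (n + 0) = _ := h 0 (by simp [Expr.blockLarge])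
  have q1 : G (n + 1) = _ := h 1 (by simp [Expr.blockLarge])
  have q2 : G (n + 2) = _ := h 2 (by simp [Expr.blockLarge])
  have q3 : G (n + 3) = _ := h 3 (by simp [Expr.blockLarge])
  have q4 : G (n + 4) = _ := h 4 (by simp [Expr.blockLarge])
  have q5 : G (n + 5) = _ := h 5 (by simp [Expr.blockLarge])
  have q6 : G (n + 6) = _ := h 6 (by simp [Expr.blockLarge])
  have q7 : G (n + 7) = _ := h 7 (by simp [Expr.blockLarge])
  have q8 : G (n + 8) = _ := h 8 (by simp [Expr.blockLarge])
  have q9 : G (n + 9) = _ := h 9 (by simp [Expr.blockLarge])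
  have q10 : G (n + 10) = _ := h 10 (by simp [Expr.blockLarge])
  have q11 : G (n + 11) = _ := h 11 (by simp [Expr.blockLarge])
  have q12 : G (n + 12) = _ := h 12 (by simp [Expr.blockLarge])
  have q13 : G (n + 13) = _ := h 13 (by simp [Expr.blockLarge])
  have q14 : G (n + 14) = _ := h 14 (by simp [Expr.blockLarge])
  have q15 : G (n + 15) = _ := h 15 (by simp [Expr.blockLarge])
  have q16 : G (n + 16) = _ := h 16 (by simp [Expr.blockLarge])
  have a0 := h0 0 (by norm_num)
  have a1 := h0 1 (by norm_num)
  have a2 := h0 2 (by norm_num)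
  have a3 := h0 3 (by norm_num)
  have b0 := h1 0 (by norm_num)
  have b1 : G (t + 5) = _ := h1 1 (by norm_num)
  have b2 : G (t + 6) = _ := h1 2 (by norm_num)
  have b3 : G (t + 7) = _ := h1 3 (by norm_num)
  rw [tp_zero_expand_large 0 hX, tp_zero_expand_large 1 hX, tp_zero_expand_large 2 hX,
    tp_zero_expand_large 3 hX, tp_half_expand_large 0 hX, tp_half_expand_large 1 hX,
    tp_half_expand_large 2 hX, tp_half_expand_large 3 hX]
  simp only [add_zero] at q0 a0 b0
  simp only [Expr.blockLarge, List.getElem_cons_succ, List.getElem_cons_zero, evG] at q0 q1 q2 q3 q4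
  simp only [Expr.blockLarge, List.getElem_cons_succ, List.getElem_cons_zero, evG] at q5 q6 q7 q8 q9
  simp only [Expr.blockLarge, List.getElem_cons_succ, List.getElem_cons_zero, evG] at q10 q11 q12 q13
  simp only [Expr.blockLarge, List.getElem_cons_succ, List.getElem_cons_zero, evG] at q14 q15 q16
  generalize evG G x = X at *
  rw [(exp_neg_eq_quarter_pow X).1]
  rw [q0] at q1 q5 q6 q12
  rw [q1] at q2 q7 q8 q16
  push_cast at *
  generalize exp (-(1 / 4 * X)) = Q at *
  rw [q2] at q3 q7 q13
  refine ⟨⟨?_, ?_, ?_, ?_⟩, ?_, ?_, ?_, ?_⟩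
  · rw [q9, q4, q3, a0]; ring
  · rw [q10, q5, q4, q3, a1]; ring
  · rw [q11, q6, q5, q4, q3, a2]; ring
  · rw [q12, q6, q5, q4, q3, a3]; ring
  · rw [q13, b0]; ring
  · rw [q14, q7, b1]; ring
  · rw [q15, q8, q7, b2]; ring
  · rw [q16, q8, q7, b3]; ring

end Expr

end ThetaBlocks
end LatticePhase

/-! ### Monotonicity from the hexagonal to the square lattice on x = 1/2. -/

namespace LatticePhase

noncomputable section RhombicMonotone

open Real

/-- Enclosures of the tails for arguments that are at least `14 / 5`. -/
def tailBalls : List Ball :=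
  [Ball.tail 3 10000, Ball.tail 2 100000, Ball.tail 1 1000000, Ball.tail 6 100000000,
    Ball.tail 4 10000000, Ball.tail 2 100000000, Ball.tail 1 1000000000, Ball.tail 1 1000000000]

theorem hs_tail_le {j : ℕ} (c X₀ : ℝ) {X b : ℝ} (k : ℕ) (hk : k = j) (hc : 0 < c) (hX₀ : 0 < X₀) (hX : X₀ ≤ X)
    (h1 : 1 ≤ c ^ 2 * X₀) (hj : (k : ℝ) ≤ c ^ 2 * X₀) {a d : ℝ}
    (hr : exp (-((2 * c + 1) * X₀)) ≤ a) (ha : ((c + 1) / c) ^ (2 * k) * a ≤ 1 / 2)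
    (he : exp (-(c ^ 2 * X₀)) ≤ d) (hd : 2 * ((c ^ 2 * X₀) ^ k * d) ≤ b) : hs j c X ≤ b := by
  subst hk
  refine (hs_le_of_le le_rfl hc hX₀ hX h1 hj ?_).trans (le_trans ?_ hd)
  · exact (mul_le_mul_of_nonneg_left hr (by positivity)).trans ha
  · gcongr

theorem tails_mem {X : ℝ} (hX : 14 / 5 ≤ X) : List.Forall₂ Ball.Mem tailBalls (Expr.tails X) := by
  have hX0 : (0 : ℝ) ≤ X := by linarith
  have r1 := (exp_neg_lt_of_le (w := (2 * 3 + 1) * (14 / 5)) 19 1 1 1000 (by norm_num) (by norm_num)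
    (by norm_num) (by decide +kernel)).le
  have r2 := (exp_neg_lt_of_le (w := (2 * (5 / 2) + 1) * (14 / 5)) 16 1 1 1000 (by norm_num)
    (by norm_num) (by norm_num) (by decide +kernel)).le
  have e1 := (exp_neg_lt_of_le (w := 3 ^ 2 * (14 / 5)) 252 10 12 (10 ^ 12) (by norm_num)
    (by norm_num) (by norm_num) (by decide +kernel)).le
  have e2 := (exp_neg_lt_of_le (w := (5 / 2) ^ 2 * (14 / 5)) 175 10 26 (10 ^ 9) (by norm_num)
    (by norm_num) (by norm_num) (by decide +kernel)).le
  have k1 : ∀ j (b : ℝ), j ≤ 3 → 2 * ((3 ^ 2 * (14 / 5) : ℝ) ^ j * ((12 : ℕ) / (10 ^ 12 : ℕ))) ≤ b →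
      hs j 3 X ≤ b := fun j b hj hb => by
    refine hs_tail_le 3 (14 / 5) j rfl (by norm_num) (by norm_num) hX (by norm_num) ?_ r1 ?_ e1 hb
    · interval_cases j <;> norm_num
    · interval_cases j <;> norm_num
  have k2 : ∀ j (b : ℝ), j ≤ 3 →
      2 * (((5 / 2) ^ 2 * (14 / 5) : ℝ) ^ j * ((26 : ℕ) / (10 ^ 9 : ℕ))) ≤ b →
      hs j (5 / 2) X ≤ b := fun j b hj hb => by
    refine hs_tail_le (5 / 2) (14 / 5) j rfl (by norm_num) (by norm_num) hX (by norm_num) ?_ r2 ?_ e2 hb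
    · interval_cases j <;> norm_num
    · interval_cases j <;> norm_num
  refine .cons ?_ (.cons ?_ (.cons ?_ (.cons ?_ (.cons ?_ (.cons ?_ (.cons ?_ (.cons ?_ .nil)))))))
  all_goals refine Ball.mem_tail (by norm_num) (hs_nonneg _ _ hX0) ?_
  · exact k2 3 _ (by norm_num) (by norm_num)
  · exact k2 2 _ (by norm_num) (by norm_num)
  · exact k2 1 _ (by norm_num) (by norm_num)
  · exact k2 0 _ (by norm_num) (by norm_num)
  · exact k1 3 _ (by norm_num) (by norm_num)
  · exact k1 2 _ (by norm_num) (by norm_num)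
  · exact k1 1 _ (by norm_num) (by norm_num)
  · exact k1 0 _ (by norm_num) (by norm_num)

/-- Enclosures of the tails `tailsLarge` for arguments that are at least `49 / 5`. -/
def tailBallsLarge : List Ball :=
  [Ball.tail 6 1000000, Ball.tail 3 10000000, Ball.tail 2 100000000, Ball.tail 1 1000000000,
    Ball.tail 1 1000000000, Ball.tail 1 1000000000, Ball.tail 1 1000000000, Ball.tail 1 1000000000]

theorem tailsLarge_mem {X : ℝ} (hX : 49 / 5 ≤ X) :
    List.Forall₂ Ball.Mem tailBallsLarge (Expr.tailsLarge X) := by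
  have hX0 : (0 : ℝ) ≤ X := by linarith
  have r1 := (exp_neg_lt_of_le (w := (2 * 2 + 1) * (49 / 5)) 19 1 1 1000 (by norm_num) (by norm_num)
    (by norm_num) (by decide +kernel)).le
  have r2 := (exp_neg_lt_of_le (w := (2 * (3 / 2) + 1) * (49 / 5)) 16 1 1 1000 (by norm_num)
    (by norm_num) (by norm_num) (by decide +kernel)).le
  have e1 := (exp_neg_lt_of_le (w := 2 ^ 2 * (49 / 5)) 39 1 1 (10 ^ 16) (by norm_num)
    (by norm_num) (by norm_num) (by decide +kernel)).le
  have e2 := (exp_neg_lt_of_le (w := (3 / 2) ^ 2 * (49 / 5)) 2205 100 27 (10 ^ 11) (by norm_num)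
    (by norm_num) (by norm_num) (by decide +kernel)).le
  have k1 : ∀ j (b : ℝ), j ≤ 3 → 2 * ((2 ^ 2 * (49 / 5) : ℝ) ^ j * ((1 : ℕ) / (10 ^ 16 : ℕ))) ≤ b →
      hs j 2 X ≤ b := fun j b hj hb => by
    refine hs_tail_le 2 (49 / 5) j rfl (by norm_num) (by norm_num) hX (by norm_num) ?_ r1 ?_ e1 hb
    · interval_cases j <;> norm_num
    · interval_cases j <;> norm_num
  have k2 : ∀ j (b : ℝ), j ≤ 3 →
      2 * (((3 / 2) ^ 2 * (49 / 5) : ℝ) ^ j * ((27 : ℕ) / (10 ^ 11 : ℕ))) ≤ b →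
      hs j (3 / 2) X ≤ b := fun j b hj hb => by
    refine hs_tail_le (3 / 2) (49 / 5) j rfl (by norm_num) (by norm_num) hX (by norm_num) ?_ r2 ?_ e2 hb
    · interval_cases j <;> norm_num
    · interval_cases j <;> norm_num
  refine .cons ?_ (.cons ?_ (.cons ?_ (.cons ?_ (.cons ?_ (.cons ?_ (.cons ?_ (.cons ?_ .nil)))))))
  all_goals refine Ball.mem_tail (by norm_num) (hs_nonneg _ _ hX0) ?_
  · exact k2 3 _ (by norm_num) (by norm_num)
  · exact k2 2 _ (by norm_num) (by norm_num)
  · exact k2 1 _ (by norm_num) (by norm_num)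
  · exact k2 0 _ (by norm_num) (by norm_num)
  · exact k1 3 _ (by norm_num) (by norm_num)
  · exact k1 2 _ (by norm_num) (by norm_num)
  · exact k1 1 _ (by norm_num) (by norm_num)
  · exact k1 0 _ (by norm_num) (by norm_num)

open LatticePhase.Expr

/-- Computes the theta series on the line `x = 1 / 2`, from `A` and `y`. -/
def halfProg : List Expr :=
  blockLarge 19 3 (smul 4 (mul (var 0) (var 1))) ++ block 36 11 (mul (var 0) (var 2))

def exprHalfSum (s b : ℕ) : Expr :=
  add (add (mul (var s) (sub (add (var (b + 3)) (var (b + 1))) (smul 3 (var (b + 2)))))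
      (mul (var (s + 1)) (sub (add (var b) (smul 2 (var (b + 1)))) (var (b + 2)))))
    (sub (mul (var (s + 3)) (var b)) (mul (var (s + 2)) (add (smul 3 (var b)) (var (b + 1)))))

def exprHalfQ' : Expr := add (exprHalfSum 28 53) (exprHalfSum 32 57)

theorem halfProg_wf : ∀ a ∈ halfProg, a.WF := by
  intro a ha
  rcases List.mem_append.1 ha with h | h
  · exact blockLarge_wf _ _ (by simp [WF]) a h
  · exact block_wf _ _ (by simp [WF]) a h

theorem get_tails (X : ℝ) {G : ℕ → ℝ} {t : ℕ}
    (h : ∀ i, i < 8 → G (t + i) = (tails X).getD (7 - i) 0) :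
    (∀ j ≤ 3, G (t + j) = hs j 3 X) ∧ ∀ j ≤ 3, G (t + 4 + j) = hs j (5 / 2) X := by
  refine ⟨fun j hj => ?_, fun j hj => ?_⟩
  · rw [h j (by omega)]; interval_cases j <;> simp [tails]
  · rw [add_assoc, h (4 + j) (by omega)]; interval_cases j <;> simp [tails]

theorem get_tailsLarge (X : ℝ) {G : ℕ → ℝ} {t : ℕ}
    (h : ∀ i, i < 8 → G (t + i) = (tailsLarge X).getD (7 - i) 0) :
    (∀ j ≤ 3, G (t + j) = hs j 2 X) ∧ ∀ j ≤ 3, G (t + 4 + j) = hs j (3 / 2) X := by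
  refine ⟨fun j hj => ?_, fun j hj => ?_⟩
  · rw [h j (by omega)]; interval_cases j <;> simp [tailsLarge]
  · rw [add_assoc, h (4 + j) (by omega)]; interval_cases j <;> simp [tailsLarge]

/-- The ranges of A and y guarantee 4Ay ≥ 49/5 and A/y ≥ 14/5, where the tail enclosures hold. -/
theorem halfQ'_pos_of_check {u code x0 x1 y0 y1 : ℕ} (hu : 0 < u) (hy0 : 0 < y0) (hx : x0 ≤ x1)
    (hy : y0 ≤ y1) (h : checkWith u (tailBalls ++ tailBallsLarge) halfProg exprHalfQ' code x0 x1
      y0 y1 = true) {A y : ℝ} (hA : 2.88 ≤ A) (hy0' : 0.866 ≤ y) (hy1' : y ≤ 1)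
    (h1 : (x0 : ℝ) / u ≤ A) (h2 : A ≤ (x1 : ℝ) / u) (h3 : (y0 : ℝ) / u ≤ y) (h4 : y ≤ (y1 : ℝ) / u) :
    0 < halfQ' A y := by
  have hS : 49 / 5 ≤ 4 * (A * y) := by nlinarith
  have hB : 14 / 5 ≤ A / y := by rw [le_div_iff₀ (by linarith)]; nlinarith
  obtain ⟨G, g0, g1, g2, gc, hs', hp⟩ := evG_pos_of_checkWith hu
    (List.rel_append (tails_mem hB) (tailsLarge_mem hS)) halfProg_wf
    (by simp [exprHalfQ', exprHalfSum, sub, WF]) (by rfl) (by rfl) hy0 hx hy h h1 h2 h3 h4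
  have eS : evG G (smul 4 (mul (var 0) (var 1))) = 4 * (A * y) := by simp [evG, g0, g1]
  have eB : evG G (mul (var 0) (var 2)) = A / y := by simp [evG, g0, g2, div_eq_mul_inv]
  have tS := get_tailsLarge (4 * (A * y)) (G := G) (t := 3) (fun i hi => by
    rw [gc i (by simp [tails, tailsLarge]; omega)]
    interval_cases i <;> simp [tails, tailsLarge])
  have tB := get_tails (A / y) (G := G) (t := 11) (fun i hi => by
    rw [show 11 + i = 3 + (8 + i) by ring, gc (8 + i) (by simp [tails, tailsLarge]; omega)]
    interval_cases i <;> simp [tails, tailsLarge])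
  obtain ⟨⟨s0, s1, s2, s3⟩, s4, s5, s6, s7⟩ := Sat.blockLarge (n := 19) (t := 3) hs'.left
    (by rw [eS]; linarith) (by rw [eS]; exact tS.1) (by rw [eS]; exact tS.2)
  obtain ⟨⟨b0, b1, b2, b3⟩, b4, b5, b6, b7⟩ := Sat.block (n := 36) (t := 11)
    (hs'.right (by simp [tails, tailsLarge, blockLarge]))
    (by rw [eB]; linarith) (by rw [eB]; exact tB.1) (by rw [eB]; exact tB.2)
  rw [eS] at s0 s1 s2 s3 s4 s5 s6 s7
  rw [eB] at b0 b1 b2 b3 b4 b5 b6 b7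
  simp only [exprHalfQ', exprHalfSum, evG_sub, evG, Nat.reduceAdd, s0, s1, s2, s3, s4, s5, s6, s7,
    b0, b1, b2, b3, b4, b5, b6, b7] at hp
  unfold halfQ' mixed
  push_cast at hp
  linarith

/-- The code is only a hint for the subdivision: an unsuitable one makes the check fail and cannot
make it succeed wrongly. -/
theorem halfQ'_check_lower : checkWith (10 ^ 9) (tailBalls ++ tailBallsLarge) halfProg exprHalfQ'
    215998536988566071664293953056349910431090912711174420369587357062670535533085904500358503577473021726375
    2880800000 3050000000 866000000 1000000000 = true := by decide +kernel

theorem halfQ'_check_middle : checkWith (10 ^ 9) (tailBalls ++ tailBallsLarge) halfProg exprHalfQ'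
    17940885213151024682495134733133074157538612540230566714194301023
    3050000000 3700000000 866000000 1000000000 = true := by decide +kernel

theorem halfQ'_check_upper : checkWith (10 ^ 9) (tailBalls ++ tailBallsLarge) halfProg exprHalfQ'
    5097075919044846069609503537682436415790968941598679624134535844992475856866
    3700000000 6283200000 866000000 1000000000 = true := by decide +kernel

theorem halfQ'_pos {A y : ℝ} (hA0 : 2.8808 ≤ A) (hA1 : A ≤ 6.2832) (hy0 : 0.866 ≤ y) (hy1 : y ≤ 1) :
    0 < halfQ' A y := by
  have key : ∀ code x0 x1 : ℕ, x0 ≤ x1 → checkWith (10 ^ 9) (tailBalls ++ tailBallsLarge) halfProg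
      exprHalfQ' code x0 x1 866000000 1000000000 = true → (x0 : ℝ) / (10 ^ 9 : ℕ) ≤ A →
      A ≤ (x1 : ℝ) / (10 ^ 9 : ℕ) → 0 < halfQ' A y := fun code x0 x1 hx h h1 h2 =>
    halfQ'_pos_of_check (by norm_num) (by norm_num) hx (by norm_num) h (by linarith) hy0 hy1 h1 h2
      (by norm_num at *; linarith) (by norm_num at *; linarith)
  rcases le_total A (3050000000 / (10 ^ 9 : ℕ)) with h | h
  · exact key _ _ _ (by norm_num) halfQ'_check_lower (by norm_num at *; linarith)
      (by norm_num at *; linarith)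
  rcases le_total A (3700000000 / (10 ^ 9 : ℕ)) with h' | h'
  · exact key _ _ _ (by norm_num) halfQ'_check_middle (by norm_num at *; linarith)
      (by norm_num at *; linarith)
  · exact key _ _ _ (by norm_num) halfQ'_check_upper (by norm_num at *; linarith)
      (by norm_num at *; linarith)

/-- On the line `x = 1 / 2` the energy increases from the hexagonal to the square lattice. -/
theorem En_half_strictMonoOn {A : ℝ} (hA0 : 2.8808 ≤ A) (hA1 : A ≤ 6.2832) :
    StrictMonoOn (En A (1 / 2)) (Set.Icc (√3 / 2) 1) := by
  have hA : 0 < A := by linarith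
  have h3 : 0.866 ≤ √3 / 2 := by
    have : (1.732 : ℝ) ≤ √3 := le_sqrt_of_sq_le (by norm_num)
    linarith
  have hs0 : 0 < √3 / 2 := by linarith
  have hmQ : StrictMonoOn (fun u => halfQ A (exp u)) (Set.Icc (log (√3 / 2)) 0) := by
    refine strictMonoOn_of_deriv_pos (convex_Icc _ _)
      (fun u _ => (hasDerivAt_halfQ hA u).continuousAt.continuousWithinAt) fun u hu => ?_
    rw [interior_Icc] at hu
    rw [(hasDerivAt_halfQ hA u).deriv]
    exact halfQ'_pos hA0 hA1 (h3.trans ((log_le_iff_le_exp hs0).1 hu.1.le))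
      (exp_le_one_iff.2 hu.2.le)
  have hm : StrictMonoOn (fun u => En A (1 / 2) (exp u)) (Set.Icc (log (√3 / 2)) 0) := by
    refine strictMonoOn_of_deriv_pos (convex_Icc _ _)
      (fun u _ => (hasDerivAt_En_half hA u).continuousAt.continuousWithinAt) fun u hu => ?_
    rw [interior_Icc] at hu
    rw [(hasDerivAt_En_half hA u).deriv]
    -- The logarithmic derivative increases and vanishes at the hexagonal point, so it is positive
    -- beyond it.
    have := hmQ ⟨le_rfl, hu.1.le.trans hu.2.le⟩ ⟨hu.1.le, hu.2.le⟩ hu.1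
    simp only [exp_log hs0, halfQ_hex hA] at this
    exact div_pos this hA
  intro y hy z hz hyz
  have hy' : 0 < y := hs0.trans_le hy.1
  have hz' : 0 < z := hs0.trans_le hz.1
  have := hm ⟨log_le_log hs0 hy.1, log_nonpos hy'.le hy.2⟩ ⟨log_le_log hs0 hz.1, log_nonpos hz'.le hz.2⟩
    (log_lt_log hy' hyz)
  simpa only [exp_log hy', exp_log hz'] using this

end RhombicMonotone
end LatticePhase

/-! ### Certified bounds for the interpolation error. -/

namespace LatticePhase

noncomputable section InterpolationError

open Real LatticePhase.Expr

/-- An enclosure of `π`. -/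
def piBall : Ball := Ball.add (Ball.const 314159265358979323846 (10 ^ 20)) (Ball.tail 1 (10 ^ 20))

theorem piBall_mem : piBall.Mem π := by
  have h := (Ball.mem_const 314159265358979323846 (10 ^ 20) (by norm_num)).add
    (Ball.mem_tail (a := 1) (b := 10 ^ 20) (by norm_num)
      (x := π - (314159265358979323846 : ℕ) / (10 ^ 20 : ℕ))
      (by have := pi_gt_d20; norm_num at *; linarith)
      (by have := pi_lt_d20; norm_num at *; linarith))
  rwa [add_sub_cancel] at h

theorem sqrt_le_half_add {t : ℝ} (ht : 0 ≤ t) : √t ≤ (1 + t) / 2 := by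
  nlinarith [sq_sqrt ht, sq_nonneg (√t - 1)]

/-- The error in the interpolation between `x = 0` and `x = 1 / 2`. -/
def errL (A y : ℝ) : ℝ := 4 * pref A y * interpErr (A * y) (π ^ 2 * y / A)

/-- Computes the parts of `errL`, from `y` (the variable `0`) and `A` (the variable `1`). -/
def errProg : List Expr :=
  [mul (var 0) (var 1), mul (mul (var 3) (var 3)) (mul (var 0) (var 2)), nexp (var 4), nexp (var 5),
    mul (var 6) (var 6), mul (var 7) (var 7), mul (var 8) (var 8), mul (var 9) (var 9),
    mul (var 10) (var 10), mul (var 11) (var 11),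
    mul (mul (mul (const 1 2) (add (const 1 2) (add (var 4) (var 5)))) (mul (var 6) (var 7)))
      (add (smul 82 (add (var 12) (var 13)))
        (mul (add (smul 16 (mul (var 6) (var 8))) (smul 82 (var 12)))
          (add (smul 16 (mul (var 7) (var 9))) (smul 82 (var 13))))),
    smul 2 (add (mul (sub (add (const 1 2) (var 4)) (smul 4 (var 5))) (mul (var 6) (var 11)))
      (mul (sub (add (const 1 2) (smul 4 (var 4))) (var 5)) (mul (var 10) (var 7)))),
    mul (smul 2 (add (const 1 1) (mul (var 3) (mul (var 0) (var 2))))) (var 2)]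

def exprErr (a b : ℕ) : Expr := sub (const a b) (mul (var 16) (var 14))

def exprErr' (a b : ℕ) : Expr := sub (const a b) (mul (var 16) (add (var 14) (var 15)))

/-- The square root in the prefactor is replaced by (1 + t)/2, and the maximum in `interpErr` is
handled by one check for each alternative. The first coordinate is y and the second A, so the
available inverse is 1/A. -/
theorem errL_lt_of_check {u code code' y0 y1 x0 x1 a b : ℕ} (hu : 0 < u) (hx0 : 0 < x0) (hy : y0 ≤ y1)
    (hx : x0 ≤ x1) (hb : 0 < b)
    (hc : checkWith u [piBall] errProg (exprErr a b) code y0 y1 x0 x1 = true)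
    (hc' : checkWith u [piBall] errProg (exprErr' a b) code' y0 y1 x0 x1 = true) {A y : ℝ}
    (hA : 0 < A) (hy' : 0 < y) (h1 : (x0 : ℝ) / u ≤ A) (h2 : A ≤ (x1 : ℝ) / u) (h3 : (y0 : ℝ) / u ≤ y)
    (h4 : y ≤ (y1 : ℝ) / u) : errL A y < a / b := by
  have hwf : ∀ e ∈ errProg, e.WF := by simp [errProg, sub, WF]
  have key : ∀ (e : Expr) (code : ℕ), e.WF → e.varsBelow 17 = true →
      checkWith u [piBall] errProg e code y0 y1 x0 x1 = true →
      ∃ G : ℕ → ℝ, 0 < e.evG G ∧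
        G 14 = 1 / 2 * (1 / 2 + A * y + π ^ 2 * y / A) * exp (-(A * y + π ^ 2 * y / A)) *
          (82 * exp (-(8 * (A * y))) + 82 * exp (-(8 * (π ^ 2 * y / A)))
            + qb (A * y) * qb (π ^ 2 * y / A)) ∧
        G 15 = 2 * ((1 / 2 + A * y - 4 * (π ^ 2 * y / A)) * exp (-(A * y + 4 * (π ^ 2 * y / A)))
          + (1 / 2 + 4 * (A * y) - π ^ 2 * y / A) * exp (-(4 * (A * y) + π ^ 2 * y / A))) ∧
        G 16 = 2 * (1 + π * y / A) / A := by
    intro e code he hv hck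
    obtain ⟨G, g0, g1, g2, gc, hs', hp⟩ := evG_pos_of_checkWith hu (.cons piBall_mem .nil) hwf he
      (by rfl) hv hx0 hy hx hck h3 h4 h1 h2
    have g3 : G 3 = π := by simpa using gc 0 (by simp)
    have q4 : G 4 = _ := hs' 0 (by simp [errProg])
    have q5 : G 5 = _ := hs' 1 (by simp [errProg])
    have q6 : G 6 = _ := hs' 2 (by simp [errProg])
    have q7 : G 7 = _ := hs' 3 (by simp [errProg])
    have q8 : G 8 = _ := hs' 4 (by simp [errProg])
    have q9 : G 9 = _ := hs' 5 (by simp [errProg])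
    have q10 : G 10 = _ := hs' 6 (by simp [errProg])
    have q11 : G 11 = _ := hs' 7 (by simp [errProg])
    have q12 : G 12 = _ := hs' 8 (by simp [errProg])
    have q13 : G 13 = _ := hs' 9 (by simp [errProg])
    have q14 : G 14 = _ := hs' 10 (by simp [errProg])
    have q15 : G 15 = _ := hs' 11 (by simp [errProg])
    have q16 : G 16 = _ := hs' 12 (by simp [errProg])
    simp only [errProg, List.getElem_cons_succ, List.getElem_cons_zero, evG, evG_sub, g0, g1, g2, g3]
      at q4 q5 q6 q7 q8 q9 q10 q11 q12 q13 q14 q15 q16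
    have q4' : G 4 = A * y := by rw [q4]; ring
    have q5' : G 5 = π ^ 2 * y / A := by rw [q5]; field_simp
    have pw : ∀ (k : ℕ) (t : ℝ), exp (-(k * t)) = exp (-t) ^ k := fun k t => by
      rw [← exp_nat_mul]; ring_nf
    have p3 := pw 3
    have p4 := pw 4
    have p8 := pw 8
    push_cast at p3 p4 p8
    rw [q4', q5'] at q14 q15
    rw [q4'] at q6
    rw [q5'] at q7
    rw [q12, q13, q10, q11, q8, q9, q6, q7] at q14
    rw [q10, q11, q8, q9, q6, q7] at q15
    refine ⟨G, hp, ?_, ?_, ?_⟩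
    · rw [q14, qb, qb, p3, p3, p8, p8, neg_add, exp_add]; push_cast; ring
    · rw [q15, neg_add, neg_add, exp_add, exp_add, p4, p4]; push_cast; ring
    · rw [q16]; push_cast; field_simp
  obtain ⟨G, hp, k13, k14, k15⟩ := key (exprErr a b) _ (by simp [exprErr, sub, WF, hb]) (by rfl) hc
  obtain ⟨G', hp', k13', k14', k15'⟩ := key (exprErr' a b) _ (by simp [exprErr', sub, WF, hb])
    (by rfl) hc'
  simp only [exprErr, exprErr', evG_sub, evG] at hp hp'
  rw [k13, k15] at hp
  rw [k13', k14', k15'] at hp'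
  set r := 1 / 2 * (1 / 2 + A * y + π ^ 2 * y / A) * exp (-(A * y + π ^ 2 * y / A)) *
          (82 * exp (-(8 * (A * y))) + 82 * exp (-(8 * (π ^ 2 * y / A)))
            + qb (A * y) * qb (π ^ 2 * y / A)) with hr
  have hr0 : 0 ≤ r := by
    have hpi := pi_pos
    have : 0 ≤ π ^ 2 * y / A := by positivity
    have : 0 ≤ A * y := by positivity
    rw [hr]; unfold qb; positivity
  have hpf : 4 * pref A y ≤ 2 * (1 + π * y / A) / A := by
    have ht : 0 ≤ π * y / A := by have := pi_pos; positivity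
    have hsq := sqrt_le_half_add ht
    unfold pref
    rw [← mul_div_assoc, div_le_div_iff_of_pos_right hA]
    linarith
  have hP := pref_pos hA hy'
  have ha0 : 0 < (a : ℝ) / b := by
    have : 0 ≤ 2 * (1 + π * y / A) / A * r := mul_nonneg (by linarith) hr0
    linarith
  have hi : interpErr (A * y) (π ^ 2 * y / A) = 2 * max 0 ((1 / 2 + A * y - 4 * (π ^ 2 * y / A))
      * exp (-(A * y + 4 * (π ^ 2 * y / A))) + (1 / 2 + 4 * (A * y) - π ^ 2 * y / A)
      * exp (-(4 * (A * y) + π ^ 2 * y / A))) + r := rfl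
  rw [errL, hi]
  set e := (1 / 2 + A * y - 4 * (π ^ 2 * y / A))
      * exp (-(A * y + 4 * (π ^ 2 * y / A))) + (1 / 2 + 4 * (A * y) - π ^ 2 * y / A)
      * exp (-(4 * (A * y) + π ^ 2 * y / A))
  rcases le_total e 0 with he | he
  · rw [max_eq_left he]
    have := mul_le_mul_of_nonneg_right hpf hr0
    linarith
  · rw [max_eq_right he]
    have := mul_le_mul_of_nonneg_right hpf (by linarith : 0 ≤ 2 * e + r)
    linarith

theorem errL_lt_of_le_2_875 {A y : ℝ} (hA0 : 2.843 ≤ A) (hA1 : A ≤ 2.875) (hy0 : 0.866 ≤ y) (hy1 : y ≤ 1) :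
    errL A y < 42 / 10 ^ 6 := by
  have := errL_lt_of_check (u := 10 ^ 9) (code := 0)
    (code' := 121)
    (y0 := 866000000) (y1 := 1000000000) (x0 := 2843000000) (x1 := 2875000000) (a := 42)
    (b := 10 ^ 6) (by norm_num) (by norm_num) (by norm_num) (by norm_num) (by norm_num)
    (by decide +kernel) (by decide +kernel) (A := A) (y := y) (by linarith) (by linarith)
    (by norm_num at *; linarith) (by norm_num at *; linarith) (by norm_num at *; linarith)
    (by norm_num at *; linarith)
  exact_mod_cast this

theorem errL_lt_of_le_2_881 {A y : ℝ} (hA0 : 2.875 ≤ A) (hA1 : A ≤ 2.881) (hy0 : 0.866 ≤ y) (hy1 : y ≤ 1) :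
    errL A y < 365 / 10 ^ 7 := by
  have := errL_lt_of_check (u := 10 ^ 9) (code := 0)
    (code' := 40)
    (y0 := 866000000) (y1 := 1000000000) (x0 := 2875000000) (x1 := 2881000000) (a := 365)
    (b := 10 ^ 7) (by norm_num) (by norm_num) (by norm_num) (by norm_num) (by norm_num)
    (by decide +kernel) (by decide +kernel) (A := A) (y := y) (by linarith) (by linarith)
    (by norm_num at *; linarith) (by norm_num at *; linarith) (by norm_num at *; linarith)
    (by norm_num at *; linarith)
  exact_mod_cast this

/-- The strips in y and their bounds are matched to the energy gaps used in `lt_En_of_window`: four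
times the bound stays below the gap, except on the strip from 0.94 to 0.97, where gaps on both lines
are available and the factor four is not needed. -/
theorem errL_lt_of_le_0_9 {A y : ℝ} (hA0 : 2.8808 ≤ A) (hA1 : A ≤ 3.2) (hy0 : 0.866 ≤ y) (hy1 : y ≤ 0.9) :
    errL A y < 36 / 10 ^ 6 := by
  have := errL_lt_of_check (u := 10 ^ 9) (code := 0)
    (code' := 782814452)
    (y0 := 866000000) (y1 := 900000000) (x0 := 2880800000) (x1 := 3200000000) (a := 36)
    (b := 10 ^ 6) (by norm_num) (by norm_num) (by norm_num) (by norm_num) (by norm_num)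
    (by decide +kernel) (by decide +kernel) (A := A) (y := y) (by linarith) (by linarith)
    (by norm_num at *; linarith) (by norm_num at *; linarith) (by norm_num at *; linarith)
    (by norm_num at *; linarith)
  exact_mod_cast this

theorem errL_lt_of_le_0_92 {A y : ℝ} (hA0 : 2.8808 ≤ A) (hA1 : A ≤ 3.2) (hy0 : 0.9 ≤ y) (hy1 : y ≤ 0.92) :
    errL A y < 23 / 10 ^ 6 := by
  have := errL_lt_of_check (u := 10 ^ 9) (code := 0)
    (code' := 87689600)
    (y0 := 900000000) (y1 := 920000000) (x0 := 2880800000) (x1 := 3200000000) (a := 23)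
    (b := 10 ^ 6) (by norm_num) (by norm_num) (by norm_num) (by norm_num) (by norm_num)
    (by decide +kernel) (by decide +kernel) (A := A) (y := y) (by linarith) (by linarith)
    (by norm_num at *; linarith) (by norm_num at *; linarith) (by norm_num at *; linarith)
    (by norm_num at *; linarith)
  exact_mod_cast this

theorem errL_lt_of_le_0_94 {A y : ℝ} (hA0 : 2.8808 ≤ A) (hA1 : A ≤ 3.2) (hy0 : 0.92 ≤ y) (hy1 : y ≤ 0.94) :
    errL A y < 18 / 10 ^ 6 := by
  have := errL_lt_of_check (u := 10 ^ 9) (code := 0)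
    (code' := 9743705)
    (y0 := 920000000) (y1 := 940000000) (x0 := 2880800000) (x1 := 3200000000) (a := 18)
    (b := 10 ^ 6) (by norm_num) (by norm_num) (by norm_num) (by norm_num) (by norm_num)
    (by decide +kernel) (by decide +kernel) (A := A) (y := y) (by linarith) (by linarith)
    (by norm_num at *; linarith) (by norm_num at *; linarith) (by norm_num at *; linarith)
    (by norm_num at *; linarith)
  exact_mod_cast this

theorem errL_lt_of_le_0_97 {A y : ℝ} (hA0 : 2.8808 ≤ A) (hA1 : A ≤ 3.2) (hy0 : 0.94 ≤ y) (hy1 : y ≤ 0.97) :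
    errL A y < 14 / 10 ^ 6 := by
  have := errL_lt_of_check (u := 10 ^ 9) (code := 0)
    (code' := 86979821)
    (y0 := 940000000) (y1 := 970000000) (x0 := 2880800000) (x1 := 3200000000) (a := 14)
    (b := 10 ^ 6) (by norm_num) (by norm_num) (by norm_num) (by norm_num) (by norm_num)
    (by decide +kernel) (by decide +kernel) (A := A) (y := y) (by linarith) (by linarith)
    (by norm_num at *; linarith) (by norm_num at *; linarith) (by norm_num at *; linarith)
    (by norm_num at *; linarith)
  exact_mod_cast this

theorem errL_lt_of_le_one {A y : ℝ} (hA0 : 2.8808 ≤ A) (hA1 : A ≤ 3.2) (hy0 : 0.97 ≤ y) (hy1 : y ≤ 1) :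
    errL A y < 93 / 10 ^ 7 := by
  have := errL_lt_of_check (u := 10 ^ 9) (code := 0)
    (code' := 787597421)
    (y0 := 970000000) (y1 := 1000000000) (x0 := 2880800000) (x1 := 3200000000) (a := 93)
    (b := 10 ^ 7) (by norm_num) (by norm_num) (by norm_num) (by norm_num) (by norm_num)
    (by decide +kernel) (by decide +kernel) (A := A) (y := y) (by linarith) (by linarith)
    (by norm_num at *; linarith) (by norm_num at *; linarith) (by norm_num at *; linarith)
    (by norm_num at *; linarith)
  exact_mod_cast this

theorem errL_lt_of_ge {A y : ℝ} (hA0 : 3.2 ≤ A) (hA1 : A ≤ 6.2832) (hy0 : 0.866 ≤ y) (hy1 : y ≤ 1) :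
    errL A y < 14 / 10 ^ 6 := by
  have := errL_lt_of_check (u := 10 ^ 9) (code := 1157882965496)
    (code' := 19642556623728631987671293776562044319357841214888093918000146776796737309882687)
    (y0 := 866000000) (y1 := 1000000000) (x0 := 3200000000) (x1 := 6283200000) (a := 14)
    (b := 10 ^ 6) (by norm_num) (by norm_num) (by norm_num) (by norm_num) (by norm_num)
    (by decide +kernel) (by decide +kernel) (A := A) (y := y) (by linarith) (by linarith)
    (by norm_num at *; linarith) (by norm_num at *; linarith) (by norm_num at *; linarith)
    (by norm_num at *; linarith)
  exact_mod_cast this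

end InterpolationError
end LatticePhase

/-! ### Certified differences of energies of rectangular, rhombic and square lattices. -/

namespace LatticePhase

noncomputable section WindowEnergies

open Real LatticePhase.Expr

namespace Expr

/-- Computes `tp 0 0 X` and `tp 0 1 X`, as the variables `n + 5` and `n + 6`. -/
def blockInt (n t : ℕ) (x : Expr) : List Expr :=
  [x, nexp (var n), mul (var (n + 1)) (var (n + 1)), mul (var (n + 2)) (var (n + 2)),
    mul (var n) (add (var (n + 1)) (smul 4 (var (n + 3)))),
    add (const 1 1) (smul 2 (add (add (var (n + 1)) (var (n + 3))) (var t))),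
    smul 2 (add (var (n + 4)) (var (t + 1)))]

theorem Sat.blockInt {G : ℕ → ℝ} {n t : ℕ} {x : Expr} (h : Sat G n (blockInt n t x)) {X : ℝ}
    (hx : evG G x = X) (hX : 0 < X) (h0 : G t = hs 0 3 X) (h1 : G (t + 1) = hs 1 3 X) :
    G (n + 5) = tp 0 0 X ∧ G (n + 6) = tp 0 1 X := by
  have q0 : G (n + 0) = _ := h 0 (by simp [Expr.blockInt])
  have q1 : G (n + 1) = _ := h 1 (by simp [Expr.blockInt])
  have q2 : G (n + 2) = _ := h 2 (by simp [Expr.blockInt])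
  have q3 : G (n + 3) = _ := h 3 (by simp [Expr.blockInt])
  have q4 : G (n + 4) = _ := h 4 (by simp [Expr.blockInt])
  have q5 : G (n + 5) = _ := h 5 (by simp [Expr.blockInt])
  have q6 : G (n + 6) = _ := h 6 (by simp [Expr.blockInt])
  have E4 : exp (-(4 * X)) = exp (-X) ^ 4 := by rw [← exp_nat_mul]; push_cast; ring_nf
  rw [tp_zero_expand 0 hX, tp_zero_expand 1 hX, E4]
  simp only [add_zero] at q0
  simp only [Expr.blockInt, List.getElem_cons_succ, List.getElem_cons_zero, evG] at q0 q1 q2 q3 q4 q5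
  simp only [Expr.blockInt, List.getElem_cons_succ, List.getElem_cons_zero, evG] at q6
  rw [q0, hx] at q1 q4
  constructor
  · rw [q5, q3, q2, q1, h0]; push_cast; ring
  · rw [q6, q4, q3, q2, q1, h1]; push_cast; ring

/-- Computes `tp 0 0`, `tp 0 1`, `tp (1 / 2) 0` and `tp (1 / 2) 1`, as the variables
`n + 10, …, n + 13`. -/
def blockPair (n t : ℕ) (x : Expr) : List Expr :=
  [x, mul (const 1 4) (var n), nexp (var (n + 1)), mul (var (n + 2)) (var (n + 2)),
    mul (var (n + 3)) (var (n + 3)), mul (var (n + 4)) (var (n + 4)),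
    mul (var (n + 2)) (var (n + 5)), mul (var (n + 5)) (var (n + 5)),
    mul (var (n + 1)) (add (smul 4 (var (n + 4))) (smul 16 (var (n + 7)))),
    mul (var (n + 1)) (add (var (n + 2)) (smul 9 (var (n + 6)))),
    add (const 1 1) (smul 2 (add (add (var (n + 4)) (var (n + 7))) (var t))),
    smul 2 (add (var (n + 8)) (var (t + 1))),
    smul 2 (add (add (var (n + 2)) (var (n + 6))) (var (t + 2))),
    smul 2 (add (var (n + 9)) (var (t + 3)))]

/-- The tails used by `blockPair`, in the order of the environment. -/
def tailsPair (X : ℝ) : List ℝ := [hs 1 (5 / 2) X, hs 0 (5 / 2) X, hs 1 3 X, hs 0 3 X]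

theorem Sat.blockPair {G : ℕ → ℝ} {n t : ℕ} {x : Expr} (h : Sat G n (blockPair n t x)) {X : ℝ}
    (hx : evG G x = X) (hX : 0 < X) (ht : ∀ i, i < 4 → G (t + i) = (tailsPair X).getD (3 - i) 0) :
    G (n + 10) = tp 0 0 X ∧ G (n + 11) = tp 0 1 X ∧ G (n + 12) = tp (1 / 2) 0 X ∧
      G (n + 13) = tp (1 / 2) 1 X := by
  have q0 : G (n + 0) = _ := h 0 (by simp [Expr.blockPair])
  have q1 : G (n + 1) = _ := h 1 (by simp [Expr.blockPair])
  have q2 : G (n + 2) = _ := h 2 (by simp [Expr.blockPair])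
  have q3 : G (n + 3) = _ := h 3 (by simp [Expr.blockPair])
  have q4 : G (n + 4) = _ := h 4 (by simp [Expr.blockPair])
  have q5 : G (n + 5) = _ := h 5 (by simp [Expr.blockPair])
  have q6 : G (n + 6) = _ := h 6 (by simp [Expr.blockPair])
  have q7 : G (n + 7) = _ := h 7 (by simp [Expr.blockPair])
  have q8 : G (n + 8) = _ := h 8 (by simp [Expr.blockPair])
  have q9 : G (n + 9) = _ := h 9 (by simp [Expr.blockPair])
  have q10 : G (n + 10) = _ := h 10 (by simp [Expr.blockPair])
  have q11 : G (n + 11) = _ := h 11 (by simp [Expr.blockPair])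
  have q12 : G (n + 12) = _ := h 12 (by simp [Expr.blockPair])
  have q13 : G (n + 13) = _ := h 13 (by simp [Expr.blockPair])
  have t0 : G t = hs 0 3 X := ht 0 (by norm_num)
  have t1 : G (t + 1) = hs 1 3 X := ht 1 (by norm_num)
  have t2 : G (t + 2) = hs 0 (5 / 2) X := ht 2 (by norm_num)
  have t3 : G (t + 3) = hs 1 (5 / 2) X := ht 3 (by norm_num)
  obtain ⟨E1, E4, E9⟩ := exp_neg_eq_quarter_pow X
  rw [tp_zero_expand 0 hX, tp_zero_expand 1 hX, tp_half_expand 0 hX, tp_half_expand 1 hX, E1, E4, E9]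
  simp only [add_zero] at q0
  simp only [Expr.blockPair, List.getElem_cons_succ, List.getElem_cons_zero, evG] at q0 q1 q2 q3 q4
  simp only [Expr.blockPair, List.getElem_cons_succ, List.getElem_cons_zero, evG] at q5 q6 q7 q8 q9
  simp only [Expr.blockPair, List.getElem_cons_succ, List.getElem_cons_zero, evG] at q10 q11 q12 q13
  rw [q0, hx] at q1
  rw [q1] at q2 q8 q9
  push_cast at *
  generalize exp (-(1 / 4 * X)) = Q at *
  rw [q2] at q3 q6 q9 q12
  refine ⟨?_, ?_, ?_, ?_⟩
  · rw [q10, q7, q5, q4, q3, t0]; ring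
  · rw [q11, q8, q7, q5, q4, q3, t1]; ring
  · rw [q12, q6, q5, q4, q3, t2]; ring
  · rw [q13, q9, q6, q5, q4, q3, t3]; ring

/-- The variant of `blockPair` for large arguments: the values are the variables
`n + 5, …, n + 8`. -/
def blockPairLarge (n t : ℕ) (x : Expr) : List Expr :=
  [x, mul (const 1 4) (var n), nexp (var (n + 1)), mul (var (n + 2)) (var (n + 2)),
    mul (var (n + 3)) (var (n + 3)), add (const 1 1) (smul 2 (add (var (n + 4)) (var t))),
    smul 2 (add (mul (var n) (var (n + 4))) (var (t + 1))),
    smul 2 (add (var (n + 2)) (var (t + 2))),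
    smul 2 (add (mul (var (n + 1)) (var (n + 2))) (var (t + 3)))]

/-- The tails used by `blockPairLarge`, in the order of the environment. -/
def tailsPairLarge (X : ℝ) : List ℝ := [hs 1 (3 / 2) X, hs 0 (3 / 2) X, hs 1 2 X, hs 0 2 X]

theorem Sat.blockPairLarge {G : ℕ → ℝ} {n t : ℕ} {x : Expr} (h : Sat G n (blockPairLarge n t x))
    {X : ℝ} (hx : evG G x = X) (hX : 0 < X)
    (ht : ∀ i, i < 4 → G (t + i) = (tailsPairLarge X).getD (3 - i) 0) :
    G (n + 5) = tp 0 0 X ∧ G (n + 6) = tp 0 1 X ∧ G (n + 7) = tp (1 / 2) 0 X ∧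
      G (n + 8) = tp (1 / 2) 1 X := by
  have q0 : G (n + 0) = _ := h 0 (by simp [Expr.blockPairLarge])
  have q1 : G (n + 1) = _ := h 1 (by simp [Expr.blockPairLarge])
  have q2 : G (n + 2) = _ := h 2 (by simp [Expr.blockPairLarge])
  have q3 : G (n + 3) = _ := h 3 (by simp [Expr.blockPairLarge])
  have q4 : G (n + 4) = _ := h 4 (by simp [Expr.blockPairLarge])
  have q5 : G (n + 5) = _ := h 5 (by simp [Expr.blockPairLarge])
  have q6 : G (n + 6) = _ := h 6 (by simp [Expr.blockPairLarge])
  have q7 : G (n + 7) = _ := h 7 (by simp [Expr.blockPairLarge])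
  have q8 : G (n + 8) = _ := h 8 (by simp [Expr.blockPairLarge])
  have t0 : G t = hs 0 2 X := ht 0 (by norm_num)
  have t1 : G (t + 1) = hs 1 2 X := ht 1 (by norm_num)
  have t2 : G (t + 2) = hs 0 (3 / 2) X := ht 2 (by norm_num)
  have t3 : G (t + 3) = hs 1 (3 / 2) X := ht 3 (by norm_num)
  rw [tp_zero_expand_large 0 hX, tp_zero_expand_large 1 hX, tp_half_expand_large 0 hX,
    tp_half_expand_large 1 hX, (exp_neg_eq_quarter_pow X).1]
  simp only [add_zero] at q0
  simp only [Expr.blockPairLarge, List.getElem_cons_succ, List.getElem_cons_zero, evG] at q0 q1 q2 q3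
  simp only [Expr.blockPairLarge, List.getElem_cons_succ, List.getElem_cons_zero, evG] at q4 q5 q6
  simp only [Expr.blockPairLarge, List.getElem_cons_succ, List.getElem_cons_zero, evG] at q7 q8
  rw [q0, hx] at q1 q6
  rw [q1] at q2 q8
  push_cast at *
  generalize exp (-(1 / 4 * X)) = Q at *
  rw [q2] at q3 q7 q8
  refine ⟨?_, ?_, ?_, ?_⟩
  · rw [q5, q4, q3, t0]; ring
  · rw [q6, q4, q3, t1]; ring
  · rw [q7, t2]; ring
  · rw [q8, t3]; ring

/-- The terms of a mixed theta product that enter an energy. -/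
def mixedPair (s b : ℕ) : Expr :=
  add (add (mul (var (s + 1)) (var b)) (mul (var s) (var (b + 1))))
    (add (mul (var (s + 3)) (var (b + 2))) (mul (var (s + 2)) (var (b + 3))))

end Expr

def tailBallsPair : List Ball :=
  [Ball.tail 1 1000000, Ball.tail 6 100000000, Ball.tail 1 1000000000, Ball.tail 1 1000000000]

theorem tailsPair_mem {X : ℝ} (hX : 14 / 5 ≤ X) :
    List.Forall₂ Ball.Mem tailBallsPair (tailsPair X) := by
  rcases tails_mem hX with _ | ⟨_, _ | ⟨_, _ | ⟨h1, _ | ⟨h2, _ | ⟨_, _ | ⟨_, _ | ⟨h3, _ | ⟨h4, _⟩⟩⟩⟩⟩⟩⟩⟩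
  exact .cons h1 (.cons h2 (.cons h3 (.cons h4 .nil)))

def tailBallsPairLarge : List Ball :=
  [Ball.tail 2 100000000, Ball.tail 1 1000000000, Ball.tail 1 1000000000, Ball.tail 1 1000000000]

theorem tailsPairLarge_mem {X : ℝ} (hX : 49 / 5 ≤ X) :
    List.Forall₂ Ball.Mem tailBallsPairLarge (tailsPairLarge X) := by
  rcases tailsLarge_mem hX with _ | ⟨_, _ | ⟨_, _ | ⟨h1, _ | ⟨h2, _ | ⟨_, _ | ⟨_, _ | ⟨h3, _ | ⟨h4, _⟩⟩⟩⟩⟩⟩⟩⟩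
  exact .cons h1 (.cons h2 (.cons h3 (.cons h4 .nil)))

theorem hs_three_le {X : ℝ} (hX : 5 / 2 ≤ X) {j : ℕ} (hj : j ≤ 1) :
    (Ball.tail 1 (10 ^ 8)).Mem (hs j 3 X) := by
  have r1 := (exp_neg_lt_of_le (w := (2 * 3 + 1) * (5 / 2)) 17 1 1 1000 (by norm_num) (by norm_num)
    (by norm_num) (by decide +kernel)).le
  have e1 := (exp_neg_lt_of_le (w := 3 ^ 2 * (5 / 2)) 225 10 2 (10 ^ 10) (by norm_num)
    (by norm_num) (by norm_num) (by decide +kernel)).le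
  refine Ball.mem_tail (by norm_num) (hs_nonneg _ _ (by linarith)) ?_
  refine hs_tail_le 3 (5 / 2) j rfl (by norm_num) (by norm_num) hX (by norm_num) ?_ r1 ?_ e1 ?_
  all_goals interval_cases j <;> norm_num

def rectProg : List Expr :=
  blockInt 9 3 (mul (var 0) (var 1)) ++ (blockInt 16 5 (mul (var 0) (var 2)) ++ blockInt 23 7 (var 0))

/-- `A` times the difference of the energies of a rectangular lattice and the square lattice, minus
`A a / b`. -/
def exprRect (a b : ℕ) : Expr :=
  sub (add (mul (var 15) (var 21)) (mul (var 14) (var 22)))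
    (add (smul 2 (mul (var 28) (var 29))) (mul (const a b) (var 0)))

theorem lt_En_zero_sub {u code x0 x1 z a b : ℕ} (hu : 0 < u) (hz : 0 < z) (hx : x0 ≤ x1) (hb : 0 < b)
    (hc : checkWith u [Ball.tail 1 (10 ^ 8), Ball.tail 1 (10 ^ 8), Ball.tail 1 (10 ^ 8),
      Ball.tail 1 (10 ^ 8), Ball.tail 1 (10 ^ 8), Ball.tail 1 (10 ^ 8)] rectProg (exprRect a b)
      code x0 x1 z z = true) {A y : ℝ} (hA : 2.88 ≤ A) (hy : y = z / u) (hy0 : 0.9 ≤ y) (hy1 : y ≤ 1)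
    (h1 : (x0 : ℝ) / u ≤ A) (h2 : A ≤ (x1 : ℝ) / u) : a / b < En A 0 y - En A 0 1 := by
  have hA' : 0 < A := by linarith
  have hy' : 0 < y := by linarith
  have hS : 5 / 2 ≤ A * y := by nlinarith
  have hB : 5 / 2 ≤ A / y := by rw [le_div_iff₀ hy']; nlinarith
  have hwf : ∀ e ∈ rectProg, e.WF := by
    simp [rectProg, Expr.blockInt, WF]
  obtain ⟨G, g0, g1, g2, gc, hs', hp⟩ := evG_pos_of_checkWith hu
    (c := [hs 1 3 A, hs 0 3 A, hs 1 3 (A / y), hs 0 3 (A / y), hs 1 3 (A * y), hs 0 3 (A * y)])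
    (.cons (hs_three_le (by linarith) (by norm_num)) (.cons (hs_three_le (by linarith) (by norm_num))
      (.cons (hs_three_le hB (by norm_num)) (.cons (hs_three_le hB (by norm_num))
      (.cons (hs_three_le hS (by norm_num)) (.cons (hs_three_le hS (by norm_num)) .nil)))))) hwf
    (by simp [exprRect, sub, WF, hb]) (by rfl) (by rfl) hz hx le_rfl hc h1 h2 hy.ge hy.le
  have eS : evG G (mul (var 0) (var 1)) = A * y := by simp [evG, g0, g1]
  have eB : evG G (mul (var 0) (var 2)) = A / y := by simp [evG, g0, g2, div_eq_mul_inv]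
  obtain ⟨s0, s1⟩ := Sat.blockInt (n := 9) (t := 3) hs'.left eS (by linarith)
    (by simpa using gc 0 (by simp)) (by simpa using gc 1 (by simp))
  obtain ⟨b0, b1⟩ := Sat.blockInt (n := 16) (t := 5) (hs'.right rfl).left eB (by linarith)
    (by simpa using gc 2 (by simp)) (by simpa using gc 3 (by simp))
  obtain ⟨a0, a1⟩ := Sat.blockInt (n := 23) (t := 7) ((hs'.right rfl).right rfl) g0 (by linarith)
    (by simpa using gc 4 (by simp)) (by simpa using gc 5 (by simp))
  simp only [Nat.reduceAdd] at s0 s1 b0 b1 a0 a1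
  simp only [exprRect, evG_sub, evG, g0] at hp
  rw [s0, s1, b0, b1, a0, a1] at hp
  rw [En_zero_eq hA' hy', En_zero_eq hA' one_pos, mul_one, div_one, ← sub_div, lt_div_iff₀ hA']
  push_cast at hp
  linarith

def mixedAt (s b i j : ℕ) : Expr :=
  add (mul (var (s + i)) (var (b + j))) (mul (var (s + 4 + i)) (var (b + 4 + j)))

def halfRectProg : List Expr :=
  blockLarge 27 3 (smul 4 (mul (var 0) (var 1))) ++ (block 44 11 (mul (var 0) (var 2)) ++
    block 69 19 (var 0))

/-- `A` times the difference of the energies of the square lattice and a rhombic lattice. -/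
def squareGap (A y : ℝ) : ℝ :=
  2 * (tp 0 0 A * tp 0 1 A) - (mixed 1 0 (4 * (A * y)) (A / y) + mixed 0 1 (4 * (A * y)) (A / y))

theorem En_zero_one_sub {A y : ℝ} (hA : 0 < A) (hy : 0 < y) :
    En A 0 1 - En A (1 / 2) y = squareGap A y / A := by
  rw [En_half_eq hA hy, En_zero_eq hA one_pos, mul_one, div_one, ← sub_div, squareGap]
  ring

/-- The logarithmic derivative of `squareGap` in `A`. -/
def squareGap' (A y : ℝ) : ℝ :=
  2 * (tp 0 0 A * tp 0 1 A - tp 0 1 A ^ 2 - tp 0 0 A * tp 0 2 A) -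
    (mixed 1 0 (4 * (A * y)) (A / y) + mixed 0 1 (4 * (A * y)) (A / y)
      - mixed 2 0 (4 * (A * y)) (A / y) - 2 * mixed 1 1 (4 * (A * y)) (A / y)
      - mixed 0 2 (4 * (A * y)) (A / y))

/-- Differentiation in log A at fixed y: both theta arguments grow, in contrast to
`hasDerivAt_mixed`, where they move in opposite directions. -/
theorem hasDerivAt_mixed_scale (i j : ℕ) {y : ℝ} (hy : 0 < y) (u : ℝ) :
    HasDerivAt (fun u => mixed i j (4 * (exp u * y)) (exp u / y))
      ((i + j) * mixed i j (4 * (exp u * y)) (exp u / y)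
        - mixed (i + 1) j (4 * (exp u * y)) (exp u / y)
        - mixed i (j + 1) (4 * (exp u * y)) (exp u / y)) u := by
  have e1 : ∀ s, 4 * (exp s * y) = exp (log (4 * y) + s) := fun s => by
    rw [exp_add, exp_log (by positivity)]; ring
  have e2 : ∀ s, exp s / y = exp (s - log y) := fun s => by rw [exp_sub, exp_log hy]
  have i1 : HasDerivAt (fun s => log (4 * y) + s) 1 u := by
    simpa using (hasDerivAt_id u).const_add (log (4 * y))
  have i2 : HasDerivAt (fun s => s - log y) 1 u := by
    simpa using (hasDerivAt_id u).sub_const (log y)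
  have h := fun ξ => ((hasDerivAt_tp ξ i (log (4 * y) + u)).comp u i1).mul
    ((hasDerivAt_tp ξ j (u - log y)).comp u i2)
  have h' := (h 0).add (h (1 / 2))
  simp only [e1, e2]
  refine HasDerivAt.congr_deriv (f := fun u => mixed i j (exp (log (4 * y) + u)) (exp (u - log y)))
    h' ?_
  simp only [mixed, Function.comp]
  ring

theorem hasDerivAt_squareGap {y : ℝ} (hy : 0 < y) (u : ℝ) :
    HasDerivAt (fun u => squareGap (exp u) y) (squareGap' (exp u) y) u := by
  refine ((((hasDerivAt_tp 0 0 u).mul (hasDerivAt_tp 0 1 u)).const_mul 2).sub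
    ((hasDerivAt_mixed_scale 1 0 hy u).add (hasDerivAt_mixed_scale 0 1 hy u))).congr_deriv ?_
  unfold squareGap'
  push_cast
  ring

def exprSquareGap' : Expr :=
  sub (add (smul 2 (mul (var 86) (var 87)))
      (add (add (mixedAt 36 61 2 0) (mixedAt 36 61 0 2)) (smul 2 (mixedAt 36 61 1 1))))
    (add (smul 2 (add (mul (var 87) (var 87)) (mul (var 86) (var 88))))
      (add (mixedAt 36 61 1 0) (mixedAt 36 61 0 1)))

theorem halfRect_values {u code x0 x1 y0 y1 : ℕ} {e : Expr} (he : e.WF) (hv : e.varsBelow 94 = true)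
    (hu : 0 < u) (hy0 : 0 < y0) (hx : x0 ≤ x1) (hy : y0 ≤ y1)
    (hc : checkWith u (tailBalls ++ (tailBalls ++ tailBallsLarge)) halfRectProg e code
      x0 x1 y0 y1 = true) {A y : ℝ} (hA : 2.843 ≤ A) (hy0' : 0.866 ≤ y) (hy1' : y ≤ 1)
    (h1 : (x0 : ℝ) / u ≤ A) (h2 : A ≤ (x1 : ℝ) / u) (h3 : (y0 : ℝ) / u ≤ y) (h4 : y ≤ (y1 : ℝ) / u) :
    ∃ G : ℕ → ℝ, G 0 = A ∧ 0 < evG G e ∧ (G 86 = tp 0 0 A ∧ G 87 = tp 0 1 A ∧ G 88 = tp 0 2 A) ∧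
      ((∀ j ≤ 2, G (36 + j) = tp 0 j (4 * (A * y))) ∧
        ∀ j ≤ 2, G (40 + j) = tp (1 / 2) j (4 * (A * y))) ∧
      (∀ j ≤ 2, G (61 + j) = tp 0 j (A / y)) ∧ ∀ j ≤ 2, G (65 + j) = tp (1 / 2) j (A / y) := by
  have hA' : 0 < A := by linarith
  have hy' : 0 < y := by linarith
  have hS : 49 / 5 ≤ 4 * (A * y) := by nlinarith
  have hB : 14 / 5 ≤ A / y := by rw [le_div_iff₀ (by linarith)]; nlinarith
  have hwf : ∀ e ∈ halfRectProg, e.WF := by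
    intro e he
    rcases List.mem_append.1 he with h | h
    · exact blockLarge_wf _ _ (by simp [WF]) e h
    rcases List.mem_append.1 h with h | h
    · exact block_wf _ _ (by simp [WF]) e h
    · exact block_wf _ _ (by simp [WF]) e h
  obtain ⟨G, g0, g1, g2, gc, hs', hp⟩ := evG_pos_of_checkWith hu
    (List.rel_append (tails_mem (X := A) (by linarith))
      (List.rel_append (tails_mem hB) (tailsLarge_mem hS))) hwf
    he (by rfl) hv hy0 hx hy hc h1 h2 h3 h4
  have eS : evG G (smul 4 (mul (var 0) (var 1))) = 4 * (A * y) := by simp [evG, g0, g1]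
  have eB : evG G (mul (var 0) (var 2)) = A / y := by simp [evG, g0, g2, div_eq_mul_inv]
  have eA : evG G (var 0) = A := g0
  have tS := get_tailsLarge (4 * (A * y)) (G := G) (t := 3) (fun i hi => by
    rw [gc i (by simp [tails, tailsLarge]; omega)]
    interval_cases i <;> simp [tails, tailsLarge])
  have tB := get_tails (A / y) (G := G) (t := 11) (fun i hi => by
    rw [show 11 + i = 3 + (8 + i) by ring, gc (8 + i) (by simp [tails, tailsLarge]; omega)]
    interval_cases i <;> simp [tails, tailsLarge])
  have tA := get_tails A (G := G) (t := 19) (fun i hi => by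
    rw [show 19 + i = 3 + (16 + i) by ring, gc (16 + i) (by simp [tails, tailsLarge]; omega)]
    interval_cases i <;> simp [tails, tailsLarge])
  obtain ⟨⟨s0, s1, s2, -⟩, s4, s5, s6, -⟩ := Sat.blockLarge (n := 27) (t := 3) hs'.left
    (by rw [eS]; linarith) (by rw [eS]; exact tS.1) (by rw [eS]; exact tS.2)
  obtain ⟨⟨b0, b1, b2, -⟩, b4, b5, b6, -⟩ := Sat.block (n := 44) (t := 11)
    (hs'.right rfl).left
    (by rw [eB]; linarith) (by rw [eB]; exact tB.1) (by rw [eB]; exact tB.2)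
  obtain ⟨⟨a0, a1, a2, -⟩, -⟩ := Sat.block (n := 69) (t := 19)
    ((hs'.right rfl).right rfl)
    (by rw [eA]; linarith) (by rw [eA]; exact tA.1) (by rw [eA]; exact tA.2)
  rw [eS] at s0 s1 s2 s4 s5 s6
  rw [eB] at b0 b1 b2 b4 b5 b6
  rw [eA] at a0 a1 a2
  refine ⟨G, g0, hp, ⟨a0, a1, a2⟩, ⟨fun j hj => ?_, fun j hj => ?_⟩, fun j hj => ?_, fun j hj => ?_⟩
  · interval_cases j <;> assumption
  · interval_cases j <;> assumption
  · interval_cases j <;> assumption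
  · interval_cases j <;> assumption

theorem squareGap'_pos_of_check {u code x0 x1 y0 y1 : ℕ} (hu : 0 < u) (hy0 : 0 < y0) (hx : x0 ≤ x1)
    (hy : y0 ≤ y1)
    (hc : checkWith u (tailBalls ++ (tailBalls ++ tailBallsLarge)) halfRectProg exprSquareGap' code
      x0 x1 y0 y1 = true) {A y : ℝ} (hA : 2.843 ≤ A) (hy0' : 0.866 ≤ y) (hy1' : y ≤ 1)
    (h1 : (x0 : ℝ) / u ≤ A) (h2 : A ≤ (x1 : ℝ) / u) (h3 : (y0 : ℝ) / u ≤ y) (h4 : y ≤ (y1 : ℝ) / u) :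
    0 < squareGap' A y := by
  obtain ⟨G, g0, hp, ⟨a0, a1, a2⟩, ⟨s, s'⟩, b, b'⟩ := halfRect_values
    (by simp [exprSquareGap', mixedAt, sub, WF]) (by rfl) hu hy0 hx hy hc hA hy0' hy1' h1 h2 h3 h4
  simp only [exprSquareGap', mixedAt, evG_sub, evG, a0, a1, a2, s 0 (by norm_num), s 1 (by norm_num),
    s 2 le_rfl, s' 0 (by norm_num), s' 1 (by norm_num), s' 2 le_rfl, b 0 (by norm_num),
    b 1 (by norm_num), b 2 le_rfl, b' 0 (by norm_num), b' 1 (by norm_num), b' 2 le_rfl] at hp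
  unfold squareGap' mixed
  push_cast at hp
  linarith

/-- Computes the theta series for a rhombic lattice and the square lattice, from `A` and `y`. -/
def halfSquareProg : List Expr :=
  blockPairLarge 13 3 (smul 4 (mul (var 0) (var 1))) ++ (blockPair 22 7 (mul (var 0) (var 2)) ++
    blockInt 36 11 (var 0))

/-- `A` times the difference of the energies of a rhombic lattice and the square lattice, minus
`A a / b`. -/
def exprHalfSquare (a b : ℕ) : Expr :=
  sub (mixedPair 18 32) (add (smul 2 (mul (var 41) (var 42))) (mul (const a b) (var 0)))

def halfSquareBalls : List Ball :=
  [Ball.tail 1 (10 ^ 8), Ball.tail 1 (10 ^ 8)] ++ (tailBallsPair ++ tailBallsPairLarge)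

theorem lt_En_half_sub_square {u code x0 x1 y0 y1 a b : ℕ} (hu : 0 < u) (hy0 : 0 < y0) (hx : x0 ≤ x1)
    (hy : y0 ≤ y1) (hb : 0 < b)
    (hc : checkWith u halfSquareBalls halfSquareProg (exprHalfSquare a b) code x0 x1 y0 y1 = true)
    {A y : ℝ} (hA : 2.843 ≤ A) (hy0' : 0.866 ≤ y) (hy1' : y ≤ 1)
    (h1 : (x0 : ℝ) / u ≤ A) (h2 : A ≤ (x1 : ℝ) / u) (h3 : (y0 : ℝ) / u ≤ y) (h4 : y ≤ (y1 : ℝ) / u) :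
    a / b < En A (1 / 2) y - En A 0 1 := by
  have hA' : 0 < A := by linarith
  have hy' : 0 < y := by linarith
  have hS : 49 / 5 ≤ 4 * (A * y) := by nlinarith
  have hB : 14 / 5 ≤ A / y := by rw [le_div_iff₀ (by linarith)]; nlinarith
  have hwf : ∀ e ∈ halfSquareProg, e.WF := by
    simp [halfSquareProg, Expr.blockPairLarge, Expr.blockPair, Expr.blockInt, WF]
  obtain ⟨G, g0, g1, g2, gc, hs', hp⟩ := evG_pos_of_checkWith hu
    (c := [hs 1 3 A, hs 0 3 A] ++ (tailsPair (A / y) ++ tailsPairLarge (4 * (A * y))))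
    (List.rel_append (.cons (hs_three_le (by linarith) (by norm_num))
        (.cons (hs_three_le (by linarith) (by norm_num)) .nil))
      (List.rel_append (tailsPair_mem hB) (tailsPairLarge_mem hS))) hwf
    (by simp [exprHalfSquare, mixedPair, sub, WF, hb]) (by rfl) (by rfl) hy0 hx hy hc h1 h2 h3 h4
  have eS : evG G (smul 4 (mul (var 0) (var 1))) = 4 * (A * y) := by simp [evG, g0, g1]
  have eB : evG G (mul (var 0) (var 2)) = A / y := by simp [evG, g0, g2, div_eq_mul_inv]
  obtain ⟨s0, s1, s2, s3⟩ := Sat.blockPairLarge (n := 13) (t := 3) hs'.left eS (by linarith)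
    (fun i hi => by
      rw [gc i (by simp [tailsPair, tailsPairLarge]; omega)]
      interval_cases i <;> simp [tailsPair, tailsPairLarge])
  obtain ⟨b0, b1, b2, b3⟩ := Sat.blockPair (n := 22) (t := 7) (hs'.right rfl).left eB (by linarith)
    (fun i hi => by
      rw [show 7 + i = 3 + (4 + i) by ring, gc (4 + i) (by simp [tailsPair, tailsPairLarge]; omega)]
      interval_cases i <;> simp [tailsPair, tailsPairLarge])
  obtain ⟨a0, a1⟩ := Sat.blockInt (n := 36) (t := 11) ((hs'.right rfl).right rfl) g0 (by linarith)
    (by simpa [tailsPair, tailsPairLarge] using gc 8 (by simp [tailsPair, tailsPairLarge]))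
    (by simpa [tailsPair, tailsPairLarge] using gc 9 (by simp [tailsPair, tailsPairLarge]))
  simp only [Nat.reduceAdd] at s0 s1 s2 s3 b0 b1 b2 b3 a0 a1
  simp only [exprHalfSquare, mixedPair, evG_sub, evG, Nat.reduceAdd, g0] at hp
  rw [s0, s1, s2, s3, b0, b1, b2, b3, a0, a1] at hp
  rw [← neg_sub (En A 0 1), En_zero_one_sub hA' hy', ← neg_div, lt_div_iff₀ hA']
  unfold squareGap mixed
  push_cast at hp
  linarith

/-- Computes the theta series for two rhombic lattices, from `A` and `y`. -/
def rhombicDiffProg : List Expr :=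
  blockPairLarge 19 3 (smul 4 (mul (var 0) (var 1))) ++ (blockPair 28 7 (mul (var 0) (var 2)) ++
    (blockPairLarge 42 11 (smul 4 (mul (const 8661 10000) (var 0))) ++
      blockPair 51 15 (mul (const 10000 8661) (var 0))))

/-- `A` times the difference of the energies of two rhombic lattices, minus `A a / b`. -/
def exprRhombicDiff (a b : ℕ) : Expr :=
  sub (mixedPair 24 38) (add (mixedPair 47 61) (mul (const a b) (var 0)))

def rhombicDiffBalls : List Ball :=
  tailBallsPair ++ (tailBallsPairLarge ++ (tailBallsPair ++ tailBallsPairLarge))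

/-- The value 0.8661 is a rational stand-in slightly above √3/2; monotonicity on x = 1/2 later
replaces it by the hexagonal point. -/
theorem lt_En_half_sub {u code x0 x1 z a b : ℕ} (hu : 0 < u) (hz : 0 < z) (hx : x0 ≤ x1) (hb : 0 < b)
    (hc : checkWith u rhombicDiffBalls rhombicDiffProg (exprRhombicDiff a b) code x0 x1 z z = true)
    {A y : ℝ} (hA : 2.843 ≤ A) (hy : y = z / u) (hy0 : 0.866 ≤ y) (hy1 : y ≤ 1)
    (h1 : (x0 : ℝ) / u ≤ A) (h2 : A ≤ (x1 : ℝ) / u) :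
    a / b < En A (1 / 2) y - En A (1 / 2) 0.8661 := by
  have hA' : 0 < A := by linarith
  have hy' : 0 < y := by linarith
  have hS : 49 / 5 ≤ 4 * (A * y) := by nlinarith
  have hB : 14 / 5 ≤ A / y := by rw [le_div_iff₀ (by linarith)]; nlinarith
  have hS' : 49 / 5 ≤ 4 * (A * 0.8661) := by linarith
  have hB' : 14 / 5 ≤ A / 0.8661 := by rw [le_div_iff₀ (by norm_num)]; linarith
  have hwf : ∀ e ∈ rhombicDiffProg, e.WF := by
    simp [rhombicDiffProg, Expr.blockPairLarge, Expr.blockPair, WF]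
  obtain ⟨G, g0, g1, g2, gc, hs', hp⟩ := evG_pos_of_checkWith hu
    (List.rel_append (tailsPair_mem hB') (List.rel_append (tailsPairLarge_mem hS')
      (List.rel_append (tailsPair_mem hB) (tailsPairLarge_mem hS)))) hwf
    (by simp [exprRhombicDiff, mixedPair, sub, WF, hb]) (by rfl) (by rfl) hz hx le_rfl hc h1 h2 hy.ge
    hy.le
  have eS : evG G (smul 4 (mul (var 0) (var 1))) = 4 * (A * y) := by simp [evG, g0, g1]
  have eB : evG G (mul (var 0) (var 2)) = A / y := by simp [evG, g0, g2, div_eq_mul_inv]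
  have eS' : evG G (smul 4 (mul (const 8661 10000) (var 0))) = 4 * (A * 0.8661) := by
    simp only [evG, g0]; norm_num; ring
  have eB' : evG G (mul (const 10000 8661) (var 0)) = A / 0.8661 := by
    simp only [evG, g0]; norm_num; ring
  have gt : ∀ k < 4, ∀ i < 4, G (3 + (4 * k + i)) = [tailsPairLarge (4 * (A * y)), tailsPair (A / y),
      tailsPairLarge (4 * (A * 0.8661)), tailsPair (A / 0.8661)][k]!.getD (3 - i) 0 := by
    intro k hk i hi
    rw [gc (4 * k + i) (by simp [tailsPair, tailsPairLarge]; omega)]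
    interval_cases k <;> interval_cases i <;> simp [tailsPair, tailsPairLarge]
  obtain ⟨s0, s1, s2, s3⟩ := Sat.blockPairLarge (n := 19) (t := 3) hs'.left eS (by linarith)
    (fun i hi => by simpa using gt 0 (by norm_num) i hi)
  obtain ⟨b0, b1, b2, b3⟩ := Sat.blockPair (n := 28) (t := 7) (hs'.right rfl).left eB (by linarith)
    (fun i hi => by simpa [← add_assoc] using gt 1 (by norm_num) i hi)
  obtain ⟨c0, c1, c2, c3⟩ := Sat.blockPairLarge (n := 42) (t := 11) ((hs'.right rfl).right rfl).left
    eS' (by linarith) (fun i hi => by simpa [← add_assoc] using gt 2 (by norm_num) i hi)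
  obtain ⟨d0, d1, d2, d3⟩ := Sat.blockPair (n := 51) (t := 15) (((hs'.right rfl).right rfl).right rfl)
    eB' (by linarith) (fun i hi => by simpa [← add_assoc] using gt 3 (by norm_num) i hi)
  simp only [Nat.reduceAdd] at s0 s1 s2 s3 b0 b1 b2 b3 c0 c1 c2 c3 d0 d1 d2 d3
  simp only [exprRhombicDiff, mixedPair, evG_sub, evG, Nat.reduceAdd, g0] at hp
  rw [s0, s1, s2, s3, b0, b1, b2, b3, c0, c1, c2, c3, d0, d1, d2, d3] at hp
  rw [En_half_eq hA' hy', En_half_eq hA' (by norm_num), ← sub_div, lt_div_iff₀ hA']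
  unfold mixed
  linarith

end WindowEnergies
end LatticePhase

/-! ### The window √3/2 ≤ y ≤ 1. -/

namespace LatticePhase

noncomputable section Window

open Real LatticePhase.Expr

/-- The symmetry y ↦ 1/y of rectangular lattices reflects the monotonicity above 1 to heights below
1. -/
theorem En_zero_le_of_le {A : ℝ} (hA : 0 < A) (hm : StrictMonoOn (En A 0) (Set.Ici 1)) {y z : ℝ} (hy : 0 < y)
    (hyz : y ≤ z) (hz : z ≤ 1) : En A 0 z ≤ En A 0 y := by
  have hz0 := hy.trans_le hyz
  rw [← En_zero_inv hA hz0, ← En_zero_inv hA hy]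
  exact hm.monotoneOn ((one_le_inv₀ hz0).2 hz) ((one_le_inv₀ hy).2 (hyz.trans hz))
    (inv_anti₀ hy hyz)

/-- By monotonicity in y the gap need only be certified at the single height z/10⁹, which leaves a
one-parameter check in A. -/
theorem lt_En_zero_sub_of_check {code z a b : ℕ} (hb : 0 < b) (hz0 : 9 * 10 ^ 8 ≤ z) (hz1 : z ≤ 10 ^ 9)
    (hc : checkWith (10 ^ 9) [Ball.tail 1 (10 ^ 8), Ball.tail 1 (10 ^ 8), Ball.tail 1 (10 ^ 8),
      Ball.tail 1 (10 ^ 8), Ball.tail 1 (10 ^ 8), Ball.tail 1 (10 ^ 8)] rectProg (exprRect a b)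
      code 2880800000 6283200000 z z = true) {A : ℝ} (hA0 : 2.8808 ≤ A) (hA1 : A ≤ 6.2832)
    (hm : StrictMonoOn (En A 0) (Set.Ici 1)) {y : ℝ} (hy : 0 < y) (hyz : y ≤ z / (10 ^ 9 : ℕ)) :
    a / b < En A 0 y - En A 0 1 := by
  have h0 : (9 * 10 ^ 8 : ℝ) ≤ z := by exact_mod_cast hz0
  have h1 : (z : ℝ) ≤ 10 ^ 9 := by exact_mod_cast hz1
  have h2 : (0.9 : ℝ) ≤ z / (10 ^ 9 : ℕ) := by
    rw [le_div_iff₀ (by norm_num)]; push_cast; linarith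
  have h3 : (z : ℝ) / (10 ^ 9 : ℕ) ≤ 1 := by
    rw [div_le_one (by norm_num)]; push_cast; linarith
  have := lt_En_zero_sub (by norm_num) (by omega) (by norm_num) hb hc (A := A) (by linarith) rfl h2 h3
    (by norm_num at *; linarith) (by norm_num at *; linarith)
  have := En_zero_le_of_le (by linarith) hm hy hyz h3
  linarith

theorem lt_En_half_sub_of_check {code x0 x1 z a b : ℕ} (hx0 : 2880800000 ≤ x0) (hx : x0 ≤ x1)
    (hx1 : x1 ≤ 6283200000) (hb : 0 < b) (hz0 : 9 * 10 ^ 8 ≤ z) (hz1 : z ≤ 10 ^ 9)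
    (hc : checkWith (10 ^ 9) rhombicDiffBalls rhombicDiffProg (exprRhombicDiff a b) code x0 x1 z z
      = true) {A : ℝ}
    (hA0 : x0 / (10 ^ 9 : ℕ) ≤ A) (hA1 : A ≤ x1 / (10 ^ 9 : ℕ)) {y : ℝ}
    (hzy : z / (10 ^ 9 : ℕ) ≤ y) (hy : y ≤ 1) :
    a / b < En A (1 / 2) y - En A (1 / 2) (√3 / 2) := by
  have h0 : (9 * 10 ^ 8 : ℝ) ≤ z := by exact_mod_cast hz0
  have h1 : (z : ℝ) ≤ 10 ^ 9 := by exact_mod_cast hz1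
  have h4 : (2880800000 : ℝ) ≤ x0 := by exact_mod_cast hx0
  have h5 : (x1 : ℝ) ≤ 6283200000 := by exact_mod_cast hx1
  have h2 : (0.9 : ℝ) ≤ z / (10 ^ 9 : ℕ) := by
    rw [le_div_iff₀ (by norm_num)]; push_cast; linarith
  have h6 : 2.8808 ≤ A := le_trans (by rw [le_div_iff₀ (by norm_num)]; push_cast; linarith) hA0
  have h7 : A ≤ 6.2832 := hA1.trans (by rw [div_le_iff₀ (by norm_num)]; push_cast; linarith)
  have h3 : √3 ≤ 1.7322 := sqrt_le_iff.2 (by norm_num)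
  have hm := (En_half_strictMonoOn h6 h7).monotoneOn
  have := lt_En_half_sub (by norm_num) (by omega) hx hb hc (A := A) (by linarith) rfl (by linarith)
    (hzy.trans hy) hA0 hA1
  have e1 := hm (a := √3 / 2) (b := 0.8661) ⟨le_rfl, by linarith⟩ ⟨by linarith, by norm_num⟩
    (by linarith)
  have e2 := hm (a := z / (10 ^ 9 : ℕ)) (b := y) ⟨by linarith, hzy.trans hy⟩ ⟨by linarith, hy⟩ hzy
  linarith

theorem lt_En_half_sub_0_97 {A y : ℝ} (hA0 : 2.8808 ≤ A) (hA1 : A ≤ 3.2) (hy0 : 0.97 ≤ y)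
    (hy1 : y ≤ 1) : 38 / 10 ^ 6 < En A (1 / 2) y - En A (1 / 2) (√3 / 2) := by
  have := lt_En_half_sub_of_check
    (code := 216157406942776)
    (x0 := 2880800000) (x1 := 3200000000) (z := 970000000) (a := 38)
    (b := 10 ^ 6) (by norm_num) (by norm_num) (by norm_num) (by norm_num) (by norm_num)
    (by norm_num) (by decide +kernel) (A := A) (by norm_num at *; linarith)
    (by norm_num at *; linarith) (y := y) (by norm_num at *; linarith) hy1
  exact_mod_cast this

theorem lt_En_half_sub_0_97_of_ge {A y : ℝ} (hA0 : 3.2 ≤ A) (hA1 : A ≤ 6.2832) (hy0 : 0.97 ≤ y)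
    (hy1 : y ≤ 1) : 6 / 10 ^ 5 < En A (1 / 2) y - En A (1 / 2) (√3 / 2) := by
  have := lt_En_half_sub_of_check
    (code := 6783260496628768899201589)
    (x0 := 3200000000) (x1 := 6283200000) (z := 970000000) (a := 6)
    (b := 10 ^ 5) (by norm_num) (by norm_num) (by norm_num) (by norm_num) (by norm_num)
    (by norm_num) (by decide +kernel) (A := A) (by norm_num at *; linarith)
    (by norm_num at *; linarith) (y := y) (by norm_num at *; linarith) hy1
  exact_mod_cast this

theorem lt_En_half_sub_0_94 {A y : ℝ} (hA0 : 2.8808 ≤ A) (hA1 : A ≤ 6.2832) (hy0 : 0.94 ≤ y)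
    (hy1 : y ≤ 1) : 15 / 10 ^ 6 < En A (1 / 2) y - En A (1 / 2) (√3 / 2) := by
  have := lt_En_half_sub_of_check
    (code := 1375344024169151730311295253008452191543073996553377526028984)
    (x0 := 2880800000) (x1 := 6283200000) (z := 940000000) (a := 15)
    (b := 10 ^ 6) (by norm_num) (by norm_num) (by norm_num) (by norm_num) (by norm_num)
    (by norm_num) (by decide +kernel) (A := A) (by norm_num at *; linarith)
    (by norm_num at *; linarith) (y := y) (by norm_num at *; linarith) hy1
  exact_mod_cast this

theorem lt_En_zero_sub_0_9 {A y : ℝ} (hA0 : 2.8808 ≤ A) (hA1 : A ≤ 6.2832)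
    (hm : StrictMonoOn (En A 0) (Set.Ici 1)) (hy : 0 < y) (hy1 : y ≤ 0.9) :
    15 / 10 ^ 5 < En A 0 y - En A 0 1 := by
  have := lt_En_zero_sub_of_check
    (code := 3604902741588889391806676441155)
    (z := 900000000) (a := 15) (b := 10 ^ 5) (by norm_num) (by norm_num)
    (by norm_num) (by decide +kernel) hA0 hA1 hm hy (by norm_num at *; linarith)
  exact_mod_cast this

theorem lt_En_zero_sub_0_92 {A y : ℝ} (hA0 : 2.8808 ≤ A) (hA1 : A ≤ 6.2832)
    (hm : StrictMonoOn (En A 0) (Set.Ici 1)) (hy : 0 < y) (hy1 : y ≤ 0.92) :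
    10 / 10 ^ 5 < En A 0 y - En A 0 1 := by
  have := lt_En_zero_sub_of_check
    (code := 1396245259233067933819861585212504689770)
    (z := 920000000) (a := 10) (b := 10 ^ 5) (by norm_num) (by norm_num)
    (by norm_num) (by decide +kernel) hA0 hA1 hm hy (by norm_num at *; linarith)
  exact_mod_cast this

theorem lt_En_zero_sub_0_94 {A y : ℝ} (hA0 : 2.8808 ≤ A) (hA1 : A ≤ 6.2832)
    (hm : StrictMonoOn (En A 0) (Set.Ici 1)) (hy : 0 < y) (hy1 : y ≤ 0.94) :
    75 / 10 ^ 6 < En A 0 y - En A 0 1 := by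
  have := lt_En_zero_sub_of_check
    (code := 1886617317104460535406440676280455681129044910232976895635)
    (z := 940000000) (a := 75) (b := 10 ^ 6) (by norm_num) (by norm_num)
    (by norm_num) (by decide +kernel) hA0 hA1 hm hy (by norm_num at *; linarith)
  exact_mod_cast this

theorem lt_En_zero_sub_0_97 {A y : ℝ} (hA0 : 2.8808 ≤ A) (hA1 : A ≤ 6.2832)
    (hm : StrictMonoOn (En A 0) (Set.Ici 1)) (hy : 0 < y) (hy1 : y ≤ 0.97) :
    15 / 10 ^ 6 < En A 0 y - En A 0 1 := by
  have := lt_En_zero_sub_of_check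
    (code := 516730795737486084109098124239853805807442709946038528156033663146718719359195976781060536971955304823408280271)
    (z := 970000000) (a := 15) (b := 10 ^ 6) (by norm_num) (by norm_num)
    (by norm_num) (by decide +kernel) hA0 hA1 hm hy (by norm_num at *; linarith)
  exact_mod_cast this

theorem En_interp_errL {A x y : ℝ} (hA0 : 2.8 ≤ A) (hA1 : A ≤ 6.2832) (hy : 0.866 ≤ y) :
    (1 + cos (2 * π * x)) / 2 * En A 0 y + (1 - cos (2 * π * x)) / 2 * En A (1 / 2) y
      - 4 * errL A y * ((1 + cos (2 * π * x)) / 2 * ((1 - cos (2 * π * x)) / 2)) ≤ En A x y := by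
  refine En_interp (by linarith) (by linarith) (by nlinarith) ?_
  have hp := pi_gt_d2
  have : 9.8 ≤ π ^ 2 := by nlinarith
  rw [le_div_iff₀ (by linarith)]
  nlinarith

/-- The error is at most cpq ≤ cp, while the end a contributes more than cp above m. The other end
needs no margin because the error vanishes there. -/
theorem lt_of_interp_left {p q a b L c m E : ℝ} (hpq : p + q = 1) (hp : 0 < p) (hq : 0 ≤ q)
    (hE : p * a + q * b - 4 * L * (p * q) ≤ E) (hb : m ≤ b) (hL : 4 * L ≤ c) (hc : 0 < c)
    (ha : m + c < a) : m < E := by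
  have h1 : 0 ≤ q * (b - m) := mul_nonneg hq (by linarith)
  have h2 : 0 < p * (a - m - c) := mul_pos hp (by linarith)
  have h3 : 0 ≤ p * q * (c - 4 * L) := mul_nonneg (by positivity) (by linarith)
  have h4 : 0 ≤ p * p * c := by positivity
  have : q = 1 - p := by linarith
  subst this
  nlinarith

/-- With a margin at both ends, 4pq ≤ 1 saves a factor of four in the admissible error. -/
theorem lt_of_interp_both {p q a b L c m E : ℝ} (hpq : p + q = 1) (hp : 0 ≤ p) (hq : 0 ≤ q)
    (hE : p * a + q * b - 4 * L * (p * q) ≤ E) (hL : L ≤ c) (hc : 0 < c)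
    (ha : m + c < a) (hb : m + c < b) : m < E := by
  have h3 : 0 ≤ p * q * (c - L) := mul_nonneg (by positivity) (by linarith)
  have h5 : c * (4 * (p * q)) ≤ c * 1 := by
    refine mul_le_mul_of_nonneg_left ?_ hc.le
    nlinarith [sq_nonneg (p - q)]
  have h6 : m + c < p * a + q * b := by
    have : q = 1 - p := by linarith
    subst this
    rcases hp.eq_or_lt with h | h
    · rw [← h]; linarith
    · nlinarith [mul_pos h (sub_pos.2 ha), mul_nonneg hq (sub_pos.2 hb).le]
  linarith

theorem cos_two_pi_mul_lt_one {x : ℝ} (h0 : 0 < x) (h1 : x ≤ 1 / 2) : cos (2 * π * x) < 1 := by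
  have := cos_lt_cos_of_nonneg_of_le_pi le_rfl (y := 2 * π * x) (by nlinarith [pi_pos]) (by positivity)
  rwa [cos_zero] at this

theorem neg_one_lt_cos_two_pi_mul {x : ℝ} (h0 : 0 ≤ x) (h1 : x < 1 / 2) : -1 < cos (2 * π * x) := by
  have := cos_lt_cos_of_nonneg_of_le_pi (x := 2 * π * x) (y := π) (by positivity) le_rfl
    (by nlinarith [pi_pos])
  rwa [cos_pi] at this

/-- Below the unit circle, only the hexagonal point can have an energy as small as that of the
better one of the square and the hexagonal lattice. -/
theorem lt_En_of_window {A m x y : ℝ} (hA0 : 2.8808 ≤ A) (hA1 : A ≤ 6.2832)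
    (hm : StrictMonoOn (En A 0) (Set.Ici 1)) (hi : m ≤ En A 0 1) (hh : m ≤ En A (1 / 2) (√3 / 2))
    (hx0 : 0 < x) (hx1 : x ≤ 1 / 2) (hy0 : √3 / 2 ≤ y) (hy1 : y ≤ 1) (hne : ¬(x = 1 / 2 ∧ y = √3 / 2)) :
    m < En A x y := by
  have h3 : (1.732 : ℝ) ≤ √3 := le_sqrt_of_sq_le (by norm_num)
  have hy866 : 0.866 ≤ y := by linarith
  have hy : 0 < y := by linarith
  have hM := En_half_strictMonoOn hA0 hA1
  have hE1 : En A (1 / 2) (√3 / 2) ≤ En A (1 / 2) y :=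
    hM.monotoneOn ⟨le_rfl, hy0.trans hy1⟩ ⟨hy0, hy1⟩ hy0
  have hE0 : En A 0 1 ≤ En A 0 y := En_zero_le_of_le (by linarith) hm hy hy1 le_rfl
  rcases hx1.eq_or_lt with rfl | hx
  · exact hh.trans_lt (hM ⟨le_rfl, hy0.trans hy1⟩ ⟨hy0, hy1⟩
      (hy0.lt_of_ne fun h => hne ⟨rfl, h.symm⟩))
  have hE := En_interp_errL (x := x) (by linarith) hA1 hy866
  have hp : 0 < (1 + cos (2 * π * x)) / 2 := by linarith [neg_one_lt_cos_two_pi_mul hx0.le hx]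
  have hq : 0 < (1 - cos (2 * π * x)) / 2 := by linarith [cos_two_pi_mul_lt_one hx0 hx1]
  obtain ⟨p, hp'⟩ : ∃ p, (1 + cos (2 * π * x)) / 2 = p := ⟨_, rfl⟩
  obtain ⟨q, hq'⟩ : ∃ q, (1 - cos (2 * π * x)) / 2 = q := ⟨_, rfl⟩
  have hpq : p + q = 1 := by linarith
  rw [hp', hq'] at hE
  rw [hp'] at hp
  rw [hq'] at hq
  have hL : 3.2 ≤ A → errL A y < 14 / 10 ^ 6 := fun h => errL_lt_of_ge h hA1 hy866 hy1
  have hb := hh.trans hE1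
  -- Up to y = 0.94 the gap on x = 0 absorbs the error alone. From 0.94 to 0.97 the gaps on both
  -- lines are used, and above 0.97 the gap on x = 1/2.
  have left : ∀ c, 0 < c → 4 * errL A y ≤ c → c < En A 0 y - En A 0 1 → m < En A x y :=
    fun c hc h1 h2 => lt_of_interp_left hpq hp hq.le hE hb h1 hc (by linarith)
  rcases le_total y 0.9 with h9 | h9
  · refine left _ (by norm_num) ?_ (lt_En_zero_sub_0_9 hA0 hA1 hm hy h9)
    rcases le_total A 3.2 with h | h
    · linarith [errL_lt_of_le_0_9 hA0 h hy866 h9]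
    · linarith [hL h]
  rcases le_total y 0.92 with h92 | h92
  · refine left _ (by norm_num) ?_ (lt_En_zero_sub_0_92 hA0 hA1 hm hy h92)
    rcases le_total A 3.2 with h | h
    · linarith [errL_lt_of_le_0_92 hA0 h h9 h92]
    · linarith [hL h]
  rcases le_total y 0.94 with h94 | h94
  · refine left _ (by norm_num) ?_ (lt_En_zero_sub_0_94 hA0 hA1 hm hy h94)
    rcases le_total A 3.2 with h | h
    · linarith [errL_lt_of_le_0_94 hA0 h h92 h94]
    · linarith [hL h]
  rcases le_total y 0.97 with h97 | h97
  · have e0 := lt_En_zero_sub_0_97 hA0 hA1 hm hy h97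
    have e1 := lt_En_half_sub_0_94 hA0 hA1 h94 hy1
    refine lt_of_interp_both hpq hp.le hq.le hE (c := 15 / 10 ^ 6) ?_ (by norm_num) (by linarith)
      (by linarith)
    rcases le_total A 3.2 with h | h
    · linarith [errL_lt_of_le_0_97 hA0 h h94 h97]
    · linarith [hL h]
  have right : ∀ c, 0 < c → 4 * errL A y ≤ c → c < En A (1 / 2) y - En A (1 / 2) (√3 / 2) →
      m < En A x y := fun c hc h1 h2 => by
    refine lt_of_interp_left (p := q) (q := p) (by linarith) hq hp.le ?_ (hi.trans hE0) h1 hc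
      (a := En A (1 / 2) y) (by linarith)
    linarith
  rcases le_total A 3.2 with h | h
  · exact right _ (by norm_num) (by linarith [errL_lt_of_le_one hA0 h h97 hy1])
      (lt_En_half_sub_0_97 hA0 h h97 hy1)
  · exact right _ (by norm_num) (by linarith [hL h]) (lt_En_half_sub_0_97_of_ge h hA1 h97 hy1)

/-- Monotonicity in A reduces later checks to one value of A and, at y = √3/2, decides the order of
the square and hexagonal energies on both sides of the transition. -/
theorem squareGap_strictMonoOn {y : ℝ} (hy0 : 0.866 ≤ y) (hy1 : y ≤ 1) :
    StrictMonoOn (fun A => squareGap A y) (Set.Icc 2.843 2.9) := by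
  have hc : checkWith (10 ^ 9) (tailBalls ++ (tailBalls ++ tailBallsLarge)) halfRectProg
      exprSquareGap' 899 2843000000 2900000000 866000000 1000000000 = true := by decide +kernel
  have hpos : ∀ A : ℝ, 2.843 ≤ A → A ≤ 2.9 → 0 < squareGap' A y := fun A h1 h2 =>
    squareGap'_pos_of_check (by norm_num) (by norm_num) (by norm_num) (by norm_num) hc h1 hy0 hy1
      (by norm_num at *; linarith) (by norm_num at *; linarith) (by norm_num at *; linarith)
      (by norm_num at *; linarith)
  have hm : StrictMonoOn (fun u => squareGap (exp u) y) (Set.Icc (log 2.843) (log 2.9)) := by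
    refine strictMonoOn_of_deriv_pos (convex_Icc _ _)
      (fun u _ => (hasDerivAt_squareGap (by linarith) u).continuousAt.continuousWithinAt)
      fun u hu => ?_
    rw [interior_Icc] at hu
    rw [(hasDerivAt_squareGap (by linarith) u).deriv]
    exact hpos _ ((log_le_iff_le_exp (by norm_num)).1 hu.1.le)
      ((le_log_iff_exp_le (by norm_num)).1 hu.2.le)
  intro a ha b hb hab
  have ha' : 0 < a := lt_of_lt_of_le (by norm_num) ha.1
  have hb' : 0 < b := ha'.trans hab
  have := hm ⟨log_le_log (by norm_num) ha.1, log_le_log ha' ha.2⟩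
    ⟨log_le_log (by norm_num) hb.1, log_le_log hb' hb.2⟩ (log_lt_log ha' hab)
  simpa only [exp_log ha', exp_log hb'] using this

theorem lt_En_half_sub_square_of_check {code x a b : ℕ} (hb : 0 < b) (hx0 : 2843000000 ≤ x)
    (hx1 : x ≤ 2900000000)
    (hc : checkWith (10 ^ 9) halfSquareBalls halfSquareProg (exprHalfSquare a b) code x x
      866000000 1000000000 = true) {A y : ℝ} (hA0 : 2.843 ≤ A)
    (hA1 : A ≤ x / (10 ^ 9 : ℕ)) (hy0 : 0.866 ≤ y) (hy1 : y ≤ 1) :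
    a / b < En A (1 / 2) y - En A 0 1 := by
  have h0 : (2843000000 : ℝ) ≤ x := by exact_mod_cast hx0
  have h1 : (x : ℝ) ≤ 2900000000 := by exact_mod_cast hx1
  obtain ⟨B, hB⟩ : ∃ B : ℝ, B = x / (10 ^ 9 : ℕ) := ⟨_, rfl⟩
  have hB1 : B ≤ 2.9 := by rw [hB, div_le_iff₀ (by norm_num)]; push_cast; linarith
  rw [← hB] at hA1
  have hA : 0 < A := by linarith
  have hy : 0 < y := by linarith
  have h2 := lt_En_half_sub_square (by norm_num) (by norm_num) le_rfl (by norm_num) hb hc (A := B)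
    (y := y) (by linarith) hy0 hy1 hB.ge hB.le (by norm_num at *; linarith) (by norm_num at *; linarith)
  have h3 : squareGap A y ≤ squareGap B y :=
    (squareGap_strictMonoOn hy0 hy1).monotoneOn ⟨hA0, by linarith⟩ ⟨by linarith, hB1⟩ hA1
  have hB' : 0 < B := by linarith
  have hab : (0 : ℝ) ≤ a / b := by positivity
  rw [← neg_sub (En B 0 1), En_zero_one_sub hB' hy, ← neg_div, lt_div_iff₀ hB'] at h2
  rw [← neg_sub (En A 0 1), En_zero_one_sub hA hy, ← neg_div, lt_div_iff₀ hA]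
  nlinarith

theorem lt_En_half_sub_square_2_875 {A y : ℝ} (hA0 : 2.843 ≤ A) (hA1 : A ≤ 2.875) (hy0 : 0.866 ≤ y)
    (hy1 : y ≤ 1) : 17 / 10 ^ 5 < En A (1 / 2) y - En A 0 1 := by
  have := lt_En_half_sub_square_of_check
    (code := 89009944236766123326028231082)
    (x := 2875000000) (a := 17) (b := 10 ^ 5) (by norm_num)
    (by norm_num) (by norm_num) (by decide +kernel) hA0 (by norm_num at *; linarith) hy0 hy1
  exact_mod_cast this

theorem lt_En_half_sub_square_2_881 {A y : ℝ} (hA0 : 2.843 ≤ A) (hA1 : A ≤ 2.881) (hy0 : 0.866 ≤ y)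
    (hy1 : y ≤ 1) : 146 / 10 ^ 6 < En A (1 / 2) y - En A 0 1 := by
  have := lt_En_half_sub_square_of_check
    (code := 63900059806154401707862994967467448376863470435914832)
    (x := 2881000000) (a := 146) (b := 10 ^ 6) (by norm_num)
    (by norm_num) (by norm_num) (by decide +kernel) hA0 (by norm_num at *; linarith) hy0 hy1
  exact_mod_cast this

/-- Before the transition every rhombic lattice in the window lies above the square by more than
four times the interpolation error, so the gap on x = 1/2 suffices throughout. -/
theorem En_square_lt_of_window {A x y : ℝ} (hA0 : 2.843 ≤ A) (hA1 : A ≤ 2.881)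
    (hm : StrictMonoOn (En A 0) (Set.Ici 1)) (hx0 : 0 < x) (hx1 : x ≤ 1 / 2) (hy0 : 0.866 ≤ y)
    (hy1 : y ≤ 1) : En A 0 1 < En A x y := by
  have hE0 : En A 0 1 ≤ En A 0 y := En_zero_le_of_le (by linarith) hm (by linarith) hy1 le_rfl
  have hE := En_interp_errL (A := A) (x := x) (by linarith) (by linarith) hy0
  have hp : 0 ≤ (1 + cos (2 * π * x)) / 2 := by linarith [neg_one_le_cos (2 * π * x)]
  have hq : 0 < (1 - cos (2 * π * x)) / 2 := by linarith [cos_two_pi_mul_lt_one hx0 hx1]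
  have key : ∀ c, 0 < c → 4 * errL A y ≤ c → c < En A (1 / 2) y - En A 0 1 →
      En A 0 1 < En A x y := fun c hc h1 h2 => by
    refine lt_of_interp_left (q := (1 + cos (2 * π * x)) / 2) (by ring) hq hp ?_ hE0 h1 hc
      (a := En A (1 / 2) y) (by linarith)
    linarith
  rcases le_total A 2.875 with h | h
  · exact key _ (by norm_num) (by linarith [errL_lt_of_le_2_875 hA0 h hy0 hy1])
      (lt_En_half_sub_square_2_875 hA0 h hy0 hy1)
  · exact key _ (by norm_num) (by linarith [errL_lt_of_le_2_881 h hA1 hy0 hy1])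
      (lt_En_half_sub_square_2_881 hA0 hA1 hy0 hy1)

end Window
end LatticePhase

/-! ### The second transition: square against hexagonal. -/

namespace LatticePhase

noncomputable section SquareHexagonal

open Real LatticePhase.Expr

namespace Expr

/-- Computes `tp 0 0`, `tp 0 1`, `tp (1 / 2) 0` and `tp (1 / 2) 1` with three terms each, as the
variables `n + 13, …, n + 16`. -/
def blockSharp (n t : ℕ) (x : Expr) : List Expr :=
  [x, nexp (var n), nexp (smul 4 (var n)), nexp (smul 9 (var n)), nexp (mul (const 1 4) (var n)),
    nexp (mul (const 9 4) (var n)), nexp (mul (const 25 4) (var n)),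
    mul (var n) (var (n + 1)), mul (smul 4 (var n)) (var (n + 2)), mul (smul 9 (var n)) (var (n + 3)),
    mul (mul (const 1 4) (var n)) (var (n + 4)), mul (mul (const 9 4) (var n)) (var (n + 5)),
    mul (mul (const 25 4) (var n)) (var (n + 6)),
    add (const 1 1) (smul 2 (add (add (add (var (n + 1)) (var (n + 2))) (var (n + 3))) (var t))),
    smul 2 (add (add (add (var (n + 7)) (var (n + 8))) (var (n + 9))) (var (t + 1))),
    smul 2 (add (add (add (var (n + 4)) (var (n + 5))) (var (n + 6))) (var (t + 2))),
    smul 2 (add (add (add (var (n + 10)) (var (n + 11))) (var (n + 12))) (var (t + 3)))]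

/-- The tails used by `blockSharp`, in the order of the environment. -/
def tailsSharp (X : ℝ) : List ℝ := [hs 1 (7 / 2) X, hs 0 (7 / 2) X, hs 1 4 X, hs 0 4 X]

theorem Sat.blockSharp {G : ℕ → ℝ} {n t : ℕ} {x : Expr} (h : Sat G n (blockSharp n t x)) {X : ℝ}
    (hx : evG G x = X) (hX : 0 < X)
    (ht : ∀ i, i < 4 → G (t + i) = (tailsSharp X).getD (3 - i) 0) :
    G (n + 13) = tp 0 0 X ∧ G (n + 14) = tp 0 1 X ∧ G (n + 15) = tp (1 / 2) 0 X ∧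
      G (n + 16) = tp (1 / 2) 1 X := by
  have q0 : G (n + 0) = _ := h 0 (by simp [Expr.blockSharp])
  have q1 : G (n + 1) = _ := h 1 (by simp [Expr.blockSharp])
  have q2 : G (n + 2) = _ := h 2 (by simp [Expr.blockSharp])
  have q3 : G (n + 3) = _ := h 3 (by simp [Expr.blockSharp])
  have q4 : G (n + 4) = _ := h 4 (by simp [Expr.blockSharp])
  have q5 : G (n + 5) = _ := h 5 (by simp [Expr.blockSharp])
  have q6 : G (n + 6) = _ := h 6 (by simp [Expr.blockSharp])
  have q7 : G (n + 7) = _ := h 7 (by simp [Expr.blockSharp])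
  have q8 : G (n + 8) = _ := h 8 (by simp [Expr.blockSharp])
  have q9 : G (n + 9) = _ := h 9 (by simp [Expr.blockSharp])
  have q10 : G (n + 10) = _ := h 10 (by simp [Expr.blockSharp])
  have q11 : G (n + 11) = _ := h 11 (by simp [Expr.blockSharp])
  have q12 : G (n + 12) = _ := h 12 (by simp [Expr.blockSharp])
  have q13 : G (n + 13) = _ := h 13 (by simp [Expr.blockSharp])
  have q14 : G (n + 14) = _ := h 14 (by simp [Expr.blockSharp])
  have q15 : G (n + 15) = _ := h 15 (by simp [Expr.blockSharp])
  have q16 : G (n + 16) = _ := h 16 (by simp [Expr.blockSharp])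
  have t0 : G t = hs 0 4 X := ht 0 (by norm_num)
  have t1 : G (t + 1) = hs 1 4 X := ht 1 (by norm_num)
  have t2 : G (t + 2) = hs 0 (7 / 2) X := ht 2 (by norm_num)
  have t3 : G (t + 3) = hs 1 (7 / 2) X := ht 3 (by norm_num)
  have z : ∀ j, tp 0 j X = 0 ^ j + 2 * (X ^ j * exp (-X) + (4 * X) ^ j * exp (-(4 * X))
      + (9 * X) ^ j * exp (-(9 * X)) + hs j 4 X) := fun j => by
    rw [tp_zero_expand j hX, hs_eq_add j 3 hX]; norm_num; ring
  have hf : ∀ j, tp (1 / 2) j X = 2 * ((1 / 4 * X) ^ j * exp (-(1 / 4 * X))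
      + (9 / 4 * X) ^ j * exp (-(9 / 4 * X)) + (25 / 4 * X) ^ j * exp (-(25 / 4 * X))
      + hs j (7 / 2) X) := fun j => by
    rw [tp_half_expand j hX, hs_eq_add j (5 / 2) hX]; norm_num; ring
  rw [z, z, hf, hf]
  simp only [add_zero] at q0
  simp only [Expr.blockSharp, List.getElem_cons_succ, List.getElem_cons_zero, evG] at q0 q1 q2 q3 q4
  simp only [Expr.blockSharp, List.getElem_cons_succ, List.getElem_cons_zero, evG] at q5 q6 q7 q8 q9
  simp only [Expr.blockSharp, List.getElem_cons_succ, List.getElem_cons_zero, evG] at q10 q11 q12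
  simp only [Expr.blockSharp, List.getElem_cons_succ, List.getElem_cons_zero, evG] at q13 q14 q15 q16
  rw [hx] at q0
  refine ⟨?_, ?_, ?_, ?_⟩
  · rw [q13, q1, q2, q3, t0, q0]; push_cast; ring
  · rw [q14, q7, q8, q9, q1, q2, q3, t1, q0]; push_cast; ring
  · rw [q15, q4, q5, q6, t2, q0]; push_cast; ring
  · rw [q16, q10, q11, q12, q4, q5, q6, t3, q0]; push_cast; ring

end Expr

def tailBallsSharp : List Ball :=
  [Ball.tail 1 (10 ^ 13), Ball.tail 1 (10 ^ 13), Ball.tail 1 (10 ^ 13), Ball.tail 1 (10 ^ 13)]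

theorem tailsSharp_mem {X : ℝ} (hX : 14 / 5 ≤ X) :
    List.Forall₂ Ball.Mem tailBallsSharp (tailsSharp X) := by
  have hX0 : (0 : ℝ) ≤ X := by linarith
  have r1 := (exp_neg_lt_of_le (w := (2 * 4 + 1) * (14 / 5)) 19 1 1 1000 (by norm_num) (by norm_num)
    (by norm_num) (by decide +kernel)).le
  have r2 := (exp_neg_lt_of_le (w := (2 * (7 / 2) + 1) * (14 / 5)) 16 1 1 1000 (by norm_num)
    (by norm_num) (by norm_num) (by decide +kernel)).le
  have e1 := (exp_neg_lt_of_le (w := 4 ^ 2 * (14 / 5)) 448 10 1 (10 ^ 17) (by norm_num)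
    (by norm_num) (by norm_num) (by decide +kernel)).le
  have e2 := (exp_neg_lt_of_le (w := (7 / 2) ^ 2 * (14 / 5)) 343 10 13 (10 ^ 16) (by norm_num)
    (by norm_num) (by norm_num) (by decide +kernel)).le
  have k1 : ∀ j, j ≤ 1 → hs j 4 X ≤ (1 : ℕ) / (10 ^ 13 : ℕ) := fun j hj => by
    refine hs_tail_le 4 (14 / 5) j rfl (by norm_num) (by norm_num) hX (by norm_num) ?_ r1 ?_ e1 ?_
    all_goals interval_cases j <;> norm_num
  have k2 : ∀ j, j ≤ 1 → hs j (7 / 2) X ≤ (1 : ℕ) / (10 ^ 13 : ℕ) := fun j hj => by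
    refine hs_tail_le (7 / 2) (14 / 5) j rfl (by norm_num) (by norm_num) hX (by norm_num) ?_ r2 ?_ e2 ?_
    all_goals interval_cases j <;> norm_num
  refine .cons ?_ (.cons ?_ (.cons ?_ (.cons ?_ .nil)))
  all_goals refine Ball.mem_tail (by norm_num) (hs_nonneg _ _ hX0) ?_
  · exact k2 1 le_rfl
  · exact k2 0 (by norm_num)
  · exact k1 1 le_rfl
  · exact k1 0 (by norm_num)

/-- An enclosure of `√3 / 2`. -/
def sqrtBall : Ball := Ball.add (Ball.const 86602540378443864676 (10 ^ 20)) (Ball.tail 1 (10 ^ 20))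

theorem sqrtBall_mem : sqrtBall.Mem (√3 / 2) := by
  have h1 : 2 * 0.86602540378443864676 ≤ √3 := le_sqrt_of_sq_le (by norm_num)
  have h2 : √3 ≤ 2 * 0.86602540378443864677 := sqrt_le_iff.2 (by norm_num)
  have h := (Ball.mem_const 86602540378443864676 (10 ^ 20) (by norm_num)).add
    (Ball.mem_tail (a := 1) (b := 10 ^ 20) (by norm_num)
      (x := √3 / 2 - (86602540378443864676 : ℕ) / (10 ^ 20 : ℕ))
      (by norm_num at *; linarith) (by norm_num at *; linarith))
  rwa [add_sub_cancel] at h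

def hexGapProg : List Expr :=
  blockSharp 16 4 (smul 4 (mul (var 0) (var 3))) ++
    (blockSharp 33 8 (mul (const 4 3) (mul (var 0) (var 3))) ++ blockSharp 50 12 (var 0))

def exprSquareEnergy : Expr := smul 2 (mul (var 63) (var 64))

def exprHexEnergy : Expr :=
  add (add (mul (var 30) (var 46)) (mul (var 32) (var 48)))
    (add (mul (var 29) (var 47)) (mul (var 31) (var 49)))

def hexGapBalls : List Ball := tailBallsSharp ++ (tailBallsSharp ++ (tailBallsSharp ++ [sqrtBall]))

/-- Since A/(√3/2) = (4/3) A (√3/2), an enclosure of √3/2 serves for both theta arguments. Single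
points are evaluated, with the second coordinate frozen at 1. -/
theorem hexGap_values {u x : ℕ} {e : Expr} (he : e.WF) (hv : e.varsBelow 67 = true) (hu : 0 < u)
    (hc : checkWith u hexGapBalls hexGapProg e 0 x x u u = true) {A : ℝ} (hA : 2.85 ≤ A)
    (hx : A = x / u) : ∃ G : ℕ → ℝ, 0 < evG G e ∧
      evG G exprSquareEnergy - evG G exprHexEnergy = squareGap A (√3 / 2) := by
  have h3 : (1.732 : ℝ) ≤ √3 := le_sqrt_of_sq_le (by norm_num)
  have h3' : √3 ≤ (1.74 : ℝ) := sqrt_le_iff.2 (by norm_num)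
  have h33 : √3 * √3 = 3 := mul_self_sqrt (by norm_num)
  have hS : 14 / 5 ≤ 4 * (A * (√3 / 2)) := by nlinarith
  have hB : 14 / 5 ≤ A / (√3 / 2) := by rw [le_div_iff₀ (by linarith)]; nlinarith
  have hwf : ∀ e ∈ hexGapProg, e.WF := by simp [hexGapProg, Expr.blockSharp, WF]
  have huR : (0 : ℝ) < u := by exact_mod_cast hu
  obtain ⟨G, g0, -, -, gc, hs', hp⟩ := evG_pos_of_checkWith hu (x := A) (y := 1)
    (List.rel_append (tailsSharp_mem (X := A) (by linarith))
      (List.rel_append (tailsSharp_mem hB) (List.rel_append (tailsSharp_mem hS)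
        (.cons sqrtBall_mem .nil)))) hwf
    he (by rfl) hv hu le_rfl le_rfl hc hx.ge hx.le (by rw [div_self huR.ne']) (by rw [div_self huR.ne'])
  have g3 : G 3 = √3 / 2 := by simpa [tailsSharp] using gc 0 (by simp [tailsSharp])
  have eS : evG G (smul 4 (mul (var 0) (var 3))) = 4 * (A * (√3 / 2)) := by simp [evG, g0, g3]
  have eB : evG G (mul (const 4 3) (mul (var 0) (var 3))) = A / (√3 / 2) := by
    rw [eq_div_iff (by positivity)]
    simp only [evG, g0, g3]
    push_cast
    linear_combination (A / 3) * h33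
  obtain ⟨s0, s1, s2, s3⟩ := Sat.blockSharp (n := 16) (t := 4) hs'.left eS (by linarith)
    (fun i hi => by
      rw [show 4 + i = 3 + (1 + i) by ring, gc (1 + i) (by simp [tailsSharp]; omega)]
      interval_cases i <;> simp [tailsSharp])
  obtain ⟨b0, b1, b2, b3⟩ := Sat.blockSharp (n := 33) (t := 8) (hs'.right rfl).left eB (by linarith)
    (fun i hi => by
      rw [show 8 + i = 3 + (5 + i) by ring, gc (5 + i) (by simp [tailsSharp]; omega)]
      interval_cases i <;> simp [tailsSharp])
  obtain ⟨a0, a1, -⟩ := Sat.blockSharp (n := 50) (t := 12) ((hs'.right rfl).right rfl) g0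
    (by linarith) (fun i hi => by
      rw [show 12 + i = 3 + (9 + i) by ring, gc (9 + i) (by simp [tailsSharp]; omega)]
      interval_cases i <;> simp [tailsSharp])
  simp only [Nat.reduceAdd] at s0 s1 s2 s3 b0 b1 b2 b3 a0 a1
  refine ⟨G, hp, ?_⟩
  simp only [exprSquareEnergy, exprHexEnergy, evG, squareGap, mixed, s0, s1, s2, s3, b0, b1, b2, b3,
    a0, a1]
  push_cast
  ring

/-- Together with `squareGap_pos` this brackets π αb tightly enough for the ten decimals; the
sharper blocks with three exponential terms per series are needed here. -/
theorem squareGap_neg : squareGap 2.8913148242 (√3 / 2) < 0 := by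
  obtain ⟨G, h1, h2⟩ := hexGap_values (u := 10 ^ 10) (x := 28913148242)
    (e := sub exprHexEnergy exprSquareEnergy) (by simp [exprHexEnergy, exprSquareEnergy, sub, WF])
    (by rfl) (by norm_num) (by decide +kernel) (A := 2.8913148242) (by norm_num) (by norm_num)
  rw [evG_sub] at h1
  linarith

theorem squareGap_pos : 0 < squareGap 2.8913148247 (√3 / 2) := by
  obtain ⟨G, h1, h2⟩ := hexGap_values (u := 10 ^ 10) (x := 28913148247)
    (e := sub exprSquareEnergy exprHexEnergy) (by simp [exprHexEnergy, exprSquareEnergy, sub, WF])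
    (by rfl) (by norm_num) (by decide +kernel) (A := 2.8913148247) (by norm_num) (by norm_num)
  rw [evG_sub] at h1
  linarith

/-- Where the hexagonal lattice takes over from the square lattice. -/
theorem exists_hexagonal_transition : ∃ αb : ℝ, |αb - 0.9203340927| < 1 / 10 ^ 10 ∧
    En (π * αb) 0 1 = En (π * αb) (1 / 2) (√3 / 2) ∧
    (∀ α, 0.905 ≤ α → α < αb → En (π * α) 0 1 < En (π * α) (1 / 2) (√3 / 2)) ∧
    ∀ α, αb < α → α ≤ 0.923 → En (π * α) (1 / 2) (√3 / 2) < En (π * α) 0 1 := by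
  have h3 : (1.732 : ℝ) ≤ √3 := le_sqrt_of_sq_le (by norm_num)
  have h3' : √3 ≤ (1.74 : ℝ) := sqrt_le_iff.2 (by norm_num)
  have hs0 : 0 < √3 / 2 := by linarith
  have hm := squareGap_strictMonoOn (y := √3 / 2) (by linarith) (by linarith)
  have hcont : ContinuousOn (fun A => squareGap A (√3 / 2)) (Set.Icc 2.8913148242 2.8913148247) := by
    intro A hA
    have hA0 : 0 < A := lt_of_lt_of_le (by norm_num) hA.1
    have h := ((hasDerivAt_squareGap hs0 (log A)).continuousAt.comp (continuousAt_log hA0.ne'))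
    refine (h.congr ?_).continuousWithinAt
    filter_upwards [lt_mem_nhds hA0] with B hB
    simp [exp_log hB]
  obtain ⟨A, hA, hA0⟩ := intermediate_value_Icc (by norm_num) hcont
    ⟨squareGap_neg.le, squareGap_pos.le⟩
  simp only at hA0
  have hpi := pi_gt_d20
  have hpi' := pi_lt_d20
  have hp := pi_pos
  have e : π * (A / π) = A := mul_div_cancel₀ _ hp.ne'
  have hA' : 0 < A := lt_of_lt_of_le (by norm_num) hA.1
  have hA2 : A ∈ Set.Icc (2.843 : ℝ) 2.9 := ⟨le_trans (by norm_num) hA.1, hA.2.trans (by norm_num)⟩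
  refine ⟨A / π, ?_, ?_, fun α h1 h2 => ?_, fun α h1 h2 => ?_⟩
  · rw [abs_sub_lt_iff, sub_lt_iff_lt_add, div_lt_iff₀ hp, sub_lt_comm, lt_div_iff₀ hp]
    norm_num at *
    exact ⟨by linarith, by linarith⟩
  · have := En_zero_one_sub hA' hs0
    rw [hA0, zero_div] at this
    rw [e]
    linarith
  · have h4 : π * α < A := by rw [← e]; exact mul_lt_mul_of_pos_left h2 hp
    have h5 : 2.843 ≤ π * α := by nlinarith
    have := hm ⟨h5, by linarith [hA2.2]⟩ hA2 h4
    simp only [hA0] at this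
    have h6 := En_zero_one_sub (A := π * α) (by linarith) hs0
    have := div_neg_of_neg_of_pos this (by linarith : 0 < π * α)
    linarith
  · have h4 : A < π * α := by rw [← e]; exact mul_lt_mul_of_pos_left h1 hp
    have h5 : π * α ≤ 2.9 := by nlinarith
    have := hm hA2 ⟨by linarith [hA2.1], h5⟩ h4
    simp only [hA0] at this
    have h6 := En_zero_one_sub (A := π * α) (by linarith) hs0
    have := div_pos this (by linarith : 0 < π * α)
    linarith

end SquareHexagonal
end LatticePhase

/-! ### Heights y ≥ 1 beyond the second transition. -/

namespace LatticePhase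

noncomputable section AboveUnitCircle

open Real LatticePhase.Expr

/-- Bounds the amplitude of the energy in the horizontal direction, for `y = 1`. -/
def ampl (A : ℝ) : ℝ :=
  1 / 2 + A - π ^ 2 / A + (1 / 2 + A + π ^ 2 / A) * ((1 + qb A) * (1 + qb (π ^ 2 / A)) - 1)

def amplProg : List Expr :=
  blockPairLarge 15 5 (smul 4 (mul (var 1) (var 4))) ++
    (blockPair 24 9 (mul (const 4 3) (mul (var 1) (var 4))) ++ (blockInt 38 13 (var 1) ++
      [mul (mul (var 3) (var 3)) (var 2), nexp (add (var 1) (var 45)),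
        add (const 1 1) (add (smul 16 (nexp (smul 3 (var 1)))) (smul 82 (nexp (smul 8 (var 1))))),
        add (const 1 1) (add (smul 16 (nexp (smul 3 (var 45)))) (smul 82 (nexp (smul 8 (var 45))))),
        sub (add (add (const 1 2) (var 1)) (mul (add (add (const 1 2) (var 1)) (var 45))
          (sub (mul (var 47) (var 48)) (const 1 1)))) (var 45)]))

def exprGap : Expr := sub (smul 2 (mul (var 43) (var 44))) (mixedPair 20 34)

def exprGapAmpl : Expr :=
  sub exprGap (mul (smul 4 (add (const 1 1) (mul (var 3) (var 2)))) (mul (var 46) (var 49)))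

def amplBalls : List Ball :=
  [Ball.tail 1 (10 ^ 8), Ball.tail 1 (10 ^ 8)] ++ (tailBallsPair ++ (tailBallsPairLarge ++
    [sqrtBall, piBall]))

theorem ampl_values {u code x0 x1 : ℕ} {e : Expr} (he : e.WF) (hv : e.varsBelow 50 = true) (hu : 0 < u)
    (hx0 : 0 < x0) (hx : x0 ≤ x1)
    (hc : checkWith u amplBalls amplProg e code u u x0 x1 = true) {A : ℝ} (hA : 2.85 ≤ A)
    (h1 : (x0 : ℝ) / u ≤ A) (h2 : A ≤ x1 / u) : ∃ G : ℕ → ℝ, 0 < evG G e ∧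
      evG G exprGap = squareGap A (√3 / 2) ∧ evG G exprGapAmpl = squareGap A (√3 / 2) -
        4 * (1 + π / A) * (exp (-(A + π ^ 2 / A)) * ampl A) := by
  have h3 : (1.732 : ℝ) ≤ √3 := le_sqrt_of_sq_le (by norm_num)
  have h3' : √3 ≤ (1.74 : ℝ) := sqrt_le_iff.2 (by norm_num)
  have h33 : √3 * √3 = 3 := mul_self_sqrt (by norm_num)
  have hS : 49 / 5 ≤ 4 * (A * (√3 / 2)) := by nlinarith
  have hB : 14 / 5 ≤ A / (√3 / 2) := by rw [le_div_iff₀ (by linarith)]; nlinarith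
  have hwf : ∀ e ∈ amplProg, e.WF := by
    simp [amplProg, Expr.blockPairLarge, Expr.blockPair, Expr.blockInt, sub, WF]
  have huR : (0 : ℝ) < u := by exact_mod_cast hu
  obtain ⟨G, -, g1, g2, gc, hs', hp⟩ := evG_pos_of_checkWith hu (x := 1) (y := A)
    (c := [hs 1 3 A, hs 0 3 A] ++ (tailsPair (A / (√3 / 2)) ++ (tailsPairLarge (4 * (A * (√3 / 2))) ++
      [√3 / 2, π])))
    (List.rel_append (.cons (hs_three_le (by linarith) (by norm_num))
        (.cons (hs_three_le (by linarith) (by norm_num)) .nil))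
      (List.rel_append (tailsPair_mem hB) (List.rel_append (tailsPairLarge_mem hS)
        (.cons sqrtBall_mem (.cons piBall_mem .nil))))) hwf
    he (by rfl) hv hx0 le_rfl hx hc (by rw [div_self huR.ne']) (by rw [div_self huR.ne']) h1 h2
  have g3 : G 3 = π := by simpa [tailsPair, tailsPairLarge] using gc 0 (by simp [tailsPair, tailsPairLarge])
  have g4 : G 4 = √3 / 2 := by simpa [tailsPair, tailsPairLarge] using gc 1 (by simp [tailsPair, tailsPairLarge])
  have g13 : G 13 = hs 0 3 A := by simpa [tailsPair, tailsPairLarge] using gc 10 (by simp [tailsPair, tailsPairLarge])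
  have g14 : G 14 = hs 1 3 A := by simpa [tailsPair, tailsPairLarge] using gc 11 (by simp [tailsPair, tailsPairLarge])
  have eS : evG G (smul 4 (mul (var 1) (var 4))) = 4 * (A * (√3 / 2)) := by simp [evG, g1, g4]
  have eB : evG G (mul (const 4 3) (mul (var 1) (var 4))) = A / (√3 / 2) := by
    rw [eq_div_iff (by positivity)]
    simp only [evG, g1, g4]
    push_cast
    linear_combination (A / 3) * h33
  obtain ⟨s0, s1, s2, s3⟩ := Sat.blockPairLarge (n := 15) (t := 5) hs'.left eS (by linarith)
    (fun i hi => by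
      rw [show 5 + i = 3 + (2 + i) by ring, gc (2 + i) (by simp [tailsPair, tailsPairLarge]; omega)]
      interval_cases i <;> simp [tailsPair, tailsPairLarge])
  obtain ⟨b0, b1, b2, b3⟩ := Sat.blockPair (n := 24) (t := 9) (hs'.right rfl).left eB (by linarith)
    (fun i hi => by
      rw [show 9 + i = 3 + (6 + i) by ring, gc (6 + i) (by simp [tailsPair, tailsPairLarge]; omega)]
      interval_cases i <;> simp [tailsPair, tailsPairLarge])
  obtain ⟨a0, a1⟩ := Sat.blockInt (n := 38) (t := 13) ((hs'.right rfl).right rfl).left g1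
    (by linarith) g13 g14
  have hr := ((hs'.right rfl).right rfl).right (m := 45) rfl
  have q0 : G 45 = _ := hr 0 (by simp)
  have q1 : G 46 = _ := hr 1 (by simp)
  have q2 : G 47 = _ := hr 2 (by simp)
  have q3 : G 48 = _ := hr 3 (by simp)
  have q4 : G 49 = _ := hr 4 (by simp)
  simp only [List.getElem_cons_succ, List.getElem_cons_zero, evG, evG_sub, g1, g2, g3] at q0 q1 q2 q3 q4
  have eT : π * π * A⁻¹ = π ^ 2 / A := by ring
  rw [eT] at q0
  rw [q0] at q1 q3 q4
  rw [q2, q3] at q4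
  simp only [Nat.reduceAdd] at s0 s1 s2 s3 b0 b1 b2 b3 a0 a1
  have hg : evG G exprGap = squareGap A (√3 / 2) := by
    simp only [exprGap, mixedPair, evG_sub, evG, Nat.reduceAdd, squareGap, mixed, s0, s1, s2, s3, b0, b1,
      b2, b3, a0, a1]
    push_cast
    ring
  refine ⟨G, hp, hg, ?_⟩
  rw [exprGapAmpl, evG_sub, hg]
  simp only [evG, g2, g3, q1, q4, ampl, qb]
  push_cast
  ring

theorem squareGap_sub_ampl_pos {A : ℝ} (hA0 : 2.8965 ≤ A) (hA1 : A ≤ 6.2832) :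
    0 < squareGap A (√3 / 2) ∧
      4 * (1 + π / A) * (exp (-(A + π ^ 2 / A)) * ampl A) < squareGap A (√3 / 2) := by
  have h1 : (2896500000 : ℕ) / ((10 ^ 9 : ℕ) : ℝ) ≤ A := by norm_num at *; linarith
  have h2 : A ≤ (6283200000 : ℕ) / ((10 ^ 9 : ℕ) : ℝ) := by norm_num at *; linarith
  obtain ⟨G, hp, hg, -⟩ := ampl_values (code := 35017499925622088)
    (e := exprGap) (by simp [exprGap, mixedPair, sub, WF]) (by rfl)
    (by norm_num) (by norm_num) (by norm_num) (by decide +kernel) (by linarith) h1 h2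
  obtain ⟨G', hp', -, hg'⟩ := ampl_values
    (code := 226251335636905621764360654524993161373756) (e := exprGapAmpl)
    (by simp [exprGapAmpl, exprGap, mixedPair, sub, WF]) (by rfl) (by norm_num) (by norm_num)
    (by norm_num) (by decide +kernel) (by linarith) h1 h2
  exact ⟨hg ▸ hp, by linarith⟩

/-- One of three estimates that reduce the amplitude at height y to height 1. The bracket and the
prefactor each grow at most linearly in y (for the prefactor, after a bound by means), and
`sq_mul_exp_scale_le` lets the exponential absorb y². The maximum with 0 covers a negative bracket.
-/
theorem ampl_scale_le {A y : ℝ} (hA : 0 < A) (hy : 1 ≤ y) :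
    1 / 2 + A * y - π ^ 2 * y / A + (1 / 2 + A * y + π ^ 2 * y / A) *
      ((1 + qb (A * y)) * (1 + qb (π ^ 2 * y / A)) - 1) ≤ y * max (ampl A) 0 := by
  have hy' : 0 < y := by linarith
  refine le_trans ?_ (mul_le_mul_of_nonneg_left (le_max_left _ _) hy'.le)
  rw [ampl, show π ^ 2 * y / A = π ^ 2 / A * y by ring]
  have hT : 0 < π ^ 2 / A := by positivity
  generalize π ^ 2 / A = T at *
  have hq : ∀ s, 0 ≤ qb s := fun s => by unfold qb; positivity
  have q1 := qb_anti (le_mul_of_one_le_right hA.le hy)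
  have q2 := qb_anti (le_mul_of_one_le_right hT.le hy)
  have h1 : (1 + qb (A * y)) * (1 + qb (T * y)) ≤ (1 + qb A) * (1 + qb T) :=
    mul_le_mul (by linarith) (by linarith) (by linarith [hq (T * y)]) (by linarith [hq A])
  have h2 : 0 ≤ (1 + qb (A * y)) * (1 + qb (T * y)) - 1 := by
    nlinarith [hq (A * y), hq (T * y), mul_nonneg (hq (A * y)) (hq (T * y))]
  have h3 := mul_le_mul (by linarith : 1 / 2 + A * y + T * y ≤ y * (1 / 2 + A + T))
    (sub_le_sub_right h1 1) h2 (by positivity)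
  linarith

theorem pref_mul_le {A y : ℝ} (hA : 0 < A) (hy : 1 ≤ y) : pref A y * A ≤ y * ((1 + π / A) / 2) := by
  have h1 : 0 < π / A := by positivity
  rw [pref, div_mul_cancel₀ _ hA.ne']
  refine sqrt_le_iff.2 ⟨by positivity, ?_⟩
  rw [show π * y / A = π / A * y by ring, mul_pow, sq y]
  have h3 : π / A ≤ ((1 + π / A) / 2) ^ 2 := by nlinarith [sq_nonneg (1 - π / A)]
  have h4 := mul_le_mul h3 (le_mul_of_one_le_right (zero_le_one.trans hy) hy) (zero_le_one.trans hy)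
    (by positivity)
  linarith

theorem sq_mul_exp_scale_le {c y : ℝ} (hc : 2 ≤ c) (hy : 1 ≤ y) :
    y * y * exp (-(c * y)) ≤ exp (-c) := by
  have h1 : y ≤ exp (y - 1) := by linarith [add_one_le_exp (y - 1)]
  calc y * y * exp (-(c * y)) ≤ exp (y - 1) * exp (y - 1) * exp (-(c * y)) := by gcongr
    _ = exp (y - 1 + (y - 1) + -(c * y)) := by rw [exp_add, exp_add]
    _ ≤ _ := exp_le_exp.2 (by nlinarith)

/-- Above the line `y = 1`, the energy exceeds that of the hexagonal lattice. -/
theorem En_hex_lt_of_one_le {A x y : ℝ} (hA0 : 2.8965 ≤ A) (hA1 : A ≤ 6.2832)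
    (hm : StrictMonoOn (En A 0) (Set.Ici 1)) (hy : 1 ≤ y) :
    En A (1 / 2) (√3 / 2) < En A x y := by
  have hA : 0 < A := by linarith
  have hy' : 0 < y := by linarith
  have hpi := pi_gt_d2
  have hpi2 : 9.8 ≤ π ^ 2 := by nlinarith
  obtain ⟨hg, hg'⟩ := squareGap_sub_ampl_pos hA0 hA1
  have hgap := En_zero_one_sub hA (y := √3 / 2) (by positivity)
  have hE0 : En A 0 1 ≤ En A 0 y := hm.monotoneOn (Set.mem_Ici.2 le_rfl) hy hy
  have hT1 : 1.5 ≤ π ^ 2 / A := by rw [le_div_iff₀ hA]; linarith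
  have hσ : A ≤ A * y := by nlinarith
  have eτ : π ^ 2 * y / A = π ^ 2 / A * y := by ring
  have hτ : π ^ 2 / A ≤ π ^ 2 * y / A := by rw [eτ]; nlinarith
  have hδ := En_zero_sub_le (x := x) hA hy' (by linarith) (by linarith)
  have hbr := ampl_scale_le hA hy
  have hpref := pref_mul_le hA hy
  have hexp := sq_mul_exp_scale_le (c := A + π ^ 2 / A) (by linarith) hy
  rw [add_mul, ← eτ] at hexp
  have hmain : A * (4 * pref A y * ((1 - cos (2 * π * x)) * (exp (-(A * y + π ^ 2 * y / A)) *
      (1 / 2 + A * y - π ^ 2 * y / A + (1 / 2 + A * y + π ^ 2 * y / A) *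
        ((1 + qb (A * y)) * (1 + qb (π ^ 2 * y / A)) - 1))))) ≤
      4 * (1 + π / A) * (exp (-(A + π ^ 2 / A)) * max (ampl A) 0) := by
    have hP := pref_pos hA hy'
    have hc : 0 ≤ 1 - cos (2 * π * x) := by linarith [cos_le_one (2 * π * x)]
    have hc2 : 1 - cos (2 * π * x) ≤ 2 := by linarith [neg_one_le_cos (2 * π * x)]
    have hM : 0 ≤ max (ampl A) 0 := le_max_right _ _
    have hpi0 := pi_pos
    have e1 : 0 < exp (-(A * y + π ^ 2 * y / A)) := exp_pos _
    calc _ ≤ A * (4 * pref A y * ((1 - cos (2 * π * x)) * (exp (-(A * y + π ^ 2 * y / A)) *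
          (y * max (ampl A) 0)))) := by gcongr
      _ ≤ A * (4 * pref A y * (2 * (exp (-(A * y + π ^ 2 * y / A)) * (y * max (ampl A) 0)))) := by
        gcongr
      _ = 8 * (pref A y * A) * (exp (-(A * y + π ^ 2 * y / A)) * (y * max (ampl A) 0)) := by ring
      _ ≤ 8 * (y * ((1 + π / A) / 2)) * (exp (-(A * y + π ^ 2 * y / A)) * (y * max (ampl A) 0)) := by
        gcongr
      _ = 4 * (1 + π / A) * ((y * y * exp (-(A * y + π ^ 2 * y / A))) * max (ampl A) 0) := by ring
      _ ≤ _ := by gcongr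
  -- The gap between square and hexagonal exceeds the largest horizontal drop below the square
  -- energy; the two certified inequalities treat the two values of the maximum.
  have hfin : 4 * (1 + π / A) * (exp (-(A + π ^ 2 / A)) * max (ampl A) 0) < squareGap A (√3 / 2) := by
    rcases max_choice (ampl A) 0 with h | h
    · rw [h]; exact hg'
    · rw [h, mul_zero, mul_zero]; exact hg
  rw [eq_div_iff hA.ne'] at hgap
  refine lt_of_mul_lt_mul_left ?_ hA.le
  have := mul_le_mul_of_nonneg_left hδ hA.le
  have := mul_le_mul_of_nonneg_left hE0 hA.le
  rw [mul_sub] at *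
  linarith

end AboveUnitCircle
end LatticePhase

/-! ### Large parameters: tangent bounds and the shells of the hexagonal lattice. -/

namespace LatticePhase

noncomputable section LargeParameter

open Real

theorem cubic_le_exp_neg {t : ℝ} (ht : 0 ≤ t) : 1 - t + t ^ 2 / 2 - t ^ 3 / 6 ≤ exp (-t) := by
  have hd : ∀ s : ℝ, HasDerivAt (fun s => exp (-s) - (1 - s + s ^ 2 / 2 - s ^ 3 / 6))
      (1 - s + s ^ 2 / 2 - exp (-s)) s := fun s => by
    have h1 := (hasDerivAt_neg s).exp
    have h2 := ((((hasDerivAt_id s).const_sub 1).add (((hasDerivAt_id s).pow 2).div_const 2)).sub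
      (((hasDerivAt_id s).pow 3).div_const 6))
    refine (h1.sub h2).congr_deriv ?_
    simp only [id]
    push_cast
    ring
  have hm : MonotoneOn (fun s => exp (-s) - (1 - s + s ^ 2 / 2 - s ^ 3 / 6)) (Set.Ici 0) := by
    refine monotoneOn_of_deriv_nonneg (convex_Ici 0)
      (fun s _ => (hd s).continuousAt.continuousWithinAt)
      (fun s _ => (hd s).differentiableAt.differentiableWithinAt) fun s hs => ?_
    rw [interior_Ici] at hs
    have hs0 : 0 ≤ s := le_of_lt hs
    rw [(hd s).deriv, sub_nonneg, exp_neg, inv_le_iff_one_le_mul₀ (exp_pos s)]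
    have h1 := quadratic_le_exp_of_nonneg hs0
    have h2 : 0 < 1 - s + s ^ 2 / 2 := by nlinarith [sq_nonneg (s - 1)]
    nlinarith [mul_le_mul_of_nonneg_left h1 h2.le, sq_nonneg (s ^ 2)]
  have := hm Set.self_mem_Ici ht ht
  norm_num at this
  linarith

/-- The function `r ↦ r exp (-A r)` lies above its tangent at `R`. -/
theorem tangent_le {A r R : ℝ} (hA : 0 < A) (hr : 2 ≤ A * r) (hR : 20 ≤ A * R) :
    R * exp (-(A * R)) + (1 - A * R) * exp (-(A * R)) * (r - R) ≤ r * exp (-(A * r)) := by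
  obtain ⟨t, ht⟩ : ∃ t, t = A * (r - R) := ⟨_, rfl⟩
  have hr' : A * r = A * R + t := by rw [ht]; ring
  rw [hr', neg_add, exp_add]
  suffices h : A * R + t - A * R * t ≤ (A * R + t) * exp (-t) by
    have e : 0 < exp (-(A * R)) := exp_pos _
    have h2 := mul_le_mul_of_nonneg_left h e.le
    refine le_of_mul_le_mul_left ?_ hA
    calc A * (R * exp (-(A * R)) + (1 - A * R) * exp (-(A * R)) * (r - R))
        = exp (-(A * R)) * (A * R + t - A * R * t) := by rw [ht]; ring
      _ ≤ _ := h2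
      _ = _ := by rw [← hr']; ring
  generalize A * R = W at *
  rcases le_total t 0 with h0 | h0
  · have h1 := quadratic_le_exp_of_nonneg (neg_nonneg.2 h0)
    have h2 := mul_le_mul_of_nonneg_left h1 (by linarith : 0 ≤ W + t)
    nlinarith [mul_nonneg (sq_nonneg t) (by linarith : 0 ≤ W + t - 2)]
  · rcases le_total t 1.06 with h1 | h1
    · have h2 := mul_le_mul_of_nonneg_left (cubic_le_exp_neg h0) (by linarith : 0 ≤ W + t)
      refine le_trans ?_ h2
      have h3 : 0 ≤ t ^ 2 * ((W - 20) * (1 / 2 - t / 6) + (9 - 17 / 6 * t - t ^ 2 / 6)) := by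
        refine mul_nonneg (sq_nonneg t) (add_nonneg (mul_nonneg (by linarith) (by linarith)) ?_)
        nlinarith
      nlinarith
    · have : 0 ≤ (W + t) * exp (-t) := mul_nonneg (by linarith) (exp_pos _).le
      nlinarith

/-- A quadratic lower bound that is strong enough for the six shortest vectors. -/
theorem quadratic_le_shell {u w : ℝ} (hu : 7.25 ≤ u) (hw0 : -0.25 ≤ w) (hw1 : w ≤ 0.76) :
    1 - (u - 1) * w + (u - 0.9) * w ^ 2 ≤ (1 + w) * exp (-(u * w)) := by
  rcases le_total w 0 with h0 | h0
  · have h1 := quadratic_le_exp_of_nonneg (x := -(u * w)) (by nlinarith)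
    refine le_trans ?_ (mul_le_mul_of_nonneg_left h1 (by linarith : 0 ≤ 1 + w))
    have h2 : 0 ≤ w ^ 2 * (u ^ 2 * (1 + w) / 2 - 2 * u + 0.9) := by
      refine mul_nonneg (sq_nonneg w) ?_
      nlinarith [mul_nonneg (sq_nonneg u) (by linarith : 0 ≤ w + 0.25)]
    nlinarith
  · rcases le_total (u * w) 1.6 with h1 | h1
    · refine le_trans ?_ (mul_le_mul_of_nonneg_left (cubic_le_exp_neg (by positivity : 0 ≤ u * w))
        (by linarith : 0 ≤ 1 + w))
      obtain ⟨t, ht⟩ : ∃ t, t = u * w := ⟨_, rfl⟩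
      rw [← ht] at h1 ⊢
      have ht0 : 0 ≤ t := ht ▸ by positivity
      have h2 : 0 ≤ w ^ 2 * (u ^ 2 * (1 / 2 - t / 6) - u * (2 - t / 2 + t ^ 2 / 6) + 0.9) := by
        refine mul_nonneg (sq_nonneg w) ?_
        have h3 : u * 7.25 * (1 / 2 - t / 6) ≤ u ^ 2 * (1 / 2 - t / 6) :=
          mul_le_mul_of_nonneg_right (by nlinarith) (by linarith)
        have h4 : 0 ≤ 7.25 * (1 / 2 - t / 6) - (2 - t / 2 + t ^ 2 / 6) + 0.1 := by nlinarith
        nlinarith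
      have h5 : w ^ 2 * (u ^ 2 * (1 / 2 - t / 6) - u * (2 - t / 2 + t ^ 2 / 6) + 0.9) =
          (1 + w) * (1 - t + t ^ 2 / 2 - t ^ 3 / 6) - (1 - (u - 1) * w + (u - 0.9) * w ^ 2) := by
        rw [ht]; ring
      linarith
    · have h2 : 0 ≤ (1 + w) * exp (-(u * w)) := by positivity
      refine le_trans ?_ h2
      rcases le_total w 0.22 with h3 | h3
      · nlinarith
      · nlinarith [mul_nonneg (sub_nonneg.2 h3) (sub_nonneg.2 hw1),
          mul_nonneg (sub_nonneg.2 hu) (mul_nonneg h0 (by linarith : 0 ≤ 1 - w))]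

/-- The form with the parameters `a`, `b`, `c` of Selling. -/
def sell (a b c : ℝ) (p : ℤ × ℤ) : ℝ :=
  a * ((p.1 : ℝ) + p.2) ^ 2 + b * (p.2 : ℝ) ^ 2 + c * (p.1 : ℝ) ^ 2

/-- On the half fundamental domain all three Selling parameters are nonnegative, and unit area is
the relation ab + bc + ca = 1. The parametrisation makes the symmetry of the hexagonal lattice
usable. -/
theorem rad_eq_sell {x y : ℝ} (hy : 0 < y) (p : ℤ × ℤ) :
    rad x y p = sell (x / y) ((1 - x) / y) ((x ^ 2 + y ^ 2 - x) / y) p := by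
  unfold rad sell
  field_simp
  ring

/-- The form `m² + m n + n²`. -/
def hexN (p : ℤ × ℤ) : ℤ := p.1 ^ 2 + p.1 * p.2 + p.2 ^ 2

theorem rad_hex (p : ℤ × ℤ) : rad (1 / 2) (√3 / 2) p = 2 / √3 * hexN p := by
  have h : √3 ^ 2 = 3 := sq_sqrt (by norm_num)
  unfold rad hexN
  field_simp
  rw [h]
  push_cast
  ring

def hexShell : Finset (ℤ × ℤ) := {(0, 1), (0, -1), (1, 0), (-1, 0), (1, -1), (-1, 1)}

theorem hexN_cases (p : ℤ × ℤ) : p = 0 ∨ p ∈ hexShell ∨ 3 ≤ hexN p := by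
  by_contra! h
  obtain ⟨h0, h1, h2⟩ := h
  obtain ⟨m, n⟩ := p
  simp only [hexN] at h2
  have hn : n ^ 2 < 4 := by nlinarith [sq_nonneg (2 * m + n)]
  have hm : m ^ 2 < 4 := by nlinarith [sq_nonneg (2 * n + m)]
  have hn1 : n < 2 := by nlinarith
  have hn2 : -2 < n := by nlinarith
  have hm1 : m < 2 := by nlinarith
  have hm2 : -2 < m := by nlinarith
  interval_cases m <;> interval_cases n <;> simp_all [hexShell]

theorem hexN_shell {p : ℤ × ℤ} (hp : p ∈ hexShell) : hexN p = 1 := by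
  simp only [hexShell, Finset.mem_insert, Finset.mem_singleton] at hp
  rcases hp with rfl | rfl | rfl | rfl | rfl | rfl <;> rfl

/-- A crude bound is enough: with the factor 1/25 of `far_weight_le` the far shells contribute at
most 12/25 < 0.5. -/
theorem tp_half_sq_le : tp 0 0 (1 / 2) ^ 2 ≤ 12 := by
  have e := (exp_neg_lt_of_le (w := 3 / 2) 3 2 1 4 (by norm_num) (by norm_num)
    (by norm_num) (by decide +kernel)).le
  have e' := (exp_neg_lt_of_le (w := 1 / 2) 1 2 61 100 (by norm_num) (by norm_num)
    (by norm_num) (by decide +kernel)).le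
  have h := hs_le 0 (c := 1) (X := 1 / 2) one_pos (by norm_num) (by norm_num at *; linarith)
  have h0 := tp_zero_eq_hs 0 (X := 1 / 2) (by norm_num)
  have h1 := tp_nonneg 0 0 (X := 1 / 2) (by norm_num)
  norm_num at h h0 e'
  have : tp 0 0 (1 / 2) ≤ 3.45 := by norm_num; linarith
  nlinarith

/-- With t = uN one has u ≤ t/3 and N ≤ t/7.25, so t - u - N ≥ 0.52 t. One term of the exponential
series, of degree six, then beats the polynomial factor. -/
theorem far_weight_le {u N : ℝ} (hu : 7.25 ≤ u) (hN : 3 ≤ N) :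
    (u * N - 1) * N * exp (-(u * N)) ≤ exp (-u) * (1 / 25 * exp (-N)) := by
  obtain ⟨t, ht⟩ : ∃ t, t = u * N := ⟨_, rfl⟩
  have ht0 : 21.75 ≤ t := by rw [ht]; nlinarith
  have hNt : N * 7.25 ≤ t := by rw [ht]; nlinarith
  have h1 : (0.52 * t) ^ 6 / 720 ≤ exp (t - u - N) := by
    have h2 := pow_div_factorial_le_exp (0.52 * t) (by linarith) 6
    norm_num [Nat.factorial] at h2
    refine le_trans (le_of_eq (by norm_num)) (h2.trans (exp_le_exp.2 ?_))
    have : u * 3 ≤ t := by rw [ht]; nlinarith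
    linarith
  have h3 : (t - 1) * N ≤ 1 / 25 * exp (t - u - N) := by
    refine le_trans ?_ (mul_le_mul_of_nonneg_left h1 (by norm_num))
    have h4 : (21.75 : ℝ) ^ 4 ≤ t ^ 4 := by gcongr
    have h5 : (t - 1) * N ≤ t * (t / 7.25) := by
      refine mul_le_mul (by linarith) ?_ (by linarith) (by linarith)
      rw [le_div_iff₀ (by norm_num)]; exact hNt
    refine h5.trans ?_
    have h6 := mul_le_mul_of_nonneg_right h4 (sq_nonneg t)
    have h8 : 1 / 25 * ((0.52 * t) ^ 6 / 720) = 0.52 ^ 6 / 18000 * (t ^ 4 * t ^ 2) := by ring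
    rw [h8, show t * (t / 7.25) = t ^ 2 / 7.25 by ring]
    norm_num at h6 ⊢
    linarith [sq_nonneg t]
  have h7 := mul_le_mul_of_nonneg_right h3 (exp_pos (-t)).le
  rw [mul_assoc (1 / 25), ← exp_add] at h7
  rw [← ht]
  refine h7.trans (le_of_eq ?_)
  rw [mul_left_comm, ← exp_add]
  congr 2
  ring

/-- The sum that measures how the energy of the hexagonal lattice changes under scaling. -/
theorem hex_weight_le {A : ℝ} (hA : 7.25 ≤ A * (2 / √3)) :
    ∑' p : ℤ × ℤ, (A * rad (1 / 2) (√3 / 2) p - 1) * rad (1 / 2) (√3 / 2) p *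
        exp (-(A * rad (1 / 2) (√3 / 2) p)) ≤
      (6 * (A * (2 / √3) - 1) + 0.5) * (2 / √3 * exp (-(A * (2 / √3)))) := by
  obtain ⟨u, hu⟩ : ∃ u, u = A * (2 / √3) := ⟨_, rfl⟩
  have hk : 0 < 2 / √3 := by positivity
  have hA' : 0 < A := by
    by_contra h
    nlinarith
  simp only [rad_hex]
  rw [← hu] at hA ⊢
  set K := 2 / √3 * exp (-u) with hK
  have hK0 : 0 < K := by positivity
  have hg : HasSum (fun p : ℤ × ℤ => exp (-(1 / 2) * (p.1 : ℝ) ^ 2) * exp (-(1 / 2) * (p.2 : ℝ) ^ 2))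
      (tp 0 0 (1 / 2) * tp 0 0 (1 / 2)) := by
    have h := summable_th 0 0 (X := 1 / 2) (by norm_num)
    simp only [pow_zero, one_mul, add_zero] at h
    have e : tp 0 0 (1 / 2) = ∑' n : ℤ, exp (-(1 / 2) * (n : ℝ) ^ 2) := by simp [tp, th]
    rw [e]
    have h' := hasSum_mul_of_nonneg h.hasSum h.hasSum (fun _ => (exp_pos _).le)
      fun _ => (exp_pos _).le
    exact h'
  have hI : HasSum (fun p : ℤ × ℤ => if p ∈ hexShell then (u - 1) * K else 0) (6 * ((u - 1) * K)) := by
    have : HasSum (fun p : ℤ × ℤ => if p ∈ hexShell then (u - 1) * K else 0) _ :=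
      hasSum_sum_of_ne_finset_zero (s := hexShell) (fun p hp => if_neg hp)
    rwa [Finset.sum_congr rfl (fun p hp => if_pos hp), Finset.sum_const,
      show hexShell.card = 6 by rfl, nsmul_eq_mul] at this
  have hT := hI.add (hg.mul_left (K * (1 / 25)))
  have hle : ∀ p : ℤ × ℤ, (A * (2 / √3 * hexN p) - 1) * (2 / √3 * hexN p) *
      exp (-(A * (2 / √3 * hexN p))) ≤ (if p ∈ hexShell then (u - 1) * K else 0) +
        K * (1 / 25) * (exp (-(1 / 2) * (p.1 : ℝ) ^ 2) * exp (-(1 / 2) * (p.2 : ℝ) ^ 2)) := by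
    intro p
    have e1 : A * (2 / √3 * hexN p) = u * hexN p := by rw [hu]; ring
    rw [e1]
    rcases hexN_cases p with rfl | hp | hp
    · have : hexN 0 = 0 := rfl
      rw [this, if_neg (by decide)]
      simp only [Int.cast_zero, mul_zero, zero_mul, zero_add]
      positivity
    · rw [if_pos hp, hexN_shell hp]
      have : 0 ≤ K * (1 / 25) * (exp (-(1 / 2) * (p.1 : ℝ) ^ 2) * exp (-(1 / 2) * (p.2 : ℝ) ^ 2)) := by
        positivity
      rw [Int.cast_one, mul_one, mul_one, hK] at *
      linarith
    · have hp' : (3 : ℝ) ≤ hexN p := by exact_mod_cast hp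
      have h1 := far_weight_le hA hp'
      have h2 : exp (-(hexN p : ℝ)) ≤ exp (-(1 / 2) * (p.1 : ℝ) ^ 2) * exp (-(1 / 2) * (p.2 : ℝ) ^ 2) := by
        rw [← exp_add]
        refine exp_le_exp.2 ?_
        simp only [hexN]
        push_cast
        nlinarith [sq_nonneg ((p.1 : ℝ) + p.2)]
      rw [if_neg (fun h => by rw [hexN_shell h] at hp; norm_num at hp), zero_add]
      calc _ = 2 / √3 * ((u * hexN p - 1) * hexN p * exp (-(u * hexN p))) := by ring
        _ ≤ 2 / √3 * (exp (-u) * (1 / 25 * (exp (-(1 / 2) * (p.1 : ℝ) ^ 2) *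
            exp (-(1 / 2) * (p.2 : ℝ) ^ 2)))) := by
          refine mul_le_mul_of_nonneg_left (h1.trans ?_) hk.le
          gcongr
        _ = _ := by rw [hK]; ring
  have hs : Summable fun p : ℤ × ℤ => (A * (2 / √3 * hexN p) - 1) * (2 / √3 * hexN p) *
      exp (-(A * (2 / √3 * hexN p))) := by
    have h1 := summable_rad 1 (x := 1 / 2) (y := √3 / 2) hA' (by positivity)
    have h2 := summable_rad 2 (x := 1 / 2) (y := √3 / 2) hA' (by positivity)
    refine ((h2.mul_left A).sub h1).congr fun p => ?_
    rw [rad_hex, neg_mul]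
    ring
  refine (hs.tsum_le_tsum hle hT.summable).trans ?_
  rw [hT.tsum_eq]
  have := tp_half_sq_le
  nlinarith

end LargeParameter
end LatticePhase

/-! ### Averaging over rotations and optimality among compact lattices. -/

namespace LatticePhase

noncomputable section Selling

open Real

theorem hexN_nonneg (p : ℤ × ℤ) : 0 ≤ hexN p := by
  unfold hexN; nlinarith [sq_nonneg (p.1 + p.2), sq_nonneg p.1, sq_nonneg p.2]

theorem hexN_hexRot (p : ℤ × ℤ) : hexN (hexRot p) = hexN p := by
  simp only [hexN, hexRot, Equiv.coe_fn_mk]; ring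

theorem sell_le {a b c : ℝ} (ha : 0 ≤ a) (hb : 0 ≤ b) (hc : 0 ≤ c) (p : ℤ × ℤ) :
    sell a b c p ≤ (a + b + c) * (2 * hexN p) := by
  simp only [sell, hexN]
  push_cast
  nlinarith [mul_nonneg ha (sq_nonneg (p.1 : ℝ)), mul_nonneg ha (sq_nonneg (p.2 : ℝ)),
    mul_nonneg hb (sq_nonneg (p.1 : ℝ)), mul_nonneg hb (sq_nonneg ((p.1 : ℝ) + p.2)),
    mul_nonneg hc (sq_nonneg (p.2 : ℝ)), mul_nonneg hc (sq_nonneg ((p.1 : ℝ) + p.2))]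

theorem sell_nonneg {a b c : ℝ} (ha : 0 ≤ a) (hb : 0 ≤ b) (hc : 0 ≤ c) (p : ℤ × ℤ) :
    0 ≤ sell a b c p := by
  unfold sell; positivity

/-- Averaging over the rotations of order three. -/
theorem hasSum_sell {a b c : ℝ} (ha : 0 ≤ a) (hb : 0 ≤ b) (hc : 0 ≤ c) {g : ℤ → ℝ}
    (hg : Summable fun p => g (hexN p) * hexN p) :
    HasSum (fun p => g (hexN p) * sell a b c p)
      ((a + b + c) * (2 / 3 * ∑' p, g (hexN p) * hexN p)) := by
  have hs : Summable fun p => g (hexN p) * sell a b c p := by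
    refine (hg.norm.mul_left (2 * (a + b + c))).of_norm_bounded fun p => ?_
    have h0 : (0 : ℝ) ≤ hexN p := by exact_mod_cast hexN_nonneg p
    rw [norm_mul, norm_mul, norm_of_nonneg h0, norm_of_nonneg (sell_nonneg ha hb hc p)]
    nlinarith [mul_le_mul_of_nonneg_left (sell_le ha hb hc p) (norm_nonneg (g (hexN p)))]
  have h1 := hs.hasSum
  have h2 := hexRot.hasSum_iff.2 h1
  have h3 := hexRot.hasSum_iff.2 h2
  have h4 := (h1.add h2).add h3
  -- Three successive rotates of the Selling form add up to 2(a + b + c) times m² + mn + n².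
  have e : (fun p => g (hexN p) * sell a b c p + ((fun p => g (hexN p) * sell a b c p) ∘ hexRot) p +
      (((fun p => g (hexN p) * sell a b c p) ∘ hexRot) ∘ hexRot) p) =
      fun p => 2 * (a + b + c) * (g (hexN p) * hexN p) := by
    funext p
    simp only [Function.comp, hexN_hexRot]
    simp only [sell, hexRot, Equiv.coe_fn_mk, hexN]
    push_cast
    ring
  rw [e] at h4
  have h5 := h4.unique (hg.hasSum.mul_left (2 * (a + b + c)))
  convert h1 using 1
  linarith

theorem shell_gain {A h r : ℝ} (hh : 0 < h) (hA : 7.25 ≤ A * h) (h0 : 0.75 * h ≤ r)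
    (h1 : r ≤ 1.76 * h) : h * exp (-(A * h)) * (A * h - 0.9) * (r / h - 1) ^ 2 ≤
      r * exp (-(A * r)) - h * exp (-(A * h)) - (1 - A * h) * exp (-(A * h)) * (r - h) := by
  obtain ⟨w, hw⟩ : ∃ w, w = r / h - 1 := ⟨_, rfl⟩
  have hr : r = h * (1 + w) := by rw [hw]; field_simp; ring
  have h2 := quadratic_le_shell hA (w := w) (by rw [hr] at h0; nlinarith) (by rw [hr] at h1; nlinarith)
  have h3 := mul_le_mul_of_nonneg_left h2 (by positivity : 0 ≤ h * exp (-(A * h)))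
  have e : exp (-(A * r)) = exp (-(A * h)) * exp (-(A * h * w)) := by
    rw [← exp_add, hr]; congr 1; ring
  rw [← hw, e, hr]
  linarith

/-- At a nonzero vector at most one of the three integers m + n, n, m vanishes, so two of the
parameters always contribute fully. -/
theorem sell_ge {a b c d : ℝ} (ha : 0 ≤ a) (hb : 0 ≤ b) (hc : 0 ≤ c) (h1 : d ≤ a + b)
    (h2 : d ≤ a + c) (h3 : d ≤ b + c) {p : ℤ × ℤ} (hp : p ≠ 0) : d ≤ sell a b c p := by
  obtain ⟨m, n⟩ := p
  have key : ∀ k : ℤ, k ≠ 0 → (1 : ℝ) ≤ (k : ℝ) ^ 2 := fun k hk => by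
    have : 0 < k ^ 2 := by positivity
    exact_mod_cast this
  simp only [sell]
  have e : ((m : ℝ) + n) ^ 2 = ((m + n : ℤ) : ℝ) ^ 2 := by push_cast; ring
  rw [e]
  have p1 := mul_nonneg ha (sq_nonneg ((m + n : ℤ) : ℝ))
  have p2 := mul_nonneg hb (sq_nonneg (n : ℝ))
  have p3 := mul_nonneg hc (sq_nonneg (m : ℝ))
  by_cases hm : m = 0
  · have hn : n ≠ 0 := fun h => hp (by rw [hm, h]; rfl)
    have := key n hn
    have := key (m + n) (by omega)
    nlinarith
  · have := key m hm
    by_cases hn : n = 0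
    · have := key (m + n) (by omega)
      nlinarith
    · have := key n hn
      nlinarith

/-- Here l measures a + b + c against its hexagonal value, and l > 1 since (a + b + c)² ≥ 3(ab + bc
+ ca) with equality only for a = b = c. The determinant condition makes the right side equal to 3(3l
- 1)(l - 1), which dominates 6(l - 1). -/
theorem sell_excess {a b c h : ℝ} (hh0 : 0 < h) (hh2 : h ^ 2 = 4 / 3) (ha : 0 ≤ a) (hb : 0 ≤ b)
    (hc : 0 ≤ c) (hdet : a * b + b * c + c * a = 1) (hne : ¬(a = b ∧ b = c)) :
    ∃ l, 1 < l ∧ a + b + c = 3 / 2 * h * l ∧ 6 * (l - 1) ≤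
      2 * (((a + b) / h - 1) ^ 2 + ((a + c) / h - 1) ^ 2 + ((b + c) / h - 1) ^ 2) := by
  obtain ⟨l, hl⟩ : ∃ l, a + b + c = 3 / 2 * h * l := ⟨(a + b + c) / (3 / 2 * h), by field_simp⟩
  have hS : (a + b + c) ^ 2 = 3 * l ^ 2 := by rw [hl]; linear_combination (9 / 4 * l ^ 2) * hh2
  have hl0 : 0 < l := by
    have h1 : 0 < a + b + c := by
      rcases (add_nonneg (add_nonneg ha hb) hc).eq_or_lt with h0 | h0
      · have h1 : a = 0 := by linarith
        have h2 : b = 0 := by linarith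
        rw [h1, h2] at hdet
        norm_num at hdet
      · exact h0
    rw [hl] at h1
    exact pos_of_mul_pos_right h1 (by positivity)
  have hl1 : 1 < l := by
    have hT : 3 < (a + b + c) ^ 2 := by
      by_contra! hn
      have h1 : (a - b) ^ 2 + (b - c) ^ 2 + (c - a) ^ 2 ≤ 0 := by linarith
      have h2 : (a - b) ^ 2 = 0 := by linarith [sq_nonneg (a - b), sq_nonneg (b - c), sq_nonneg (c - a)]
      have h3 : (b - c) ^ 2 = 0 := by linarith [sq_nonneg (a - b), sq_nonneg (b - c), sq_nonneg (c - a)]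
      exact hne ⟨by linarith [pow_eq_zero_iff (two_ne_zero) |>.1 h2],
        by linarith [pow_eq_zero_iff (two_ne_zero) |>.1 h3]⟩
    nlinarith
  have hw : ((a + b) / h - 1) ^ 2 + ((a + c) / h - 1) ^ 2 + ((b + c) / h - 1) ^ 2 =
      9 / 2 * l ^ 2 - 6 * l + 3 / 2 := by
    have h1 : (a + b) ^ 2 + (a + c) ^ 2 + (b + c) ^ 2 = 6 * l ^ 2 - 2 := by
      linear_combination 2 * hS - 2 * hdet
    have h2 : ∀ r : ℝ, (r / h - 1) ^ 2 = 3 / 4 * r ^ 2 - 2 * (r / h) + 1 := fun r => by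
      rw [sub_sq, div_pow, hh2]; ring
    have h3 : (a + b) / h + (a + c) / h + (b + c) / h = 3 * l := by
      rw [← add_div, ← add_div, div_eq_iff hh0.ne']; linarith
    rw [h2, h2, h2]
    linarith
  exact ⟨l, hl1, hl, by rw [hw]; nlinarith⟩

/-- Each squared length is compared with that of the hexagonal vector of the same index. All vectors
outside the first shell obey the tangent bound, the six in the shell obey it with a quadratic gain,
and by averaging the tangent terms sum to a multiple of l - 1. The gain of order l - 1 from
`sell_excess` outweighs that loss. -/
theorem En_hex_lt_of_sell {A a b c x y : ℝ} (hA : 7.25 ≤ A * (2 / √3)) (hy : 0 < y)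
    (he : ∀ p, rad x y p = sell a b c p) (ha : 0 ≤ a) (hb : 0 ≤ b) (hc : 0 ≤ c)
    (hdet : a * b + b * c + c * a = 1)
    (l1 : 0.75 * (2 / √3) ≤ a + b) (l2 : 0.75 * (2 / √3) ≤ a + c) (l3 : 0.75 * (2 / √3) ≤ b + c)
    (u1 : a + b ≤ 1.76 * (2 / √3)) (u2 : a + c ≤ 1.76 * (2 / √3)) (u3 : b + c ≤ 1.76 * (2 / √3))
    (hne : ¬(a = b ∧ b = c)) : En A (1 / 2) (√3 / 2) < En A x y := by
  set h := 2 / √3 with hh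
  have hh0 : 0 < h := by positivity
  have hh2 : h ^ 2 = 4 / 3 := by rw [hh, div_pow, sq_sqrt (by norm_num)]; norm_num
  have hA0 : 0 < A := by by_contra hn; nlinarith
  have hs1 := summable_rad 1 (x := 1 / 2) (y := √3 / 2) hA0 (by positivity)
  have hs2 := summable_rad 2 (x := 1 / 2) (y := √3 / 2) hA0 (by positivity)
  have hZ := hex_weight_le hA
  simp only [rad_hex, ← hh] at hs1 hs2 hZ
  obtain ⟨g, hg⟩ : ∃ g : ℤ → ℝ, g = fun N : ℤ => (1 - A * (h * N)) * exp (-(A * (h * N))) := ⟨_, rfl⟩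
  have hgs : Summable fun p => g (hexN p) * hexN p := by
    refine ((hs1.mul_left h⁻¹).sub (hs2.mul_left (A / h))).congr fun p => ?_
    rw [hg, neg_mul]
    field_simp
  have hZ' : -(h * ∑' p, g (hexN p) * hexN p) ≤ (6 * (A * h - 1) + 0.5) * (h * exp (-(A * h))) := by
    rw [← tsum_mul_left, ← tsum_neg]
    refine le_trans (le_of_eq (tsum_congr fun p => ?_)) hZ
    rw [hg]
    ring
  have hWQ := hasSum_sell ha hb hc hgs
  have hWR := hgs.hasSum.mul_left h
  have hQ := (summable_En (A := A) (x := x) hA0 hy).hasSum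
  have hR := (summable_En (A := A) (x := 1 / 2) (y := √3 / 2) hA0 (by positivity)).hasSum
  have hG := (hQ.sub hR).sub (hWQ.sub hWR)
  change HasSum _ (En A x y - En A (1 / 2) (√3 / 2) - _) at hG
  simp only [he, rad_hex, ← hh, neg_mul] at hG
  generalize hZdef : ∑' p, g (hexN p) * hexN p = Z at hG hZ'
  obtain ⟨G, hGdef⟩ : ∃ G : ℤ × ℤ → ℝ, G = fun p => sell a b c p * exp (-(A * sell a b c p)) -
      h * hexN p * exp (-(A * (h * hexN p))) -
      (g (hexN p) * sell a b c p - h * (g (hexN p) * hexN p)) := ⟨_, rfl⟩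
  rw [← hGdef] at hG
  have hpos : ∀ p ∉ hexShell, 0 ≤ G p := by
    intro p hp
    rw [hGdef]
    rcases hexN_cases p with rfl | hp' | hp'
    · have e1 : hexN 0 = 0 := rfl
      have e2 : sell a b c 0 = 0 := by simp [sell]
      simp [e1, e2]
    · exact absurd hp' hp
    · have h3 : (3 : ℝ) ≤ hexN p := by exact_mod_cast hp'
      have hq := sell_ge ha hb hc l1 l2 l3 (p := p) (by rintro rfl; simp [hexN] at hp')
      have := tangent_le hA0 (r := sell a b c p) (R := h * hexN p) (by nlinarith)
        (by nlinarith [mul_le_mul_of_nonneg_left h3 (by positivity : 0 ≤ A * h)])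
      simp only [hg]
      nlinarith
  have hsum := sum_le_hasSum hexShell hpos hG
  have hval : ∀ p ∈ hexShell, ∀ r, sell a b c p = r → 0.75 * h ≤ r → r ≤ 1.76 * h →
      h * exp (-(A * h)) * (A * h - 0.9) * (r / h - 1) ^ 2 ≤ G p := by
    intro p hp r hr h0 h1
    rw [hGdef]
    simp only [hexN_shell hp, hr, hg]
    have := shell_gain hh0 hA h0 h1
    norm_num at this ⊢
    linarith
  have hsum' : ∑ p ∈ hexShell, G p = G (0, 1) + (G (0, -1) + (G (1, 0) + (G (-1, 0) +
      (G (1, -1) + G (-1, 1))))) := by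
    simp [hexShell]
  rw [hsum'] at hsum
  have v1 := hval (0, 1) (by decide) (a + b) (by simp [sell]) l1 u1
  have v2 := hval (0, -1) (by decide) (a + b) (by simp [sell]) l1 u1
  have v3 := hval (1, 0) (by decide) (a + c) (by simp [sell]) l2 u2
  have v4 := hval (-1, 0) (by decide) (a + c) (by simp [sell]) l2 u2
  have v5 := hval (1, -1) (by decide) (b + c) (by simp [sell]) l3 u3
  have v6 := hval (-1, 1) (by decide) (b + c) (by simp [sell]) l3 u3
  obtain ⟨l, hl1, hl, hw⟩ := sell_excess hh0 hh2 ha hb hc hdet hne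
  have hK : 0 < h * exp (-(A * h)) := by positivity
  generalize h * exp (-(A * h)) = K at *
  have hgain : K * (A * h - 0.9) * (6 * (l - 1)) ≤ K * (A * h - 0.9) * (2 *
      (((a + b) / h - 1) ^ 2 + ((a + c) / h - 1) ^ 2 + ((b + c) / h - 1) ^ 2)) := by
    exact mul_le_mul_of_nonneg_left hw (mul_nonneg hK.le (by linarith))
  have hloss := mul_le_mul_of_nonneg_right hZ' (sub_pos.2 hl1).le
  have hlin : (a + b + c) * (2 / 3 * Z) - h * Z = h * Z * (l - 1) := by rw [hl]; ring
  have hfin : 0 < K * (l - 1) := mul_pos hK (sub_pos.2 hl1)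
  -- In units of K(l - 1) the gain is 6(Ah - 0.9) and the loss at most 6(Ah - 1) + 0.5, which leaves
  -- 0.1.
  linarith

end Selling
end LatticePhase

/-! ### Elongated lattices, and uniqueness of the hexagonal minimum for large parameters. -/

namespace LatticePhase

noncomputable section LargeMain

open Real

/-- On nonzero vectors A r - 1 is at least Ah - 1 ≥ 6.25, with h = 2/√3. Dividing `hex_weight_le` by
this factor leaves 6 + 0.5/6.25 < 6.1. -/
theorem En_hex_le {A : ℝ} (hA : 7.25 ≤ A * (2 / √3)) :
    En A (1 / 2) (√3 / 2) ≤ 6.1 * (2 / √3 * exp (-(A * (2 / √3)))) := by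
  have hZ := hex_weight_le hA
  have hh0 : 0 < 2 / √3 := by positivity
  generalize hh : 2 / √3 = h at *
  have hA0 : 0 < A := by by_contra hn; nlinarith
  have hs1 := summable_rad 1 (x := 1 / 2) (y := √3 / 2) hA0 (by positivity)
  have hs2 := summable_rad 2 (x := 1 / 2) (y := √3 / 2) hA0 (by positivity)
  have hs : Summable fun p : ℤ × ℤ => (A * rad (1 / 2) (√3 / 2) p - 1) * rad (1 / 2) (√3 / 2) p *
      exp (-(A * rad (1 / 2) (√3 / 2) p)) :=
    ((hs2.mul_left A).sub hs1).congr fun p => by rw [neg_mul]; ring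
  have h1 : (A * h - 1) * En A (1 / 2) (√3 / 2) ≤ ∑' p : ℤ × ℤ, (A * rad (1 / 2) (√3 / 2) p - 1) *
      rad (1 / 2) (√3 / 2) p * exp (-(A * rad (1 / 2) (√3 / 2) p)) := by
    have hE := summable_En (A := A) (x := 1 / 2) (y := √3 / 2) hA0 (by positivity)
    rw [En, ← tsum_mul_left]
    refine (hE.mul_left _).tsum_le_tsum (fun p => ?_) hs
    rw [rad_hex, hh, neg_mul, ← mul_assoc]
    refine mul_le_mul_of_nonneg_right ?_ (exp_pos _).le
    rcases (hexN_nonneg p).eq_or_lt with h0 | h0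
    · rw [← h0]; simp
    · have h2 : (1 : ℝ) ≤ hexN p := by exact_mod_cast h0
      refine mul_le_mul_of_nonneg_right ?_ (by positivity)
      nlinarith [mul_pos hA0 hh0]
  have hK : 0 < h * exp (-(A * h)) := by positivity
  have h2 : (A * h - 1) * En A (1 / 2) (√3 / 2) ≤ (A * h - 1) * (6.1 * (h * exp (-(A * h)))) := by
    nlinarith
  exact le_of_mul_le_mul_left h2 (by linarith)

/-- The horizontal direction of an elongated lattice contains a pair of opposite vectors whose
squared length is well below the hexagonal minimum without being too small; this pair alone already
costs more than the whole hexagonal energy. -/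
theorem En_hex_lt_of_long {A x y : ℝ} (hA : 7.25 ≤ A * (2 / √3)) (hy : 2 / √3 < y) :
    En A (1 / 2) (√3 / 2) < En A x y := by
  refine (En_hex_le hA).trans_lt ?_
  have hh0 : 0 < 2 / √3 := by positivity
  have hh2 : (2 / √3) ^ 2 = 4 / 3 := by rw [div_pow, sq_sqrt (by norm_num)]; norm_num
  generalize 2 / √3 = h at *
  have hA0 : 0 < A := by by_contra hn; nlinarith
  have hy0 : 0 < y := hh0.trans hy
  have hyh : 1 ≤ 3 / 4 * (y * h) := by nlinarith
  -- The largest n with n²/y ≤ 3h/4; as the root is at least 1, flooring loses at most a factor 2,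
  -- so n²/y lies between 3h/16 and 3h/4.
  obtain ⟨n, hn⟩ : ∃ n : ℕ, n = ⌊√(3 / 4 * (y * h))⌋₊ := ⟨_, rfl⟩
  have hsq : √(3 / 4 * (y * h)) ^ 2 = 3 / 4 * (y * h) := sq_sqrt (by linarith)
  have hr1 : 1 ≤ √(3 / 4 * (y * h)) := one_le_sqrt.2 hyh
  have hn0 : (n : ℝ) ≤ √(3 / 4 * (y * h)) := hn ▸ Nat.floor_le (by linarith)
  have hn1 : 1 ≤ n := hn ▸ Nat.le_floor (by simpa using hr1)
  have hn2 : √(3 / 4 * (y * h)) < n + 1 := hn ▸ Nat.lt_floor_add_one _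
  have hn1' : (1 : ℝ) ≤ n := by exact_mod_cast hn1
  have hv1 : (n : ℝ) ^ 2 ≤ 3 / 4 * (y * h) := by nlinarith
  have hv0 : 3 / 16 * (y * h) ≤ (n : ℝ) ^ 2 := by nlinarith
  obtain ⟨v, hv⟩ : ∃ v, v = (n : ℝ) ^ 2 / (y * h) := ⟨_, rfl⟩
  have hyh0 : 0 < y * h := by positivity
  have hv3 : 3 / 16 ≤ v := by rw [hv, le_div_iff₀ hyh0]; exact hv0
  have hv4 : v ≤ 3 / 4 := by rw [hv, div_le_iff₀ hyh0]; exact hv1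
  have hrv : (n : ℝ) ^ 2 / y = h * v := by rw [hv]; field_simp
  have hE : 2 * (h * v * exp (-(A * (h * v)))) ≤ En A x y := by
    have hsum := (summable_En (A := A) (x := x) hA0 hy0).sum_le_tsum {((0 : ℤ), (n : ℤ)), (0, -(n : ℤ))}
      (fun p _ => mul_nonneg (rad_nonneg hy0 p) (exp_pos _).le)
    have hne : ((0 : ℤ), (n : ℤ)) ≠ (0, -(n : ℤ)) := by
      intro h
      have := (Prod.mk.inj h).2
      omega
    rw [Finset.sum_pair hne] at hsum
    refine le_trans (le_of_eq ?_) hsum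
    simp only [rad]
    push_cast
    simp only [zero_mul, add_zero, neg_sq, hrv, neg_mul, ne_eq, OfNat.ofNat_ne_zero, not_false_eq_true,
      zero_pow]
    ring
  refine lt_of_lt_of_le ?_ hE
  have e : exp (-(A * (h * v))) = exp (-(A * h)) * exp (A * h * (1 - v)) := by
    rw [← exp_add]; congr 1; ring
  have ht0 : 7.25 * (1 - v) ≤ A * h * (1 - v) := mul_le_mul_of_nonneg_right hA (by linarith)
  have h1 := quadratic_le_exp_of_nonneg (x := 7.25 * (1 - v)) (by linarith)
  have h2 := h1.trans (exp_le_exp.2 ht0)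
  have h3 : 3.05 < v * exp (A * h * (1 - v)) := by
    refine lt_of_lt_of_le ?_ (mul_le_mul_of_nonneg_left h2 (by linarith))
    nlinarith [mul_nonneg (mul_nonneg (sub_nonneg.2 hv3) (sub_nonneg.2 hv4))
      (by linarith : 0 ≤ 36 - 27 * v)]
  have hK : 0 < h * exp (-(A * h)) := by positivity
  have h4 := mul_lt_mul_of_pos_left h3 hK
  rw [e]
  nlinarith

/-- For large parameters the hexagonal lattice is the unique minimiser. -/
theorem En_hex_lt_of_large {A x y : ℝ} (hA : 6.283 ≤ A) (hx0 : 0 ≤ x) (hx1 : x ≤ 1 / 2) (hy : 0 < y)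
    (hz : 1 ≤ x ^ 2 + y ^ 2) (hne : ¬(x = 1 / 2 ∧ y = √3 / 2)) :
    En A (1 / 2) (√3 / 2) < En A x y := by
  have h3 : √3 ≤ 1.7321 := sqrt_le_iff.2 (by norm_num)
  have h30 : 0 < √3 := by positivity
  have h33 : √3 ^ 2 = 3 := sq_sqrt (by norm_num)
  have hu : 7.25 ≤ A * (2 / √3) := by
    rw [mul_div_assoc', le_div_iff₀ h30]; nlinarith
  rcases lt_or_ge (2 / √3) y with h | h
  · exact En_hex_lt_of_long hu h
  have hyl : √3 / 2 ≤ y := by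
    have : (√3 / 2) ^ 2 ≤ y ^ 2 := by rw [div_pow, h33]; nlinarith
    exact le_of_sq_le_sq this hy.le
  have hh : 2 / √3 = 2 / 3 * √3 := by rw [div_eq_iff h30.ne']; nlinarith
  rw [hh] at h
  -- With h = 2/√3 and √3/2 ≤ y ≤ h: the lower bound is 1/y ≥ √3/2 = 0.75 h, and the convex function
  -- (1 + y²)/y takes the value 1.75 h at both ends of this interval.
  have key : ∀ t s : ℝ, 1 ≤ t → t ≤ 1 + y ^ 2 → s = t / y →
      0.75 * (2 / √3) ≤ s ∧ s ≤ 1.76 * (2 / √3) := by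
    rintro t s h1 h2 rfl
    rw [hh]
    constructor
    · rw [le_div_iff₀ hy]
      nlinarith
    · rw [div_le_iff₀ hy]
      nlinarith [mul_nonneg (sub_nonneg.2 hyl) (sub_nonneg.2 h)]
  obtain ⟨l1, u1⟩ := key 1 (x / y + (1 - x) / y) le_rfl (by nlinarith) (by ring)
  obtain ⟨l2, u2⟩ := key (x ^ 2 + y ^ 2) (x / y + (x ^ 2 + y ^ 2 - x) / y) hz (by nlinarith) (by ring)
  obtain ⟨l3, u3⟩ := key (1 - 2 * x + x ^ 2 + y ^ 2) ((1 - x) / y + (x ^ 2 + y ^ 2 - x) / y)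
    (by nlinarith) (by nlinarith) (by ring)
  refine En_hex_lt_of_sell hu hy (rad_eq_sell hy) (by positivity) (div_nonneg (by linarith) hy.le)
    (div_nonneg (by nlinarith) hy.le) ?_ l1 l2 l3 u1 u2 u3 ?_
  · field_simp
    ring
  · rintro ⟨h1, h2⟩
    rw [div_left_inj' hy.ne'] at h1 h2
    have hx : x = 1 / 2 := by linarith
    refine hne ⟨hx, ?_⟩
    rw [hx] at h2
    have h4 : y ^ 2 = (√3 / 2) ^ 2 := by rw [div_pow, h33]; linarith
    exact (pow_left_inj₀ hy.le (by positivity) two_ne_zero).1 h4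

end LargeMain
end LatticePhase

/-! ### From lattices of the plane to points of the fundamental domain. -/

namespace LatticePhase

noncomputable section PlaneLattices

open Real Module MeasureTheory Submodule

/-- The oriented area of the parallelogram spanned by two vectors. -/
def cross (v w : ℂ) : ℝ := v.re * w.im - v.im * w.re

theorem volume_real_fundamentalDomain_basisOneI :
    volume.real (ZSpan.fundamentalDomain Complex.basisOneI) = 1 := by
  rw [measureReal_congr (ZSpan.fundamentalDomain_ae_parallelepiped Complex.basisOneI volume)]
  have h := Complex.orthonormalBasisOneI.volume_parallelepiped
  rw [← Complex.toBasis_orthonormalBasisOneI]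
  simp only [OrthonormalBasis.coe_toBasis, measureReal_def, h, ENNReal.toReal_one]

theorem covolume_eq_abs_cross (L : Submodule ℤ ℂ) [DiscreteTopology L] [IsZLattice ℝ L]
    (b : Basis (Fin 2) ℤ L) : ZLattice.covolume L = |cross (b 0) (b 1)| := by
  rw [ZLattice.covolume_eq_det_mul_measureReal L volume b Complex.basisOneI,
    volume_real_fundamentalDomain_basisOneI, mul_one, Basis.det_apply, Matrix.det_fin_two]
  simp only [Basis.toMatrix_apply, Function.comp, Complex.coe_basisOneI_repr, Matrix.cons_val_zero,
    Matrix.cons_val_one, cross]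
  congr 1
  ring

theorem exists_span_pair {L : Submodule ℤ ℂ} (hL : IsUnitLattice L) :
    ∃ v w : ℂ, cross v w = 1 ∧ L = span ℤ {v, w} := by
  obtain ⟨_, _, hc⟩ := hL
  have hfree : Module.Free ℤ L := ZLattice.module_free ℝ L
  have hfin : Module.Finite ℤ L := ZLattice.module_finite ℝ L
  have hr : finrank ℤ L = 2 := (ZLattice.rank ℝ L).trans Complex.finrank_real_complex
  let b : Basis (Fin 2) ℤ L := finBasisOfFinrankEq ℤ L hr
  rw [covolume_eq_abs_cross L b] at hc
  have hs : L = span ℤ {(b 0 : ℂ), (b 1 : ℂ)} := by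
    have h := congrArg (Submodule.map L.subtype) b.span_eq
    rw [Submodule.map_span, Submodule.map_top, Submodule.range_subtype, ← Set.range_comp] at h
    refine h.symm.trans (congrArg (span ℤ) ?_)
    ext z
    simp [Fin.exists_fin_two, eq_comm]
  rcases eq_or_eq_neg_of_abs_eq hc with h | h
  · exact ⟨_, _, h, hs⟩
  · refine ⟨b 1, b 0, ?_, by rw [Set.pair_comm]; exact hs⟩
    simp only [cross] at h ⊢
    linarith

theorem isUnitLattice_span_pair {v w : ℂ} (h : |cross v w| = 1) : IsUnitLattice (span ℤ {v, w}) := by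
  have hne : cross v w ≠ 0 := fun h0 => by rw [h0] at h; norm_num at h
  have hli : LinearIndependent ℝ ![v, w] := by
    refine LinearIndependent.pair_iff.2 fun s t hst => ?_
    have h1 := congrArg Complex.re hst
    have h2 := congrArg Complex.im hst
    simp at h1 h2
    constructor
    · refine (mul_eq_zero.1 (?_ : s * cross v w = 0)).resolve_right hne
      unfold cross; linear_combination w.im * h1 - w.re * h2
    · refine (mul_eq_zero.1 (?_ : t * cross v w = 0)).resolve_right hne
      unfold cross; linear_combination v.re * h2 - v.im * h1
  let B : Basis (Fin 2) ℝ ℂ := basisOfLinearIndependentOfCardEqFinrank hli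
    (by simp [Complex.finrank_real_complex])
  have hB : (B : Fin 2 → ℂ) = ![v, w] := coe_basisOfLinearIndependentOfCardEqFinrank _ _
  have hr : Set.range B = {v, w} := by rw [hB]; simp [Set.pair_comm]
  rw [← hr]
  refine ⟨inferInstance, inferInstance, ?_⟩
  rw [covolume_eq_abs_cross _ (B.restrictScalars ℤ), Basis.restrictScalars_apply,
    Basis.restrictScalars_apply, hB]
  exact h

theorem image_span_pair (e : ℂ ≃ₗᵢ[ℝ] ℂ) (v w : ℂ) :
    e '' (span ℤ {v, w} : Submodule ℤ ℂ) = (span ℤ {e v, e w} : Submodule ℤ ℂ) := by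
  have h := Submodule.map_span (e.toLinearEquiv.toLinearMap.restrictScalars ℤ) {v, w}
  rw [Set.image_pair] at h
  have h' := congrArg (fun S : Submodule ℤ ℂ => (S : Set ℂ)) h
  simpa using h'

/-- The square of the area is the Gram determinant, which isometries preserve. -/
theorem abs_cross_map (e : ℂ ≃ₗᵢ[ℝ] ℂ) (v w : ℂ) : |cross (e v) (e w)| = |cross v w| := by
  rw [← sq_eq_sq_iff_abs_eq_abs]
  have key : ∀ v w : ℂ, cross v w ^ 2 = ‖v‖ ^ 2 * ‖w‖ ^ 2 - inner ℝ v w ^ 2 := fun v w => by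
    rw [Complex.inner, Complex.sq_norm, Complex.sq_norm, Complex.normSq_apply, Complex.normSq_apply]
    simp [cross]
    ring
  rw [key, key, e.norm_map, e.norm_map, e.inner_map_map]

theorem Congruent.isUnitLattice {L : Submodule ℤ ℂ} {v w : ℂ} (h : Congruent L (span ℤ {v, w}))
    (hc : |cross v w| = 1) : IsUnitLattice L := by
  obtain ⟨e, he⟩ := h
  rw [image_span_pair] at he
  rw [← SetLike.coe_injective he]
  exact isUnitLattice_span_pair (by rw [abs_cross_map, hc])

theorem Congruent.energy_eq {L L' : Submodule ℤ ℂ} (h : Congruent L L') (α : ℝ) :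
    energy α L = energy α L' := by
  obtain ⟨e, he⟩ := h
  let f : L' ≃ L := (e.toEquiv.image (L' : Set ℂ)).trans (Equiv.setCongr he)
  have hf : ∀ P : L', ((f P : L) : ℂ) = e P := fun P => rfl
  unfold energy
  rw [← f.tsum_eq]
  simp only [hf, e.norm_map]

theorem energy_bravais (α : ℝ) (z : UpperHalfPlane) :
    energy α (bravais z) = En (π * α) z.re z.im := by
  have hz := z.im_pos
  obtain ⟨s, hs⟩ : ∃ s : ℝ, s = √(1 / z.im) := ⟨_, rfl⟩
  have hs0 : 0 < s := hs ▸ sqrt_pos.2 (by positivity)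
  have hs2 : s ^ 2 = 1 / z.im := by rw [hs, sq_sqrt (by positivity)]
  have hb : bravais z = span ℤ {(s : ℂ), (s : ℂ) * z} := by rw [bravais, hs]
  rw [hb]
  let f : ℤ × ℤ → (span ℤ {(s : ℂ), (s : ℂ) * z} : Submodule ℤ ℂ) := fun p =>
    ⟨p.2 • (s : ℂ) + p.1 • ((s : ℂ) * z), mem_span_pair.2 ⟨_, _, rfl⟩⟩
  have hre : ∀ p, (f p : ℂ).re = s * (p.2 + p.1 * z.re) := fun p => by
    simp [f]; ring
  have him : ∀ p, (f p : ℂ).im = s * (p.1 * z.im) := fun p => by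
    simp [f]; ring
  have hf : Function.Bijective f := by
    constructor
    · intro p q hpq
      have h1 := congrArg (fun P : (span ℤ {(s : ℂ), (s : ℂ) * z} : Submodule ℤ ℂ) => (P : ℂ).im) hpq
      have h2 := congrArg (fun P : (span ℤ {(s : ℂ), (s : ℂ) * z} : Submodule ℤ ℂ) => (P : ℂ).re) hpq
      simp only [hre, him] at h1 h2
      have e1 := mul_right_cancel₀ hz.ne' (mul_left_cancel₀ hs0.ne' h1)
      have e2 := mul_left_cancel₀ hs0.ne' h2
      rw [e1, add_left_inj] at e2
      exact Prod.ext (by exact_mod_cast e1) (by exact_mod_cast e2)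
    · rintro ⟨P, hP⟩
      obtain ⟨n, m, hnm⟩ := mem_span_pair.1 hP
      exact ⟨(m, n), Subtype.ext hnm⟩
  have hn : ∀ p, ‖(f p : ℂ)‖ ^ 2 = rad z.re z.im p := fun p => by
    rw [Complex.sq_norm, Complex.normSq_apply, hre, him, rad]
    have : s * (p.2 + p.1 * z.re) * (s * (p.2 + p.1 * z.re)) + s * (p.1 * z.im) * (s * (p.1 * z.im)) =
      s ^ 2 * ((p.2 + p.1 * z.re) ^ 2 + (p.1 * z.im) ^ 2) := by ring
    rw [this, hs2]
    field_simp
  unfold energy En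
  rw [← (Equiv.ofBijective f hf).tsum_eq]
  refine tsum_congr fun p => ?_
  rw [Equiv.ofBijective_apply, hn, neg_mul]

theorem cross_bravais (z : UpperHalfPlane) :
    |cross ((√(1 / z.im) : ℝ) : ℂ) (((√(1 / z.im) : ℝ) : ℂ) * (z : ℂ))| = 1 := by
  have hz := z.im_pos
  have : √(1 / z.im) * √(1 / z.im) = 1 / z.im := mul_self_sqrt (by positivity)
  simp only [cross, Complex.ofReal_re, Complex.ofReal_im, Complex.mul_im, zero_mul, sub_zero, add_zero]
  rw [← mul_assoc, this, UpperHalfPlane.coe_im, one_div, inv_mul_cancel₀ hz.ne', abs_one]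

theorem Congruent.isUnitLattice_bravais {L : Submodule ℤ ℂ} {z : UpperHalfPlane}
    (h : Congruent L (bravais z)) : IsUnitLattice L :=
  Congruent.isUnitLattice h (cross_bravais z)

theorem isUnitLattice_bravais (z : UpperHalfPlane) : IsUnitLattice (bravais z) :=
  isUnitLattice_span_pair (cross_bravais z)

/-- The reflection of a point of the upper half-plane in the imaginary axis. -/
def reflect (z : UpperHalfPlane) : UpperHalfPlane :=
  ⟨-(starRingEnd ℂ) (z : ℂ), by simpa using z.im_pos⟩

theorem sqrt_im_eq_norm {v w : ℂ} (h : cross v w = 1) {z : UpperHalfPlane} (hz : w = v * z) :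
    √(1 / z.im) = ‖v‖ := by
  have hv : v ≠ 0 := by rintro rfl; simp [cross] at h
  have hn : 0 < ‖v‖ := norm_pos_iff.2 hv
  have him : z.im = 1 / ‖v‖ ^ 2 := by
    rw [eq_div_iff (by positivity), Complex.sq_norm, Complex.normSq_apply, ← h, hz]
    simp [cross]
    ring
  rw [him, one_div_one_div, sqrt_sq hn.le]

/-- Rotation by the argument of v carries the standard basis to v, vz. Composed with complex
conjugation it handles the reflected point, which permits the choice of a nonnegative real part. -/
theorem congruent_of_pair {v w : ℂ} (h : cross v w = 1) {z : UpperHalfPlane} (hz : w = v * z) :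
    Congruent (span ℤ {v, w}) (bravais z) ∧ Congruent (span ℤ {v, w}) (bravais (reflect z)) := by
  have hs := sqrt_im_eq_norm h hz
  have hrot : ∀ t : ℂ, rotation (Circle.exp v.arg) ((‖v‖ : ℂ) * t) = v * t := fun t => by
    rw [rotation_apply, Circle.coe_exp, ← mul_assoc, mul_comm (Complex.exp _),
      Complex.norm_mul_exp_arg_mul_I]
  have hrot1 : rotation (Circle.exp v.arg) (‖v‖ : ℂ) = v := by simpa using hrot 1
  constructor
  · refine ⟨rotation (Circle.exp v.arg), ?_⟩
    rw [bravais, hs, image_span_pair, hrot, hrot1, ← hz]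
  · refine ⟨Complex.conjLIE.trans (rotation (Circle.exp v.arg)), ?_⟩
    have him : (reflect z).im = z.im := by
      change (-(starRingEnd ℂ) (z : ℂ)).im = _
      simp
    have hc : ((reflect z : UpperHalfPlane) : ℂ) = -(starRingEnd ℂ) (z : ℂ) := rfl
    rw [bravais, him, hs, image_span_pair, hc]
    simp only [LinearIsometryEquiv.trans_apply, Complex.conjLIE_apply, map_mul, Complex.conj_ofReal,
      map_neg, Complex.conj_conj]
    rw [mul_neg, map_neg, hrot, hrot1, ← hz]
    refine congrArg (fun S : Submodule ℤ ℂ => (S : Set ℂ)) (le_antisymm ?_ ?_)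
    · refine span_le.2 (Set.insert_subset (subset_span (by simp)) (Set.singleton_subset_iff.2 ?_))
      exact neg_mem (subset_span (by simp))
    · refine span_le.2 (Set.insert_subset (subset_span (by simp)) (Set.singleton_subset_iff.2 ?_))
      rw [SetLike.mem_coe, ← neg_mem_iff]
      exact subset_span (by simp)

/-- Every lattice of unit density is congruent to one from one half of the fundamental domain. -/
theorem exists_congruent_bravais {L : Submodule ℤ ℂ} (hL : IsUnitLattice L) :
    ∃ z : UpperHalfPlane, 0 ≤ z.re ∧ z.re ≤ 1 / 2 ∧ 1 ≤ z.re ^ 2 + z.im ^ 2 ∧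
      Congruent L (bravais z) := by
  obtain ⟨v, w, hvw, rfl⟩ := exists_span_pair hL
  have hv : v ≠ 0 := by rintro rfl; simp [cross] at hvw
  have hn : 0 < Complex.normSq v := Complex.normSq_pos.2 hv
  have him : (w / v).im = 1 / Complex.normSq v := by
    rw [Complex.div_im, ← hvw, cross]
    ring
  obtain ⟨g, hg1, hg2⟩ := ModularGroup.exists_smul_mem_fd (⟨w / v, by rw [him]; positivity⟩ : UpperHalfPlane)
  obtain ⟨z, hz⟩ : ∃ z, z = g • (⟨w / v, by rw [him]; positivity⟩ : UpperHalfPlane) := ⟨_, rfl⟩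
  rw [← hz] at hg1 hg2
  have hdet : g 0 0 * g 1 1 - g 0 1 * g 1 0 = 1 := by
    have := g.det_coe; rwa [Matrix.det_fin_two] at this
  have hdetR : (g 0 0 : ℝ) * g 1 1 - g 0 1 * g 1 0 = 1 := by exact_mod_cast hdet
  obtain ⟨v', hv'⟩ : ∃ v', v' = g 1 0 • w + g 1 1 • v := ⟨_, rfl⟩
  obtain ⟨w', hw'⟩ : ∃ w', w' = g 0 0 • w + g 0 1 • v := ⟨_, rfl⟩
  have hcr : cross v' w' = 1 := by
    have : cross v' w' = (g 0 0 * g 1 1 - g 0 1 * g 1 0) * cross v w := by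
      rw [hv', hw']; simp [cross]; ring
    rw [this, hdetR, hvw, one_mul]
  have hv0 : v' ≠ 0 := by rintro h0; rw [h0] at hcr; simp [cross] at hcr
  have hzc : w' = v' * z := by
    have h1 := UpperHalfPlane.coe_specialLinearGroup_apply g
      (⟨w / v, by rw [him]; positivity⟩ : UpperHalfPlane)
    rw [← hz] at h1
    have e1 : v' = v * ((g 1 0 : ℂ) * (w / v) + g 1 1) := by rw [hv']; simp; field_simp
    have e2 : w' = v * ((g 0 0 : ℂ) * (w / v) + g 0 1) := by rw [hw']; simp; field_simp
    have e3 : (g 1 0 : ℂ) * (w / v) + g 1 1 ≠ 0 := fun h0 => hv0 (by rw [e1, h0, mul_zero])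
    have h2 : (z : ℂ) = ((g 0 0 : ℂ) * (w / v) + g 0 1) / ((g 1 0 : ℂ) * (w / v) + g 1 1) := by
      simpa using h1
    rw [h2, e1, e2, mul_assoc, mul_div_cancel₀ _ e3]
  have hspan : span ℤ {v, w} = span ℤ {v', w'} := by
    refine le_antisymm ?_ ?_
    · refine span_le.2 (Set.insert_subset ?_ (Set.singleton_subset_iff.2 ?_))
      · refine mem_span_pair.2 ⟨g 0 0, -g 1 0, ?_⟩
        rw [hv', hw']
        have : (g 0 0 * g 1 1 - g 0 1 * g 1 0) • v = v := by rw [hdet, one_smul]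
        exact Eq.trans (by module) this
      · refine mem_span_pair.2 ⟨-g 0 1, g 1 1, ?_⟩
        rw [hv', hw']
        have : (g 0 0 * g 1 1 - g 0 1 * g 1 0) • w = w := by rw [hdet, one_smul]
        exact Eq.trans (by module) this
    · refine span_le.2 (Set.insert_subset ?_ (Set.singleton_subset_iff.2 ?_))
      · exact mem_span_pair.2 ⟨g 1 1, g 1 0, by rw [hv', add_comm]⟩
      · exact mem_span_pair.2 ⟨g 0 1, g 0 0, by rw [hw', add_comm]⟩
  rw [hspan]
  obtain ⟨c1, c2⟩ := congruent_of_pair hcr hzc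
  have hsq : 1 ≤ z.re ^ 2 + z.im ^ 2 := by
    rw [Complex.normSq_apply] at hg1
    simpa [sq] using hg1
  rcases le_total 0 z.re with h0 | h0
  · exact ⟨z, h0, (le_abs_self _).trans hg2, hsq, c1⟩
  · have hre : (reflect z).re = -z.re := by
      change (-(starRingEnd ℂ) (z : ℂ)).re = _
      simp
    have him' : (reflect z).im = z.im := by
      change (-(starRingEnd ℂ) (z : ℂ)).im = _
      simp
    refine ⟨reflect z, by rw [hre]; linarith, ?_, ?_, c2⟩
    · rw [hre]; exact (neg_le_abs _).trans hg2
    · rw [hre, him', neg_sq]; exact hsq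

/-- Minimisers, read off from the energy on one half of the fundamental domain. -/
theorem isMinimizer_iff {α : ℝ} {ι : Type*} [Nonempty ι] (z₀ : ι → UpperHalfPlane) {m : ℝ}
    (h₀ : ∀ i, En (π * α) (z₀ i).re (z₀ i).im = m)
    (h : ∀ x y : ℝ, 0 ≤ x → x ≤ 1 / 2 → 0 < y → 1 ≤ x ^ 2 + y ^ 2 →
      (∃ i, (z₀ i).re = x ∧ (z₀ i).im = y) ∨ m < En (π * α) x y) (L : Submodule ℤ ℂ) :
    IsMinimizer α L ↔ ∃ i, Congruent L (bravais (z₀ i)) := by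
  constructor
  · rintro ⟨hL, hmin⟩
    obtain ⟨z, h1, h2, h3, hc⟩ := exists_congruent_bravais hL
    rcases h z.re z.im h1 h2 z.im_pos h3 with ⟨i, hi1, hi2⟩ | hlt
    · refine ⟨i, ?_⟩
      rwa [UpperHalfPlane.ext (Complex.ext hi1 hi2)]
    · obtain ⟨i⟩ := ‹Nonempty ι›
      have := hmin _ (isUnitLattice_bravais (z₀ i))
      rw [hc.energy_eq, energy_bravais, energy_bravais, h₀ i] at this
      exact absurd this (not_le.2 hlt)
  · rintro ⟨i, hi⟩
    refine ⟨hi.isUnitLattice_bravais, fun L' hL' => ?_⟩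
    obtain ⟨z, h1, h2, h3, hc⟩ := exists_congruent_bravais hL'
    rw [hi.energy_eq, hc.energy_eq, energy_bravais, energy_bravais, h₀ i]
    rcases h z.re z.im h1 h2 z.im_pos h3 with ⟨j, hj1, hj2⟩ | hlt
    · rw [← hj1, ← hj2, h₀ j]
    · exact hlt.le

end PlaneLattices
end LatticePhase

/-! ### Comparison of all regions of the half fundamental domain in each phase. -/

namespace LatticePhase

noncomputable section Comparison

open Real

theorem En_square_le {A y : ℝ} (hA : 0 < A) (hm : StrictMonoOn (En A 0) (Set.Ici 1)) (hy : 0 < y) :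
    En A 0 1 ≤ En A 0 y := by
  rcases le_total 1 y with h | h
  · exact hm.monotoneOn Set.self_mem_Ici h h
  · exact En_zero_le_of_le hA hm hy h le_rfl

theorem sqrt_three_half_le {x y : ℝ} (hx0 : 0 ≤ x) (hx1 : x ≤ 1 / 2) (hy : 0 < y)
    (hz : 1 ≤ x ^ 2 + y ^ 2) : √3 / 2 ≤ y := by
  refine le_of_sq_le_sq ?_ hy.le
  rw [div_pow, sq_sqrt (by norm_num)]
  nlinarith

/-- Where the energy is minimal on the imaginary axis, it exceeds the minimum elsewhere. -/
theorem lt_En_of_horizontal {α m y₀ x y : ℝ} (hα : 0 < α)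
    (hmin : ∀ t, 0 < t → m ≤ En (π * α) 0 t) (hlt : ∀ t, 1 ≤ t → t ≠ y₀ → m < En (π * α) 0 t)
    (hx0 : 0 ≤ x) (hx1 : x ≤ 1 / 2) (hy : 0 < y) (hz : 1 ≤ x ^ 2 + y ^ 2)
    (h : α ≤ 181 / 200 ∧ 3 / 4 ≤ y ^ 2 ∨ α ≤ 461 / 500 ∧ 1 ≤ y) :
    (x = 0 ∧ y = y₀) ∨ m < En (π * α) x y := by
  rcases hx0.eq_or_lt with rfl | hx
  · by_cases hy₀ : y = y₀
    · exact Or.inl ⟨rfl, hy₀⟩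
    · exact Or.inr (hlt y (by nlinarith) hy₀)
  · obtain ⟨D, hD, hE⟩ := En_zero_le x hα hy h
    have := mul_pos hD (sub_pos.2 (cos_two_pi_mul_lt_one hx hx1))
    exact Or.inr (by linarith [hmin y hy])

/-- For α ≤ 0.905, or at heights y ≥ 1, the energy is least at x = 0. Below height 1 the
interpolation window is used, with the direct comparison to the square up to A = 2.881 and
`lt_En_of_window` beyond. -/
theorem lt_En_of_square_phase {α x y : ℝ} (hα : 0 < α) (hα1 : α ≤ 0.921)
    (hm : StrictMonoOn (En (π * α) 0) (Set.Ici 1))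
    (hlt : 0.905 ≤ α → En (π * α) 0 1 < En (π * α) (1 / 2) (√3 / 2))
    (hx0 : 0 ≤ x) (hx1 : x ≤ 1 / 2) (hy : 0 < y) (hz : 1 ≤ x ^ 2 + y ^ 2) :
    (x = 0 ∧ y = 1) ∨ En (π * α) 0 1 < En (π * α) x y := by
  have hp := pi_gt_d6
  have hp' := pi_lt_d4
  have hyl := sqrt_three_half_le hx0 hx1 hy hz
  have h3 : (1.732 : ℝ) ≤ √3 := le_sqrt_of_sq_le (by norm_num)
  have hor := lt_En_of_horizontal (y₀ := 1) hα (fun t ht => En_square_le (by positivity) hm ht)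
    (fun t ht hne => hm Set.self_mem_Ici ht (lt_of_le_of_ne ht hne.symm)) hx0 hx1 hy hz
  rcases le_or_gt α (181 / 200) with h | h
  · exact hor (Or.inl ⟨h, by nlinarith⟩)
  rcases le_or_gt 1 y with h1 | h1
  · exact hor (Or.inr ⟨by linarith, h1⟩)
  refine Or.inr ?_
  have hx : 0 < x := hx0.lt_of_ne (by rintro rfl; nlinarith)
  rcases le_total (π * α) 2.881 with hA | hA
  · exact En_square_lt_of_window (by nlinarith) hA hm hx hx1 (by linarith) h1.le
  · have hl := hlt (by linarith)
    by_cases hne : x = 1 / 2 ∧ y = √3 / 2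
    · rw [hne.1, hne.2]; exact hl
    · exact lt_En_of_window (by linarith) (by nlinarith) hm le_rfl hl.le hx hx1 hyl h1.le hne

theorem lt_En_of_coexistence {α x y : ℝ} (hα0 : 0.92 ≤ α) (hα1 : α ≤ 0.921)
    (hm : StrictMonoOn (En (π * α) 0) (Set.Ici 1))
    (heq : En (π * α) 0 1 = En (π * α) (1 / 2) (√3 / 2))
    (hx0 : 0 ≤ x) (hx1 : x ≤ 1 / 2) (hy : 0 < y) (hz : 1 ≤ x ^ 2 + y ^ 2) :
    (x = 0 ∧ y = 1) ∨ (x = 1 / 2 ∧ y = √3 / 2) ∨ En (π * α) 0 1 < En (π * α) x y := by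
  have hp := pi_gt_d6
  have hp' := pi_lt_d4
  have hyl := sqrt_three_half_le hx0 hx1 hy hz
  rcases le_or_gt 1 y with h1 | h1
  · exact (lt_En_of_horizontal (y₀ := 1) (by linarith) (fun t ht => En_square_le (by positivity) hm ht)
      (fun t ht hne => hm Set.self_mem_Ici ht (lt_of_le_of_ne ht hne.symm)) hx0 hx1 hy hz
      (Or.inr ⟨by linarith, h1⟩)).imp_right Or.inr
  by_cases hne : x = 1 / 2 ∧ y = √3 / 2
  · exact Or.inr (Or.inl hne)
  have hx : 0 < x := hx0.lt_of_ne (by rintro rfl; nlinarith)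
  exact Or.inr (Or.inr (lt_En_of_window (by nlinarith) (by nlinarith) hm le_rfl heq.le hx hx1 hyl
    h1.le hne))

/-- For α ≥ 2 the tangent argument covers the whole domain. Otherwise heights y ≥ 1 pass through the
square energy, by the horizontal estimate up to 0.922 and by the amplitude bound after that, and the
window covers the rest. -/
theorem lt_En_of_hexagonal_phase {α x y : ℝ} (hα0 : 0.92 ≤ α)
    (hm : StrictMonoOn (En (π * α) 0) (Set.Ici 1))
    (hgt : α ≤ 0.923 → En (π * α) (1 / 2) (√3 / 2) < En (π * α) 0 1)
    (hx0 : 0 ≤ x) (hx1 : x ≤ 1 / 2) (hy : 0 < y) (hz : 1 ≤ x ^ 2 + y ^ 2) :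
    (x = 1 / 2 ∧ y = √3 / 2) ∨ En (π * α) (1 / 2) (√3 / 2) < En (π * α) x y := by
  have hp := pi_gt_d6
  have hp' := pi_lt_d4
  have hA0 : 0 < π * α := by positivity
  have hyl := sqrt_three_half_le hx0 hx1 hy hz
  by_cases hne : x = 1 / 2 ∧ y = √3 / 2
  · exact Or.inl hne
  refine Or.inr ?_
  rcases le_total 2 α with h2 | h2
  · exact En_hex_lt_of_large (by nlinarith) hx0 hx1 hy hz hne
  have hA1 : π * α ≤ 6.2832 := by nlinarith
  have hg : En (π * α) (1 / 2) (√3 / 2) < En (π * α) 0 1 := by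
    rcases le_total α 0.923 with h | h
    · exact hgt h
    · have h1 := (squareGap_sub_ampl_pos (A := π * α) (by nlinarith) hA1).1
      have h4 := En_zero_one_sub hA0 (y := √3 / 2) (by positivity)
      have := div_pos h1 hA0
      linarith
  rcases le_or_gt 1 y with h1 | h1
  · rcases le_total α 0.922 with h | h
    · obtain ⟨D, hD, hE⟩ := En_zero_le x (by linarith : 0 < α) hy (Or.inr ⟨by linarith, h1⟩)
      have h4 := mul_nonneg hD.le (sub_nonneg.2 (cos_le_one (2 * π * x)))
      linarith [En_square_le hA0 hm hy]
    · exact En_hex_lt_of_one_le (by nlinarith) hA1 hm h1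
  · have hx : 0 < x := hx0.lt_of_ne (by rintro rfl; nlinarith)
    exact lt_En_of_window (by nlinarith) hA1 hm hg.le le_rfl hx hx1 hyl h1.le hne

theorem hexPoint_re : hexPoint.re = 1 / 2 := by
  change (Complex.exp (Complex.I * ((π / 3 : ℝ) : ℂ))).re = _
  rw [mul_comm, Complex.exp_ofReal_mul_I_re, cos_pi_div_three]

theorem hexPoint_im : hexPoint.im = √3 / 2 := by
  change (Complex.exp (Complex.I * ((π / 3 : ℝ) : ℂ))).im = _
  rw [mul_comm, Complex.exp_ofReal_mul_I_im, sin_pi_div_three]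

theorem imagPoint_re (y : ℝ) (hy : 0 < y) : (imagPoint y hy).re = 0 := by
  change (Complex.I * (y : ℂ)).re = _
  simp

theorem imagPoint_im (y : ℝ) (hy : 0 < y) : (imagPoint y hy).im = y := by
  change (Complex.I * (y : ℂ)).im = _
  simp

theorem isMinimizer_iff_congruent {α : ℝ} (z₀ : UpperHalfPlane)
    (h : ∀ x y : ℝ, 0 ≤ x → x ≤ 1 / 2 → 0 < y → 1 ≤ x ^ 2 + y ^ 2 →
      (x = z₀.re ∧ y = z₀.im) ∨ En (π * α) z₀.re z₀.im < En (π * α) x y) (L : Submodule ℤ ℂ) :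
    IsMinimizer α L ↔ Congruent L (bravais z₀) := by
  rw [isMinimizer_iff (fun _ : Unit => z₀) (fun _ => rfl) fun x y h1 h2 h3 h4 =>
    (h x y h1 h2 h3 h4).imp_left fun h => ⟨(), h.1.symm, h.2.symm⟩]
  simp

end Comparison
end LatticePhase

theorem theorem1p1 :
    ∃ αa αb : ℝ, 4 / 5 < αa ∧ αa < αb ∧ αb < 1 ∧
      |αa - 0.8947044415| < 1 / 10 ^ 10 ∧ |αb - 0.9203340927| < 1 / 10 ^ 10 ∧
      ∀ α : ℝ, 0 < α →
        (α < αa → ∃ (y : ℝ) (hy : 1 < y), ∀ L : Submodule ℤ ℂ,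
          LatticePhase.IsMinimizer α L ↔
            LatticePhase.IsRectangularLattice y (zero_lt_one.trans hy) L) ∧
        (αa ≤ α → α < αb → ∀ L : Submodule ℤ ℂ,
          LatticePhase.IsMinimizer α L ↔ LatticePhase.IsSquareLattice L) ∧
        (α = αb → ∀ L : Submodule ℤ ℂ,
          LatticePhase.IsMinimizer α L ↔
            LatticePhase.IsSquareLattice L ∨ LatticePhase.IsHexagonalLattice L) ∧
        (αb < α → ∀ L : Submodule ℤ ℂ,
          LatticePhase.IsMinimizer α L ↔ LatticePhase.IsHexagonalLattice L) := by
  obtain ⟨αa, ha, hmono, hrect⟩ := LatticePhase.exists_rectangular_transition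
  obtain ⟨αb, hb, heq, hlt, hgt⟩ := LatticePhase.exists_hexagonal_transition
  obtain ⟨ha1, ha2⟩ := abs_lt.1 ha
  obtain ⟨hb1, hb2⟩ := abs_lt.1 hb
  norm_num at ha1 ha2 hb1 hb2
  refine ⟨αa, αb, by norm_num; linarith, by linarith, by linarith, ha, hb, fun α hα => ⟨fun h => ?_,
    fun h1 h2 => ?_, fun h => ?_, fun h => ?_⟩⟩
  · obtain ⟨y₀, hy₀, hmin⟩ := hrect α hα h
    have hle : ∀ t, 0 < t → LatticePhase.En (Real.pi * α) 0 y₀ ≤ LatticePhase.En (Real.pi * α) 0 t := by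
      have key : ∀ t, 1 ≤ t →
          LatticePhase.En (Real.pi * α) 0 y₀ ≤ LatticePhase.En (Real.pi * α) 0 t := fun t ht => by
        by_cases hne : t = y₀
        · rw [hne]
        · exact (hmin t ht hne).le
      intro t ht
      rcases le_total 1 t with h1 | h1
      · exact key t h1
      -- Heights below 1 on the imaginary axis are the same rectangles turned by a right angle.
      · rw [← LatticePhase.En_zero_inv (by positivity) ht]
        exact key _ ((one_le_inv₀ ht).2 h1)
    refine ⟨y₀, hy₀, LatticePhase.isMinimizer_iff_congruent _ fun x y hx0 hx1 hy hz => ?_⟩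
    rw [LatticePhase.imagPoint_re, LatticePhase.imagPoint_im]
    exact LatticePhase.lt_En_of_horizontal hα hle hmin hx0 hx1 hy hz
      (Or.inl ⟨by linarith, by nlinarith⟩)
  · refine LatticePhase.isMinimizer_iff_congruent _ fun x y hx0 hx1 hy hz => ?_
    rw [UpperHalfPlane.I_re, UpperHalfPlane.I_im]
    exact LatticePhase.lt_En_of_square_phase hα (by norm_num; linarith) (hmono α h1)
      (fun h => hlt α h h2) hx0 hx1 hy hz
  · subst h
    intro L
    have hm := hmono α (by linarith)
    have hmin := LatticePhase.isMinimizer_iff (α := α)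
      (fun b : Bool => cond b UpperHalfPlane.I LatticePhase.hexPoint)
      (m := LatticePhase.En (Real.pi * α) 0 1)
      (by
        rintro (_ | _)
        · simp only [cond_false, LatticePhase.hexPoint_re, LatticePhase.hexPoint_im]; exact heq.symm
        · simp)
      (fun x y hx0 hx1 hy hz => by
        rcases LatticePhase.lt_En_of_coexistence (by norm_num; linarith) (by norm_num; linarith) hm heq
          hx0 hx1 hy hz with h | h | h
        · exact Or.inl ⟨true, by simp [h.1], by simp [h.2]⟩
        · exact Or.inl ⟨false, LatticePhase.hexPoint_re.trans h.1.symm,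
            LatticePhase.hexPoint_im.trans h.2.symm⟩
        · exact Or.inr h) L
    rw [hmin, Bool.exists_bool]
    exact or_comm
  · refine LatticePhase.isMinimizer_iff_congruent _ fun x y hx0 hx1 hy hz => ?_
    rw [LatticePhase.hexPoint_re, LatticePhase.hexPoint_im]
    exact LatticePhase.lt_En_of_hexagonal_phase (by norm_num; linarith) (hmono α (by linarith))
      (hgt α h) hx0 hx1 hy hz
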